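/- Let $M$ be a compact smooth $6$-manifold. **Setting.** For a symplectic form $\omega$ and a $3$-form $\varphi$ on $M$ that is non-degenerate in the sense of Hitchin, let $J_\varphi$ be Hitchin's almost complex structure (for the orientation given by $\omega^3$), $\hat\varphi(X,Y,Z)=\varphi(J_\varphi X,J_\varphi Y,J_\varphi Z)$, let $|\varphi|^2$ be defined by $|\varphi|^2\,\omega^3/3!=\varphi\wedge\hat\varphi$, and let $g_{ij}=-|\varphi|^{-2}\varphi_{iab}\varphi_{jkp}\,\omega^{ak}\omega^{bp}$, where $\omega^{ia}\omega_{aj}=\delta^i{}_j$. Put $(\Lambda_\omega A)_I=\tfrac12\omega^{ij}A_{jiI}$. The pair $(\varphi,\omega)$ is a *Type IIA structure* if $d\varphi=d\omega=0$, $\Lambda_\omega\varphi=0$, and $g>0$. It is a *Ricci-flat Type IIA structure* if moreover $J_\varphi$ is integrable, the (then Kähler) metric $g$ is Ricci-flat, and $|\varphi|$ is locally constant (that is, constant if $M$ is connected). Fix a Ricci-flat Type IIA structure $(\bar\varphi,\bar\omega)$ with metric $\bar g$. For pairs $(\varphi,\omega)$ near $(\bar\varphi,\bar\omega)$ let $$V^k=|\varphi|^2g^{pq}(\Gamma^k_{pq}-\bar\Gamma^k_{pq})-g^{lk}\partial_l|\varphi|^2,\qquad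 E(\varphi,\omega)=d\Lambda_\omega d(|\varphi|^2\hat\varphi)+d\iota_V\varphi,\qquad F(\varphi,\omega)=d\iota_V\omega,$$ with $\Gamma,\bar\Gamma$ the Christoffel symbols of $g,\bar g$; these are the right-hand sides of the Type IIA flow reparametrized by $V$. Let $DE(\bar\varphi,\bar\omega)$, $DF(\bar\varphi,\bar\omega)$ be their linearizations, $\frac{d}{dt}\big|_{t=0}E(\bar\varphi+t\,\delta\varphi,\bar\omega+t\,\delta\omega)$ and likewise for $F$, let $\Box_d=dd^\star+d^\star d$ be the Hodge Laplacian of $\bar g$, $\bar\nabla$ its Levi-Civita connection, and $\star$ its Hodge star. **Theorem.** (i) For smooth variations with $$d(\delta\varphi)=d(\delta\omega)=0,\qquad \delta\varphi\wedge\bar\omega+\bar\varphi\wedge\delta\omega=0,$$ we have $$DE(\bar\varphi,\bar\omega)(\delta\varphi,\delta\omega)=-|\bar\varphi|^2\,\Box_d(\delta\varphi),\qquad DF(\bar\varphi,\bar\omega)(\delta\varphi,\delta\omega)=-|\bar\varphi|^2\,\Box_d(\delta\omega).$$ (ii) For all smooth closed variations $(\delta\varphi,\delta\omega)$, with $H=\star(\delta\varphi\wedge\bar\omega+\bar\varphi\wedge\delta\omega)$,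 we have $$DE(\bar\varphi,\bar\omega)(\delta\varphi,\delta\omega)=-|\bar\varphi|^2\,\Box_d(\delta\varphi)+d(\mathcal E_1*\bar\nabla H),\qquad DF(\bar\varphi,\bar\omega)(\delta\varphi,\delta\omega)=-|\bar\varphi|^2\,\Box_d(\delta\omega)+d(\mathcal E_2*\bar\nabla H),$$ where $\mathcal E_1*\bar\nabla H$ is a $2$-form, $\mathcal E_2*\bar\nabla H$ is a $1$-form, and $(\mathcal E_i*\bar\nabla H)_I=\bar g^{pr}\bar g^{qs}(\mathcal E_i)_{pqI}\bar\nabla_rH_s$ is the contraction of $\bar\nabla H$ with a tensor $\mathcal E_i$ given by a universal expression (the same for all $M$, $\bar\varphi$, $\bar\omega$, $\delta\varphi$, $\delta\omega$) that is built from $\bar\varphi$, $\bar\omega$, $\bar g$ by linear combinations with real coefficients, tensor products, permutations of indices, and contractions with $\bar g^{-1}$. -/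

import Mathlib

open scoped Manifold

noncomputable section

namespace TypeIIA

/-! ### Tensors in coordinates

Tensor calculus on `ℝ⁶` in index notation. A covariant tensor of valence `k` at a point is the
array of its components; a tensor field on (an open subset of) `ℝ⁶` is a function of the point. -/

/-- The model space `ℝ⁶`. -/
abbrev E6 : Type := EuclideanSpace ℝ (Fin 6)

/-- The order of smoothness `C^∞`. -/
abbrev Cinf : WithTop ℕ∞ := ((⊤ : ℕ∞) : WithTop ℕ∞)

/-- Components `A_{i₁…i_k}` of a covariant tensor of valence `k`. -/
abbrev Tens (k : ℕ) : Type := (Fin k → Fin 6) → ℝ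

/-- A field of covariant tensors of valence `k` in coordinates. -/
abbrev TField (k : ℕ) : Type := E6 → Tens k

/-- The `i`-th coordinate vector `∂_i`. -/
def coordVec (i : Fin 6) : E6 := EuclideanSpace.single i (1 : ℝ)

/-- The partial derivative `∂_i f`. -/
def pd (i : Fin 6) (f : E6 → ℝ) (y : E6) : ℝ := fderiv ℝ f y (coordVec i)

/-- Being totally antisymmetric, i.e. being the component array of a differential form. -/
def IsAlt {k : ℕ} (A : Tens k) : Prop :=
  ∀ (σ : Equiv.Perm (Fin k)) (i : Fin k → Fin 6),
    A (i ∘ σ) = ((Equiv.Perm.sign σ : ℤ) : ℝ) * A i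

/-- The exterior derivative
`(dA)_{i₀…i_k} = ∑_j (-1)^j ∂_{i_j} A_{i₀…î_j…i_k}`. -/
def extD {k : ℕ} (A : TField k) : TField (k + 1) := fun y i =>
  ∑ j : Fin (k + 1), (-1 : ℝ) ^ (j : ℕ) * pd (i j) (fun z => A z (fun a => i (j.succAbove a))) y

/-- On component arrays of forms on `ℝ⁶`, `extD` is Mathlib's exterior derivative. -/
theorem extDeriv_coordVec {k : ℕ} (A : E6 → E6 [⋀^Fin k]→L[ℝ] ℝ) (y : E6)
    (h : DifferentiableAt ℝ A y) (i : Fin (k + 1) → Fin 6) :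
    extDeriv A y (fun a => coordVec (i a)) =
      extD (fun z i => A z (fun a => coordVec (i a))) y i := by
  rw [extDeriv_apply h]
  simp [extD, pd]
  rfl

/-- The wedge product,
`(A ∧ B)_I = (1 / p! q!) ∑_σ sgn σ A_{I_{σ(1)}…I_{σ(p)}} B_{I_{σ(p+1)}…I_{σ(p+q)}}`. -/
def wedge {p q : ℕ} (A : Tens p) (B : Tens q) : Tens (p + q) := fun i =>
  ((p.factorial : ℝ) * (q.factorial : ℝ))⁻¹ *
    ∑ σ : Equiv.Perm (Fin (p + q)), ((Equiv.Perm.sign σ : ℤ) : ℝ) *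
      A (fun a => i (σ (Fin.castAdd q a))) * B (fun b => i (σ (Fin.natAdd p b)))

/-- The interior product `(ι_V A)_I = V^a A_{aI}`. -/
def interior {k : ℕ} (V : Fin 6 → ℝ) (A : Tens (k + 1)) : Tens k := fun i =>
  ∑ a, V a * A (Fin.cons a i)

/-- The matrix `(A_{ij})` of a tensor of valence two. -/
def toMatrix (A : Tens 2) : Matrix (Fin 6) (Fin 6) ℝ := Matrix.of fun i j => A ![i, j]

/-! ### Linear algebra of a pair `(φ, ω)` at a point -/

/-- `ω^{ij}`, the inverse of `ω_{ij}`: `ω^{ia} ω_{aj} = δ^i_j`. -/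
def omegaInv (ω : Tens 2) : Matrix (Fin 6) (Fin 6) ℝ := (toMatrix ω)⁻¹

/-- The volume form `ω³ / 3!`. -/
def volForm (ω : Tens 2) : Tens 6 := fun i => (1 / 6 : ℝ) * wedge (wedge ω ω) ω i

/-- The Hodge contraction `(Λ_ω A)_I = (1/2) ω^{ij} A_{jiI}`. -/
def contractOmega {k : ℕ} (ω : Tens 2) (A : Tens (k + 2)) : Tens k := fun i =>
  (1 / 2 : ℝ) * ∑ a, ∑ b, omegaInv ω a b * A (Fin.cons b (Fin.cons a i))

/-- Hitchin's endomorphism `K` of a three-form `φ`, with respect to the volume form `ω³ / 3!`: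
`ι_X φ ∧ φ ∧ θ = θ(K X) ω³ / 3!` for every vector `X` and covector `θ`. The entry `(i, j)` is
`K^i_j`. -/
def hitchinK (φ : Tens 3) (ω : Tens 2) : Matrix (Fin 6) (Fin 6) ℝ := Matrix.of fun i j =>
  wedge (p := 5) (q := 1)
    (wedge (p := 2) (q := 3) (fun a => φ (Fin.cons j a)) φ) (fun a => if a 0 = i then 1 else 0) id
    / volForm ω id

/-- Hitchin's invariant `λ = tr K² / 6`; the form `φ` is non-degenerate, i.e. defines an almost
complex structure, when `λ < 0`. -/
def hitchinLambda (φ : Tens 3) (ω : Tens 2) : ℝ :=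
  (hitchinK φ ω * hitchinK φ ω).trace / 6

/-- The almost complex structure `J_φ = K / √(-λ)`. It depends on `ω` only through the orientation
defined by `ω³`, and the sign is such that `φ ∧ φ̂` is positive. The entry `(i, j)` is `J^i_j`. -/
def almostComplex (φ : Tens 3) (ω : Tens 2) : Matrix (Fin 6) (Fin 6) ℝ :=
  (Real.sqrt (-hitchinLambda φ ω))⁻¹ • hitchinK φ ω

/-- `φ̂(X, Y, Z) = φ(JX, JY, JZ)`. -/
def hat (φ : Tens 3) (ω : Tens 2) : Tens 3 := fun i =>
  ∑ a, ∑ b, ∑ c, φ ![a, b, c] *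
    almostComplex φ ω a (i 0) * almostComplex φ ω b (i 1) * almostComplex φ ω c (i 2)

/-- `|φ|²`, defined by `|φ|² ω³ / 3! = φ ∧ φ̂`. -/
def normSq (φ : Tens 3) (ω : Tens 2) : ℝ := wedge φ (hat φ ω) id / volForm ω id

/-- The metric `g_{ij} = - |φ|⁻² φ_{iab} φ_{jkp} ω^{ak} ω^{bp}`. -/
def metric (φ : Tens 3) (ω : Tens 2) : Matrix (Fin 6) (Fin 6) ℝ := Matrix.of fun i j =>
  -(normSq φ ω)⁻¹ * ∑ a, ∑ b, ∑ k, ∑ p,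
    φ ![i, a, b] * φ ![j, k, p] * omegaInv ω a k * omegaInv ω b p

/-- The Hodge star of a `p`-form with respect to a metric `g` and a volume form,
`(⋆A)_J = (1/p!) A^I vol_{IJ}`. -/
def hodgeStar {p q : ℕ} (g : Matrix (Fin 6) (Fin 6) ℝ) (vol : Tens (p + q)) (A : Tens p) :
    Tens q := fun j =>
  (p.factorial : ℝ)⁻¹ * ∑ i : Fin p → Fin 6, ∑ i' : Fin p → Fin 6,
    (∏ a, g⁻¹ (i a) (i' a)) * A i' * vol (Fin.append i j)

/-! ### Riemannian geometry in coordinates -/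

/-- The Christoffel symbol `Γ^k_{pq}` of a metric. -/
def christoffel (g : E6 → Matrix (Fin 6) (Fin 6) ℝ) (y : E6) (k p q : Fin 6) : ℝ :=
  (1 / 2 : ℝ) * ∑ s, (g y)⁻¹ k s *
    (pd p (fun z => g z q s) y + pd q (fun z => g z p s) y - pd s (fun z => g z p q) y)

/-- The Levi-Civita covariant derivative of a covariant tensor,
`(∇A)_{pI} = ∂_p A_I - ∑_j Γ^m_{p i_j} A_{i₁…m…i_k}`. -/
def nabla {k : ℕ} (g : E6 → Matrix (Fin 6) (Fin 6) ℝ) (A : TField k) : TField (k + 1) := fun y i =>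
  pd (i 0) (fun z => A z (Fin.tail i)) y -
    ∑ j : Fin k, ∑ m, christoffel g y m (i 0) (i j.succ) * A y (Function.update (Fin.tail i) j m)

/-- The codifferential `(d⋆ A)_I = -∇^p A_{pI}`. -/
def codiff {k : ℕ} (g : E6 → Matrix (Fin 6) (Fin 6) ℝ) (A : TField (k + 1)) : TField k := fun y i =>
  -∑ p, ∑ q, (g y)⁻¹ p q * nabla g A y (Fin.cons p (Fin.cons q i))

/-- The Hodge Laplacian `□ = d d⋆ + d⋆ d`. -/
def hodgeLaplacian {k : ℕ} (g : E6 → Matrix (Fin 6) (Fin 6) ℝ) (A : TField (k + 1)) :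
    TField (k + 1) :=
  extD (codiff g A) + codiff g (extD A)

/-- The Ricci curvature
`R_{jk} = ∂_i Γ^i_{jk} - ∂_j Γ^i_{ik} + Γ^i_{ip} Γ^p_{jk} - Γ^i_{jp} Γ^p_{ik}`. -/
def ricci (g : E6 → Matrix (Fin 6) (Fin 6) ℝ) (y : E6) (j k : Fin 6) : ℝ :=
  ∑ i, (pd i (fun z => christoffel g z i j k) y - pd j (fun z => christoffel g z i i k) y +
    ∑ p, (christoffel g y i i p * christoffel g y p j k -
      christoffel g y i j p * christoffel g y p i k))

/-- The Nijenhuis tensor `N^i_{jk} = J^l_j ∂_l J^i_k - J^l_k ∂_l J^i_j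
- J^i_l (∂_j J^l_k - ∂_k J^l_j)` of an almost complex structure. -/
def nijenhuis (J : E6 → Matrix (Fin 6) (Fin 6) ℝ) (y : E6) (i j k : Fin 6) : ℝ :=
  ∑ l, (J y l j * pd l (fun z => J z i k) y - J y l k * pd l (fun z => J z i j) y -
    J y i l * (pd j (fun z => J z l k) y - pd k (fun z => J z l j) y))

/-! ### The reparametrized Type IIA flow in coordinates -/

/-- The field of metrics of a pair `(φ, ω)`. -/
def metricField (φ : TField 3) (ω : TField 2) : E6 → Matrix (Fin 6) (Fin 6) ℝ :=
  fun y => metric (φ y) (ω y)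

/-- The vector field `V^k = |φ|² g^{pq} (Γ^k_{pq} - Γ'^k_{pq}) - g^{lk} ∂_l |φ|²`, where `Γ` belongs
to the metric `g` of `(φ, ω)` and `Γ'` to the reference metric `g'`. -/
def deTurck (g' : E6 → Matrix (Fin 6) (Fin 6) ℝ) (φ : TField 3) (ω : TField 2) (y : E6)
    (k : Fin 6) : ℝ :=
  normSq (φ y) (ω y) * ∑ p, ∑ q, (metricField φ ω y)⁻¹ p q *
      (christoffel (metricField φ ω) y k p q - christoffel g' y k p q) -
    ∑ l, (metricField φ ω y)⁻¹ l k * pd l (fun z => normSq (φ z) (ω z)) y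

/-- `E(φ, ω) = d Λ_ω d(|φ|² φ̂) + d ι_V φ`. -/
def flowE (g' : E6 → Matrix (Fin 6) (Fin 6) ℝ) (φ : TField 3) (ω : TField 2) : TField 3 :=
  extD (k := 2) (fun z => contractOmega (k := 2) (ω z)
      (extD (k := 3) (fun w => normSq (φ w) (ω w) • hat (φ w) (ω w)) z)) +
    extD (k := 2) (fun z => interior (k := 2) (deTurck g' φ ω z) (φ z))

/-- `F(φ, ω) = d ι_V ω`. -/
def flowF (g' : E6 → Matrix (Fin 6) (Fin 6) ℝ) (φ : TField 3) (ω : TField 2) : TField 2 :=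
  extD (k := 1) (fun z => interior (k := 1) (deTurck g' φ ω z) (ω z))

/-- The one-form `H = ⋆(δφ ∧ ω̄ + φ̄ ∧ δω)`, where `⋆` belongs to the metric of `(φ̄, ω̄)`, whose
volume form is `ω̄³ / 3!`. -/
def primitiveDefect (φ : TField 3) (ω : TField 2) (δφ : TField 3) (δω : TField 2) : TField 1 :=
  fun y => hodgeStar (p := 5) (q := 1) (metric (φ y) (ω y)) (volForm (ω y))
    (wedge (δφ y) (ω y) + wedge (φ y) (δω y))

/-! ### Contractions with terms involving `(φ, ω)` -/

/-- Formal expressions for the tensors that are built from `φ`, `ω` and the metric `g` of `(φ, ω)`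
by sums, multiplication with real numbers, permutations of the indices, tensor products, and
contractions with the inverse metric. -/
inductive TensorExpr : ℕ → Type
  | phi : TensorExpr 3
  | omega : TensorExpr 2
  | metric : TensorExpr 2
  | add {n : ℕ} : TensorExpr n → TensorExpr n → TensorExpr n
  | smul {n : ℕ} : ℝ → TensorExpr n → TensorExpr n
  | perm {n : ℕ} : Equiv.Perm (Fin n) → TensorExpr n → TensorExpr n
  | prod {m n : ℕ} : TensorExpr m → TensorExpr n → TensorExpr (m + n)
  | contract {n : ℕ} : TensorExpr (n + 2) → TensorExpr n

/-- The tensor that an expression denotes for given `(φ, ω)`. -/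
def TensorExpr.eval (φ : Tens 3) (ω : Tens 2) : {n : ℕ} → TensorExpr n → Tens n
  | _, .phi => φ
  | _, .omega => ω
  | _, .metric => fun i => TypeIIA.metric φ ω (i 0) (i 1)
  | _, .add S T => S.eval φ ω + T.eval φ ω
  | _, .smul c T => c • T.eval φ ω
  | _, .perm σ T => fun i => T.eval φ ω (i ∘ σ)
  | _, .prod (m := m) (n := n) S T => fun i =>
      S.eval φ ω (fun a => i (Fin.castAdd n a)) * T.eval φ ω (fun b => i (Fin.natAdd m b))
  | _, .contract T => fun i =>
      ∑ p, ∑ q, (TypeIIA.metric φ ω)⁻¹ p q * T.eval φ ω (Fin.cons p (Fin.cons q i))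

/-- The contraction `(𝓔 * A)_I = g^{pr} g^{qs} 𝓔_{pqI} A_{rs}`. -/
def TensorExpr.star {n : ℕ} (T : TensorExpr (n + 2)) (φ : Tens 3) (ω : Tens 2) (A : Tens 2) :
    Tens n := fun i =>
  ∑ p, ∑ q, ∑ r, ∑ s, (TypeIIA.metric φ ω)⁻¹ p r * (TypeIIA.metric φ ω)⁻¹ q s *
    T.eval φ ω (Fin.cons p (Fin.cons q i)) * A ![r, s]

/-! ### Forms and Type IIA structures on a manifold -/

variable {M : Type*} [TopologicalSpace M] [ChartedSpace E6 M]

/-- A (not necessarily continuous) field of alternating `k`-linear forms on the tangent spaces. -/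
abbrev Form (M : Type*) [TopologicalSpace M] [ChartedSpace E6 M] (k : ℕ) : Type _ :=
  ∀ x : M, TangentSpace (𝓡 6) x [⋀^Fin k]→ₗ[ℝ] ℝ

/-- The components `α(∂_{i₁}, …, ∂_{i_k})` of a form in a chart `e`, as functions on the target of
`e`. -/
def inChart {k : ℕ} (e : OpenPartialHomeomorph M E6) (α : Form M k) : TField k := fun y i =>
  α (e.symm y) (fun a => mfderiv 𝓘(ℝ, E6) (𝓡 6) e.symm y (coordVec (i a)))

/-- Smooth forms: the components in every smooth chart are smooth. -/
def IsSmoothForm {k : ℕ} (α : Form M k) : Prop :=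
  ∀ e ∈ IsManifold.maximalAtlas (𝓡 6) Cinf M, ContDiffOn ℝ Cinf (inChart e α) e.target

/-- Closed forms: `dα = 0` in every smooth chart. -/
def IsClosedForm {k : ℕ} (α : Form M k) : Prop :=
  ∀ e ∈ IsManifold.maximalAtlas (𝓡 6) Cinf M, ∀ y ∈ e.target, extD (inChart e α) y = 0

/-- A Type IIA structure: a symplectic form `ω` and a closed, non-degenerate, primitive three-form
`φ` such that the metric of `(φ, ω)` is positive definite. -/
structure IsTypeIIA (φ : Form M 3) (ω : Form M 2) : Prop where
  smooth_phi : IsSmoothForm φ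
  smooth_omega : IsSmoothForm ω
  closed_phi : IsClosedForm φ
  closed_omega : IsClosedForm ω
  nondegenerate_omega : ∀ e ∈ IsManifold.maximalAtlas (𝓡 6) Cinf M, ∀ y ∈ e.target,
    (toMatrix (inChart e ω y)).det ≠ 0
  nondegenerate_phi : ∀ e ∈ IsManifold.maximalAtlas (𝓡 6) Cinf M, ∀ y ∈ e.target,
    hitchinLambda (inChart e φ y) (inChart e ω y) < 0
  primitive : ∀ e ∈ IsManifold.maximalAtlas (𝓡 6) Cinf M, ∀ y ∈ e.target,
    contractOmega (k := 1) (inChart e ω y) (inChart e φ y) = 0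
  posDef : ∀ e ∈ IsManifold.maximalAtlas (𝓡 6) Cinf M, ∀ y ∈ e.target,
    (metric (inChart e φ y) (inChart e ω y)).PosDef

/-- A Ricci-flat Type IIA structure: the almost complex structure is integrable, the (then Kähler)
metric is Ricci-flat, and `|φ|` is locally constant. -/
structure IsRicciFlatTypeIIA (φ : Form M 3) (ω : Form M 2) : Prop extends IsTypeIIA φ ω where
  integrable : ∀ e ∈ IsManifold.maximalAtlas (𝓡 6) Cinf M, ∀ y ∈ e.target, ∀ i j k,
    nijenhuis (fun z => almostComplex (inChart e φ z) (inChart e ω z)) y i j k = 0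
  ricci_flat : ∀ e ∈ IsManifold.maximalAtlas (𝓡 6) Cinf M, ∀ y ∈ e.target, ∀ j k,
    ricci (metricField (inChart e φ) (inChart e ω)) y j k = 0
  norm_const : ∀ e ∈ IsManifold.maximalAtlas (𝓡 6) Cinf M, ∀ y ∈ e.target, ∀ i,
    pd i (fun z => normSq (inChart e φ z) (inChart e ω z)) y = 0

end TypeIIA

end

open TypeIIA

/-!
# Linearization of the Type IIA flow at a Ricci-flat structure

Everything is local, so the argument takes place in a chart, where forms are arrays of components.

*Normal form.* Hitchin's endomorphism of a three-form in dimension six squares to a scalar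
(`hitchinDensity_sq`), so `J² = -1` for a nondegenerate form, and `φ` is of type `(3,0) + (0,3)` for
`J`. Together with primitivity and `g > 0` this yields a frame in which `φ = c Re (dz¹ ∧ dz² ∧ dz³)`
and `ω = ω₀` (`IsTypeIIAAt.exists_frame`). All constructions are equivariant under `GL(6)`
(the lemmas `*_pull`), so pointwise identities may be checked at the pair `(c φ₀, ω₀)`. The orbit of
`φ₀` is open: a variation of `φ₀` is the infinitesimal action of an explicit matrix (`lie_liftMat`).
This reduces the derivatives of `|φ|²`, `|φ|² φ̂` and `g` to variations of `ω` alone, for which they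
are elementary (`fderiv_nF_std`, `fderiv_nhF_std`, `fderiv_gF_std`).

*Parallelism.* Integrability of `J` and `dω = 0` make `ω` parallel (`IsParallelModel.cov_omega`).
As `g` and `|φ|` are parallel too, `∇φ = t ⊗ φ̂` for some one-form `t`, and `dφ = 0` gives `t = 0`
(`IsParallelModel.cov_phi`). Consequently `d(|φ|² φ̂)` and `V` vanish at the base point, and `∇`
commutes with every equivariant expression in `(φ, ω)` and a variation (`cov_invariant`). So the
linearizations of `E` and `F` are `d` of potentials that are linear and equivariant in `∇δφ` and
`∇δω` (`hasDerivAt_flowE`, `hasDerivAt_flowF`, `linE`, `linF`).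

*The pointwise identity.* In the standard frame, and for closed variations `(α, β)`, the two
potentials are

* `-|φ|² d⋆α + 𝓔₁ * ∇H + d ((|φ|² / 2) ⋆(α ∧ ω - φ ∧ β))` with
  `(𝓔₁)_{pqij} = (|φ|² / 2) (ω_{pi} ω_{qj} - ω_{pj} ω_{qi})`,
* `-|φ|² d⋆β + 𝓔₂ * ∇H + d (2 φ ∧ α / vol)` with `(𝓔₂)_{pqi} = 2 φ_{apq} g^{ab} ω_{bi}`,

where `H = ⋆(α ∧ ω + φ ∧ β)`. These are linear identities in the components of `∇α` and `∇β` modulo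
`dα = 0` and `dβ = 0` (`linE_std`, `linF_std`), and equivariance carries them to every frame
(`linE_eq`, `linF_eq`). Applying `d` removes the exact terms and, since `|φ|²` is constant, turns
`-|φ|² d⋆` into `-|φ|² □` on closed forms (`extD_potential`). If `H = 0`, the terms with `∇H` drop
out.
-/

namespace TypeIIA

noncomputable section

/-! ### Pullback of covariant tensors -/

/-- The pullback `P^* A` of a covariant tensor by a matrix `P`,
`(P^* A)_{i₁…i_k} = P^{j₁}_{i₁} ⋯ P^{j_k}_{i_k} A_{j₁…j_k}`. -/
def pull {k : ℕ} (P : Matrix (Fin 6) (Fin 6) ℝ) (A : Tens k) : Tens k := fun i =>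
  ∑ j : Fin k → Fin 6, (∏ a, P (j a) (i a)) * A j

variable {k l m n : ℕ} (P Q : Matrix (Fin 6) (Fin 6) ℝ)

theorem pull_add (A B : Tens k) : pull P (A + B) = pull P A + pull P B := by
  ext i; simp [pull, mul_add, Finset.sum_add_distrib]

theorem pull_smul (c : ℝ) (A : Tens k) : pull P (c • A) = c • pull P A := by
  ext i; simp only [pull, Pi.smul_apply, smul_eq_mul, Finset.mul_sum]
  exact Finset.sum_congr rfl fun j _ => by ring

theorem pull_sum {ι : Type*} (s : Finset ι) (A : ι → Tens k) :
    pull P (∑ x ∈ s, A x) = ∑ x ∈ s, pull P (A x) := by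
  ext i; simp only [pull, Finset.sum_apply, Finset.mul_sum]
  exact Finset.sum_comm

/-- `pull P` as a continuous linear map. -/
def pullL (k : ℕ) : Tens k →L[ℝ] Tens k :=
  LinearMap.toContinuousLinearMap
    { toFun := pull P, map_add' := pull_add P, map_smul' := pull_smul P }

@[simp] theorem pullL_apply (A : Tens k) : pullL P k A = pull P A := rfl

theorem pull_one (A : Tens k) : pull 1 A = A := by
  ext i
  rw [pull, Finset.sum_eq_single i]
  · simp
  · intro j _ hj
    obtain ⟨a, ha⟩ := Function.ne_iff.1 hj
    have : (∏ a, (1 : Matrix (Fin 6) (Fin 6) ℝ) (j a) (i a)) = 0 :=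
      Finset.prod_eq_zero (Finset.mem_univ a) (Matrix.one_apply_ne ha)
    rw [this, zero_mul]
  · simp

theorem pull_mul (A : Tens k) : pull (P * Q) A = pull Q (pull P A) := by
  ext i
  simp only [pull, Matrix.mul_apply, Finset.prod_univ_sum, Fintype.piFinset_univ, Finset.sum_mul,
    Finset.mul_sum]
  rw [Finset.sum_comm]
  refine Finset.sum_congr rfl fun j _ => Finset.sum_congr rfl fun x _ => ?_
  rw [Finset.prod_mul_distrib]; ring

variable {P Q} in
theorem pull_cancel (h : P * Q = 1) (A : Tens k) : pull Q (pull P A) = A := by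
  rw [← pull_mul, h, pull_one]

theorem pull_perm (σ : Fin k ≃ Fin l) (A : Tens k) :
    pull P (fun i : Fin l → Fin 6 => A (i ∘ σ)) = fun i => pull P A (i ∘ σ) := by
  ext i
  simp only [pull]
  refine Fintype.sum_equiv (Equiv.arrowCongr σ.symm (Equiv.refl _)) _ _ fun j => ?_
  have h : (Equiv.arrowCongr σ.symm (Equiv.refl (Fin 6))) j = j ∘ σ := by ext; simp
  rw [h, ← Equiv.prod_comp σ]
  rfl

/-- The tensor product. -/
def tprod (A : Tens m) (B : Tens n) : Tens (m + n) := fun i =>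
  A (fun a => i (Fin.castAdd n a)) * B (fun b => i (Fin.natAdd m b))

theorem pull_tprod (A : Tens m) (B : Tens n) :
    pull P (tprod A B) = tprod (pull P A) (pull P B) := by
  ext i
  simp only [pull, tprod, Finset.sum_mul_sum]
  rw [← Fintype.sum_prod_type']
  refine (Fintype.sum_equiv (Fin.appendEquiv m n) _ _ fun x => ?_).symm
  rw [Fin.prod_univ_add]
  simp [Fin.appendEquiv]
  ring

theorem sum_cons {α : Type*} [AddCommMonoid α] (f : (Fin (k + 1) → Fin 6) → α) :
    ∑ j, f j = ∑ a, ∑ j, f (Fin.cons a j) := by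
  rw [← Fintype.sum_prod_type']
  exact (Fintype.sum_equiv (Fin.consEquiv (fun _ => Fin 6)) _ _ fun x => rfl).symm

theorem pull_cons (A : Tens (k + 1)) (p : Fin 6) (i : Fin k → Fin 6) :
    pull P A (Fin.cons p i) = ∑ a, P a p * pull P (fun j => A (Fin.cons a j)) i := by
  rw [pull, sum_cons]
  refine Finset.sum_congr rfl fun a _ => ?_
  rw [pull, Finset.mul_sum]
  refine Finset.sum_congr rfl fun j _ => ?_
  rw [Fin.prod_univ_succ]
  simp
  ring

/-- The contraction `M^{pq} A_{pqI}` of the first two indices. -/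
def contr (M : Matrix (Fin 6) (Fin 6) ℝ) (A : Tens (k + 2)) : Tens k := fun i =>
  ∑ p, ∑ q, M p q * A (Fin.cons p (Fin.cons q i))

theorem pull_contr (M : Matrix (Fin 6) (Fin 6) ℝ) (A : Tens (k + 2)) :
    contr M (pull P A) = pull P (contr (P * M * P.transpose) A) := by
  ext i
  have h : pull P (contr (P * M * P.transpose) A) i =
      ∑ a, ∑ b, (P * M * P.transpose) a b * pull P (fun j => A (Fin.cons a (Fin.cons b j))) i := by
    have : contr (P * M * P.transpose) A =
        ∑ a, ∑ b, (P * M * P.transpose) a b • (fun j => A (Fin.cons a (Fin.cons b j))) := by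
      ext j; simp [contr]
    rw [this, pull_sum]
    simp only [pull_sum, pull_smul]
    simp
  rw [h]
  simp only [contr, pull_cons, Matrix.mul_apply, Matrix.transpose_apply, Finset.sum_mul,
    Finset.mul_sum]
  have e : ∀ (f : Fin 6 → Fin 6 → Fin 6 → Fin 6 → ℝ),
      ∑ p, ∑ q, ∑ a, ∑ b, f p q a b = ∑ a, ∑ b, ∑ q, ∑ p, f p q a b := by
    intro f
    calc _ = ∑ q, ∑ p, ∑ a, ∑ b, f p q a b := Finset.sum_comm
      _ = ∑ q, ∑ a, ∑ p, ∑ b, f p q a b := Finset.sum_congr rfl fun _ _ => Finset.sum_comm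
      _ = ∑ a, ∑ q, ∑ p, ∑ b, f p q a b := Finset.sum_comm
      _ = ∑ a, ∑ q, ∑ b, ∑ p, f p q a b := Finset.sum_congr rfl fun _ _ =>
          Finset.sum_congr rfl fun _ _ => Finset.sum_comm
      _ = _ := Finset.sum_congr rfl fun _ _ => Finset.sum_comm
  rw [e]
  refine Finset.sum_congr rfl fun a _ => Finset.sum_congr rfl fun b _ =>
    Finset.sum_congr rfl fun q _ => Finset.sum_congr rfl fun p _ => ?_
  ring

/-! ### Top-degree forms -/

theorem IsAlt.eq_zero {A : Tens k} (hA : IsAlt A) {i : Fin k → Fin 6} {a b : Fin k}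
    (hab : a ≠ b) (h : i a = i b) : A i = 0 := by
  have h1 := hA (Equiv.swap a b) i
  have h2 : i ∘ Equiv.swap a b = i := by
    ext c
    rcases eq_or_ne c a with rfl | hca
    · simp [h]
    · rcases eq_or_ne c b with rfl | hcb
      · simp [h]
      · simp [Equiv.swap_apply_of_ne_of_ne hca hcb]
  rw [h2, Equiv.Perm.sign_swap hab] at h1
  simp at h1
  linarith

theorem IsAlt.add {A B : Tens k} (hA : IsAlt A) (hB : IsAlt B) : IsAlt (A + B) := by
  intro σ i; simp [hA σ i, hB σ i]; ring

theorem IsAlt.smul {A : Tens k} (hA : IsAlt A) (c : ℝ) : IsAlt (c • A) := by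
  intro σ i; simp [hA σ i]; ring

theorem IsAlt.pull {A : Tens k} (hA : IsAlt A) : IsAlt (pull P A) := by
  intro σ i
  have h := congrFun (pull_perm P σ A) i
  rw [← h]
  have : (fun i : Fin k → Fin 6 => A (i ∘ σ)) = ((Equiv.Perm.sign σ : ℤ) : ℝ) • A := by
    ext i; simp [hA σ i]
  rw [this, pull_smul]; rfl

theorem pull_top {A : Tens 6} (hA : IsAlt A) : pull P A id = P.det * A id := by
  rw [pull, Matrix.det_apply', Finset.sum_mul]
  refine (Fintype.sum_of_injective (fun σ : Equiv.Perm (Fin 6) => (σ : Fin 6 → Fin 6))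
    DFunLike.coe_injective
    (fun σ => ((Equiv.Perm.sign σ : ℤ) : ℝ) * (∏ a, P (σ a) a) * A id)
    (fun j => (∏ a, P (j a) (id a)) * A j) ?_ ?_).symm
  · intro j hj
    have : ¬ Function.Injective j := fun h => hj
      ⟨Equiv.ofBijective j (Finite.injective_iff_bijective.1 h), rfl⟩
    simp only [Function.Injective, not_forall] at this
    obtain ⟨a, b, h, hab⟩ := this
    rw [hA.eq_zero hab h, mul_zero]
  · intro σ
    have := hA σ id
    simp only [Function.id_comp] at this
    rw [this]
    simp only [id]
    ring

theorem wedge_eq (A : Tens m) (B : Tens n) : wedge A B =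
    ((m.factorial : ℝ) * (n.factorial : ℝ))⁻¹ • ∑ σ : Equiv.Perm (Fin (m + n)),
      ((Equiv.Perm.sign σ : ℤ) : ℝ) • fun i => tprod A B (i ∘ σ) := by
  ext i
  simp [wedge, tprod, mul_assoc]

theorem wedge_isAlt (A : Tens m) (B : Tens n) : IsAlt (wedge A B) := by
  intro τ i
  rw [wedge_eq]
  simp only [Pi.smul_apply, Finset.sum_apply, smul_eq_mul]
  rw [mul_left_comm]
  refine congrArg (fun x : ℝ => ((m.factorial : ℝ) * (n.factorial : ℝ))⁻¹ * x) ?_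
  rw [Finset.mul_sum]
  refine Fintype.sum_equiv (Equiv.mulLeft τ) _ _ fun σ => ?_
  simp only [Equiv.coe_mulLeft, Equiv.Perm.sign_mul, Units.val_mul, Int.cast_mul,
    Equiv.Perm.coe_mul, ← mul_assoc]
  have : (((Equiv.Perm.sign τ : ℤ) : ℝ)) * ((Equiv.Perm.sign τ : ℤ) : ℝ) = 1 := by
    rw [← Int.cast_mul, ← Units.val_mul, Int.units_mul_self]; simp
  rw [this, one_mul]
  rfl

theorem pull_wedge (A : Tens m) (B : Tens n) :
    pull P (wedge A B) = wedge (pull P A) (pull P B) := by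
  rw [wedge_eq, wedge_eq, pull_smul, pull_sum]
  congr 1
  refine Finset.sum_congr rfl fun σ _ => ?_
  rw [pull_smul, pull_perm, pull_tprod]

theorem wedge_add_left (A A' : Tens m) (B : Tens n) :
    wedge (A + A') B = wedge A B + wedge A' B := by
  ext i; simp [wedge, add_mul, mul_add, Finset.sum_add_distrib]

theorem wedge_add_right (A : Tens m) (B B' : Tens n) :
    wedge A (B + B') = wedge A B + wedge A B' := by
  ext i; simp [wedge, mul_add, Finset.sum_add_distrib]

theorem wedge_smul_left (c : ℝ) (A : Tens m) (B : Tens n) :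
    wedge (c • A) B = c • wedge A B := by
  ext i; simp only [wedge, Pi.smul_apply, smul_eq_mul, Finset.mul_sum]
  exact Finset.sum_congr rfl fun _ _ => by ring

theorem wedge_smul_right (c : ℝ) (A : Tens m) (B : Tens n) :
    wedge A (c • B) = c • wedge A B := by
  ext i; simp only [wedge, Pi.smul_apply, smul_eq_mul, Finset.mul_sum]
  exact Finset.sum_congr rfl fun _ _ => by ring

/-- The wedge product as a bilinear map. -/
def wedgeL (m n : ℕ) : Tens m →ₗ[ℝ] Tens n →ₗ[ℝ] Tens (m + n) :=
  LinearMap.mk₂ ℝ wedge wedge_add_left wedge_smul_left wedge_add_right wedge_smul_right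

theorem wedgeL_apply (A : Tens m) (B : Tens n) : wedgeL m n A B = wedge A B := rfl

/-! ### Equivariance under linear changes of coordinates -/

section Equivariance

variable {k m n : ℕ} (P : Matrix (Fin 6) (Fin 6) ℝ)

theorem pull_contr_of_eq {M M' : Matrix (Fin 6) (Fin 6) ℝ} (h : P * M' * P.transpose = M)
    (A : Tens (k + 2)) : contr M' (pull P A) = pull P (contr M A) := by
  rw [pull_contr, h]

theorem pull_interior (V : Fin 6 → ℝ) (A : Tens (k + 1)) :
    interior V (pull P A) = pull P (interior (P.mulVec V) A) := by
  have h : interior (P.mulVec V) A = ∑ a, P.mulVec V a • fun j => A (Fin.cons a j) := by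
    ext i; simp [interior]
  ext i
  rw [h, pull_sum]
  simp only [interior, pull_cons, pull_smul, Finset.sum_apply, Pi.smul_apply, smul_eq_mul,
    Matrix.mulVec, dotProduct, Finset.sum_mul, Finset.mul_sum]
  rw [Finset.sum_comm]
  exact Finset.sum_congr rfl fun _ _ => Finset.sum_congr rfl fun _ _ => by ring

theorem sum_fin_zero (f : (Fin 0 → Fin 6) → ℝ) : ∑ j, f j = f ![] := by
  rw [Fintype.sum_eq_single ![]]
  intro j hj; exact absurd (Subsingleton.elim _ _) hj

theorem sum_fin_one (f : (Fin 1 → Fin 6) → ℝ) : ∑ j, f j = ∑ a, f ![a] := by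
  rw [sum_cons]; simp only [sum_fin_zero]; rfl

theorem sum_fin_two (f : (Fin 2 → Fin 6) → ℝ) : ∑ j, f j = ∑ a, ∑ b, f ![a, b] := by
  rw [sum_cons]; simp only [sum_fin_one]; rfl

theorem sum_fin_three (f : (Fin 3 → Fin 6) → ℝ) : ∑ j, f j = ∑ a, ∑ b, ∑ c, f ![a, b, c] := by
  rw [sum_cons]; simp only [sum_fin_two]; rfl

theorem pull_zero_valence (A : Tens 0) : pull P A = A := by
  ext i
  rw [pull, sum_fin_zero, Subsingleton.elim i ![]]; simp

theorem toMatrix_pull (ω : Tens 2) :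
    toMatrix (pull P ω) = P.transpose * toMatrix ω * P := by
  ext i j
  simp only [toMatrix, Matrix.of_apply, pull, sum_fin_two, Matrix.mul_apply,
    Matrix.transpose_apply, Finset.sum_mul]
  rw [Finset.sum_comm]
  refine Finset.sum_congr rfl fun b _ => Finset.sum_congr rfl fun a _ => ?_
  simp [Fin.prod_univ_two]; ring

theorem omegaInv_pull (ω : Tens 2) :
    omegaInv (pull P ω) = P⁻¹ * omegaInv ω * P⁻¹.transpose := by
  rw [omegaInv, toMatrix_pull, Matrix.mul_inv_rev, Matrix.mul_inv_rev, ← Matrix.mul_assoc,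
    Matrix.transpose_nonsing_inv]
  rfl

theorem contractOmega_eq (ω : Tens 2) (A : Tens (k + 2)) :
    contractOmega ω A = (1 / 2 : ℝ) • contr (omegaInv ω).transpose A := by
  ext i
  simp only [contractOmega, contr, Pi.smul_apply, smul_eq_mul, Matrix.transpose_apply]
  rw [Finset.sum_comm]

/-- The component `vol_{123456}` of the volume form `ω³ / 3!`. -/
def vol (ω : Tens 2) : ℝ := volForm ω id

theorem volForm_eq (ω : Tens 2) : volForm ω = (1 / 6 : ℝ) • wedge (wedge ω ω) ω := rfl

theorem volForm_isAlt (ω : Tens 2) : IsAlt (volForm ω) :=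
  (wedge_isAlt (wedge ω ω) ω).smul (1 / 6)

theorem pull_volForm (ω : Tens 2) : volForm (pull P ω) = pull P (volForm ω) := by
  rw [volForm_eq, volForm_eq, pull_smul, ← pull_wedge, ← pull_wedge]

theorem vol_pull (ω : Tens 2) : vol (pull P ω) = P.det * vol ω := by
  rw [vol, pull_volForm, pull_top P (volForm_isAlt ω), vol]

/-- The covector `dx^i`. -/
def dx (i : Fin 6) : Tens 1 := fun a => if a 0 = i then 1 else 0

/-- Hitchin's endomorphism with values in densities: `hitchinK φ ω` times the volume form. -/
def hitchinDensity (φ : Tens 3) : Matrix (Fin 6) (Fin 6) ℝ := Matrix.of fun i j =>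
  wedge (p := 5) (q := 1) (wedge (p := 2) (q := 3) (fun a => φ (Fin.cons j a)) φ) (dx i) id

theorem hitchinK_eq (φ : Tens 3) (ω : Tens 2) :
    hitchinK φ ω = (vol ω)⁻¹ • hitchinDensity φ := by
  ext i j
  simp only [hitchinK, hitchinDensity, vol, Matrix.of_apply, Matrix.smul_apply, smul_eq_mul]
  rw [div_eq_inv_mul]
  rfl

variable (hP : P.det ≠ 0)

include hP in
theorem dx_eq_pull (i : Fin 6) : dx i = pull P (∑ b, P⁻¹ i b • dx b) := by
  ext x
  have h : (P⁻¹ * P) i (x 0) = (1 : Matrix (Fin 6) (Fin 6) ℝ) i (x 0) := by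
    rw [Matrix.nonsing_inv_mul _ (isUnit_iff_ne_zero.2 hP)]
  have h' : pull P (∑ b, P⁻¹ i b • dx b) x = ∑ a, P⁻¹ i a * P a (x 0) := by
    rw [pull, sum_fin_one]
    refine Finset.sum_congr rfl fun a _ => ?_
    have : (∑ b, P⁻¹ i b • dx b) ![a] = P⁻¹ i a := by
      simp [dx, Finset.sum_apply]
    rw [this]
    simp [mul_comm]
  rw [h', ← Matrix.mul_apply, h, Matrix.one_apply]
  simp only [dx, eq_comm]

include hP in
theorem hitchinDensity_pull (φ : Tens 3) :
    hitchinDensity (pull P φ) = P.det • (P⁻¹ * hitchinDensity φ * P) := by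
  ext i j
  have h1 : (fun a => pull P φ (Fin.cons j a)) =
      pull P (∑ c, P c j • fun a => φ (Fin.cons c a)) := by
    ext a; rw [pull_cons, pull_sum]; simp [pull_smul]
  have h2 : hitchinDensity (pull P φ) i j =
      wedge (p := 5) (q := 1) (wedge (p := 2) (q := 3) (pull P (∑ c, P c j • fun a =>
        φ (Fin.cons c a))) (pull P φ)) (pull P (∑ b, P⁻¹ i b • dx b)) id := by
    rw [← dx_eq_pull P hP, ← h1]; rfl
  rw [h2, ← pull_wedge, ← pull_wedge, pull_top P (wedge_isAlt _ _), Matrix.smul_apply, smul_eq_mul]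
  congr 1
  simp only [← wedgeL_apply, map_sum, LinearMap.sum_apply, map_smul, LinearMap.smul_apply,
    Finset.sum_apply, Pi.smul_apply, smul_eq_mul, Matrix.mul_apply, Finset.sum_mul, Finset.mul_sum]
  rw [Finset.sum_comm]
  refine Finset.sum_congr rfl fun c _ => Finset.sum_congr rfl fun b _ => ?_
  simp only [hitchinDensity, Matrix.of_apply, wedgeL_apply]
  ring

include hP in
theorem hitchinK_pull (φ : Tens 3) (ω : Tens 2) :
    hitchinK (pull P φ) (pull P ω) = P⁻¹ * hitchinK φ ω * P := by
  rw [hitchinK_eq, hitchinK_eq, hitchinDensity_pull P hP, vol_pull, smul_smul]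
  rw [Matrix.mul_smul, Matrix.smul_mul]
  congr 1
  rcases eq_or_ne (vol ω) 0 with h | h
  · simp [h]
  · field_simp

theorem conj_mul_conj {P : Matrix (Fin 6) (Fin 6) ℝ} (hP : P.det ≠ 0)
    (A B : Matrix (Fin 6) (Fin 6) ℝ) : P⁻¹ * A * P * (P⁻¹ * B * P) = P⁻¹ * (A * B) * P := by
  have h : P * P⁻¹ = 1 := Matrix.mul_nonsing_inv _ (isUnit_iff_ne_zero.2 hP)
  calc _ = P⁻¹ * A * (P * P⁻¹) * B * P := by simp only [Matrix.mul_assoc]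
    _ = _ := by rw [h]; simp only [Matrix.mul_assoc, Matrix.mul_one]

include hP in
theorem hitchinLambda_pull (φ : Tens 3) (ω : Tens 2) :
    hitchinLambda (pull P φ) (pull P ω) = hitchinLambda φ ω := by
  have h : P * P⁻¹ = 1 := Matrix.mul_nonsing_inv _ (isUnit_iff_ne_zero.2 hP)
  rw [hitchinLambda, hitchinK_pull P hP, conj_mul_conj hP, Matrix.trace_mul_comm,
    ← Matrix.mul_assoc, h, Matrix.one_mul]
  rfl

include hP in
theorem almostComplex_pull (φ : Tens 3) (ω : Tens 2) :
    almostComplex (pull P φ) (pull P ω) = P⁻¹ * almostComplex φ ω * P := by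
  rw [almostComplex, hitchinLambda_pull P hP, hitchinK_pull P hP, almostComplex, Matrix.mul_smul,
    Matrix.smul_mul]

theorem hat_eq (φ : Tens 3) (ω : Tens 2) : hat φ ω = pull (almostComplex φ ω) φ := by
  ext i
  rw [pull, sum_fin_three]
  refine Finset.sum_congr rfl fun a _ => Finset.sum_congr rfl fun b _ =>
    Finset.sum_congr rfl fun c _ => ?_
  simp [Fin.prod_univ_three]; ring

include hP in
theorem hat_pull (φ : Tens 3) (ω : Tens 2) :
    hat (pull P φ) (pull P ω) = pull P (hat φ ω) := by
  have h : P * P⁻¹ = 1 := Matrix.mul_nonsing_inv _ (isUnit_iff_ne_zero.2 hP)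
  rw [hat_eq, hat_eq, almostComplex_pull P hP, ← pull_mul, ← pull_mul]
  congr 1
  rw [← Matrix.mul_assoc, ← Matrix.mul_assoc, h, Matrix.one_mul]

include hP in
theorem top_div_vol_pull {A : Tens 6} (hA : IsAlt A) (ω : Tens 2) :
    pull P A id / vol (pull P ω) = A id / vol ω := by
  rw [pull_top P hA, vol_pull, mul_div_mul_left _ _ hP]

theorem normSq_eq (φ : Tens 3) (ω : Tens 2) :
    normSq φ ω = wedge (p := 3) (q := 3) φ (hat φ ω) id / vol ω := rfl

include hP in
theorem normSq_pull (φ : Tens 3) (ω : Tens 2) :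
    normSq (pull P φ) (pull P ω) = normSq φ ω := by
  rw [normSq_eq, hat_pull P hP, ← pull_wedge, top_div_vol_pull P hP (wedge_isAlt _ _), normSq_eq]

/-- The metric of `(φ, ω)` as a covariant tensor. -/
def metricTens (φ : Tens 3) (ω : Tens 2) : Tens 2 := fun i => metric φ ω (i 0) (i 1)

/-- The tensor `φ_{iab} φ_{jkp}`, with the indices in the order `b, p, a, k, i, j`. -/
def phiSq (φ : Tens 3) : Tens 6 := fun i => φ ![i 4, i 2, i 0] * φ ![i 5, i 3, i 1]

theorem metricTens_eq (φ : Tens 3) (ω : Tens 2) : metricTens φ ω =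
    -(normSq φ ω)⁻¹ • contr (k := 2) (omegaInv ω) (contr (k := 4) (omegaInv ω) (phiSq φ)) := by
  ext i
  simp only [metricTens, metric, Matrix.of_apply, contr, Pi.smul_apply, smul_eq_mul]
  congr 1
  refine Finset.sum_congr rfl fun a _ => ?_
  rw [Finset.sum_comm]
  refine Finset.sum_congr rfl fun k _ => ?_
  rw [Finset.mul_sum]
  refine Finset.sum_congr rfl fun b _ => ?_
  rw [Finset.mul_sum]
  refine Finset.sum_congr rfl fun p _ => ?_
  have : phiSq φ (Fin.cons b (Fin.cons p (Fin.cons a (Fin.cons k i)))) =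
    φ ![i 0, a, b] * φ ![i 1, k, p] := rfl
  rw [this]; ring

theorem pull_phiSq (φ : Tens 3) : phiSq (pull P φ) = pull P (phiSq φ) := by
  let σ : Equiv.Perm (Fin 6) := ⟨![4, 2, 0, 5, 3, 1], ![2, 5, 1, 4, 0, 3], by decide, by decide⟩
  have h : ∀ A : Tens 3, phiSq A = fun i => tprod A A (i ∘ σ) := by
    intro A; ext i
    simp only [phiSq, tprod]
    congr 2 <;> ext a <;> fin_cases a <;> rfl
  rw [h, h, pull_perm, pull_tprod]

include hP in
theorem conj_omegaInv_pull (ω : Tens 2) : P * omegaInv (pull P ω) * P.transpose = omegaInv ω := by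
  have h : P * P⁻¹ = 1 := Matrix.mul_nonsing_inv _ (isUnit_iff_ne_zero.2 hP)
  have h' : P⁻¹.transpose * P.transpose = 1 := by rw [← Matrix.transpose_mul, h]; simp
  rw [omegaInv_pull, ← Matrix.mul_assoc, ← Matrix.mul_assoc, h, Matrix.one_mul, Matrix.mul_assoc,
    h', Matrix.mul_one]

include hP in
theorem metricTens_pull (φ : Tens 3) (ω : Tens 2) :
    metricTens (pull P φ) (pull P ω) = pull P (metricTens φ ω) := by
  rw [metricTens_eq, metricTens_eq, normSq_pull P hP, pull_phiSq,
    pull_contr_of_eq P (conj_omegaInv_pull P hP ω), pull_contr_of_eq P (conj_omegaInv_pull P hP ω),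
    pull_smul]

theorem toMatrix_metricTens (φ : Tens 3) (ω : Tens 2) :
    toMatrix (metricTens φ ω) = metric φ ω := by ext; rfl

include hP in
theorem metric_pull (φ : Tens 3) (ω : Tens 2) :
    metric (pull P φ) (pull P ω) = P.transpose * metric φ ω * P := by
  rw [← toMatrix_metricTens, metricTens_pull P hP, toMatrix_pull, toMatrix_metricTens]

include hP in
theorem contractOmega_pull (ω : Tens 2) (A : Tens (k + 2)) :
    contractOmega (pull P ω) (pull P A) = pull P (contractOmega ω A) := by
  rw [contractOmega_eq, contractOmega_eq, pull_smul, pull_contr_of_eq P (M := (omegaInv ω).transpose)]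
  rw [← conj_omegaInv_pull P hP ω]
  simp [Matrix.transpose_mul, Matrix.mul_assoc]

include hP in
theorem conj_metric_inv_pull (φ : Tens 3) (ω : Tens 2) :
    P * (metric (pull P φ) (pull P ω))⁻¹ * P.transpose = (metric φ ω)⁻¹ := by
  have h : P * P⁻¹ = 1 := Matrix.mul_nonsing_inv _ (isUnit_iff_ne_zero.2 hP)
  have h' : P.transpose⁻¹ * P.transpose = 1 :=
    Matrix.nonsing_inv_mul _ (by rw [Matrix.det_transpose]; exact isUnit_iff_ne_zero.2 hP)
  rw [metric_pull P hP, Matrix.mul_inv_rev, Matrix.mul_inv_rev, ← Matrix.mul_assoc, h,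
    Matrix.one_mul, Matrix.mul_assoc, h', Matrix.mul_one]

theorem sum_append {p q : ℕ} (f : (Fin (p + q) → Fin 6) → ℝ) :
    ∑ j, f j = ∑ a : Fin p → Fin 6, ∑ b : Fin q → Fin 6, f (Fin.append a b) := by
  rw [← Fintype.sum_prod_type']
  exact (Fintype.sum_equiv (Fin.appendEquiv p q) _ _ fun x => rfl).symm

theorem hodgeStar_eq {p q : ℕ} (g : Matrix (Fin 6) (Fin 6) ℝ) (v : Tens (p + q)) (A : Tens p)
    (j : Fin q → Fin 6) : hodgeStar g v A j =
      (p.factorial : ℝ)⁻¹ * ∑ i : Fin p → Fin 6, pull g⁻¹.transpose A i * v (Fin.append i j) := by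
  simp only [hodgeStar, pull, Finset.sum_mul, Matrix.transpose_apply]

theorem pull_append {p q : ℕ} (v : Tens (p + q)) (i : Fin p → Fin 6) (j : Fin q → Fin 6) :
    pull P v (Fin.append i j) = ∑ l : Fin p → Fin 6, (∏ a, P (l a) (i a)) *
      pull P (fun b => v (Fin.append l b)) j := by
  rw [pull, sum_append]
  refine Finset.sum_congr rfl fun a _ => ?_
  rw [pull, Finset.mul_sum]
  refine Finset.sum_congr rfl fun b _ => ?_
  simp only [Fin.prod_univ_add, Fin.append_left, Fin.append_right]
  ring

include hP in
theorem hodgeStar_pull {p q : ℕ} (φ : Tens 3) (ω : Tens 2) (v : Tens (p + q)) (A : Tens p) :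
    hodgeStar (metric (pull P φ) (pull P ω)) (pull P v) (pull P A) =
      pull P (hodgeStar (metric φ ω) v A) := by
  have h : P * P⁻¹ = 1 := Matrix.mul_nonsing_inv _ (isUnit_iff_ne_zero.2 hP)
  set B := pull (metric φ ω)⁻¹.transpose A with hB
  have h1 : pull (metric (pull P φ) (pull P ω))⁻¹.transpose (pull P A) = pull P⁻¹.transpose B := by
    rw [hB, ← pull_mul, ← pull_mul]
    congr 1
    rw [← conj_metric_inv_pull P hP φ ω]
    simp only [Matrix.transpose_mul, Matrix.transpose_transpose, Matrix.mul_assoc]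
    rw [← Matrix.transpose_mul, Matrix.nonsing_inv_mul _ (isUnit_iff_ne_zero.2 hP),
      Matrix.transpose_one, Matrix.mul_one]
  have h2 : hodgeStar (metric φ ω) v A =
      (p.factorial : ℝ)⁻¹ • ∑ l, B l • fun j => v (Fin.append l j) := by
    ext j; rw [hodgeStar_eq]; simp [hB]
  ext j
  rw [h2, pull_smul, pull_sum, hodgeStar_eq, h1]
  simp only [pull_smul, Pi.smul_apply, Finset.sum_apply, smul_eq_mul, pull_append]
  congr 1
  have h3 : ∀ i : Fin p → Fin 6, pull P⁻¹.transpose B i =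
      ∑ l : Fin p → Fin 6, (∏ a, P⁻¹ (i a) (l a)) * B l := fun i => rfl
  have h4 : B = pull P.transpose (pull P⁻¹.transpose B) := by
    rw [pull_cancel]
    rw [← Matrix.transpose_mul, h, Matrix.transpose_one]
  calc _ = ∑ l : Fin p → Fin 6, (∑ i : Fin p → Fin 6,
        (∏ a, P.transpose (i a) (l a)) * pull P⁻¹.transpose B i) *
          pull P (fun b => v (Fin.append l b)) j := by
        simp only [Finset.mul_sum, Finset.sum_mul, Matrix.transpose_apply]
        rw [Finset.sum_comm]
        exact Finset.sum_congr rfl fun _ _ => Finset.sum_congr rfl fun _ _ => by ring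
    _ = _ := by
        refine Finset.sum_congr rfl fun l _ => ?_
        congr 1
        exact (congrFun h4 l).symm

end Equivariance

/-! ### Wedge products as sums over shuffles -/

/-- The sum `∑_σ sgn σ F(i ∘ σ)` over all permutations of the positions. -/
def altSum {β : Type*} {n : ℕ} (F : (Fin n → β) → ℝ) (i : Fin n → β) : ℝ :=
  ∑ σ : Equiv.Perm (Fin n), ((Equiv.Perm.sign σ : ℤ) : ℝ) * F (i ∘ σ)

/-- The permutation that sends `0` to `j` and is `τ` on the remaining positions. -/
def permCons {n : ℕ} (j : Fin (n + 1)) (τ : Equiv.Perm (Fin n)) : Equiv.Perm (Fin (n + 1)) :=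
  j.cycleRange.symm * Equiv.Perm.decomposeFin.symm (0, τ)

theorem permCons_zero {n : ℕ} (j : Fin (n + 1)) (τ : Equiv.Perm (Fin n)) :
    permCons j τ 0 = j := by
  simp [permCons]

theorem permCons_succ {n : ℕ} (j : Fin (n + 1)) (τ : Equiv.Perm (Fin n)) (a : Fin n) :
    permCons j τ a.succ = j.succAbove (τ a) := by
  simp [permCons]

theorem sign_permCons {n : ℕ} (j : Fin (n + 1)) (τ : Equiv.Perm (Fin n)) :
    Equiv.Perm.sign (permCons j τ) = (-1) ^ (j : ℕ) * Equiv.Perm.sign τ := by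
  rw [permCons, Equiv.Perm.sign_mul, Equiv.Perm.sign_symm, Fin.sign_cycleRange]
  simp [Equiv.Perm.decomposeFin.symm_sign]

theorem permCons_bijective (n : ℕ) :
    Function.Bijective fun x : Fin (n + 1) × Equiv.Perm (Fin n) => permCons x.1 x.2 := by
  rw [Fintype.bijective_iff_injective_and_card]
  constructor
  · rintro ⟨j, τ⟩ ⟨j', τ'⟩ h
    have h0 : j = j' := by
      have := congrArg (fun σ : Equiv.Perm _ => σ 0) h
      simpa [permCons_zero] using this
    subst h0
    have : τ = τ' := by
      ext1 a
      have := congrArg (fun σ : Equiv.Perm _ => σ a.succ) h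
      simpa [permCons_succ] using this
    rw [this]
  · simp [Fintype.card_perm, Nat.factorial_succ]

/-- Expansion of an alternating sum along the image of the first position. -/
theorem altSum_succ {β : Type*} {n : ℕ} (F : (Fin (n + 1) → β) → ℝ) (i : Fin (n + 1) → β) :
    altSum F i = ∑ j : Fin (n + 1), (-1 : ℝ) ^ (j : ℕ) *
      altSum (fun x : Fin n → β => F (Fin.cons (i j) x)) (fun a => i (j.succAbove a)) := by
  simp only [altSum, Finset.mul_sum]
  rw [← Fintype.sum_prod_type']
  refine (Fintype.sum_bijective _ (permCons_bijective n) _ _ fun x => ?_).symm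
  have h : i ∘ permCons x.1 x.2 = Fin.cons (i x.1) ((fun a => i (x.1.succAbove a)) ∘ x.2) := by
    ext a
    refine Fin.cases ?_ (fun a => ?_) a
    · simp [permCons_zero]
    · simp [permCons_succ]
  rw [h, sign_permCons]
  push_cast
  ring

/-- Total antisymmetry of an array indexed by an arbitrary type. -/
def IsAlt' {β : Type*} {k : ℕ} (A : (Fin k → β) → ℝ) : Prop :=
  ∀ (σ : Equiv.Perm (Fin k)) (i : Fin k → β), A (i ∘ σ) = ((Equiv.Perm.sign σ : ℤ) : ℝ) * A i

theorem altSum_of_isAlt {β : Type*} {n : ℕ} {B : (Fin n → β) → ℝ} (hB : IsAlt' B) (c : ℝ)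
    (i : Fin n → β) : altSum (fun x => c * B x) i = n.factorial * (c * B i) := by
  have : ∀ σ : Equiv.Perm (Fin n),
      ((Equiv.Perm.sign σ : ℤ) : ℝ) * (c * B (i ∘ σ)) = c * B i := by
    intro σ
    rw [hB σ i]
    have : (((Equiv.Perm.sign σ : ℤ) : ℝ)) * ((Equiv.Perm.sign σ : ℤ) : ℝ) = 1 := by
      rw [← Int.cast_mul, ← Units.val_mul, Int.units_mul_self]; simp
    linear_combination c * B i * this
  simp [altSum, this, Fintype.card_perm]

/-- Moving the last argument to the front multiplies an alternating sum by the sign of a cycle. -/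
theorem altSum_rotate {β : Type*} {n : ℕ} (F : (Fin (n + 1) → β) → ℝ) (i : Fin (n + 1) → β) :
    altSum F i = (-1) ^ n * altSum (fun x => F (x ∘ finRotate (n + 1))) i := by
  simp only [altSum, Finset.mul_sum]
  refine (Fintype.sum_equiv (Equiv.mulRight (finRotate (n + 1))) _ _ fun σ => ?_).symm
  simp only [Equiv.coe_mulRight, Equiv.Perm.sign_mul, sign_finRotate, Equiv.Perm.coe_mul]
  push_cast
  rw [← Function.comp_assoc]
  ring

section Swap

variable {β : Type*}

theorem IsAlt'.swap_two {A : (Fin 2 → β) → ℝ} (hA : IsAlt' A) (a b : β) :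
    A ![b, a] = -A ![a, b] := by
  have h := hA (Equiv.swap 0 1) ![a, b]
  rw [Equiv.Perm.sign_swap (by decide)] at h
  have e : ![a, b] ∘ Equiv.swap (0 : Fin 2) 1 = ![b, a] := by
    ext x; fin_cases x <;> rfl
  rw [e] at h; simpa using h

theorem IsAlt'.swap01 {A : (Fin 3 → β) → ℝ} (hA : IsAlt' A) (a b c : β) :
    A ![b, a, c] = -A ![a, b, c] := by
  have h := hA (Equiv.swap 0 1) ![a, b, c]
  rw [Equiv.Perm.sign_swap (by decide)] at h
  have e : ![a, b, c] ∘ Equiv.swap (0 : Fin 3) 1 = ![b, a, c] := by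
    ext x; fin_cases x <;> rfl
  rw [e] at h; simpa using h

theorem IsAlt'.swap12 {A : (Fin 3 → β) → ℝ} (hA : IsAlt' A) (a b c : β) :
    A ![a, c, b] = -A ![a, b, c] := by
  have h := hA (Equiv.swap 1 2) ![a, b, c]
  rw [Equiv.Perm.sign_swap (by decide)] at h
  have e : ![a, b, c] ∘ Equiv.swap (1 : Fin 3) 2 = ![a, c, b] := by
    ext x; fin_cases x <;> rfl
  rw [e] at h; simpa using h

end Swap

theorem IsAlt'.comp {β γ : Type*} {k : ℕ} {A : (Fin k → β) → ℝ} (hA : IsAlt' A) (f : γ → β) :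
    IsAlt' fun x : Fin k → γ => A (f ∘ x) := fun σ i => hA σ (f ∘ i)

theorem wedge_eq_altSum {p q : ℕ} (A : Tens p) (B : Tens q) (i : Fin (p + q) → Fin 6) :
    wedge A B i = ((p.factorial : ℝ) * (q.factorial : ℝ))⁻¹ *
      altSum (fun x : Fin (p + q) → Fin 6 => A (fun a => x (Fin.castAdd q a)) *
        B (fun b => x (Fin.natAdd p b))) i := by
  simp only [wedge, altSum, mul_assoc]; rfl

/-- For antisymmetric factors, the alternating sum over the permutations of the positions reduces to
the sum over shuffles. Working with arrays indexed by the positions themselves keeps all indices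
numerals. -/
theorem shuffle_sum_two_two {A : (Fin 2 → Fin 4) → ℝ} {B : (Fin 2 → Fin 4) → ℝ}
    (hA : IsAlt' A) (hB : IsAlt' B) :
    altSum (fun x : Fin 4 → Fin 4 => A ![x 0, x 1] * B ![x 2, x 3]) id =
    4 * (A ![0, 1] * B ![2, 3] - A ![0, 2] * B ![1, 3] + A ![0, 3] * B ![1, 2] + A ![1, 2] * B
      ![0, 3] - A ![1, 3] * B ![0, 2] + A ![2, 3] * B ![0, 1]) := by
  have hB' : ∀ (c : ℝ) (i : Fin 2 → Fin 4), altSum (fun x => c * B ![x 0, x 1]) i =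
      2 * (c * B ![i 0, i 1]) := by
    intro c i
    have e : ∀ x : Fin 2 → Fin 4, ![x 0, x 1] = x := by
      intro x; ext a; fin_cases a <;> rfl
    simp only [e]
    rw [altSum_of_isAlt hB]; simp [Nat.factorial]
  have e1 : ∀ (a b : Fin 4) (x : Fin 2 → Fin 4),
      A ![(Fin.cons a (Fin.cons b x : Fin 3 → Fin 4) : Fin 4 → Fin 4) 0, (Fin.cons a (Fin.cons b x : Fin 3 → Fin 4) : Fin 4 → Fin 4) 1] *
      B ![(Fin.cons a (Fin.cons b x : Fin 3 → Fin 4) : Fin 4 → Fin 4) 2, (Fin.cons a (Fin.cons b x : Fin 3 → Fin 4) : Fin 4 → Fin 4) 3] =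
      A ![a, b] * B ![x 0, x 1] := fun _ _ _ => rfl
  rw [altSum_succ]
  simp only [altSum_succ (n := 2), e1, hB']
  simp [Fin.sum_univ_succ, Fin.succAbove]
  have a1 : ∀ a b : Fin 4, b < a → A ![a, b] = -A ![b, a] := fun a b _ => hA.swap_two b a
  simp [a1]
  ring

theorem shuffle_sum_two_three {A : (Fin 2 → Fin 5) → ℝ} {B : (Fin 3 → Fin 5) → ℝ}
    (hA : IsAlt' A) (hB : IsAlt' B) :
    altSum (fun x : Fin 5 → Fin 5 => A ![x 0, x 1] * B ![x 2, x 3, x 4]) id =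
    12 * (A ![0, 1] * B ![2, 3, 4] - A ![0, 2] * B ![1, 3, 4] + A ![0, 3] * B ![1, 2, 4] - A ![0,
      4] * B ![1, 2, 3] + A ![1, 2] * B ![0, 3, 4] - A ![1, 3] * B ![0, 2, 4] + A ![1, 4] * B
      ![0, 2, 3] + A ![2, 3] * B ![0, 1, 4] - A ![2, 4] * B ![0, 1, 3] + A ![3, 4] * B ![0, 1,
      2]) := by
  have hB' : ∀ (c : ℝ) (i : Fin 3 → Fin 5), altSum (fun x => c * B ![x 0, x 1, x 2]) i =
      6 * (c * B ![i 0, i 1, i 2]) := by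
    intro c i
    have e : ∀ x : Fin 3 → Fin 5, ![x 0, x 1, x 2] = x := by
      intro x; ext a; fin_cases a <;> rfl
    simp only [e]
    rw [altSum_of_isAlt hB]; simp [Nat.factorial]
  have e1 : ∀ (a b : Fin 5) (x : Fin 3 → Fin 5),
      A ![(Fin.cons a (Fin.cons b x : Fin 4 → Fin 5) : Fin 5 → Fin 5) 0, (Fin.cons a (Fin.cons b x : Fin 4 → Fin 5) : Fin 5 → Fin 5) 1] *
      B ![(Fin.cons a (Fin.cons b x : Fin 4 → Fin 5) : Fin 5 → Fin 5) 2, (Fin.cons a (Fin.cons b x : Fin 4 → Fin 5) : Fin 5 → Fin 5) 3, (Fin.cons a (Fin.cons b x : Fin 4 → Fin 5) : Fin 5 → Fin 5) 4] =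
      A ![a, b] * B ![x 0, x 1, x 2] := fun _ _ _ => rfl
  rw [altSum_succ]
  simp only [altSum_succ (n := 3), e1, hB']
  simp [Fin.sum_univ_succ, Fin.succAbove]
  have a1 : ∀ a b : Fin 5, b < a → A ![a, b] = -A ![b, a] := fun a b _ => hA.swap_two b a
  simp [a1]
  ring

theorem shuffle_sum_two_four {A : (Fin 2 → Fin 6) → ℝ} {B : (Fin 4 → Fin 6) → ℝ}
    (hA : IsAlt' A) (hB : IsAlt' B) :
    altSum (fun x : Fin 6 → Fin 6 => A ![x 0, x 1] * B ![x 2, x 3, x 4, x 5]) id =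
    48 * (A ![0, 1] * B ![2, 3, 4, 5] - A ![0, 2] * B ![1, 3, 4, 5] + A ![0, 3] * B ![1, 2, 4, 5]
      - A ![0, 4] * B ![1, 2, 3, 5] + A ![0, 5] * B ![1, 2, 3, 4] + A ![1, 2] * B ![0, 3, 4,
      5] - A ![1, 3] * B ![0, 2, 4, 5] + A ![1, 4] * B ![0, 2, 3, 5] - A ![1, 5] * B ![0, 2,
      3, 4] + A ![2, 3] * B ![0, 1, 4, 5] - A ![2, 4] * B ![0, 1, 3, 5] + A ![2, 5] * B ![0,
      1, 3, 4] + A ![3, 4] * B ![0, 1, 2, 5] - A ![3, 5] * B ![0, 1, 2, 4] + A ![4, 5] * B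
      ![0, 1, 2, 3]) := by
  have hB' : ∀ (c : ℝ) (i : Fin 4 → Fin 6), altSum (fun x => c * B ![x 0, x 1, x 2, x 3]) i =
      24 * (c * B ![i 0, i 1, i 2, i 3]) := by
    intro c i
    have e : ∀ x : Fin 4 → Fin 6, ![x 0, x 1, x 2, x 3] = x := by
      intro x; ext a; fin_cases a <;> rfl
    simp only [e]
    rw [altSum_of_isAlt hB]; simp [Nat.factorial]
  have e1 : ∀ (a b : Fin 6) (x : Fin 4 → Fin 6),
      A ![(Fin.cons a (Fin.cons b x : Fin 5 → Fin 6) : Fin 6 → Fin 6) 0, (Fin.cons a (Fin.cons b x : Fin 5 → Fin 6) : Fin 6 → Fin 6) 1] *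
      B ![(Fin.cons a (Fin.cons b x : Fin 5 → Fin 6) : Fin 6 → Fin 6) 2, (Fin.cons a (Fin.cons b x : Fin 5 → Fin 6) : Fin 6 → Fin 6) 3, (Fin.cons a (Fin.cons b x : Fin 5 → Fin 6) : Fin 6 → Fin 6) 4, (Fin.cons a (Fin.cons b x : Fin 5 → Fin 6) : Fin 6 → Fin 6) 5] =
      A ![a, b] * B ![x 0, x 1, x 2, x 3] := fun _ _ _ => rfl
  rw [altSum_succ]
  simp only [altSum_succ (n := 4), e1, hB']
  simp [Fin.sum_univ_succ, Fin.succAbove]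
  have a1 : ∀ a b : Fin 6, b < a → A ![a, b] = -A ![b, a] := fun a b _ => hA.swap_two b a
  simp [a1]
  ring

theorem shuffle_sum_three_three {A : (Fin 3 → Fin 6) → ℝ} {B : (Fin 3 → Fin 6) → ℝ}
    (hA : IsAlt' A) (hB : IsAlt' B) :
    altSum (fun x : Fin 6 → Fin 6 => A ![x 0, x 1, x 2] * B ![x 3, x 4, x 5]) id =
    36 * (A ![0, 1, 2] * B ![3, 4, 5] - A ![0, 1, 3] * B ![2, 4, 5] + A ![0, 1, 4] * B ![2, 3, 5]
      - A ![0, 1, 5] * B ![2, 3, 4] + A ![0, 2, 3] * B ![1, 4, 5] - A ![0, 2, 4] * B ![1, 3,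
      5] + A ![0, 2, 5] * B ![1, 3, 4] + A ![0, 3, 4] * B ![1, 2, 5] - A ![0, 3, 5] * B ![1,
      2, 4] + A ![0, 4, 5] * B ![1, 2, 3] - A ![1, 2, 3] * B ![0, 4, 5] + A ![1, 2, 4] * B
      ![0, 3, 5] - A ![1, 2, 5] * B ![0, 3, 4] - A ![1, 3, 4] * B ![0, 2, 5] + A ![1, 3, 5] *
      B ![0, 2, 4] - A ![1, 4, 5] * B ![0, 2, 3] + A ![2, 3, 4] * B ![0, 1, 5] - A ![2, 3, 5]
      * B ![0, 1, 4] + A ![2, 4, 5] * B ![0, 1, 3] - A ![3, 4, 5] * B ![0, 1, 2]) := by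
  have hB' : ∀ (c : ℝ) (i : Fin 3 → Fin 6), altSum (fun x => c * B ![x 0, x 1, x 2]) i =
      6 * (c * B ![i 0, i 1, i 2]) := by
    intro c i
    have e : ∀ x : Fin 3 → Fin 6, ![x 0, x 1, x 2] = x := by
      intro x; ext a; fin_cases a <;> rfl
    simp only [e]
    rw [altSum_of_isAlt hB]; simp [Nat.factorial]
  have e1 : ∀ (a b c : Fin 6) (x : Fin 3 → Fin 6),
      A ![(Fin.cons a (Fin.cons b (Fin.cons c x : Fin 4 → Fin 6) : Fin 5 → Fin 6) : Fin 6 → Fin 6) 0, (Fin.cons a (Fin.cons b (Fin.cons c x : Fin 4 → Fin 6) : Fin 5 → Fin 6) : Fin 6 → Fin 6) 1, (Fin.cons a (Fin.cons b (Fin.cons c x : Fin 4 → Fin 6) : Fin 5 → Fin 6) : Fin 6 → Fin 6) 2] *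
      B ![(Fin.cons a (Fin.cons b (Fin.cons c x : Fin 4 → Fin 6) : Fin 5 → Fin 6) : Fin 6 → Fin 6) 3, (Fin.cons a (Fin.cons b (Fin.cons c x : Fin 4 → Fin 6) : Fin 5 → Fin 6) : Fin 6 → Fin 6) 4, (Fin.cons a (Fin.cons b (Fin.cons c x : Fin 4 → Fin 6) : Fin 5 → Fin 6) : Fin 6 → Fin 6) 5] =
      A ![a, b, c] * B ![x 0, x 1, x 2] := fun _ _ _ _ => rfl
  rw [altSum_succ]
  simp only [altSum_succ (n := 4), altSum_succ (n := 3), e1, hB']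
  simp [Fin.sum_univ_succ, Fin.succAbove]
  have a1 : ∀ a b c : Fin 6, b < a → A ![a, b, c] = -A ![b, a, c] :=
    fun a b c _ => hA.swap01 b a c
  have a2 : ∀ a b c : Fin 6, c < b → A ![a, b, c] = -A ![a, c, b] :=
    fun a b c _ => hA.swap12 a c b
  simp [a1, a2]
  ring

/-- An alternating sum only sees the pulled back array, so that the shuffle formulas transfer to
arbitrary indices. -/
theorem altSum_comp {β γ : Type*} {n : ℕ} (F : (Fin n → β) → ℝ) (f : γ → β) (i : Fin n → γ) :
    altSum (fun x : Fin n → γ => F (f ∘ x)) i = altSum F (f ∘ i) := rfl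

theorem comp_vec_two {β γ : Type*} (f : β → γ) (a b : β) : f ∘ ![a, b] = ![f a, f b] := by
  ext x; fin_cases x <;> rfl

theorem comp_vec_three {β γ : Type*} (f : β → γ) (a b c : β) :
    f ∘ ![a, b, c] = ![f a, f b, f c] := by
  ext x; fin_cases x <;> rfl

theorem comp_vec_four {β γ : Type*} (f : β → γ) (a b c d : β) :
    f ∘ ![a, b, c, d] = ![f a, f b, f c, f d] := by
  ext x; fin_cases x <;> rfl

theorem wedge_two_two {A : Tens 2} {B : Tens 2} (hA : IsAlt A) (hB : IsAlt B)
    (i : Fin 4 → Fin 6) : wedge A B i =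
      A ![i 0, i 1] * B ![i 2, i 3] - A ![i 0, i 2] * B ![i 1, i 3] + A ![i 0, i 3] * B ![i 1,
      i 2] + A ![i 1, i 2] * B ![i 0, i 3] - A ![i 1, i 3] * B ![i 0, i 2] + A ![i 2, i 3] * B
      ![i 0, i 1] := by
  have e : (fun x : Fin 4 → Fin 6 => A (fun a => x (Fin.castAdd 2 a)) *
      B (fun b => x (Fin.natAdd 2 b))) = fun x => A ![x 0, x 1] * B ![x 2, x 3] := by
    ext x; congr 2 <;> ext a <;> fin_cases a <;> rfl
  have h := shuffle_sum_two_two (IsAlt'.comp hA i) (IsAlt'.comp hB i)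
  rw [wedge_eq_altSum, e]
  simp only [comp_vec_two] at h
  have h2 := altSum_comp (fun x : Fin 4 → Fin 6 =>
    A ![x 0, x 1] * B ![x 2, x 3]) i id
  simp only [Function.comp_apply, Function.comp_id] at h2
  rw [← h2, h]
  simp [Nat.factorial]
  ring

theorem wedge_two_three {A : Tens 2} {B : Tens 3} (hA : IsAlt A) (hB : IsAlt B)
    (i : Fin 5 → Fin 6) : wedge A B i =
      A ![i 0, i 1] * B ![i 2, i 3, i 4] - A ![i 0, i 2] * B ![i 1, i 3, i 4] + A ![i 0, i 3]
      * B ![i 1, i 2, i 4] - A ![i 0, i 4] * B ![i 1, i 2, i 3] + A ![i 1, i 2] * B ![i 0, i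
      3, i 4] - A ![i 1, i 3] * B ![i 0, i 2, i 4] + A ![i 1, i 4] * B ![i 0, i 2, i 3] + A
      ![i 2, i 3] * B ![i 0, i 1, i 4] - A ![i 2, i 4] * B ![i 0, i 1, i 3] + A ![i 3, i 4] *
      B ![i 0, i 1, i 2] := by
  have e : (fun x : Fin 5 → Fin 6 => A (fun a => x (Fin.castAdd 3 a)) *
      B (fun b => x (Fin.natAdd 2 b))) = fun x => A ![x 0, x 1] * B ![x 2, x 3, x 4] := by
    ext x; congr 2 <;> ext a <;> fin_cases a <;> rfl
  have h := shuffle_sum_two_three (IsAlt'.comp hA i) (IsAlt'.comp hB i)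
  rw [wedge_eq_altSum, e]
  simp only [comp_vec_two, comp_vec_three] at h
  have h2 := altSum_comp (fun x : Fin 5 → Fin 6 =>
    A ![x 0, x 1] * B ![x 2, x 3, x 4]) i id
  simp only [Function.comp_apply, Function.comp_id] at h2
  rw [← h2, h]
  simp [Nat.factorial]
  ring

theorem wedge_three_three {A : Tens 3} {B : Tens 3} (hA : IsAlt A) (hB : IsAlt B)
    (i : Fin 6 → Fin 6) : wedge A B i =
      A ![i 0, i 1, i 2] * B ![i 3, i 4, i 5] - A ![i 0, i 1, i 3] * B ![i 2, i 4, i 5] + A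
      ![i 0, i 1, i 4] * B ![i 2, i 3, i 5] - A ![i 0, i 1, i 5] * B ![i 2, i 3, i 4] + A ![i
      0, i 2, i 3] * B ![i 1, i 4, i 5] - A ![i 0, i 2, i 4] * B ![i 1, i 3, i 5] + A ![i 0, i
      2, i 5] * B ![i 1, i 3, i 4] + A ![i 0, i 3, i 4] * B ![i 1, i 2, i 5] - A ![i 0, i 3, i
      5] * B ![i 1, i 2, i 4] + A ![i 0, i 4, i 5] * B ![i 1, i 2, i 3] - A ![i 1, i 2, i 3] *
      B ![i 0, i 4, i 5] + A ![i 1, i 2, i 4] * B ![i 0, i 3, i 5] - A ![i 1, i 2, i 5] * B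
      ![i 0, i 3, i 4] - A ![i 1, i 3, i 4] * B ![i 0, i 2, i 5] + A ![i 1, i 3, i 5] * B ![i
      0, i 2, i 4] - A ![i 1, i 4, i 5] * B ![i 0, i 2, i 3] + A ![i 2, i 3, i 4] * B ![i 0, i
      1, i 5] - A ![i 2, i 3, i 5] * B ![i 0, i 1, i 4] + A ![i 2, i 4, i 5] * B ![i 0, i 1, i
      3] - A ![i 3, i 4, i 5] * B ![i 0, i 1, i 2] := by
  have e : (fun x : Fin 6 → Fin 6 => A (fun a => x (Fin.castAdd 3 a)) *
      B (fun b => x (Fin.natAdd 3 b))) = fun x => A ![x 0, x 1, x 2] * B ![x 3, x 4, x 5] := by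
    ext x; congr 2 <;> ext a <;> fin_cases a <;> rfl
  have h := shuffle_sum_three_three (IsAlt'.comp hA i) (IsAlt'.comp hB i)
  rw [wedge_eq_altSum, e]
  simp only [comp_vec_three] at h
  have h2 := altSum_comp (fun x : Fin 6 → Fin 6 =>
    A ![x 0, x 1, x 2] * B ![x 3, x 4, x 5]) i id
  simp only [Function.comp_apply, Function.comp_id] at h2
  rw [← h2, h]
  simp [Nat.factorial]
  ring

theorem wedge_three_two {A : Tens 3} {B : Tens 2} (hA : IsAlt A) (hB : IsAlt B)
    (i : Fin 5 → Fin 6) : wedge A B i =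
      B ![i 0, i 1] * A ![i 2, i 3, i 4] - B ![i 0, i 2] * A ![i 1, i 3, i 4] + B ![i 0, i 3]
      * A ![i 1, i 2, i 4] - B ![i 0, i 4] * A ![i 1, i 2, i 3] + B ![i 1, i 2] * A ![i 0, i
      3, i 4] - B ![i 1, i 3] * A ![i 0, i 2, i 4] + B ![i 1, i 4] * A ![i 0, i 2, i 3] + B
      ![i 2, i 3] * A ![i 0, i 1, i 4] - B ![i 2, i 4] * A ![i 0, i 1, i 3] + B ![i 3, i 4] *
      A ![i 0, i 1, i 2] := by
  have e : (fun x : Fin 5 → Fin 6 =>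
      (fun y : Fin 5 → Fin 6 => A (fun a => y (Fin.castAdd 2 a)) *
      B (fun b => y (Fin.natAdd 3 b))) ((x ∘ finRotate 5) ∘ finRotate 5)) =
      fun x => B ![x 0, x 1] * A ![x 2, x 3, x 4] := by
    ext x
    refine (mul_comm _ _).trans (congrArg₂ (· * ·) (congrArg B ?_) (congrArg A ?_)) <;>
      ext a <;> fin_cases a <;> rfl
  have h := shuffle_sum_two_three (IsAlt'.comp hB i) (IsAlt'.comp hA i)
  rw [wedge_eq_altSum, altSum_rotate, altSum_rotate, e]
  simp only [comp_vec_two, comp_vec_three] at h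
  have h2 := altSum_comp (fun x : Fin 5 → Fin 6 =>
    B ![x 0, x 1] * A ![x 2, x 3, x 4]) i id
  simp only [Function.comp_apply, Function.comp_id] at h2
  rw [← h2, h]
  simp [Nat.factorial]
  ring

theorem wedge_four_two {A : Tens 4} {B : Tens 2} (hA : IsAlt A) (hB : IsAlt B)
    (i : Fin 6 → Fin 6) : wedge A B i =
      B ![i 0, i 1] * A ![i 2, i 3, i 4, i 5] - B ![i 0, i 2] * A ![i 1, i 3, i 4, i 5] + B
      ![i 0, i 3] * A ![i 1, i 2, i 4, i 5] - B ![i 0, i 4] * A ![i 1, i 2, i 3, i 5] + B ![i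
      0, i 5] * A ![i 1, i 2, i 3, i 4] + B ![i 1, i 2] * A ![i 0, i 3, i 4, i 5] - B ![i 1, i
      3] * A ![i 0, i 2, i 4, i 5] + B ![i 1, i 4] * A ![i 0, i 2, i 3, i 5] - B ![i 1, i 5] *
      A ![i 0, i 2, i 3, i 4] + B ![i 2, i 3] * A ![i 0, i 1, i 4, i 5] - B ![i 2, i 4] * A
      ![i 0, i 1, i 3, i 5] + B ![i 2, i 5] * A ![i 0, i 1, i 3, i 4] + B ![i 3, i 4] * A ![i
      0, i 1, i 2, i 5] - B ![i 3, i 5] * A ![i 0, i 1, i 2, i 4] + B ![i 4, i 5] * A ![i 0, i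
      1, i 2, i 3] := by
  have e : (fun x : Fin 6 → Fin 6 =>
      (fun y : Fin 6 → Fin 6 => A (fun a => y (Fin.castAdd 2 a)) *
      B (fun b => y (Fin.natAdd 4 b))) ((x ∘ finRotate 6) ∘ finRotate 6)) =
      fun x => B ![x 0, x 1] * A ![x 2, x 3, x 4, x 5] := by
    ext x
    refine (mul_comm _ _).trans (congrArg₂ (· * ·) (congrArg B ?_) (congrArg A ?_)) <;>
      ext a <;> fin_cases a <;> rfl
  have h := shuffle_sum_two_four (IsAlt'.comp hB i) (IsAlt'.comp hA i)
  rw [wedge_eq_altSum, altSum_rotate, altSum_rotate, e]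
  simp only [comp_vec_two, comp_vec_four] at h
  have h2 := altSum_comp (fun x : Fin 6 → Fin 6 =>
    B ![x 0, x 1] * A ![x 2, x 3, x 4, x 5]) i id
  simp only [Function.comp_apply, Function.comp_id] at h2
  rw [← h2, h]
  simp [Nat.factorial]
  ring

theorem wedge_dx {A : Tens 5} (hA : IsAlt A) (i : Fin 6) :
    wedge A (dx i) id = (-1) ^ ((i : ℕ) + 1) * A i.succAbove := by
  have e : (fun x : Fin 6 → Fin 6 => (fun y : Fin 6 → Fin 6 => A (fun a => y (Fin.castAdd 1 a)) *
      dx i (fun b => y (Fin.natAdd 5 b))) (x ∘ finRotate 6)) =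
      fun x => dx i ![x 0] * A ![x 1, x 2, x 3, x 4, x 5] := by
    ext x
    refine (mul_comm _ _).trans (congrArg₂ (· * ·) (congrArg (dx i) ?_) (congrArg A ?_)) <;>
      ext a <;> fin_cases a <;> rfl
  have e1 : ∀ (a : Fin 6) (x : Fin 5 → Fin 6), dx i ![(Fin.cons a x : Fin 6 → Fin 6) 0] *
      A ![(Fin.cons a x : Fin 6 → Fin 6) 1, (Fin.cons a x : Fin 6 → Fin 6) 2,
        (Fin.cons a x : Fin 6 → Fin 6) 3, (Fin.cons a x : Fin 6 → Fin 6) 4,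
        (Fin.cons a x : Fin 6 → Fin 6) 5] = dx i ![a] * A x := by
    intro a x
    congr 2
    ext b; fin_cases b <;> rfl
  rw [wedge_eq_altSum, altSum_rotate, e, altSum_succ]
  simp only [e1, altSum_of_isAlt hA]
  rw [Finset.sum_eq_single i]
  · simp [dx, Nat.factorial, id]
    ring
  · intro b _ hb
    simp [dx, hb]
  · simp

/-! ### Hitchin's endomorphism of an arbitrary three-form -/

theorem IsAlt.interior_basis {k : ℕ} {A : Tens (k + 1)} (hA : IsAlt A) (j : Fin 6) :
    IsAlt fun a : Fin k → Fin 6 => A (Fin.cons j a) := by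
  intro σ i
  have h := hA (Equiv.Perm.decomposeFin.symm (0, σ)) (Fin.cons j i)
  rw [Equiv.Perm.decomposeFin.symm_sign] at h
  simp only [if_true, one_mul] at h
  rw [← h]
  refine congrArg A ?_
  ext a
  refine Fin.cases ?_ (fun a => ?_) a <;> simp

theorem hitchinDensity_apply {φ : Tens 3} (hφ : IsAlt φ) (i j : Fin 6) :
    hitchinDensity φ i j = (-1) ^ ((i : ℕ) + 1) *
      (φ ![j, i.succAbove 0, i.succAbove 1] * φ ![i.succAbove 2, i.succAbove 3, i.succAbove 4]
      - φ ![j, i.succAbove 0, i.succAbove 2] * φ ![i.succAbove 1, i.succAbove 3, i.succAbove 4]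
      + φ ![j, i.succAbove 0, i.succAbove 3] * φ ![i.succAbove 1, i.succAbove 2, i.succAbove 4]
      - φ ![j, i.succAbove 0, i.succAbove 4] * φ ![i.succAbove 1, i.succAbove 2, i.succAbove 3]
      + φ ![j, i.succAbove 1, i.succAbove 2] * φ ![i.succAbove 0, i.succAbove 3, i.succAbove 4]
      - φ ![j, i.succAbove 1, i.succAbove 3] * φ ![i.succAbove 0, i.succAbove 2, i.succAbove 4]
      + φ ![j, i.succAbove 1, i.succAbove 4] * φ ![i.succAbove 0, i.succAbove 2, i.succAbove 3]
      + φ ![j, i.succAbove 2, i.succAbove 3] * φ ![i.succAbove 0, i.succAbove 1, i.succAbove 4]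
      - φ ![j, i.succAbove 2, i.succAbove 4] * φ ![i.succAbove 0, i.succAbove 1, i.succAbove 3]
      + φ ![j, i.succAbove 3, i.succAbove 4] *
        φ ![i.succAbove 0, i.succAbove 1, i.succAbove 2]) := by
  rw [hitchinDensity, Matrix.of_apply, wedge_dx (wedge_isAlt _ _),
    wedge_two_three (hφ.interior_basis j) hφ]
  rfl

/-- The sorting rules for the components of a three-form; they terminate because each of them
requires that two neighbouring indices are in the wrong order. -/
theorem IsAlt.sort_three {φ : Tens 3} (hφ : IsAlt φ) :
    (∀ a b c : Fin 6, b < a → φ ![a, b, c] = -φ ![b, a, c]) ∧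
    (∀ a b c : Fin 6, c < b → φ ![a, b, c] = -φ ![a, c, b]) ∧
    (∀ a c : Fin 6, φ ![a, a, c] = 0) ∧ (∀ a b : Fin 6, φ ![a, b, b] = 0) :=
  ⟨fun a b c _ => IsAlt'.swap01 hφ b a c, fun a b c _ => IsAlt'.swap12 hφ a c b,
    fun _ _ => hφ.eq_zero (a := 0) (b := 1) (by decide) rfl,
    fun _ _ => hφ.eq_zero (a := 1) (b := 2) (by decide) rfl⟩

theorem IsAlt.sort_two {ω : Tens 2} (hω : IsAlt ω) :
    (∀ a b : Fin 6, b < a → ω ![a, b] = -ω ![b, a]) ∧ (∀ a : Fin 6, ω ![a, a] = 0) :=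
  ⟨fun a b _ => IsAlt'.swap_two hω b a, fun _ => hω.eq_zero (a := 0) (b := 1) (by decide) rfl⟩

/-- The identities for `hitchinDensity` are polynomial identities in the twenty components of `φ`.
They are checked for a few indices; permutations of the coordinates carry them to all others. -/
theorem hitchinDensity_contract_zero_one {φ : Tens 3} (hφ : IsAlt φ) :
    ∑ a, φ ![a, 0, 1] * hitchinDensity φ a 0 = 0 := by
  obtain ⟨h1, h2, h3, h4⟩ := hφ.sort_three
  simp only [Fin.sum_univ_six, hitchinDensity_apply hφ]
  simp [Fin.succAbove, h3, h4, h1, h2]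
  ring

theorem hitchinDensity_contract_zero_one_two {φ : Tens 3} (hφ : IsAlt φ) :
    ∑ a, (φ ![a, 1, 2] * hitchinDensity φ a 0 + φ ![a, 0, 2] * hitchinDensity φ a 1) = 0 := by
  obtain ⟨h1, h2, h3, h4⟩ := hφ.sort_three
  simp only [Fin.sum_univ_six, hitchinDensity_apply hφ]
  simp [Fin.succAbove, h3, h4, h1, h2]
  ring

theorem hitchinDensity_sq_one_zero {φ : Tens 3} (hφ : IsAlt φ) :
    ∑ a, hitchinDensity φ 1 a * hitchinDensity φ a 0 = 0 := by
  obtain ⟨h1, h2, h3, h4⟩ := hφ.sort_three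
  simp only [Fin.sum_univ_six, hitchinDensity_apply hφ]
  simp [Fin.succAbove, h3, h4, h1, h2]
  ring

theorem hitchinDensity_sq_diag {φ : Tens 3} (hφ : IsAlt φ) :
    ∑ a, hitchinDensity φ 0 a * hitchinDensity φ a 0 =
      ∑ a, hitchinDensity φ 1 a * hitchinDensity φ a 1 := by
  obtain ⟨h1, h2, h3, h4⟩ := hφ.sort_three
  simp only [Fin.sum_univ_six, hitchinDensity_apply hφ]
  simp [Fin.succAbove, h3, h4, h1, h2]
  ring

/-- The matrix of a permutation of the coordinates. -/
def permMat (σ : Equiv.Perm (Fin 6)) : Matrix (Fin 6) (Fin 6) ℝ :=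
  Matrix.of fun a i => if a = σ i then 1 else 0

theorem pull_permMat {k : ℕ} (σ : Equiv.Perm (Fin 6)) (A : Tens k) :
    pull (permMat σ) A = fun i => A (σ ∘ i) := by
  ext i
  rw [pull, Finset.sum_eq_single (σ ∘ i)]
  · simp [permMat]
  · intro j _ hj
    obtain ⟨a, ha⟩ := Function.ne_iff.1 hj
    have : (∏ a, permMat σ (j a) (i a)) = 0 :=
      Finset.prod_eq_zero (Finset.mem_univ a) (if_neg ha)
    rw [this, zero_mul]
  · simp

theorem permMat_mul_symm (σ : Equiv.Perm (Fin 6)) : permMat σ * permMat σ.symm = 1 := by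
  ext i j
  simp [permMat, Matrix.mul_apply, Matrix.one_apply, eq_comm]

theorem det_permMat_ne (σ : Equiv.Perm (Fin 6)) : (permMat σ).det ≠ 0 := by
  intro h
  have := congrArg Matrix.det (permMat_mul_symm σ)
  simp [h] at this

/-- Permuting the coordinates permutes the entries of `hitchinDensity`, up to the sign by which the
volume changes. -/
theorem hitchinDensity_perm (σ : Equiv.Perm (Fin 6)) (φ : Tens 3) (i j : Fin 6) :
    hitchinDensity (fun a => φ (σ ∘ a)) i j =
      (permMat σ).det * hitchinDensity φ (σ i) (σ j) := by
  have hi : (permMat σ)⁻¹ = permMat σ.symm := Matrix.inv_eq_right_inv (permMat_mul_symm σ)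
  rw [← pull_permMat, hitchinDensity_pull _ (det_permMat_ne σ), hi]
  simp [Matrix.mul_apply, permMat, Equiv.eq_symm_apply, eq_comm]

theorem exists_perm_two {i j : Fin 6} (h : i ≠ j) : ∃ σ : Equiv.Perm (Fin 6), σ 0 = i ∧ σ 1 = j := by
  refine ⟨Equiv.swap (Equiv.swap 0 i 1) j * Equiv.swap 0 i, ?_, ?_⟩
  · rw [Equiv.Perm.mul_apply, Equiv.swap_apply_left, Equiv.swap_apply_of_ne_of_ne _ h]
    intro h'
    have : Equiv.swap 0 i 0 = Equiv.swap 0 i 1 := by rw [Equiv.swap_apply_left]; exact h'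
    exact absurd ((Equiv.swap (0 : Fin 6) i).injective this) (by decide)
  · rw [Equiv.Perm.mul_apply, Equiv.swap_apply_left]

theorem exists_perm_three {i j k : Fin 6} (h : i ≠ j) (hi : i ≠ k) (hj : j ≠ k) :
    ∃ σ : Equiv.Perm (Fin 6), σ 0 = i ∧ σ 1 = j ∧ σ 2 = k := by
  obtain ⟨τ, h0, h1⟩ := exists_perm_two h
  refine ⟨Equiv.swap (τ 2) k * τ, ?_, ?_, ?_⟩
  · rw [Equiv.Perm.mul_apply, h0, Equiv.swap_apply_of_ne_of_ne _ hi]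
    rw [← h0]; exact fun h' => absurd (τ.injective h') (by decide)
  · rw [Equiv.Perm.mul_apply, h1, Equiv.swap_apply_of_ne_of_ne _ hj]
    rw [← h1]; exact fun h' => absurd (τ.injective h') (by decide)
  · rw [Equiv.Perm.mul_apply, Equiv.swap_apply_left]

theorem IsAlt.comp_perm {k : ℕ} {A : Tens k} (hA : IsAlt A) (σ : Fin 6 → Fin 6) :
    IsAlt fun a : Fin k → Fin 6 => A (σ ∘ a) := fun τ i => hA τ (σ ∘ i)

theorem hitchinDensity_contract_self {φ : Tens 3} (hφ : IsAlt φ) (i k : Fin 6) :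
    ∑ a, φ ![a, i, k] * hitchinDensity φ a i = 0 := by
  rcases eq_or_ne i k with rfl | hik
  · simp [hφ.sort_three.2.2.2]
  obtain ⟨σ, rfl, rfl⟩ := exists_perm_two hik
  have h := hitchinDensity_contract_zero_one (hφ.comp_perm σ)
  simp only [hitchinDensity_perm, comp_vec_three] at h
  rw [← Equiv.sum_comp σ]
  refine (mul_eq_zero.1 (?_ : (permMat σ).det * _ = 0)).resolve_left (det_permMat_ne σ)
  rw [Finset.mul_sum, ← h]
  exact Finset.sum_congr rfl fun _ _ => by ring

/-- `φ(KX, Y, Z)` is antisymmetric in `X` and `Y`. -/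
theorem hitchinDensity_contract {φ : Tens 3} (hφ : IsAlt φ) (i j k : Fin 6) :
    ∑ a, (φ ![a, j, k] * hitchinDensity φ a i + φ ![a, i, k] * hitchinDensity φ a j) = 0 := by
  have swap : ∀ x y z, φ ![x, y, z] = -φ ![x, z, y] := fun x y z => IsAlt'.swap12 hφ x z y
  rw [Finset.sum_add_distrib]
  rcases eq_or_ne i j with rfl | hij
  · rw [hitchinDensity_contract_self hφ, add_zero]
  rcases eq_or_ne i k with rfl | hik
  · have := hitchinDensity_contract_self hφ i j
    simp only [swap _ i j, neg_mul, Finset.sum_neg_distrib] at this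
    simpa [hφ.sort_three.2.2.2] using this
  rcases eq_or_ne j k with rfl | hjk
  · have := hitchinDensity_contract_self hφ j i
    simp only [swap _ j i, neg_mul, Finset.sum_neg_distrib] at this
    simpa [hφ.sort_three.2.2.2] using this
  obtain ⟨σ, rfl, rfl, rfl⟩ := exists_perm_three hij hik hjk
  have h := hitchinDensity_contract_zero_one_two (hφ.comp_perm σ)
  simp only [hitchinDensity_perm, comp_vec_three] at h
  rw [← Finset.sum_add_distrib, ← Equiv.sum_comp σ]
  refine (mul_eq_zero.1 (?_ : (permMat σ).det * _ = 0)).resolve_left (det_permMat_ne σ)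
  rw [Finset.mul_sum, ← h]
  exact Finset.sum_congr rfl fun _ _ => by ring

/-- The square of Hitchin's endomorphism is a multiple of the identity. -/
theorem hitchinDensity_sq {φ : Tens 3} (hφ : IsAlt φ) :
    hitchinDensity φ * hitchinDensity φ =
      ((hitchinDensity φ * hitchinDensity φ).trace / 6) • (1 : Matrix (Fin 6) (Fin 6) ℝ) := by
  set K := hitchinDensity φ with hK
  have off : ∀ i j, i ≠ j → (K * K) i j = 0 := by
    intro i j hij
    obtain ⟨σ, rfl, rfl⟩ := exists_perm_two hij.symm
    have h := hitchinDensity_sq_one_zero (hφ.comp_perm σ)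
    simp only [hitchinDensity_perm] at h
    rw [Matrix.mul_apply, ← Equiv.sum_comp σ]
    refine (mul_eq_zero.1 (?_ : ((permMat σ).det * (permMat σ).det) * _ = 0)).resolve_left
      (mul_ne_zero (det_permMat_ne σ) (det_permMat_ne σ))
    rw [Finset.mul_sum, ← h]
    exact Finset.sum_congr rfl fun _ _ => by ring
  have diag : ∀ i, (K * K) i i = (K * K) 0 0 := by
    intro i
    rcases eq_or_ne i 0 with rfl | hi
    · rfl
    obtain ⟨σ, h0, rfl⟩ := exists_perm_two hi.symm
    have h := hitchinDensity_sq_diag (hφ.comp_perm σ)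
    simp only [hitchinDensity_perm, h0] at h
    rw [Matrix.mul_apply, Matrix.mul_apply, ← Equiv.sum_comp σ,
      ← Equiv.sum_comp σ (fun a => K 0 a * K a 0)]
    refine mul_left_cancel₀ (mul_ne_zero (det_permMat_ne σ) (det_permMat_ne σ)) ?_
    rw [Finset.mul_sum, Finset.mul_sum]
    convert h.symm using 1 <;> exact Finset.sum_congr rfl fun _ _ => by ring
  have tr : (K * K).trace = 6 * (K * K) 0 0 := by
    simp only [Matrix.trace, Matrix.diag, diag]
    simp
  ext i j
  rw [Matrix.smul_apply, tr]
  rcases eq_or_ne i j with rfl | hij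
  · rw [diag]; simp
  · rw [off i j hij]; simp [hij]

/-! ### The standard model on `ℂ³` -/

/-- The Vandermonde product of the complex indices `a / 2`, `b / 2`, `c / 2`, times the real
(`t = 0`) or imaginary (`t = 3`) part of the power of `i` that counts the coordinates `yʲ`. This is
twice the real or imaginary part of the component of `dz¹ ∧ dz² ∧ dz³`. -/
def dzComp (t : ℕ) (a b c : Fin 6) : ℤ :=
  (((b : ℕ) / 2 : ℕ) - ((a : ℕ) / 2 : ℕ) : ℤ) * (((c : ℕ) / 2 : ℕ) - ((a : ℕ) / 2 : ℕ) : ℤ) *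
    (((c : ℕ) / 2 : ℕ) - ((b : ℕ) / 2 : ℕ) : ℤ) *
      ([1, 0, -1, 0, 1, 0, -1].getD ((a : ℕ) % 2 + (b : ℕ) % 2 + (c : ℕ) % 2 + t) 0)

/-- `Re (dz¹ ∧ dz² ∧ dz³)` in the real coordinates `x¹, y¹, x², y², x³, y³`. -/
def phi0 : Tens 3 := fun i => (dzComp 0 (i 0) (i 1) (i 2) : ℝ) / 2

/-- `Im (dz¹ ∧ dz² ∧ dz³)`. -/
def hat0 : Tens 3 := fun i => (dzComp 3 (i 0) (i 1) (i 2) : ℝ) / 2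

/-- The standard complex structure, `J e₀ = e₁`. -/
def J0 : Matrix (Fin 6) (Fin 6) ℝ :=
  !![0, -1, 0, 0, 0, 0; 1, 0, 0, 0, 0, 0; 0, 0, 0, -1, 0, 0; 0, 0, 1, 0, 0, 0;
     0, 0, 0, 0, 0, -1; 0, 0, 0, 0, 1, 0]

/-- The standard symplectic form. -/
def omega0 : Tens 2 := fun i => -J0 (i 0) (i 1)

theorem J0_mul_J0 : J0 * J0 = -1 := by
  ext i j
  fin_cases i <;> fin_cases j <;> simp [J0, Matrix.mul_apply, Fin.sum_univ_six]

theorem J0_transpose : J0.transpose = -J0 := by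
  ext i j
  fin_cases i <;> fin_cases j <;> simp [J0]

theorem sum_J0 (X : Fin 6 → ℝ) :
    ∑ a, X a * J0 a 0 = X 1 ∧ ∑ a, X a * J0 a 1 = -X 0 ∧ ∑ a, X a * J0 a 2 = X 3 ∧
    ∑ a, X a * J0 a 3 = -X 2 ∧ ∑ a, X a * J0 a 4 = X 5 ∧ ∑ a, X a * J0 a 5 = -X 4 := by
  simp [Fin.sum_univ_six, J0]

theorem toMatrix_omega0 : toMatrix omega0 = -J0 := by ext; rfl

theorem dzComp_isAlt (t : Fin 4) : ∀ (σ : Equiv.Perm (Fin 3)) (a b c : Fin 6),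
    dzComp t (![a, b, c] (σ 0)) (![a, b, c] (σ 1)) (![a, b, c] (σ 2)) =
      (Equiv.Perm.sign σ : ℤ) * dzComp t a b c := by
  revert t
  decide +kernel

theorem phi0_isAlt : IsAlt phi0 := by
  intro σ i
  have h := dzComp_isAlt 0 σ (i 0) (i 1) (i 2)
  have e : ![i 0, i 1, i 2] = i := by ext a; fin_cases a <;> rfl
  rw [e] at h
  have := congrArg (Int.cast (R := ℝ)) h
  push_cast at this
  simp only [phi0, Function.comp_apply]
  rw [← mul_div_assoc]
  exact congrArg (· / 2) this

theorem hat0_isAlt : IsAlt hat0 := by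
  intro σ i
  have h := dzComp_isAlt 3 σ (i 0) (i 1) (i 2)
  have e : ![i 0, i 1, i 2] = i := by ext a; fin_cases a <;> rfl
  rw [e] at h
  have := congrArg (Int.cast (R := ℝ)) h
  push_cast at this
  simp only [hat0, Function.comp_apply]
  rw [← mul_div_assoc]
  exact congrArg (· / 2) this

theorem sum_phi0 (X : Fin 6 → Fin 6 → ℝ) :
    ∑ a, ∑ b, phi0 ![0, a, b] * X a b = X 2 4 - X 4 2 - X 3 5 + X 5 3 ∧
    ∑ a, ∑ b, phi0 ![1, a, b] * X a b = X 5 2 - X 2 5 + X 4 3 - X 3 4 ∧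
    ∑ a, ∑ b, phi0 ![2, a, b] * X a b = X 4 0 - X 0 4 - X 5 1 + X 1 5 ∧
    ∑ a, ∑ b, phi0 ![3, a, b] * X a b = X 0 5 - X 5 0 + X 1 4 - X 4 1 ∧
    ∑ a, ∑ b, phi0 ![4, a, b] * X a b = X 0 2 - X 2 0 - X 1 3 + X 3 1 ∧
    ∑ a, ∑ b, phi0 ![5, a, b] * X a b = X 3 0 - X 0 3 - X 1 2 + X 2 1 := by
  simp only [Fin.sum_univ_six, phi0]
  simp [dzComp]
  refine ⟨?_, ?_, ?_, ?_, ?_, ?_⟩ <;> ring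

theorem IsAlt.ext_three {A B : Tens 3} (hA : IsAlt A) (hB : IsAlt B)
    (h : ∀ a b c : Fin 6, a < b → b < c → A ![a, b, c] = B ![a, b, c]) : A = B := by
  ext i
  have e : i = ![i 0, i 1, i 2] := by ext a; fin_cases a <;> rfl
  rw [e]
  generalize i 0 = a, i 1 = b, i 2 = c
  obtain ⟨a1, a2, a3, a4⟩ := hA.sort_three
  obtain ⟨b1, b2, b3, b4⟩ := hB.sort_three
  rcases lt_trichotomy a b with hab | rfl | hab
  · rcases lt_trichotomy b c with hbc | rfl | hbc
    · exact h a b c hab hbc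
    · rw [a4, b4]
    · rw [a2 a b c hbc, b2 a b c hbc]
      rcases lt_trichotomy a c with hac | rfl | hac
      · rw [h a c b hac hbc]
      · rw [a3, b3]
      · rw [a1 a c b hac, b1 a c b hac, h c a b hac hab]
  · rw [a3, b3]
  · rw [a1 a b c hab, b1 a b c hab]
    rcases lt_trichotomy a c with hac | rfl | hac
    · rw [h b a c hab hac]
    · rw [a4, b4]
    · rw [a2 b a c hac, b2 b a c hac]
      rcases lt_trichotomy b c with hbc | rfl | hbc
      · rw [h b c a hbc hac]
      · rw [a3, b3]
      · rw [a1 b c a hbc, b1 b c a hbc, h c b a hbc hab]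

/-- A three-form is determined by its twenty increasing components. -/
theorem IsAlt.ext_twenty {A B : Tens 3} (hA : IsAlt A) (hB : IsAlt B)
    (h : ((A ![0, 1, 2] = B ![0, 1, 2] ∧ A ![0, 1, 3] = B ![0, 1, 3] ∧
      A ![0, 1, 4] = B ![0, 1, 4] ∧ A ![0, 1, 5] = B ![0, 1, 5]) ∧
      (A ![0, 2, 3] = B ![0, 2, 3] ∧ A ![1, 2, 3] = B ![1, 2, 3] ∧
      A ![2, 3, 4] = B ![2, 3, 4] ∧ A ![2, 3, 5] = B ![2, 3, 5]) ∧
      (A ![0, 4, 5] = B ![0, 4, 5] ∧ A ![1, 4, 5] = B ![1, 4, 5] ∧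
      A ![2, 4, 5] = B ![2, 4, 5] ∧ A ![3, 4, 5] = B ![3, 4, 5])) ∧
      (A ![0, 2, 4] = B ![0, 2, 4] ∧ A ![0, 2, 5] = B ![0, 2, 5] ∧
      A ![0, 3, 4] = B ![0, 3, 4] ∧ A ![0, 3, 5] = B ![0, 3, 5]) ∧
      A ![1, 2, 4] = B ![1, 2, 4] ∧ A ![1, 2, 5] = B ![1, 2, 5] ∧
      A ![1, 3, 4] = B ![1, 3, 4] ∧ A ![1, 3, 5] = B ![1, 3, 5]) : A = B := by
  refine hA.ext_three hB fun a b c hab hbc => ?_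
  obtain ⟨⟨⟨h1, h2, h3, h4⟩, ⟨h5, h6, h7, h8⟩, ⟨h9, h10, h11, h12⟩⟩, ⟨h13, h14, h15, h16⟩,
    h17, h18, h19, h20⟩ := h
  fin_cases a <;> fin_cases b <;> first | exact absurd hab (by decide) | skip
  all_goals fin_cases c <;> first | exact absurd hbc (by decide) | assumption

/-! ### Forms of type `(3,0) + (0,3)` -/

/-- The contraction `J^a_{i₁} A_{a i₂…}` of an endomorphism with the first index. -/
def slot {k : ℕ} (J : Matrix (Fin 6) (Fin 6) ℝ) (A : Tens (k + 1)) : Tens (k + 1) := fun i =>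
  ∑ a, A (Fin.cons a (Fin.tail i)) * J a (i 0)

theorem slot_pull {k : ℕ} {P J J' : Matrix (Fin 6) (Fin 6) ℝ} (h : J * P = P * J')
    (A : Tens (k + 1)) : slot J' (pull P A) = pull P (slot J A) := by
  ext i
  obtain ⟨p, x, rfl⟩ : ∃ p x, i = Fin.cons p x := ⟨i 0, Fin.tail i, (Fin.cons_self_tail i).symm⟩
  have e : ∀ m, (fun j => slot J A (Fin.cons m j)) =
      ∑ a, J a m • fun j => A (Fin.cons a j) := by
    intro m; ext j; simp [slot, mul_comm]
  rw [pull_cons]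
  simp only [e, pull_sum, pull_smul, Finset.sum_apply, Pi.smul_apply, smul_eq_mul]
  simp only [slot, Fin.tail_cons, Fin.cons_zero, pull_cons, Finset.sum_mul, Finset.mul_sum]
  have h1 : ∀ a, ∑ m, P m p * J a m = ∑ m, P a m * J' m p := by
    intro a
    have := congrFun (congrFun h a) p
    simp only [Matrix.mul_apply] at this
    rw [← this]; exact Finset.sum_congr rfl fun _ _ => mul_comm _ _
  rw [Finset.sum_comm]
  conv_rhs => rw [Finset.sum_comm]
  refine Finset.sum_congr rfl fun a _ => ?_
  have := congrArg (· * pull P (fun j => A (Fin.cons a j)) x) (h1 a)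
  simp only [Finset.sum_mul] at this
  calc _ = ∑ m, P a m * J' m p * pull P (fun j => A (Fin.cons a j)) x :=
        Finset.sum_congr rfl fun _ _ => by ring
    _ = _ := this.symm.trans (Finset.sum_congr rfl fun _ _ => by ring)

/-- `φ(JX, Y, Z) = φ(X, JY, Z)`. -/
def JCompat (J : Matrix (Fin 6) (Fin 6) ℝ) (φ : Tens 3) : Prop :=
  slot (k := 2) J φ = -fun i => slot (k := 2) J φ (i ∘ Equiv.swap 0 1)

theorem JCompat.pull {P J J' : Matrix (Fin 6) (Fin 6) ℝ} {φ : Tens 3} (hφ : JCompat J φ)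
    (h : J * P = P * J') : JCompat J' (pull P φ) := by
  have e := congrArg (TypeIIA.pull P) hφ
  have h2 : TypeIIA.pull P (-fun i => slot (k := 2) J φ (i ∘ Equiv.swap 0 1)) =
      -fun i => TypeIIA.pull P (slot (k := 2) J φ) (i ∘ Equiv.swap 0 1) := by
    rw [← pull_perm, ← neg_one_smul ℝ, pull_smul, neg_one_smul]
  rw [h2] at e
  rw [JCompat, slot_pull h]
  exact e

theorem jCompat_iff {J : Matrix (Fin 6) (Fin 6) ℝ} {φ : Tens 3} : JCompat J φ ↔
    ∀ i j k, ∑ a, φ ![a, j, k] * J a i + ∑ a, φ ![a, i, k] * J a j = 0 := by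
  have e1 : ∀ i : Fin 3 → Fin 6, slot (k := 2) J φ i = ∑ a, φ ![a, i 1, i 2] * J a (i 0) := by
    intro i
    refine Finset.sum_congr rfl fun a _ => ?_
    congr 2
    ext x; fin_cases x <;> rfl
  rw [JCompat, funext_iff]
  constructor
  · intro h i j k
    have := h ![i, j, k]
    simp only [Pi.neg_apply, e1] at this
    exact eq_neg_iff_add_eq_zero.1 this
  · intro h i
    simp only [Pi.neg_apply, e1]
    exact eq_neg_iff_add_eq_zero.2 (h (i 0) (i 1) (i 2))

/-- The real three-forms of type `(3,0) + (0,3)` on `ℂ³` are the real multiples of the real and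
imaginary parts of `dz¹ ∧ dz² ∧ dz³`. -/
theorem JCompat.eq_smul_add_smul {φ : Tens 3} (hφ : IsAlt φ) (h : JCompat J0 φ) :
    φ = φ ![0, 2, 4] • phi0 + φ ![0, 2, 5] • hat0 := by
  obtain ⟨h1, h2, h3, h4⟩ := hφ.sort_three
  rw [jCompat_iff] at h
  have h00 : ∀ k, φ ![0, 1, k] = 0 := fun k => by
    have := h 0 0 k; rw [(sum_J0 _).1, h1 1 0 k (by decide)] at this; linarith
  have h22 : ∀ k, φ ![2, 3, k] = 0 := fun k => by
    have := h 2 2 k; rw [(sum_J0 _).2.2.1, h1 3 2 k (by decide)] at this; linarith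
  have h44 : ∀ k, φ ![4, 5, k] = 0 := fun k => by
    have := h 4 4 k; rw [(sum_J0 _).2.2.2.2.1, h1 5 4 k (by decide)] at this; linarith
  have c23 : ∀ k, φ ![k, 2, 3] = 0 := fun k => by
    rw [IsAlt'.swap01 hφ 2 k 3, IsAlt'.swap12 hφ 2 3 k, h22]; simp
  have c45 : ∀ k, φ ![k, 4, 5] = 0 := fun k => by
    rw [IsAlt'.swap01 hφ 4 k 5, IsAlt'.swap12 hφ 4 5 k, h44]; simp
  have r1 := fun k => h 0 2 k
  have r2 := fun k => h 0 3 k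
  have r4 := fun k => h 1 3 k
  simp only [(sum_J0 _).1, (sum_J0 _).2.1, (sum_J0 _).2.2.1, (sum_J0 _).2.2.2.1] at r1 r2 r4
  have s1 := h 0 4 2
  have s2 := h 0 5 2
  simp only [(sum_J0 _).1, (sum_J0 _).2.2.2.2.1, (sum_J0 _).2.2.2.2.2] at s1 s2
  have r14 := r1 4
  have r15 := r1 5
  have r24 := r2 4
  have r25 := r2 5
  have r44 := r4 4
  have r45 := r4 5
  simp only [h1, h2, Fin.isValue, Fin.reduceLT] at r14 r15 r24 r25 r44 r45 s1 s2
  refine hφ.ext_twenty ((phi0_isAlt.smul _).add (hat0_isAlt.smul _)) ?_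
  simp only [Pi.add_apply, Pi.smul_apply, smul_eq_mul, phi0, hat0]
  simp [dzComp, h00, h22, c23, c45]
  repeat' apply And.intro
  all_goals linarith

/-! ### Normal form of a Type IIA structure at a point -/

theorem exists_orthogonal {m : ℕ} (hm : m < 6) (s : Fin m → Fin 6 → ℝ) :
    ∃ v : Fin 6 → ℝ, v ≠ 0 ∧ ∀ i, s i ⬝ᵥ v = 0 := by
  have h : LinearMap.ker (Matrix.mulVecLin (Matrix.of s)) ≠ ⊥ :=
    LinearMap.ker_ne_bot_of_finrank_lt (by simpa using hm)
  obtain ⟨v, hv, hv0⟩ := (Submodule.ne_bot_iff _).1 h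
  exact ⟨v, hv0, fun i => congrFun (LinearMap.mem_ker.1 hv) i⟩

/-- An endomorphism `J` with `J² = -1` that is orthogonal for an inner product `g` has a unitary
frame. -/
theorem exists_unitary_frame {J g : Matrix (Fin 6) (Fin 6) ℝ} (hJ : J * J = -1) (hg : g.PosDef)
    (hJg : J.transpose * g * J = g) :
    ∃ P : Matrix (Fin 6) (Fin 6) ℝ, P.transpose * g * P = 1 ∧ J * P = P * J0 := by
  set b : (Fin 6 → ℝ) → (Fin 6 → ℝ) → ℝ := fun u v => u ⬝ᵥ (g.mulVec v) with hb
  have gsymm : g.transpose = g := by simpa [Matrix.IsHermitian] using hg.isHermitian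
  have bsymm : ∀ u v, b u v = b v u := fun u v => by
    simp only [hb]
    rw [Matrix.dotProduct_mulVec, ← Matrix.mulVec_transpose, gsymm, dotProduct_comm]
  have bJ : ∀ u v, b (J.mulVec u) (J.mulVec v) = b u v := fun u v => by
    simp only [hb]
    rw [← Matrix.vecMul_transpose J u, ← Matrix.dotProduct_mulVec, Matrix.mulVec_mulVec,
      Matrix.mulVec_mulVec, hJg]
  have JJ : ∀ u, J.mulVec (J.mulVec u) = -u := fun u => by
    rw [Matrix.mulVec_mulVec, hJ, Matrix.neg_mulVec, Matrix.one_mulVec]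
  have bneg : ∀ u v, b (-u) v = -b u v := fun u v => by simp [hb]
  have bneg' : ∀ u v, b u (-v) = -b u v := fun u v => by simp [hb, Matrix.mulVec_neg]
  have bJ' : ∀ u v, b u (J.mulVec v) = -b (J.mulVec u) v := fun u v => by
    rw [← bJ u, JJ, bneg']
  have bself : ∀ u, b u (J.mulVec u) = 0 := fun u => by
    have := bJ' u u; rw [bsymm (J.mulVec u)] at this; linarith
  have step : ∀ {m : ℕ} (_ : m < 6) (s : Fin m → Fin 6 → ℝ),
      ∃ v, b v v = 1 ∧ ∀ i, b (s i) v = 0 := by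
    intro m hm s
    obtain ⟨v, hv0, hv⟩ := exists_orthogonal hm fun i => Matrix.vecMul (s i) g
    have pos : 0 < b v v := by simpa using hg.dotProduct_mulVec_pos hv0
    refine ⟨(Real.sqrt (b v v))⁻¹ • v, ?_, fun i => ?_⟩
    · have : b ((Real.sqrt (b v v))⁻¹ • v) ((Real.sqrt (b v v))⁻¹ • v) =
          ((Real.sqrt (b v v))⁻¹ * (Real.sqrt (b v v))⁻¹) * b v v := by
        simp [hb, Matrix.mulVec_smul, mul_assoc]
      rw [this, ← mul_inv, Real.mul_self_sqrt pos.le, inv_mul_cancel₀ pos.ne']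
    · have : b (s i) ((Real.sqrt (b v v))⁻¹ • v) = (Real.sqrt (b v v))⁻¹ * b (s i) v := by
        simp [hb, Matrix.mulVec_smul]
      rw [this]
      have h2 : b (s i) v = 0 := by rw [← hv i, ← Matrix.dotProduct_mulVec]
      rw [h2, mul_zero]
  obtain ⟨u, hu, -⟩ := step (m := 0) (by norm_num) ![]
  obtain ⟨v, hv, hv'⟩ := step (m := 2) (by norm_num) ![u, J.mulVec u]
  obtain ⟨w, hw, hw'⟩ := step (m := 4) (by norm_num) ![u, J.mulVec u, v, J.mulVec v]
  have uv : b u v = 0 := hv' 0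
  have Juv : b (J.mulVec u) v = 0 := hv' 1
  have uw : b u w = 0 := hw' 0
  have Juw : b (J.mulVec u) w = 0 := hw' 1
  have vw : b v w = 0 := hw' 2
  have Jvw : b (J.mulVec v) w = 0 := hw' 3
  have vu : b v u = 0 := by rw [bsymm, uv]
  have Jvu : b (J.mulVec v) u = 0 := by rw [bsymm, bJ', Juv, neg_zero]
  have wu : b w u = 0 := by rw [bsymm, uw]
  have Jwu : b (J.mulVec w) u = 0 := by rw [bsymm, bJ', Juw, neg_zero]
  have wv : b w v = 0 := by rw [bsymm, vw]
  have Jwv : b (J.mulVec w) v = 0 := by rw [bsymm, bJ', Jvw, neg_zero]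
  have Jself : ∀ x, b (J.mulVec x) x = 0 := fun x => by rw [bsymm, bself]
  set f : Fin 6 → Fin 6 → ℝ := ![u, J.mulVec u, v, J.mulVec v, w, J.mulVec w] with hf
  refine ⟨Matrix.of fun i a => f a i, ?_, ?_⟩
  · have e : ∀ a c, ((Matrix.of fun i a => f a i).transpose * g * Matrix.of fun i a => f a i) a c =
        b (f a) (f c) := by
      intro a c
      simp only [hb, Matrix.mul_assoc]
      rfl
    ext a c
    rw [e]
    fin_cases a <;> fin_cases c <;>
      simp [hf, hu, hv, hw, uv, Juv, uw, Juw, vw, Jvw, vu, Jvu, wu, Jwu, wv, Jwv, Jself, bself, bJ,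
        bJ' _ u, bJ' _ v, bJ' _ w]
  · have e : ∀ i a, (J * Matrix.of fun i a => f a i) i a = J.mulVec (f a) i := fun i a => rfl
    ext i a
    rw [e, Matrix.mul_apply]
    obtain ⟨s0, s1, s2, s3, s4, s5⟩ := sum_J0 fun x => (Matrix.of fun i a => f a i) i x
    fin_cases a
    · exact s0.symm
    · refine Eq.trans ?_ s1.symm
      simp [hf, JJ]
    · exact s2.symm
    · refine Eq.trans ?_ s3.symm
      simp [hf, JJ]
    · exact s4.symm
    · refine Eq.trans ?_ s5.symm
      simp [hf, JJ]

/-- The rotation of the last complex coordinate by the angle with cosine `c` and sine `s`. -/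
def rot (c s : ℝ) : Matrix (Fin 6) (Fin 6) ℝ :=
  !![1, 0, 0, 0, 0, 0; 0, 1, 0, 0, 0, 0; 0, 0, 1, 0, 0, 0; 0, 0, 0, 1, 0, 0;
     0, 0, 0, 0, c, -s; 0, 0, 0, 0, s, c]

theorem rot_transpose_mul {c s : ℝ} (h : c * c + s * s = 1) :
    (rot c s).transpose * rot c s = 1 := by
  ext i j
  fin_cases i <;> fin_cases j <;> simp [rot, Matrix.mul_apply, Fin.sum_univ_six] <;> linarith

theorem J0_mul_rot (c s : ℝ) : J0 * rot c s = rot c s * J0 := by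
  ext i j
  fin_cases i <;> fin_cases j <;> simp [rot, J0, Matrix.mul_apply, Fin.sum_univ_six]

theorem pull_three (P : Matrix (Fin 6) (Fin 6) ℝ) (A : Tens 3) (i j k : Fin 6) :
    pull P A ![i, j, k] = ∑ a, P a i * ∑ b, P b j * ∑ c, P c k * A ![a, b, c] := by
  rw [pull, sum_fin_three]
  simp only [Finset.mul_sum, Fin.prod_univ_three]
  refine Finset.sum_congr rfl fun a _ => Finset.sum_congr rfl fun b _ =>
    Finset.sum_congr rfl fun c _ => ?_
  simp; ring

theorem pull_rot (c s : ℝ) (A : Tens 3) :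
    pull (rot c s) A ![0, 2, 4] = c * A ![0, 2, 4] + s * A ![0, 2, 5] ∧
    pull (rot c s) A ![0, 2, 5] = -s * A ![0, 2, 4] + c * A ![0, 2, 5] := by
  constructor <;> simp [pull_three, Fin.sum_univ_six, rot]

/-- A nonzero form of type `(3,0) + (0,3)` is a positive multiple of `Re (dz¹ ∧ dz² ∧ dz³)` in some
unitary frame. -/
theorem exists_adapted_frame {J g : Matrix (Fin 6) (Fin 6) ℝ} {φ : Tens 3} (hJ : J * J = -1)
    (hg : g.PosDef) (hJg : J.transpose * g * J = g) (hφ : IsAlt φ) (hφ0 : φ ≠ 0)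
    (hc : JCompat J φ) :
    ∃ (P : Matrix (Fin 6) (Fin 6) ℝ) (c : ℝ), 0 < c ∧ P.transpose * g * P = 1 ∧ J * P = P * J0 ∧
      pull P φ = c • phi0 := by
  obtain ⟨P, hP, hJP⟩ := exists_unitary_frame hJ hg hJg
  set ψ := pull P φ with hψ
  have hψa : IsAlt ψ := hφ.pull P
  have hψc : JCompat J0 ψ := hc.pull hJP
  have hψe := hψc.eq_smul_add_smul hψa
  set a := ψ ![0, 2, 4]
  set b := ψ ![0, 2, 5]
  have hinv : P * (P.transpose * g) = 1 := by
    rw [mul_eq_one_comm]; exact hP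
  have hψ0 : ψ ≠ 0 := by
    intro h
    apply hφ0
    rw [← pull_cancel hinv φ, ← hψ, h]
    ext i; simp [pull]
  have hpos : 0 < a * a + b * b := by
    rcases (add_nonneg (mul_self_nonneg a) (mul_self_nonneg b)).lt_or_eq with h | h
    · exact h
    · have ha : a = 0 := by nlinarith [mul_self_nonneg a, mul_self_nonneg b]
      have hb : b = 0 := by nlinarith [mul_self_nonneg a, mul_self_nonneg b]
      exact absurd (by rw [hψe, ha, hb]; simp) hψ0
  set c := Real.sqrt (a * a + b * b) with hcdef
  have hc0 : 0 < c := Real.sqrt_pos.2 hpos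
  have hcc : c * c = a * a + b * b := Real.mul_self_sqrt hpos.le
  -- The rotation brings `a Re Ω + b Im Ω`, where `Ω = dz¹ ∧ dz² ∧ dz³`, into the form `c Re Ω`.
  set R := rot (a / c) (b / c) with hR
  have hRR : R.transpose * R = 1 := rot_transpose_mul (by field_simp; nlinarith)
  refine ⟨P * R, c, hc0, ?_, ?_, ?_⟩
  · rw [Matrix.transpose_mul]
    calc _ = R.transpose * (P.transpose * g * P) * R := by simp only [Matrix.mul_assoc]
      _ = 1 := by rw [hP, Matrix.mul_one, hRR]
  · rw [← Matrix.mul_assoc, hJP, Matrix.mul_assoc, J0_mul_rot, Matrix.mul_assoc]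
  · have h1 : JCompat J0 (pull R ψ) := hψc.pull (J0_mul_rot _ _)
    rw [pull_mul, ← hψ, h1.eq_smul_add_smul (hψa.pull R), (pull_rot _ _ ψ).1, (pull_rot _ _ ψ).2]
    have e1 : a / c * a + b / c * b = c := by field_simp; nlinarith
    have e2 : -(b / c) * a + a / c * b = 0 := by ring
    change (a / c * a + b / c * b) • phi0 + (-(b / c) * a + a / c * b) • hat0 = _
    rw [e1, e2, zero_smul, add_zero]

/-! ### Invariants of the standard pair -/

theorem hitchinDensity_smul (c : ℝ) (φ : Tens 3) :
    hitchinDensity (c • φ) = (c * c) • hitchinDensity φ := by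
  ext i j
  simp only [hitchinDensity, Matrix.of_apply, Matrix.smul_apply, smul_eq_mul]
  have : (fun a => (c • φ) (Fin.cons j a)) = c • fun a : Fin 2 → Fin 6 => φ (Fin.cons j a) := rfl
  rw [this, wedge_smul_left, wedge_smul_right, wedge_smul_left, wedge_smul_left]
  simp only [Pi.smul_apply, smul_eq_mul]
  ring

set_option maxHeartbeats 1600000 in
theorem hitchinDensity_phi0 : hitchinDensity phi0 = (2 : ℝ) • J0 := by
  ext i j
  rw [hitchinDensity_apply phi0_isAlt]
  fin_cases i <;> fin_cases j <;> simp [phi0, dzComp, J0, Fin.succAbove] <;> norm_num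

theorem omega0_isAlt : IsAlt omega0 := by
  intro σ i
  have h : ∀ i j, J0 i j = -J0 j i := fun i j => by
    have := congrFun (congrFun J0_transpose j) i
    simpa using this
  have h2 : σ = 1 ∨ σ = Equiv.swap 0 1 := by revert σ; decide
  rcases h2 with rfl | rfl
  · simp
  · rw [Equiv.Perm.sign_swap (by decide)]
    simp [omega0, h (i 1) (i 0)]

theorem vol_omega0 : vol omega0 = 1 := by
  have h : vol omega0 = (1 / 6 : ℝ) * wedge (wedge omega0 omega0) omega0 id := rfl
  rw [h, wedge_four_two (wedge_isAlt _ _) omega0_isAlt]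
  simp only [wedge_two_two omega0_isAlt omega0_isAlt, id]
  simp [omega0, J0]
  norm_num

theorem vol_smul (s : ℝ) (ω : Tens 2) : vol (s • ω) = s ^ 3 * vol ω := by
  have h : ∀ ω, vol ω = (1 / 6 : ℝ) * wedge (wedge ω ω) ω id := fun _ => rfl
  rw [h, h, wedge_smul_left, wedge_smul_right, wedge_smul_left, wedge_smul_right, wedge_smul_left]
  simp only [Pi.smul_apply, smul_eq_mul]
  ring

theorem pull_J0_phi0 : pull J0 phi0 = hat0 := by
  refine (phi0_isAlt.pull J0).ext_twenty hat0_isAlt ?_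
  simp only [pull_three, Fin.sum_univ_six]
  simp [J0, phi0, hat0, dzComp]
  try norm_num

theorem wedge_phi0_hat0 : wedge (p := 3) (q := 3) phi0 hat0 id = 4 := by
  rw [wedge_three_three phi0_isAlt hat0_isAlt]
  simp [phi0, hat0, dzComp]
  norm_num

/-- The contraction `φ₀_{iab} φ₀_{jkp} w^{ak} w^{bp}`. -/
def phi0Contr (w : Matrix (Fin 6) (Fin 6) ℝ) : Matrix (Fin 6) (Fin 6) ℝ := Matrix.of fun i j =>
  ∑ a, ∑ b, phi0 ![i, a, b] * ∑ k, ∑ p, phi0 ![j, k, p] * (w a k * w b p)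

theorem metric_smul_phi0 (c : ℝ) (ω : Tens 2) : metric (c • phi0) ω =
    (-(normSq (c • phi0) ω)⁻¹ * c ^ 2) • phi0Contr (omegaInv ω) := by
  ext i j
  simp only [metric, phi0Contr, Matrix.of_apply, Matrix.smul_apply, smul_eq_mul, Finset.mul_sum,
    Pi.smul_apply]
  refine Finset.sum_congr rfl fun _ _ => Finset.sum_congr rfl fun _ _ =>
    Finset.sum_congr rfl fun _ _ => Finset.sum_congr rfl fun _ _ => ?_
  ring

theorem omegaInv_transpose {ω : Tens 2} (hω : IsAlt ω) :
    (omegaInv ω).transpose = -omegaInv ω := by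
  have h : (toMatrix ω).transpose = -toMatrix ω := by
    ext i j
    simp only [toMatrix, Matrix.transpose_apply, Matrix.of_apply, Matrix.neg_apply]
    exact IsAlt'.swap_two hω i j
  rw [omegaInv, Matrix.transpose_nonsing_inv, h]
  by_cases hd : IsUnit (toMatrix ω).det
  · refine Matrix.inv_eq_right_inv ?_
    rw [neg_mul_neg, Matrix.mul_nonsing_inv _ hd]
  · rw [Matrix.nonsing_inv_apply_not_isUnit _ hd, Matrix.nonsing_inv_apply_not_isUnit, neg_zero]
    rwa [Matrix.det_neg, IsUnit.mul_iff, and_iff_right (by simp)]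

theorem sum_phi0_swap (w : Matrix (Fin 6) (Fin 6) ℝ) (i : Fin 6) :
    ∑ a, ∑ b, w a b * phi0 ![b, a, i] = ∑ b, ∑ a, phi0 ![i, b, a] * w a b := by
  rw [Finset.sum_comm]
  refine Finset.sum_congr rfl fun b _ => Finset.sum_congr rfl fun a _ => ?_
  rw [IsAlt'.swap12 phi0_isAlt b i a, IsAlt'.swap01 phi0_isAlt i b a]; ring

/-- If the contraction of an antisymmetric matrix with `φ₀` vanishes, then the matrix is invariant
under the complex structure. -/
theorem components_of_primitive {w : Matrix (Fin 6) (Fin 6) ℝ} (hs : ∀ i j, w j i = -w i j)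
    (h : ∀ i, ∑ a, ∑ b, w a b * phi0 ![b, a, i] = 0) :
    w 1 3 = w 0 2 ∧ w 0 3 = -w 1 2 ∧ w 1 5 = w 0 4 ∧ w 0 5 = -w 1 4 ∧ w 3 5 = w 2 4 ∧
      w 2 5 = -w 3 4 := by
  obtain ⟨e0, e1, e2, e3, e4, e5⟩ := sum_phi0 fun a b => w b a
  simp only [sum_phi0_swap] at h
  have f0 := (h 0).symm.trans e0
  have f1 := (h 1).symm.trans e1
  have f2 := (h 2).symm.trans e2
  have f3 := (h 3).symm.trans e3
  have f4 := (h 4).symm.trans e4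
  have f5 := (h 5).symm.trans e5
  rw [hs 2 4, hs 3 5] at f0
  rw [hs 2 5, hs 3 4] at f1
  rw [hs 0 4, hs 1 5] at f2
  rw [hs 0 5, hs 1 4] at f3
  rw [hs 0 2, hs 1 3] at f4
  rw [hs 0 3, hs 1 2] at f5
  refine ⟨?_, ?_, ?_, ?_, ?_, ?_⟩ <;> linarith

theorem phi0Contr_apply (w : Matrix (Fin 6) (Fin 6) ℝ) (j : Fin 6) (Y : Fin 6 → Fin 6 → ℝ)
    (hY : ∀ a b, ∑ k, ∑ p, phi0 ![j, k, p] * (w a k * w b p) = Y a b) (i : Fin 6) :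
    phi0Contr w i j = ∑ a, ∑ b, phi0 ![i, a, b] * Y a b := by
  simp only [phi0Contr, Matrix.of_apply, hY]

theorem phi0Contr_symm {w : Matrix (Fin 6) (Fin 6) ℝ} (hs : ∀ i j, w j i = -w i j) (i j : Fin 6) :
    phi0Contr w i j = phi0Contr w j i := by
  simp only [phi0Contr, Matrix.of_apply, Finset.mul_sum]
  have e : ∀ f : Fin 6 → Fin 6 → Fin 6 → Fin 6 → ℝ,
      ∑ a, ∑ b, ∑ k, ∑ p, f a b k p = ∑ k, ∑ p, ∑ a, ∑ b, f a b k p := by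
    intro f
    calc _ = ∑ a, ∑ k, ∑ b, ∑ p, f a b k p :=
          Finset.sum_congr rfl fun _ _ => Finset.sum_comm
      _ = ∑ k, ∑ a, ∑ b, ∑ p, f a b k p := Finset.sum_comm
      _ = ∑ k, ∑ a, ∑ p, ∑ b, f a b k p :=
          Finset.sum_congr rfl fun _ _ => Finset.sum_congr rfl fun _ _ => Finset.sum_comm
      _ = _ := Finset.sum_congr rfl fun _ _ => Finset.sum_comm
  rw [e]
  refine Finset.sum_congr rfl fun k _ => Finset.sum_congr rfl fun p _ =>
    Finset.sum_congr rfl fun a _ => Finset.sum_congr rfl fun b _ => ?_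
  rw [hs k a, hs p b]
  ring

set_option linter.unusedSimpArgs false in
/-- For a `J`-invariant bivector `w` on `ℂ³`, the quadratic expression `phi0Contr w` is the
Hermitian adjugate of `w`. -/
theorem mul_phi0Contr {w : Matrix (Fin 6) (Fin 6) ℝ} (hs : ∀ i j, w j i = -w i j)
    (h : ∀ i, ∑ a, ∑ b, w a b * phi0 ![b, a, i] = 0) :
    w * (phi0Contr w * J0) =
      ((w * (phi0Contr w * J0)) 0 0) • (1 : Matrix (Fin 6) (Fin 6) ℝ) := by
  obtain ⟨w13, w03, w15, w05, w35, w25⟩ := components_of_primitive hs h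
  have hd : ∀ i, w i i = 0 := fun i => by have := hs i i; linarith
  have k : ∀ i j, j < i → w i j = -w j i := fun i j _ => hs j i
  obtain ⟨y0, y1, y2, y3, y4, y5⟩ : (∀ a b, _ = _) ∧ (∀ a b, _ = _) ∧ (∀ a b, _ = _) ∧
      (∀ a b, _ = _) ∧ (∀ a b, _ = _) ∧ (∀ a b, _ = _) :=
    ⟨fun a b => (sum_phi0 fun k p => w a k * w b p).1,
      fun a b => (sum_phi0 fun k p => w a k * w b p).2.1,
      fun a b => (sum_phi0 fun k p => w a k * w b p).2.2.1,
      fun a b => (sum_phi0 fun k p => w a k * w b p).2.2.2.1,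
      fun a b => (sum_phi0 fun k p => w a k * w b p).2.2.2.2.1,
      fun a b => (sum_phi0 fun k p => w a k * w b p).2.2.2.2.2⟩
  have m00 : phi0Contr w 0 0 = -(4 * (w 2 3 * w 4 5)) + 4 * (w 2 4 * w 2 4) + 4 * (w 3 4 * w 3 4) := by
    rw [phi0Contr_apply w 0 _ y0 0, (sum_phi0 _).1]
    simp [hd, k, w13, w03, w15, w05, w35, w25]; ring
  have m01 : phi0Contr w 0 1 = 0 := by
    rw [phi0Contr_apply w 1 _ y1 0, (sum_phi0 _).1]
    simp [hd, k, w13, w03, w15, w05, w35, w25]; ring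
  have m02 : phi0Contr w 0 2 = -(4 * (w 0 4 * w 2 4)) - 4 * (w 1 2 * w 4 5) - 4 * (w 1 4 * w 3 4) := by
    rw [phi0Contr_apply w 2 _ y2 0, (sum_phi0 _).1]
    simp [hd, k, w13, w03, w15, w05, w35, w25]; ring
  have m03 : phi0Contr w 0 3 = -(4 * (w 0 2 * w 4 5)) - 4 * (w 0 4 * w 3 4) + 4 * (w 1 4 * w 2 4) := by
    rw [phi0Contr_apply w 3 _ y3 0, (sum_phi0 _).1]
    simp [hd, k, w13, w03, w15, w05, w35, w25]; ring
  have m04 : phi0Contr w 0 4 = 4 * (w 0 2 * w 2 4) - 4 * (w 1 2 * w 3 4) - 4 * (w 1 4 * w 2 3) := by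
    rw [phi0Contr_apply w 4 _ y4 0, (sum_phi0 _).1]
    simp [hd, k, w13, w03, w15, w05, w35, w25]; ring
  have m05 : phi0Contr w 0 5 = -(4 * (w 0 2 * w 3 4)) - 4 * (w 0 4 * w 2 3) - 4 * (w 1 2 * w 2 4) := by
    rw [phi0Contr_apply w 5 _ y5 0, (sum_phi0 _).1]
    simp [hd, k, w13, w03, w15, w05, w35, w25]; ring
  have m11 : phi0Contr w 1 1 = -(4 * (w 2 3 * w 4 5)) + 4 * (w 2 4 * w 2 4) + 4 * (w 3 4 * w 3 4) := by
    rw [phi0Contr_apply w 1 _ y1 1, (sum_phi0 _).2.1]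
    simp [hd, k, w13, w03, w15, w05, w35, w25]; ring
  have m12 : phi0Contr w 1 2 = 4 * (w 0 2 * w 4 5) + 4 * (w 0 4 * w 3 4) - 4 * (w 1 4 * w 2 4) := by
    rw [phi0Contr_apply w 2 _ y2 1, (sum_phi0 _).2.1]
    simp [hd, k, w13, w03, w15, w05, w35, w25]; ring
  have m13 : phi0Contr w 1 3 = -(4 * (w 0 4 * w 2 4)) - 4 * (w 1 2 * w 4 5) - 4 * (w 1 4 * w 3 4) := by
    rw [phi0Contr_apply w 3 _ y3 1, (sum_phi0 _).2.1]
    simp [hd, k, w13, w03, w15, w05, w35, w25]; ring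
  have m14 : phi0Contr w 1 4 = 4 * (w 0 2 * w 3 4) + 4 * (w 0 4 * w 2 3) + 4 * (w 1 2 * w 2 4) := by
    rw [phi0Contr_apply w 4 _ y4 1, (sum_phi0 _).2.1]
    simp [hd, k, w13, w03, w15, w05, w35, w25]; ring
  have m15 : phi0Contr w 1 5 = 4 * (w 0 2 * w 2 4) - 4 * (w 1 2 * w 3 4) - 4 * (w 1 4 * w 2 3) := by
    rw [phi0Contr_apply w 5 _ y5 1, (sum_phi0 _).2.1]
    simp [hd, k, w13, w03, w15, w05, w35, w25]; ring
  have m22 : phi0Contr w 2 2 = -(4 * (w 0 1 * w 4 5)) + 4 * (w 0 4 * w 0 4) + 4 * (w 1 4 * w 1 4) := by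
    rw [phi0Contr_apply w 2 _ y2 2, (sum_phi0 _).2.2.1]
    simp [hd, k, w13, w03, w15, w05, w35, w25]; ring
  have m23 : phi0Contr w 2 3 = 0 := by
    rw [phi0Contr_apply w 3 _ y3 2, (sum_phi0 _).2.2.1]
    simp [hd, k, w13, w03, w15, w05, w35, w25]; ring
  have m24 : phi0Contr w 2 4 = -(4 * (w 0 1 * w 3 4)) - 4 * (w 0 2 * w 0 4) - 4 * (w 1 2 * w 1 4) := by
    rw [phi0Contr_apply w 4 _ y4 2, (sum_phi0 _).2.2.1]
    simp [hd, k, w13, w03, w15, w05, w35, w25]; ring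
  have m25 : phi0Contr w 2 5 = -(4 * (w 0 1 * w 2 4)) + 4 * (w 0 2 * w 1 4) - 4 * (w 0 4 * w 1 2) := by
    rw [phi0Contr_apply w 5 _ y5 2, (sum_phi0 _).2.2.1]
    simp [hd, k, w13, w03, w15, w05, w35, w25]; ring
  have m33 : phi0Contr w 3 3 = -(4 * (w 0 1 * w 4 5)) + 4 * (w 0 4 * w 0 4) + 4 * (w 1 4 * w 1 4) := by
    rw [phi0Contr_apply w 3 _ y3 3, (sum_phi0 _).2.2.2.1]
    simp [hd, k, w13, w03, w15, w05, w35, w25]; ring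
  have m34 : phi0Contr w 3 4 = 4 * (w 0 1 * w 2 4) - 4 * (w 0 2 * w 1 4) + 4 * (w 0 4 * w 1 2) := by
    rw [phi0Contr_apply w 4 _ y4 3, (sum_phi0 _).2.2.2.1]
    simp [hd, k, w13, w03, w15, w05, w35, w25]; ring
  have m35 : phi0Contr w 3 5 = -(4 * (w 0 1 * w 3 4)) - 4 * (w 0 2 * w 0 4) - 4 * (w 1 2 * w 1 4) := by
    rw [phi0Contr_apply w 5 _ y5 3, (sum_phi0 _).2.2.2.1]
    simp [hd, k, w13, w03, w15, w05, w35, w25]; ring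
  have m44 : phi0Contr w 4 4 = -(4 * (w 0 1 * w 2 3)) + 4 * (w 0 2 * w 0 2) + 4 * (w 1 2 * w 1 2) := by
    rw [phi0Contr_apply w 4 _ y4 4, (sum_phi0 _).2.2.2.2.1]
    simp [hd, k, w13, w03, w15, w05, w35, w25]; ring
  have m45 : phi0Contr w 4 5 = 0 := by
    rw [phi0Contr_apply w 5 _ y5 4, (sum_phi0 _).2.2.2.2.1]
    simp [hd, k, w13, w03, w15, w05, w35, w25]; ring
  have m55 : phi0Contr w 5 5 = -(4 * (w 0 1 * w 2 3)) + 4 * (w 0 2 * w 0 2) + 4 * (w 1 2 * w 1 2) := by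
    rw [phi0Contr_apply w 5 _ y5 5, (sum_phi0 _).2.2.2.2.2]
    simp [hd, k, w13, w03, w15, w05, w35, w25]; ring
  have ms : ∀ i j, j < i → phi0Contr w i j = phi0Contr w j i := fun i j _ => phi0Contr_symm hs i j
  obtain ⟨j0, j1, j2, j3, j4, j5⟩ : (∀ i, _ = _) ∧ (∀ i, _ = _) ∧ (∀ i, _ = _) ∧
      (∀ i, _ = _) ∧ (∀ i, _ = _) ∧ (∀ i, _ = _) :=
    ⟨fun i => (sum_J0 (phi0Contr w i)).1, fun i => (sum_J0 (phi0Contr w i)).2.1,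
      fun i => (sum_J0 (phi0Contr w i)).2.2.1, fun i => (sum_J0 (phi0Contr w i)).2.2.2.1,
      fun i => (sum_J0 (phi0Contr w i)).2.2.2.2.1, fun i => (sum_J0 (phi0Contr w i)).2.2.2.2.2⟩
  simp only [← Matrix.mul_apply] at j0 j1 j2 j3 j4 j5
  set N := phi0Contr w * J0 with hN
  clear_value N
  ext i j
  rw [Matrix.smul_apply, Matrix.mul_apply, Matrix.mul_apply]
  simp only [Fin.sum_univ_six]
  fin_cases i <;> fin_cases j <;> simp [hd, k, w13, w03, w15, w05, w35, w25, j0, j1, j2, j3, j4, j5,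
    ms, m00, m01, m02, m03, m04, m05, m11, m12, m13, m14, m15, m22, m23, m24, m25, m33, m34, m35, m44, m45, m55] <;> ring

theorem J0_sum_phi0 (i : Fin 6) : ∑ a, ∑ b, J0 a b * phi0 ![b, a, i] = 0 := by
  rw [sum_phi0_swap]
  obtain ⟨e0, e1, e2, e3, e4, e5⟩ := sum_phi0 fun a b => J0 b a
  fin_cases i
  · exact e0.trans (by simp [J0])
  · exact e1.trans (by simp [J0])
  · exact e2.trans (by simp [J0])
  · exact e3.trans (by simp [J0])
  · exact e4.trans (by simp [J0])
  · exact e5.trans (by simp [J0])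

theorem phi0Contr_smul (s : ℝ) (w : Matrix (Fin 6) (Fin 6) ℝ) :
    phi0Contr (s • w) = (s * s) • phi0Contr w := by
  ext i j
  simp only [phi0Contr, Matrix.of_apply, Matrix.smul_apply, smul_eq_mul, Finset.mul_sum]
  exact Finset.sum_congr rfl fun _ _ => Finset.sum_congr rfl fun _ _ =>
    Finset.sum_congr rfl fun _ _ => Finset.sum_congr rfl fun _ _ => by ring

theorem J0_antisymm (i j : Fin 6) : J0 j i = -J0 i j := by
  have := congrFun (congrFun J0_transpose i) j
  simpa using this

theorem phi0Contr_J0 : phi0Contr J0 = (-4 : ℝ) • (1 : Matrix (Fin 6) (Fin 6) ℝ) := by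
  have h := mul_phi0Contr J0_antisymm J0_sum_phi0
  set κ := (J0 * (phi0Contr J0 * J0)) 0 0
  have h1 : phi0Contr J0 = κ • (J0 * J0) := by
    have h2 := congrArg (fun X => J0 * X * J0) h
    simp only [← Matrix.mul_assoc, J0_mul_J0] at h2
    simpa [Matrix.mul_assoc, J0_mul_J0] using h2
  have h3 : phi0Contr J0 0 0 = -4 := by
    rw [phi0Contr_apply J0 0 _ (fun a b => (sum_phi0 fun k p => J0 a k * J0 b p).1) 0,
      (sum_phi0 _).1]
    simp [J0]
    norm_num
  rw [h1, J0_mul_J0] at h3 ⊢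
  simp at h3
  have : κ = 4 := by linarith
  rw [this]; simp

theorem hitchinK_std (c s : ℝ) :
    hitchinK (c • phi0) (s • omega0) = (2 * c ^ 2 / s ^ 3) • J0 := by
  rw [hitchinK_eq, hitchinDensity_smul, hitchinDensity_phi0, vol_smul, vol_omega0, smul_smul,
    smul_smul]
  congr 1
  rw [mul_one]
  ring

theorem trace_J0_sq : (J0 * J0).trace = -6 := by rw [J0_mul_J0]; simp

/-- For nonzero `c` and `s`, the factor of `J₀` is the sign of `s`, i.e. the orientation given by
`(s ω₀)³`. -/
theorem almostComplex_std (c s : ℝ) : almostComplex (c • phi0) (s • omega0) =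
    (|2 * c ^ 2 / s ^ 3|⁻¹ * (2 * c ^ 2 / s ^ 3)) • J0 := by
  have h : hitchinLambda (c • phi0) (s • omega0) = -(2 * c ^ 2 / s ^ 3) ^ 2 := by
    rw [hitchinLambda, hitchinK_std, Matrix.smul_mul, Matrix.mul_smul, Matrix.trace_smul,
      Matrix.trace_smul, trace_J0_sq, smul_eq_mul, smul_eq_mul]
    ring
  rw [almostComplex, h, hitchinK_std, neg_neg, Real.sqrt_sq_eq_abs, smul_smul]

theorem almostComplex_std_of_pos {c s : ℝ} (hc : c ≠ 0) (hs : 0 < s) :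
    almostComplex (c • phi0) (s • omega0) = J0 := by
  have h : 0 < 2 * c ^ 2 / s ^ 3 := by positivity
  rw [almostComplex_std, abs_of_pos h, inv_mul_cancel₀ h.ne', one_smul]

theorem hat_std {c s : ℝ} (hc : c ≠ 0) (hs : 0 < s) :
    hat (c • phi0) (s • omega0) = c • hat0 := by
  rw [hat_eq, almostComplex_std_of_pos hc hs, pull_smul, pull_J0_phi0]

theorem normSq_std {c s : ℝ} (hc : c ≠ 0) (hs : 0 < s) :
    normSq (c • phi0) (s • omega0) = 4 * c ^ 2 / s ^ 3 := by
  rw [normSq_eq, hat_std hc hs, vol_smul, vol_omega0, wedge_smul_left, wedge_smul_right]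
  simp only [Pi.smul_apply, smul_eq_mul, wedge_phi0_hat0]
  rw [mul_one]; ring

theorem omegaInv_std {s : ℝ} (hs : s ≠ 0) : omegaInv (s • omega0) = s⁻¹ • J0 := by
  have h : toMatrix (s • omega0) = s • (-J0) := by rw [← toMatrix_omega0]; rfl
  rw [omegaInv, h]
  refine Matrix.inv_eq_right_inv ?_
  rw [Matrix.smul_mul, Matrix.mul_smul, smul_smul, mul_inv_cancel₀ hs, one_smul, Matrix.neg_mul,
    J0_mul_J0, neg_neg]

theorem metric_std {c s : ℝ} (hc : c ≠ 0) (hs : 0 < s) :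
    metric (c • phi0) (s • omega0) = s • (1 : Matrix (Fin 6) (Fin 6) ℝ) := by
  rw [metric_smul_phi0, normSq_std hc hs, omegaInv_std hs.ne', phi0Contr_smul, phi0Contr_J0,
    smul_smul, smul_smul]
  congr 1
  field_simp

/-- The pointwise conditions on a Type IIA structure. -/
structure IsTypeIIAAt (φ : Tens 3) (ω : Tens 2) : Prop where
  alt_phi : IsAlt φ
  alt_omega : IsAlt ω
  det_ne : (toMatrix ω).det ≠ 0
  lambda_neg : hitchinLambda φ ω < 0
  primitive : contractOmega (k := 1) ω φ = 0
  posDef : (metric φ ω).PosDef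

theorem hitchinLambda_eq (φ : Tens 3) (ω : Tens 2) : hitchinLambda φ ω =
    (vol ω)⁻¹ * (vol ω)⁻¹ * ((hitchinDensity φ * hitchinDensity φ).trace / 6) := by
  rw [hitchinLambda, hitchinK_eq, Matrix.smul_mul, Matrix.mul_smul, Matrix.trace_smul,
    Matrix.trace_smul, smul_eq_mul, smul_eq_mul]
  ring

theorem hitchinK_sq {φ : Tens 3} (hφ : IsAlt φ) (ω : Tens 2) :
    hitchinK φ ω * hitchinK φ ω = hitchinLambda φ ω • (1 : Matrix (Fin 6) (Fin 6) ℝ) := by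
  rw [hitchinLambda_eq, hitchinK_eq, Matrix.smul_mul, Matrix.mul_smul, hitchinDensity_sq hφ,
    smul_smul, smul_smul, ← hitchinDensity_sq hφ]

theorem almostComplex_sq {φ : Tens 3} {ω : Tens 2} (hφ : IsAlt φ) (h : hitchinLambda φ ω < 0) :
    almostComplex φ ω * almostComplex φ ω = -1 := by
  rw [almostComplex, Matrix.smul_mul, Matrix.mul_smul, hitchinK_sq hφ, smul_smul, smul_smul,
    ← mul_inv, Real.mul_self_sqrt (by linarith), inv_neg, neg_mul, inv_mul_cancel₀ h.ne, neg_smul,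
    one_smul]

/-- Every nondegenerate three-form is of type `(3,0) + (0,3)` for its own almost complex structure. -/
theorem jCompat_almostComplex {φ : Tens 3} (hφ : IsAlt φ) (ω : Tens 2) :
    JCompat (almostComplex φ ω) φ := by
  rw [jCompat_iff]
  intro i j k
  have h := hitchinDensity_contract hφ i j k
  rw [Finset.sum_add_distrib] at h
  rw [almostComplex, hitchinK_eq, smul_smul]
  simp only [Matrix.smul_apply, smul_eq_mul, mul_left_comm (φ _), ← Finset.mul_sum, ← mul_add, h,
    mul_zero]

theorem hitchinLambda_zero (ω : Tens 2) : hitchinLambda 0 ω = 0 := by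
  have : hitchinDensity 0 = 0 := by
    have := hitchinDensity_smul 0 0
    simpa using this
  rw [hitchinLambda_eq, this]; simp

/-- The normal form of a Type IIA structure at a point. -/
theorem IsTypeIIAAt.exists_frame {φ : Tens 3} {ω : Tens 2} (h : IsTypeIIAAt φ ω) :
    ∃ (P : Matrix (Fin 6) (Fin 6) ℝ) (c : ℝ), 0 < c ∧ P.det ≠ 0 ∧ pull P φ = c • phi0 ∧
      pull P ω = omega0 := by
  have hφ0 : φ ≠ 0 := by
    rintro rfl
    have := h.lambda_neg
    rw [hitchinLambda_zero] at this
    exact lt_irrefl _ this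
  set J := almostComplex φ ω with hJdef
  have hJ : J * J = -1 := almostComplex_sq h.alt_phi h.lambda_neg
  -- An auxiliary `J`-invariant inner product brings `φ` and `J` into normal form.
  set g' : Matrix (Fin 6) (Fin 6) ℝ := 1 + J.transpose * J with hg'
  have pos' : g'.PosDef := Matrix.PosDef.one.add_posSemidef
    (by simpa using Matrix.posSemidef_conjTranspose_mul_self J)
  have inv' : J.transpose * g' * J = g' := by
    have : J.transpose * J.transpose = -1 := by rw [← Matrix.transpose_mul, hJ]; simp
    calc _ = J.transpose * J + (J.transpose * J.transpose) * (J * J) := by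
          rw [hg']; noncomm_ring
      _ = g' := by rw [this, hJ, hg']; simp [add_comm]
  have det_ne_of : ∀ P g : Matrix (Fin 6) (Fin 6) ℝ, P.transpose * g * P = 1 → P.det ≠ 0 := by
    intro P g h h0
    have := congrArg Matrix.det h
    simp [h0] at this
  obtain ⟨P, c, hc, hP, hJP, hPφ⟩ := exists_adapted_frame hJ pos' inv' h.alt_phi hφ0
    (jCompat_almostComplex h.alt_phi ω)
  have hPd := det_ne_of P g' hP
  set ω₁ := pull P ω with hω₁
  have conj : ∀ {P J J' : Matrix (Fin 6) (Fin 6) ℝ}, P.det ≠ 0 → J * P = P * J' →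
      P⁻¹ * J * P = J' := by
    intro P J J' hP hJ
    rw [Matrix.mul_assoc, hJ, ← Matrix.mul_assoc,
      Matrix.nonsing_inv_mul _ (isUnit_iff_ne_zero.2 hP), Matrix.one_mul]
  have hJ₁ : almostComplex (c • phi0) ω₁ = J0 := by
    rw [← hPφ, hω₁, almostComplex_pull P hPd, ← hJdef, conj hPd hJP]
  have alt₁ : IsAlt ω₁ := h.alt_omega.pull P
  set Ω := toMatrix ω₁ with hΩ
  have hΩdet : Ω.det ≠ 0 := by
    rw [hΩ, hω₁, toMatrix_pull, Matrix.det_mul, Matrix.det_mul, Matrix.det_transpose]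
    exact mul_ne_zero (mul_ne_zero hPd h.det_ne) hPd
  set w := omegaInv ω₁ with hw
  have hΩw : Ω * w = 1 := Matrix.mul_nonsing_inv _ (isUnit_iff_ne_zero.2 hΩdet)
  have hws : ∀ i j, w j i = -w i j := fun i j => by
    have := congrFun (congrFun (omegaInv_transpose alt₁) i) j
    simpa using this
  have hprim : ∀ i, ∑ a, ∑ b, w a b * phi0 ![b, a, i] = 0 := by
    intro i
    have h1 : contractOmega (k := 1) ω₁ (pull P φ) = 0 := by
      rw [hω₁, contractOmega_pull P hPd, h.primitive]
      ext i; simp [pull]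
    rw [hPφ] at h1
    have h2 := congrFun h1 ![i]
    simp only [contractOmega, Pi.smul_apply, smul_eq_mul, mul_left_comm _ c, ← Finset.mul_sum,
      Pi.zero_apply] at h2
    have h3 := (mul_eq_zero.1 ((mul_eq_zero.1 h2).resolve_left hc.ne')).resolve_left (by norm_num)
    exact h3
  -- The metric is a multiple of `phi0Contr w`, hence of `Ω J₀`.
  have hκ := mul_phi0Contr hws hprim
  set κ := (w * (phi0Contr w * J0)) 0 0
  have hM : phi0Contr w * J0 = κ • Ω := by
    have := congrArg (Ω * ·) hκ
    simp only [← Matrix.mul_assoc, hΩw, Matrix.one_mul] at this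
    rw [this]; simp
  have hM' : phi0Contr w = -(κ • (Ω * J0)) := by
    have := congrArg (· * J0) hM
    simp only [Matrix.mul_assoc, J0_mul_J0] at this
    rw [← Matrix.smul_mul, ← this]; simp
  set g := metric (c • phi0) ω₁ with hg
  obtain ⟨ρ, hρ⟩ : ∃ ρ : ℝ, g = ρ • (Ω * J0) := by
    refine ⟨(normSq (c • phi0) ω₁)⁻¹ * c ^ 2 * κ, ?_⟩
    rw [hg, metric_smul_phi0, ← hw, hM', smul_neg, smul_smul, ← neg_smul]
    congr 1; ring
  have gpos : g.PosDef := by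
    rw [hg, ← hPφ, hω₁, metric_pull P hPd]
    exact h.posDef.conjTranspose_mul_mul_same (by
      intro x y hxy
      have := congrArg (P⁻¹.mulVec ·) hxy
      simpa [Matrix.mulVec_mulVec, Matrix.nonsing_inv_mul _ (isUnit_iff_ne_zero.2 hPd)] using this)
  have gsymm : g.transpose = g := by simpa [Matrix.IsHermitian] using gpos.isHermitian
  have hρ0 : ρ ≠ 0 := by
    rintro rfl
    have := gpos.det_pos
    rw [hρ] at this
    simp at this
  have Ωt : Ω.transpose = -Ω := by
    ext i j
    exact IsAlt'.swap_two alt₁ i j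
  have ginv : J0.transpose * g * J0 = g := by
    have h1 : J0 * Ω = Ω * J0 := by
      have h2 := gsymm
      rw [hρ, Matrix.transpose_smul, Matrix.transpose_mul, Ωt, J0_transpose, neg_mul_neg] at h2
      exact smul_right_injective _ hρ0 h2
    rw [hρ, J0_transpose]
    calc _ = -(ρ • (J0 * Ω * (J0 * J0))) := by
          simp [Matrix.mul_assoc]
      _ = _ := by rw [J0_mul_J0, h1]; simp
  have hc0 : c • phi0 ≠ 0 := by
    intro h0
    apply hφ0
    have h1 := pull_cancel (P := P) (Q := P⁻¹)
      (Matrix.mul_nonsing_inv _ (isUnit_iff_ne_zero.2 hPd)) φ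
    rw [← h1, hPφ, h0]
    ext i; simp [pull]
  -- The metric is invariant under the complex structure; a second unitary frame diagonalizes it.
  obtain ⟨Q, c', hc', hQ, hJQ, hQφ⟩ := exists_adapted_frame J0_mul_J0 gpos ginv
    (phi0_isAlt.smul c) hc0 (by rw [← hJ₁]; exact jCompat_almostComplex (phi0_isAlt.smul c) _)
  have hQd := det_ne_of Q g hQ
  have hω₂ : pull Q ω₁ = ρ⁻¹ • omega0 := by
    have h1 : toMatrix (pull Q ω₁) = ρ⁻¹ • -J0 := by
      have h2 : Ω = -(ρ⁻¹ • (g * J0)) := by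
        rw [hρ, Matrix.smul_mul, Matrix.mul_assoc, J0_mul_J0, smul_smul, inv_mul_cancel₀ hρ0]
        simp
      rw [toMatrix_pull, ← hΩ, h2]
      calc _ = -(ρ⁻¹ • (Q.transpose * g * (J0 * Q))) := by simp [Matrix.mul_assoc]
        _ = -(ρ⁻¹ • (Q.transpose * g * Q * J0)) := by rw [hJQ]; simp [Matrix.mul_assoc]
        _ = _ := by rw [hQ]; simp
    ext i
    have := congrFun (congrFun h1 (i 0)) (i 1)
    have e : i = ![i 0, i 1] := by ext a; fin_cases a <;> rfl
    simp only [toMatrix, Matrix.of_apply] at this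
    rw [← e] at this
    rw [this]; rfl
  have hJ₂ : almostComplex (c' • phi0) (ρ⁻¹ • omega0) = J0 := by
    rw [← hQφ, ← hω₂, almostComplex_pull Q hQd, hJ₁, conj hQd hJQ]
  -- For negative `ρ` the orientation would turn the almost complex structure into `-J₀`.
  have hρpos : 0 < ρ⁻¹ := by
    rcases lt_or_gt_of_ne (inv_ne_zero hρ0) with hneg | hpos
    · exfalso
      have hk : 2 * c' ^ 2 / ρ⁻¹ ^ 3 < 0 :=
        div_neg_of_pos_of_neg (by positivity) (Odd.pow_neg (by decide) hneg)
      have h10 : J0 1 0 = 1 := rfl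
      rw [almostComplex_std, abs_of_neg hk, inv_neg, neg_mul, inv_mul_cancel₀ hk.ne] at hJ₂
      have := congrFun (congrFun hJ₂ 1) 0
      simp [h10] at this
      norm_num at this
    · exact hpos
  have hg₂ : metric (c' • phi0) (ρ⁻¹ • omega0) = 1 := by
    rw [← hQφ, ← hω₂, metric_pull Q hQd, ← hg, hQ]
  rw [metric_std hc'.ne' hρpos] at hg₂
  have hρ1 : ρ⁻¹ = 1 := by
    have := congrFun (congrFun hg₂ 0) 0
    simpa using this
  refine ⟨P * Q, c', hc', ?_, ?_, ?_⟩
  · rw [Matrix.det_mul]; exact mul_ne_zero hPd hQd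
  · rw [pull_mul, hPφ, hQφ]
  · rw [pull_mul, ← hω₁, hω₂, hρ1, one_smul]

/-! ### Smoothness -/

section Smooth

variable {E : Type*} [NormedAddCommGroup E] [NormedSpace ℝ E] {x : E}

theorem contDiffAt_det {M : E → Matrix (Fin 6) (Fin 6) ℝ}
    (hM : ∀ i j, ContDiffAt ℝ Cinf (fun y => M y i j) x) :
    ContDiffAt ℝ Cinf (fun y => (M y).det) x := by
  simp only [Matrix.det_apply']
  exact ContDiffAt.sum fun σ _ => contDiffAt_const.mul (contDiffAt_prod fun i _ => hM _ _)

theorem contDiffAt_inv_entry {M : E → Matrix (Fin 6) (Fin 6) ℝ}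
    (hM : ∀ i j, ContDiffAt ℝ Cinf (fun y => M y i j) x) (h : (M x).det ≠ 0) (i j : Fin 6) :
    ContDiffAt ℝ Cinf (fun y => (M y)⁻¹ i j) x := by
  have e : (fun y => (M y)⁻¹ i j) =
      fun y => (M y).det⁻¹ * ((M y).updateRow j (Pi.single i 1)).det := by
    ext y
    rw [Matrix.inv_def, Matrix.smul_apply, Ring.inverse_eq_inv', Matrix.adjugate_apply, smul_eq_mul]
  rw [e]
  refine ((contDiffAt_det hM).inv h).mul (contDiffAt_det fun a b => ?_)
  by_cases ha : a = j
  · subst ha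
    simp only [Matrix.updateRow_self]
    exact contDiffAt_const
  · simp only [Matrix.updateRow_ne ha]
    exact hM a b

theorem contDiffAt_wedge {p q : ℕ} {A : E → Tens p} {B : E → Tens q}
    (hA : ContDiffAt ℝ Cinf A x) (hB : ContDiffAt ℝ Cinf B x) :
    ContDiffAt ℝ Cinf (fun y => wedge (A y) (B y)) x := by
  rw [contDiffAt_pi] at hA hB ⊢
  intro i
  exact contDiffAt_const.mul
    (ContDiffAt.sum fun σ _ => (contDiffAt_const.mul (hA _)).mul (hB _))

variable {φ : E → Tens 3} {ω : E → Tens 2}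

theorem contDiffAt_vol (hω : ContDiffAt ℝ Cinf ω x) :
    ContDiffAt ℝ Cinf (fun y => vol (ω y)) x :=
  contDiffAt_const.mul (contDiffAt_pi.1 (contDiffAt_wedge (contDiffAt_wedge hω hω) hω) _)

theorem contDiffAt_hitchinDensity (hφ : ContDiffAt ℝ Cinf φ x) (i j : Fin 6) :
    ContDiffAt ℝ Cinf (fun y => hitchinDensity (φ y) i j) x := by
  refine contDiffAt_pi.1 (contDiffAt_wedge (contDiffAt_wedge ?_ hφ) contDiffAt_const) _
  exact contDiffAt_pi.2 fun a => contDiffAt_pi.1 hφ _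

theorem contDiffAt_hitchinK (hφ : ContDiffAt ℝ Cinf φ x) (hω : ContDiffAt ℝ Cinf ω x)
    (hv : vol (ω x) ≠ 0) (i j : Fin 6) :
    ContDiffAt ℝ Cinf (fun y => hitchinK (φ y) (ω y) i j) x := by
  simp only [hitchinK_eq, Matrix.smul_apply, smul_eq_mul]
  exact ((contDiffAt_vol hω).inv hv).mul (contDiffAt_hitchinDensity hφ i j)

/-- If `vol ω = 0`, then the factor `1 / vol ω` in `hitchinK` is zero, and so is `hitchinLambda`. -/
theorem vol_ne_zero {φ : Tens 3} {ω : Tens 2} (h : hitchinLambda φ ω < 0) : vol ω ≠ 0 := by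
  intro h0
  rw [hitchinLambda_eq, h0] at h
  simp at h

/-- Smoothness holds where `λ < 0`, since the square root of `-λ` is smooth and nonzero there. -/
theorem contDiffAt_almostComplex (hφ : ContDiffAt ℝ Cinf φ x) (hω : ContDiffAt ℝ Cinf ω x)
    (hl : hitchinLambda (φ x) (ω x) < 0) (i j : Fin 6) :
    ContDiffAt ℝ Cinf (fun y => almostComplex (φ y) (ω y) i j) x := by
  have hK := contDiffAt_hitchinK hφ hω (vol_ne_zero hl)
  have hL : ContDiffAt ℝ Cinf (fun y => hitchinLambda (φ y) (ω y)) x := by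
    simp only [hitchinLambda, Matrix.trace, Matrix.diag, Matrix.mul_apply]
    exact (ContDiffAt.sum fun i _ => ContDiffAt.sum fun j _ => (hK _ _).mul (hK _ _)).div_const _
  simp only [almostComplex, Matrix.smul_apply, smul_eq_mul]
  refine ((hL.neg.sqrt ?_).inv ?_).mul (hK i j)
  · exact (neg_pos.2 hl).ne'
  · exact (Real.sqrt_pos.2 (neg_pos.2 hl)).ne'

theorem contDiffAt_hat (hφ : ContDiffAt ℝ Cinf φ x) (hω : ContDiffAt ℝ Cinf ω x)
    (hl : hitchinLambda (φ x) (ω x) < 0) :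
    ContDiffAt ℝ Cinf (fun y => hat (φ y) (ω y)) x := by
  have hJ := contDiffAt_almostComplex hφ hω hl
  refine contDiffAt_pi.2 fun i => ?_
  exact ContDiffAt.sum fun a _ => ContDiffAt.sum fun b _ => ContDiffAt.sum fun c _ =>
    (((contDiffAt_pi.1 hφ _).mul (hJ _ _)).mul (hJ _ _)).mul (hJ _ _)

theorem contDiffAt_normSq (hφ : ContDiffAt ℝ Cinf φ x) (hω : ContDiffAt ℝ Cinf ω x)
    (hl : hitchinLambda (φ x) (ω x) < 0) :
    ContDiffAt ℝ Cinf (fun y => normSq (φ y) (ω y)) x :=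
  (contDiffAt_pi.1 (contDiffAt_wedge hφ (contDiffAt_hat hφ hω hl)) _).div
    (contDiffAt_vol hω) (vol_ne_zero hl)

theorem contDiffAt_omegaInv (hω : ContDiffAt ℝ Cinf ω x) (hd : (toMatrix (ω x)).det ≠ 0)
    (i j : Fin 6) : ContDiffAt ℝ Cinf (fun y => omegaInv (ω y) i j) x :=
  contDiffAt_inv_entry (fun _ _ => contDiffAt_pi.1 hω _) hd i j

theorem contDiffAt_metric (hφ : ContDiffAt ℝ Cinf φ x) (hω : ContDiffAt ℝ Cinf ω x)
    (hl : hitchinLambda (φ x) (ω x) < 0) (hd : (toMatrix (ω x)).det ≠ 0)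
    (hn : normSq (φ x) (ω x) ≠ 0) (i j : Fin 6) :
    ContDiffAt ℝ Cinf (fun y => metric (φ y) (ω y) i j) x := by
  have hw := contDiffAt_omegaInv hω hd
  exact ((contDiffAt_normSq hφ hω hl).inv hn).neg.mul (ContDiffAt.sum fun a _ =>
    ContDiffAt.sum fun b _ => ContDiffAt.sum fun k _ => ContDiffAt.sum fun p _ =>
    (((contDiffAt_pi.1 hφ _).mul (contDiffAt_pi.1 hφ _)).mul (hw _ _)).mul (hw _ _))

end Smooth

/-! ### The infinitesimal action of matrices on tensors -/

/-- The derivative at `τ = 0` of the pullback by `1 + τ X`. -/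
def lie {k : ℕ} (X : Matrix (Fin 6) (Fin 6) ℝ) (A : Tens k) : Tens k := fun i =>
  ∑ a : Fin k, ∑ m, X m (i a) * A (Function.update i a m)

theorem lie_smul {k : ℕ} (X : Matrix (Fin 6) (Fin 6) ℝ) (c : ℝ) (A : Tens k) :
    lie X (c • A) = c • lie X A := by
  ext i; simp only [lie, Pi.smul_apply, smul_eq_mul, Finset.mul_sum]
  exact Finset.sum_congr rfl fun _ _ => Finset.sum_congr rfl fun _ _ => by ring

theorem hasDerivAt_pull {k : ℕ} (X : Matrix (Fin 6) (Fin 6) ℝ) {f : ℝ → Tens k} {f' : Tens k}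
    (hf : HasDerivAt f f' 0) :
    HasDerivAt (fun τ : ℝ => pull (1 + τ • X) (f τ)) (lie X (f 0) + f') 0 := by
  rw [hasDerivAt_pi] at hf ⊢
  intro i
  have h1 : ∀ j : Fin k → Fin 6, ∀ a ∈ (Finset.univ : Finset (Fin k)),
      HasDerivAt (fun τ : ℝ => (1 + τ • X) (j a) (i a)) (X (j a) (i a)) 0 := by
    intro j a _
    have := ((hasDerivAt_id (0 : ℝ)).mul_const (X (j a) (i a))).const_add
      ((1 : Matrix (Fin 6) (Fin 6) ℝ) (j a) (i a))
    simpa using this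
  have h2 := HasDerivAt.fun_sum (u := Finset.univ) fun (j : Fin k → Fin 6) _ =>
    (HasDerivAt.fun_finsetProd (h1 j)).mul (hf j)
  refine h2.congr_deriv ?_
  simp only [zero_smul, add_zero, smul_eq_mul]
  rw [Finset.sum_add_distrib, Pi.add_apply]
  congr 1
  · simp only [lie, Finset.sum_mul]
    rw [Finset.sum_comm]
    refine Finset.sum_congr rfl fun a _ => ?_
    refine (Fintype.sum_of_injective (fun m : Fin 6 => Function.update i a m)
      (Function.update_injective i a) (fun m => X m (i a) * f 0 (Function.update i a m))
      (fun j => ((∏ b ∈ Finset.univ.erase a, (1 : Matrix (Fin 6) (Fin 6) ℝ) (j b) (i b)) *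
        X (j a) (i a)) * f 0 j) ?_ ?_).symm
    · intro j hj
      have : ∃ b, b ≠ a ∧ j b ≠ i b := by
        by_contra! h
        refine hj ⟨j a, ?_⟩
        ext b
        rcases eq_or_ne b a with rfl | hb
        · simp
        · simp [Function.update_of_ne hb, h b hb]
      obtain ⟨b, hb, hjb⟩ := this
      have h0 : (∏ b ∈ Finset.univ.erase a, (1 : Matrix (Fin 6) (Fin 6) ℝ) (j b) (i b)) = 0 :=
        Finset.prod_eq_zero (Finset.mem_erase.2 ⟨hb, Finset.mem_univ b⟩) (Matrix.one_apply_ne hjb)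
      rw [h0]; ring
    · intro m
      have h0 : (∏ b ∈ Finset.univ.erase a,
          (1 : Matrix (Fin 6) (Fin 6) ℝ) (Function.update i a m b) (i b)) = 1 := by
        refine Finset.prod_eq_one fun b hb => ?_
        rw [Function.update_of_ne (Finset.ne_of_mem_erase hb), Matrix.one_apply_eq]
      rw [h0, Function.update_self, one_mul]
  · exact congrFun (pull_one f') i

theorem eventually_det_ne (X : Matrix (Fin 6) (Fin 6) ℝ) :
    ∀ᶠ τ : ℝ in nhds 0, (1 + τ • X).det ≠ 0 := by
  have h : Continuous fun τ : ℝ => (1 + τ • X).det := by fun_prop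
  have h0 : (1 + (0 : ℝ) • X).det ≠ 0 := by simp
  exact h.continuousAt.eventually_ne h0

/-! ### First derivatives of the invariants of a pair -/

/-- `|φ|²` as a function of the pair `(φ, ω)`. -/
def nF (s : Tens 3 × Tens 2) : ℝ := normSq s.1 s.2

/-- `|φ|² φ̂` as a function of the pair `(φ, ω)`. -/
def nhF (s : Tens 3 × Tens 2) : Tens 3 := normSq s.1 s.2 • hat s.1 s.2

/-- The metric as a function of the pair `(φ, ω)`. -/
def gF (s : Tens 3 × Tens 2) : Tens 2 := metricTens s.1 s.2

/-- The pullback of a pair. -/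
def pullPair (P : Matrix (Fin 6) (Fin 6) ℝ) (s : Tens 3 × Tens 2) : Tens 3 × Tens 2 :=
  (pull P s.1, pull P s.2)

/-- The infinitesimal action on pairs. -/
def liePair (X : Matrix (Fin 6) (Fin 6) ℝ) (s : Tens 3 × Tens 2) : Tens 3 × Tens 2 :=
  (lie X s.1, lie X s.2)

theorem IsTypeIIAAt.normSq_ne {φ : Tens 3} {ω : Tens 2} (h : IsTypeIIAAt φ ω) :
    normSq φ ω ≠ 0 := by
  obtain ⟨P, c, hc, hP, h1, h2⟩ := h.exists_frame
  rw [← normSq_pull P hP, h1, h2]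
  have := normSq_std hc.ne' one_pos
  rw [one_smul] at this
  rw [this]; positivity

section

variable {s : Tens 3 × Tens 2} (h : IsTypeIIAAt s.1 s.2)
include h

theorem contDiffAt_nF : ContDiffAt ℝ Cinf nF s :=
  contDiffAt_normSq contDiffAt_fst contDiffAt_snd h.lambda_neg

theorem contDiffAt_nhF : ContDiffAt ℝ Cinf nhF s :=
  (contDiffAt_nF h).smul (contDiffAt_hat contDiffAt_fst contDiffAt_snd h.lambda_neg)

theorem contDiffAt_gF : ContDiffAt ℝ Cinf gF s :=
  contDiffAt_pi.2 fun _ => contDiffAt_metric contDiffAt_fst contDiffAt_snd h.lambda_neg h.det_ne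
    h.normSq_ne _ _

end

theorem cinf_ne_zero : Cinf ≠ 0 := by decide

/-- The derivative of an equivariant map along the infinitesimal action. -/
theorem fderiv_liePair {k : ℕ} {T : Tens 3 × Tens 2 → Tens k} {s : Tens 3 × Tens 2}
    (hT : DifferentiableAt ℝ T s)
    (he : ∀ P : Matrix (Fin 6) (Fin 6) ℝ, P.det ≠ 0 → T (pullPair P s) = pull P (T s))
    (X : Matrix (Fin 6) (Fin 6) ℝ) : fderiv ℝ T s (liePair X s) = lie X (T s) := by
  have h1 := hasDerivAt_pull X (hasDerivAt_const (0 : ℝ) s.1)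
  have h2 := hasDerivAt_pull X (hasDerivAt_const (0 : ℝ) s.2)
  have h3 := hasDerivAt_pull X (hasDerivAt_const (0 : ℝ) (T s))
  simp only [add_zero] at h1 h2 h3
  have e0 : pullPair (1 + (0 : ℝ) • X) s = s := by
    simp [pullPair, pull_one]
  have h4 : HasDerivAt (fun τ : ℝ => T (pullPair (1 + τ • X) s)) (fderiv ℝ T s (liePair X s)) 0 := by
    refine HasFDerivAt.comp_hasDerivAt (0 : ℝ) ?_ (h1.prodMk h2)
    rw [e0]
    exact hT.hasFDerivAt
  refine h4.unique (h3.congr_of_eventuallyEq ?_)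
  filter_upwards [eventually_det_ne X] with τ hτ using he _ hτ

/-- The norm is a scalar invariant, so it does not change along the infinitesimal action. -/
theorem fderiv_nF_liePair {s : Tens 3 × Tens 2} (h : IsTypeIIAAt s.1 s.2)
    (X : Matrix (Fin 6) (Fin 6) ℝ) : fderiv ℝ nF s (liePair X s) = 0 := by
  have hd : DifferentiableAt ℝ nF s := (contDiffAt_nF h).differentiableAt cinf_ne_zero
  have h0 := fderiv_liePair (k := 0) (T := fun s _ => nF s) (s := s)
    (differentiableAt_pi.2 fun _ => hd) (fun P hP => by
      ext i; rw [pull_zero_valence]; exact normSq_pull P hP _ _) X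
  have h1 := congrFun h0 ![]
  rw [fderiv_pi (fun _ => hd)] at h1
  simpa [lie] using h1

theorem fderiv_nhF_liePair {s : Tens 3 × Tens 2} (h : IsTypeIIAAt s.1 s.2)
    (X : Matrix (Fin 6) (Fin 6) ℝ) : fderiv ℝ nhF s (liePair X s) = lie X (nhF s) := by
  refine fderiv_liePair ((contDiffAt_nhF h).differentiableAt cinf_ne_zero) (fun P hP => ?_) X
  simp only [nhF, pullPair, normSq_pull P hP, hat_pull P hP, pull_smul]

theorem fderiv_gF_liePair {s : Tens 3 × Tens 2} (h : IsTypeIIAAt s.1 s.2)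
    (X : Matrix (Fin 6) (Fin 6) ℝ) : fderiv ℝ gF s (liePair X s) = lie X (gF s) :=
  fderiv_liePair ((contDiffAt_gF h).differentiableAt cinf_ne_zero)
    (fun P hP => metricTens_pull P hP _ _) X

/-! ### The derivatives at the standard pair -/

/-- The standard pair `(c φ₀, ω₀)`. -/
def stdPair (c : ℝ) : Tens 3 × Tens 2 := (c • phi0, omega0)

theorem isTypeIIAAt_std {c : ℝ} (hc : 0 < c) : IsTypeIIAAt (stdPair c).1 (stdPair c).2 where
  alt_phi := phi0_isAlt.smul c
  alt_omega := omega0_isAlt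
  det_ne := by
    show (toMatrix omega0).det ≠ 0
    rw [toMatrix_omega0]
    intro h
    have := congrArg Matrix.det J0_mul_J0
    rw [← neg_mul_neg, Matrix.det_mul, h, Matrix.det_neg] at this
    norm_num at this
  lambda_neg := by
    have h := hitchinK_std c 1
    rw [one_smul] at h
    show hitchinLambda (c • phi0) omega0 < 0
    rw [hitchinLambda, h, Matrix.smul_mul, Matrix.mul_smul, Matrix.trace_smul, Matrix.trace_smul,
      trace_J0_sq]
    have : 0 < (2 * c ^ 2 / 1 ^ 3) * (2 * c ^ 2 / 1 ^ 3) := by positivity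
    simp only [smul_eq_mul]
    nlinarith
  primitive := by
    have h := omegaInv_std one_ne_zero
    rw [one_smul] at h
    ext i
    have h1 := J0_sum_phi0 (i 0)
    simp only [contractOmega, stdPair, h, inv_one, one_smul, Pi.smul_apply, smul_eq_mul,
      Pi.zero_apply]
    have e : ∀ a b, (Fin.cons b (Fin.cons a i : Fin 2 → Fin 6) : Fin 3 → Fin 6) = ![b, a, i 0] := by
      intro a b; ext x; fin_cases x <;> rfl
    have h2 : ∑ a, ∑ b, J0 a b * (c * phi0 ![b, a, i 0]) = 0 := by
      rw [← mul_zero c, ← h1]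
      simp only [Finset.mul_sum]
      exact Finset.sum_congr rfl fun _ _ => Finset.sum_congr rfl fun _ _ => by ring
    simp only [e]
    rw [h2, mul_zero]
  posDef := by
    have h := metric_std hc.ne' one_pos
    rw [one_smul, one_smul] at h
    show (metric (c • phi0) omega0).PosDef
    rw [h]
    exact Matrix.PosDef.one

theorem vol_apply {ω : Tens 2} (hω : IsAlt ω) : vol ω =
    ω ![0, 1] * (ω ![2, 3] * ω ![4, 5] - ω ![2, 4] * ω ![3, 5] + ω ![2, 5] * ω ![3, 4])
    - ω ![0, 2] * (ω ![1, 3] * ω ![4, 5] - ω ![1, 4] * ω ![3, 5] + ω ![1, 5] * ω ![3, 4])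
    + ω ![0, 3] * (ω ![1, 2] * ω ![4, 5] - ω ![1, 4] * ω ![2, 5] + ω ![1, 5] * ω ![2, 4])
    - ω ![0, 4] * (ω ![1, 2] * ω ![3, 5] - ω ![1, 3] * ω ![2, 5] + ω ![1, 5] * ω ![2, 3])
    + ω ![0, 5] * (ω ![1, 2] * ω ![3, 4] - ω ![1, 3] * ω ![2, 4] + ω ![1, 4] * ω ![2, 3]) := by
  have h : vol ω = (1 / 6 : ℝ) * wedge (wedge ω ω) ω id := rfl
  rw [h, wedge_four_two (wedge_isAlt _ _) hω]
  simp only [wedge_two_two hω hω, id]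
  simp only [Matrix.cons_val]
  ring

/-- At `ω₀`, `vol` changes at the rate of the trace of the variation with respect to `ω₀`. -/
theorem hasDerivAt_vol {B : Tens 2} (hB : IsAlt B) :
    HasDerivAt (fun τ : ℝ => vol (omega0 + τ • B)) (B ![0, 1] + B ![2, 3] + B ![4, 5]) 0 := by
  have e : ∀ τ : ℝ, vol (omega0 + τ • B) = 1 + τ * (B ![0, 1] + B ![2, 3] + B ![4, 5]) +
      τ ^ 2 * ((vol (omega0 + B) + vol (omega0 - B) - 2) / 2) + τ ^ 3 * vol B := by
    intro τ
    rw [vol_apply (omega0_isAlt.add (hB.smul τ)), vol_apply (omega0_isAlt.add hB),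
      sub_eq_add_neg omega0, ← neg_one_smul ℝ B, vol_apply (omega0_isAlt.add (hB.smul _)),
      vol_apply hB]
    simp [omega0, J0]
    ring
  -- `vol` is cubic, and the coefficient of `τ²` is determined by the values at `τ = 1` and `τ = -1`.
  simp only [e]
  have h1 := hasDerivAt_id (0 : ℝ)
  have h := (((h1.mul_const (B ![0, 1] + B ![2, 3] + B ![4, 5])).const_add 1).add
    ((h1.pow 2).mul_const ((vol (omega0 + B) + vol (omega0 - B) - 2) / 2))).add
    ((h1.pow 3).mul_const (vol B))
  refine h.congr_deriv ?_
  simp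

theorem hasDerivAt_omegaInv {B : Tens 2} (i j : Fin 6) :
    HasDerivAt (fun τ : ℝ => omegaInv (omega0 + τ • B) i j) (-(J0 * toMatrix B * J0) i j) 0 := by
  have hd : (toMatrix omega0).det ≠ 0 := (isTypeIIAAt_std one_pos).det_ne
  have hB : HasDerivAt (fun τ : ℝ => omega0 + τ • B) B 0 := by
    simpa using ((hasDerivAt_id (0 : ℝ)).smul_const B).const_add omega0
  have hc : ContDiffAt ℝ Cinf (fun τ : ℝ => omega0 + τ • B) 0 := by fun_prop
  have hw : ∀ a b, HasDerivAt (fun τ : ℝ => omegaInv (omega0 + τ • B) a b)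
      (deriv (fun τ : ℝ => omegaInv (omega0 + τ • B) a b) 0) 0 := fun a b =>
    ((contDiffAt_omegaInv hc (by simpa using hd) a b).differentiableAt cinf_ne_zero).hasDerivAt
  set W : Matrix (Fin 6) (Fin 6) ℝ :=
    Matrix.of fun a b => deriv (fun τ : ℝ => omegaInv (omega0 + τ • B) a b) 0 with hW
  have e0 : omegaInv omega0 = J0 := by
    have := omegaInv_std one_ne_zero
    rwa [one_smul, inv_one, one_smul] at this
  have key : toMatrix B * J0 + -J0 * W = 0 := by
    ext a b
    have h1 := HasDerivAt.fun_sum (u := Finset.univ) fun (k : Fin 6) _ =>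
      ((hasDerivAt_pi.1 hB ![a, k]).mul (hw k b))
    have h2 : HasDerivAt (fun τ : ℝ => ∑ k, (omega0 + τ • B) ![a, k] *
        omegaInv (omega0 + τ • B) k b) 0 0 := by
      refine (hasDerivAt_const (0 : ℝ) ((1 : Matrix (Fin 6) (Fin 6) ℝ) a b)).congr_of_eventuallyEq ?_
      have hcont : ContinuousAt (fun τ : ℝ => (toMatrix (omega0 + τ • B)).det) 0 := by
        have : Continuous fun τ : ℝ => toMatrix (omega0 + τ • B) :=
          continuous_matrix fun i j => by simp only [toMatrix, Matrix.of_apply]; fun_prop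
        exact this.matrix_det.continuousAt
      filter_upwards [hcont.eventually_ne (by simpa using hd)] with τ hτ
      have := congrFun (congrFun (Matrix.mul_nonsing_inv (toMatrix (omega0 + τ • B))
        (isUnit_iff_ne_zero.2 hτ)) a) b
      rw [Matrix.mul_apply] at this
      exact this
    have h3 := h1.unique h2
    simp only [zero_smul, add_zero, e0, Finset.sum_add_distrib] at h3
    rw [← toMatrix_omega0]
    simpa [Matrix.mul_apply, Matrix.add_apply, toMatrix, hW] using h3
  have : W = -(J0 * toMatrix B * J0) := by
    have h1 := congrArg (J0 * ·) key
    simp only [Matrix.mul_add, Matrix.mul_zero, Matrix.neg_mul, Matrix.mul_neg,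
      ← Matrix.mul_assoc, J0_mul_J0, Matrix.one_mul, neg_neg] at h1
    exact (neg_eq_of_add_eq_zero_right h1).symm
  refine (hw i j).congr_deriv ?_
  exact congrFun (congrFun this i) j

/-- A matrix whose infinitesimal action on `φ₀` is a given three-form `A`; among all such matrices
it is the one of least norm, i.e. the one orthogonal to the stabilizer of `φ₀`. -/
def liftMat (A : Tens 3) : Matrix (Fin 6) (Fin 6) ℝ :=
  !![A ![0, 2, 4] / 3 - A ![0, 3, 5] / 3 + A ![1, 2, 5] / 6 + A ![1, 3, 4] / 6,
     -A ![0, 2, 5] / 6 - A ![0, 3, 4] / 6 + A ![1, 2, 4] / 3 - A ![1, 3, 5] / 3,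
     -A ![2, 3, 5] / 2,
     -A ![2, 3, 4] / 2,
     A ![3, 4, 5] / 2,
     A ![2, 4, 5] / 2;
     -A ![0, 2, 5] / 3 - A ![0, 3, 4] / 3 + A ![1, 2, 4] / 6 - A ![1, 3, 5] / 6,
     -A ![0, 2, 4] / 6 + A ![0, 3, 5] / 6 - A ![1, 2, 5] / 3 - A ![1, 3, 4] / 3,
     -A ![2, 3, 4] / 2,
     A ![2, 3, 5] / 2,
     A ![2, 4, 5] / 2,
     -A ![3, 4, 5] / 2;
     A ![0, 1, 5] / 2,
     A ![0, 1, 4] / 2,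
     A ![0, 2, 4] / 3 + A ![0, 3, 5] / 6 - A ![1, 2, 5] / 3 + A ![1, 3, 4] / 6,
     -A ![0, 2, 5] / 6 + A ![0, 3, 4] / 3 - A ![1, 2, 4] / 6 - A ![1, 3, 5] / 3,
     -A ![1, 4, 5] / 2,
     -A ![0, 4, 5] / 2;
     A ![0, 1, 4] / 2,
     -A ![0, 1, 5] / 2,
     -A ![0, 2, 5] / 3 + A ![0, 3, 4] / 6 - A ![1, 2, 4] / 3 - A ![1, 3, 5] / 6,
     -A ![0, 2, 4] / 6 - A ![0, 3, 5] / 3 + A ![1, 2, 5] / 6 - A ![1, 3, 4] / 3,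
     -A ![0, 4, 5] / 2,
     A ![1, 4, 5] / 2;
     -A ![0, 1, 3] / 2,
     -A ![0, 1, 2] / 2,
     A ![1, 2, 3] / 2,
     A ![0, 2, 3] / 2,
     A ![0, 2, 4] / 3 + A ![0, 3, 5] / 6 + A ![1, 2, 5] / 6 - A ![1, 3, 4] / 3,
     A ![0, 2, 5] / 3 - A ![0, 3, 4] / 6 - A ![1, 2, 4] / 6 - A ![1, 3, 5] / 3;
     -A ![0, 1, 2] / 2,
     A ![0, 1, 3] / 2,
     A ![0, 2, 3] / 2,
     -A ![1, 2, 3] / 2,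
     A ![0, 2, 5] / 6 - A ![0, 3, 4] / 3 - A ![1, 2, 4] / 3 - A ![1, 3, 5] / 6,
     -A ![0, 2, 4] / 6 - A ![0, 3, 5] / 3 - A ![1, 2, 5] / 3 + A ![1, 3, 4] / 6]

theorem lie_three (X : Matrix (Fin 6) (Fin 6) ℝ) (A : Tens 3) (i j k : Fin 6) :
    lie X A ![i, j, k] =
      ∑ m, X m i * A ![m, j, k] + ∑ m, X m j * A ![i, m, k] + ∑ m, X m k * A ![i, j, m] := by
  rw [lie, Fin.sum_univ_three]
  congr! 6 with m _ m _ m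
  all_goals ext x; fin_cases x <;> rfl

theorem lie_two (X : Matrix (Fin 6) (Fin 6) ℝ) (A : Tens 2) (i j : Fin 6) :
    lie X A ![i, j] = ∑ m, X m i * A ![m, j] + ∑ m, X m j * A ![i, m] := by
  rw [lie, Fin.sum_univ_two]
  congr! 5 with m _ m
  all_goals ext x; fin_cases x <;> rfl

theorem IsAlt.lie {k : ℕ} (X : Matrix (Fin 6) (Fin 6) ℝ) {A : Tens k} (hA : IsAlt A) :
    IsAlt (lie X A) := by
  intro σ i
  have h := hasDerivAt_pull X (hasDerivAt_const (0 : ℝ) A)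
  rw [add_zero, hasDerivAt_pi] at h
  refine (h (i ∘ σ)).unique (((h i).const_mul _).congr_of_eventuallyEq (.of_forall fun τ => ?_))
  exact hA.pull _ σ i

/-- The orbit of `φ₀` under `GL(6)` is open: every variation of `φ₀` is an infinitesimal coordinate
change. -/
theorem lie_liftMat {A : Tens 3} (hA : IsAlt A) : lie (liftMat A) phi0 = A := by
  refine (phi0_isAlt.lie _).ext_twenty hA ?_
  simp only [lie_three, Fin.sum_univ_six, phi0]
  simp [dzComp, liftMat]
  repeat' apply And.intro
  all_goals ring

/-- With `φ` fixed, `K`, `J` and `φ̂` depend on `ω` only through its volume form. -/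
theorem hitchinK_congr (φ : Tens 3) {ω ω' : Tens 2} (h : vol ω = vol ω') :
    hitchinK φ ω = hitchinK φ ω' := by
  rw [hitchinK_eq, hitchinK_eq, h]

theorem hat_phi0_of_vol_pos {c : ℝ} (hc : c ≠ 0) {ω : Tens 2} (hω : 0 < vol ω) :
    hat (c • phi0) ω = c • hat0 := by
  have hs : (vol ω ^ (1 / 3 : ℝ)) ^ 3 = vol ω := by
    rw [← Real.rpow_natCast, ← Real.rpow_mul hω.le]; norm_num
  have hp : 0 < vol ω ^ (1 / 3 : ℝ) := Real.rpow_pos_of_pos hω _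
  have h : vol ω = vol ((vol ω ^ (1 / 3 : ℝ)) • omega0) := by
    rw [vol_smul, vol_omega0, hs, mul_one]
  have hK := hitchinK_congr (c • phi0) h
  rw [← hat_std hc hp, hat_eq, hat_eq, almostComplex, almostComplex, hitchinLambda, hitchinLambda,
    ← hK]

theorem normSq_phi0_of_vol_pos {c : ℝ} (hc : c ≠ 0) {ω : Tens 2} (hω : 0 < vol ω) :
    normSq (c • phi0) ω = 4 * c ^ 2 * (vol ω)⁻¹ := by
  rw [normSq_eq, hat_phi0_of_vol_pos hc hω, wedge_smul_left, wedge_smul_right]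
  simp only [Pi.smul_apply, smul_eq_mul, wedge_phi0_hat0]
  ring

section

variable {c : ℝ} (hc : 0 < c) {B : Tens 2} (hB : IsAlt B)

theorem hasDerivAt_stdPair_snd (c : ℝ) (B : Tens 2) :
    HasDerivAt (fun τ : ℝ => (c • phi0, omega0 + τ • B)) ((0, B) : Tens 3 × Tens 2) 0 :=
  (hasDerivAt_const _ _).prodMk
    (by simpa using ((hasDerivAt_id (0 : ℝ)).smul_const B).const_add omega0)

theorem hasDerivAt_comp_snd {F : Type*} [NormedAddCommGroup F] [NormedSpace ℝ F]
    {T : Tens 3 × Tens 2 → F} (hT : ContDiffAt ℝ Cinf T (stdPair c)) :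
    HasDerivAt (fun τ : ℝ => T (c • phi0, omega0 + τ • B)) (fderiv ℝ T (stdPair c) (0, B)) 0 := by
  refine HasFDerivAt.comp_hasDerivAt (0 : ℝ) ?_ (hasDerivAt_stdPair_snd c B)
  rw [zero_smul, add_zero]
  exact (hT.differentiableAt cinf_ne_zero).hasFDerivAt

include hB

theorem eventually_vol_pos : ∀ᶠ τ : ℝ in nhds 0, 0 < vol (omega0 + τ • B) := by
  refine (hasDerivAt_vol hB).continuousAt.eventually_const_lt ?_
  simp [vol_omega0]

theorem hasDerivAt_inv_vol :
    HasDerivAt (fun τ : ℝ => (vol (omega0 + τ • B))⁻¹) (-(B ![0, 1] + B ![2, 3] + B ![4, 5])) 0 := by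
  have h := (hasDerivAt_vol hB).fun_inv (by rw [zero_smul, add_zero, vol_omega0]; exact one_ne_zero)
  rw [zero_smul, add_zero, vol_omega0] at h
  simpa using h

include hc

theorem fderiv_nF_snd : fderiv ℝ nF (stdPair c) (0, B) =
    -4 * c ^ 2 * (B ![0, 1] + B ![2, 3] + B ![4, 5]) := by
  refine (hasDerivAt_comp_snd (contDiffAt_nF (isTypeIIAAt_std hc))).unique ?_
  refine (((hasDerivAt_inv_vol hB).const_mul (4 * c ^ 2)).congr_deriv (by ring)).congr_of_eventuallyEq
    ?_
  filter_upwards [eventually_vol_pos hB] with τ hτ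
  exact normSq_phi0_of_vol_pos hc.ne' hτ

theorem fderiv_nhF_snd : fderiv ℝ nhF (stdPair c) (0, B) =
    (-4 * c ^ 3 * (B ![0, 1] + B ![2, 3] + B ![4, 5])) • hat0 := by
  refine (hasDerivAt_comp_snd (contDiffAt_nhF (isTypeIIAAt_std hc))).unique ?_
  refine ((((hasDerivAt_inv_vol hB).const_mul (4 * c ^ 3)).congr_deriv (by ring)).smul_const
    hat0).congr_of_eventuallyEq ?_
  filter_upwards [eventually_vol_pos hB] with τ hτ
  simp only [nhF, normSq_phi0_of_vol_pos hc.ne' hτ, hat_phi0_of_vol_pos hc.ne' hτ, smul_smul]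
  congr 1
  ring

end

theorem metric_phi0_of_vol_pos {c : ℝ} (hc : 0 < c) {ω : Tens 2} (hω : 0 < vol ω) (i j : Fin 6) :
    metric (c • phi0) ω i j = -(1 / 4) * (vol ω * phi0Contr (omegaInv ω) i j) := by
  rw [metric_smul_phi0, normSq_phi0_of_vol_pos hc.ne' hω, Matrix.smul_apply, smul_eq_mul]
  field_simp

theorem sum_phi0_eq (i : Fin 6) (X : Fin 6 → Fin 6 → ℝ) :
    ∑ a, ∑ b, phi0 ![i, a, b] * X a b =
      ![X 2 4 - X 4 2 - X 3 5 + X 5 3, X 5 2 - X 2 5 + X 4 3 - X 3 4,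
        X 4 0 - X 0 4 - X 5 1 + X 1 5, X 0 5 - X 5 0 + X 1 4 - X 4 1,
        X 0 2 - X 2 0 - X 1 3 + X 3 1, X 3 0 - X 0 3 - X 1 2 + X 2 1] i := by
  obtain ⟨e0, e1, e2, e3, e4, e5⟩ := sum_phi0 X
  fin_cases i
  exacts [e0, e1, e2, e3, e4, e5]

theorem J0_entries :
    (J0 0 0 = 0 ∧ J0 0 1 = -1 ∧ J0 0 2 = 0 ∧ J0 0 3 = 0 ∧ J0 0 4 = 0 ∧ J0 0 5 = 0) ∧
    (J0 1 0 = 1 ∧ J0 1 1 = 0 ∧ J0 1 2 = 0 ∧ J0 1 3 = 0 ∧ J0 1 4 = 0 ∧ J0 1 5 = 0) ∧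
    (J0 2 0 = 0 ∧ J0 2 1 = 0 ∧ J0 2 2 = 0 ∧ J0 2 3 = -1 ∧ J0 2 4 = 0 ∧ J0 2 5 = 0) ∧
    (J0 3 0 = 0 ∧ J0 3 1 = 0 ∧ J0 3 2 = 1 ∧ J0 3 3 = 0 ∧ J0 3 4 = 0 ∧ J0 3 5 = 0) ∧
    (J0 4 0 = 0 ∧ J0 4 1 = 0 ∧ J0 4 2 = 0 ∧ J0 4 3 = 0 ∧ J0 4 4 = 0 ∧ J0 4 5 = -1) ∧
    (J0 5 0 = 0 ∧ J0 5 1 = 0 ∧ J0 5 2 = 0 ∧ J0 5 3 = 0 ∧ J0 5 4 = 1 ∧ J0 5 5 = 0) := by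
  simp [J0]

theorem J0_mul_apply (M : Matrix (Fin 6) (Fin 6) ℝ) (i j : Fin 6) :
    (J0 * M) i j = ![-M 1 j, M 0 j, -M 3 j, M 2 j, -M 5 j, M 4 j] i := by
  fin_cases i <;> simp [Matrix.mul_apply, J0, Fin.sum_univ_six]

theorem mul_J0_apply (M : Matrix (Fin 6) (Fin 6) ℝ) (i j : Fin 6) :
    (M * J0) i j = ![M i 1, -M i 0, M i 3, -M i 2, M i 5, -M i 4] j := by
  fin_cases j <;> simp [Matrix.mul_apply, J0, Fin.sum_univ_six]

set_option maxHeartbeats 800000 in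
/-- The polarization of `phi0Contr` at `J₀`. -/
theorem phi0Contr_deriv {B : Tens 2} (hB : IsAlt B) (i j : Fin 6) :
    ∑ a, ∑ b, phi0 ![i, a, b] * ∑ k, ∑ p, phi0 ![j, k, p] *
      (-(J0 * toMatrix B * J0) a k * J0 b p + J0 a k * -(J0 * toMatrix B * J0) b p) =
    4 * (B ![0, 1] + B ![2, 3] + B ![4, 5]) * (1 : Matrix (Fin 6) (Fin 6) ℝ) i j -
      2 * (toMatrix B * J0 + J0 * toMatrix B) i j := by
  obtain ⟨h1, h2⟩ := hB.sort_two
  have e : ∀ i j, toMatrix B i j = B ![i, j] := fun _ _ => rfl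
  simp only [sum_phi0_eq, Matrix.add_apply, J0_mul_apply, mul_J0_apply, e]
  obtain ⟨⟨a00, a01, a02, a03, a04, a05⟩, ⟨a10, a11, a12, a13, a14, a15⟩,
    ⟨a20, a21, a22, a23, a24, a25⟩, ⟨a30, a31, a32, a33, a34, a35⟩,
    ⟨a40, a41, a42, a43, a44, a45⟩, ⟨a50, a51, a52, a53, a54, a55⟩⟩ := J0_entries
  fin_cases i <;> fin_cases j
  all_goals
    simp only [Fin.zero_eta, Fin.mk_one, Fin.reduceFinMk, Matrix.cons_val, Fin.isValue,
      a00, a01, a02, a03, a04, a05, a10, a11, a12, a13, a14, a15, a20, a21, a22, a23, a24, a25,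
      a30, a31, a32, a33, a34, a35, a40, a41, a42, a43, a44, a45, a50, a51, a52, a53, a54, a55,
      mul_zero, zero_mul, mul_one, add_zero, zero_add, sub_zero, mul_neg, neg_neg, neg_zero, sub_self,
      h2, Matrix.one_apply, Fin.reduceEq, if_true, if_false, neg_mul, one_mul]
    try simp only [h1, Fin.isValue, Fin.reduceLT]
  all_goals try ring

theorem fderiv_gF_snd {c : ℝ} (hc : 0 < c) {B : Tens 2} (hB : IsAlt B) (i j : Fin 6) :
    fderiv ℝ gF (stdPair c) (0, B) ![i, j] =
      (1 / 2 : ℝ) * (toMatrix B * J0 + J0 * toMatrix B) i j := by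
  have h := hasDerivAt_pi.1 (hasDerivAt_comp_snd (B := B) (contDiffAt_gF (isTypeIIAAt_std hc))) ![i, j]
  refine h.unique ?_
  have h1 : HasDerivAt (fun τ : ℝ => phi0Contr (omegaInv (omega0 + τ • B)) i j)
      (∑ a, ∑ b, phi0 ![i, a, b] * ∑ k, ∑ p, phi0 ![j, k, p] *
      (-(J0 * toMatrix B * J0) a k * J0 b p + J0 a k * -(J0 * toMatrix B * J0) b p)) 0 := by
    have hw := hasDerivAt_omegaInv (B := B)
    have e0 : omegaInv (omega0 + (0 : ℝ) • B) = J0 := by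
      have := omegaInv_std one_ne_zero
      rw [one_smul, inv_one, one_smul] at this
      rwa [zero_smul, add_zero]
    have e1 : ∀ a b k p, HasDerivAt (fun τ : ℝ =>
        omegaInv (omega0 + τ • B) a k * omegaInv (omega0 + τ • B) b p)
        (-(J0 * toMatrix B * J0) a k * J0 b p + J0 a k * -(J0 * toMatrix B * J0) b p) 0 := by
      intro a b k p
      have := (hw a k).mul (hw b p)
      rwa [e0] at this
    simp only [phi0Contr, Matrix.of_apply]
    exact HasDerivAt.fun_sum fun a _ => HasDerivAt.fun_sum fun b _ =>
      (HasDerivAt.fun_sum fun k _ => HasDerivAt.fun_sum fun p _ =>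
        (e1 a b k p).const_mul (phi0 ![j, k, p])).const_mul (phi0 ![i, a, b])
  rw [phi0Contr_deriv hB] at h1
  have e0 : omegaInv (omega0 + (0 : ℝ) • B) = J0 := by
    have := omegaInv_std one_ne_zero
    rw [one_smul, inv_one, one_smul] at this
    rwa [zero_smul, add_zero]
  have h2 := ((hasDerivAt_vol hB).mul h1).const_mul (-(1 / 4) : ℝ)
  rw [e0, phi0Contr_J0, zero_smul, add_zero, vol_omega0] at h2
  refine (h2.congr_deriv ?_).congr_of_eventuallyEq ?_
  · simp only [Matrix.smul_apply, smul_eq_mul]; ring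
  filter_upwards [eventually_vol_pos hB] with τ hτ
  exact metric_phi0_of_vol_pos hc hτ i j

/-- A variation of the standard pair is the sum of an infinitesimal coordinate change and a
variation of `ω` alone. -/
theorem variation_eq {A : Tens 3} (hA : IsAlt A) (c : ℝ) (B : Tens 2) :
    (c • A, B) = liePair (liftMat A) (stdPair c) + (0, B - lie (liftMat A) omega0) := by
  refine Prod.ext ?_ ?_
  · show c • A = lie (liftMat A) (c • phi0) + 0
    rw [lie_smul, lie_liftMat hA, add_zero]
  · show B = lie (liftMat A) omega0 + (B - lie (liftMat A) omega0)
    rw [add_sub_cancel]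

theorem lie_omega0 (X : Matrix (Fin 6) (Fin 6) ℝ) (i j : Fin 6) : lie X omega0 ![i, j] =
    (J0 * X) j i - (J0 * X) i j := by
  rw [lie_two, Matrix.mul_apply, Matrix.mul_apply, ← Finset.sum_add_distrib, ← Finset.sum_sub_distrib]
  refine Finset.sum_congr rfl fun m _ => ?_
  show X m i * -J0 m j + X m j * -J0 i m = _
  rw [J0_antisymm j m]; ring

theorem IsAlt.sub {k : ℕ} {A B : Tens k} (hA : IsAlt A) (hB : IsAlt B) : IsAlt (A - B) := by
  intro σ i
  simp only [Pi.sub_apply, hA σ i, hB σ i]; ring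

theorem toMatrix_transpose {A : Tens 2} (hA : IsAlt A) :
    (toMatrix A).transpose = -toMatrix A := by
  ext i j
  exact IsAlt'.swap_two hA i j

section

variable {c : ℝ} (hc : 0 < c) {A : Tens 3} {B : Tens 2} (hA : IsAlt A) (hB : IsAlt B)
include hc hA hB

/-- The derivative of `|φ|²` at the standard pair, in components. The variation of `φ` is scaled by
`c` so that `c` factors out. -/
theorem fderiv_nF_std : fderiv ℝ nF (stdPair c) (c • A, B) = c ^ 2 *
    (2 * A ![0, 2, 4] - 2 * A ![0, 3, 5] - 2 * A ![1, 2, 5] - 2 * A ![1, 3, 4] - 4 * B ![0, 1] - 4 *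
    B ![2, 3] - 4 * B ![4, 5]) := by
  rw [variation_eq hA, map_add, fderiv_nF_liePair (isTypeIIAAt_std hc),
    fderiv_nF_snd hc (hB.sub (omega0_isAlt.lie _))]
  simp only [Pi.sub_apply, lie_omega0, J0_mul_apply]
  simp [liftMat]
  ring

theorem fderiv_nhF_std_eq : fderiv ℝ nhF (stdPair c) (c • A, B) =
    c ^ 3 • ((4 : ℝ) • lie (liftMat A) hat0 + fderiv ℝ nF (stdPair 1) ((1 : ℝ) • A, B) • hat0) := by
  have h1 : nhF (stdPair c) = (4 * c ^ 3) • hat0 := by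
    have h2 := hat_std hc.ne' one_pos
    have h3 := normSq_std hc.ne' one_pos
    rw [one_smul] at h2 h3
    simp only [nhF, stdPair, h2, h3, smul_smul]
    congr 1; ring
  have h4 := hB.sub (omega0_isAlt.lie (liftMat A))
  rw [variation_eq hA, variation_eq hA, map_add, map_add, fderiv_nhF_liePair (isTypeIIAAt_std hc),
    fderiv_nF_liePair (isTypeIIAAt_std one_pos), fderiv_nF_snd one_pos h4, fderiv_nhF_snd hc h4, h1,
    lie_smul, smul_add, smul_smul, smul_smul]
  congr 2 <;> ring

theorem fderiv_nhF_std_isAlt : IsAlt (fderiv ℝ nhF (stdPair c) (c • A, B)) := by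
  rw [fderiv_nhF_std_eq hc hA hB]
  exact (((hat0_isAlt.lie _).smul _).add (hat0_isAlt.smul _)).smul _

/-- The derivative of `|φ|² φ̂` at the standard pair, in increasing components. -/
theorem fderiv_nhF_std :
    fderiv ℝ nhF (stdPair c) (c • A, B) ![0, 1, 2] = c ^ 3 * (-4 * A ![0, 1, 3]) ∧
    fderiv ℝ nhF (stdPair c) (c • A, B) ![0, 1, 3] = c ^ 3 * (4 * A ![0, 1, 2]) ∧
    fderiv ℝ nhF (stdPair c) (c • A, B) ![0, 1, 4] = c ^ 3 * (-4 * A ![0, 1, 5]) ∧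
    fderiv ℝ nhF (stdPair c) (c • A, B) ![0, 1, 5] = c ^ 3 * (4 * A ![0, 1, 4]) ∧
    fderiv ℝ nhF (stdPair c) (c • A, B) ![0, 2, 3] = c ^ 3 * (-4 * A ![1, 2, 3]) ∧
    fderiv ℝ nhF (stdPair c) (c • A, B) ![0, 2, 4] = c ^ 3 * (-2 * A ![0, 2, 5] -
      2 * A ![0, 3, 4] - 2 * A ![1, 2, 4] - 2 * A ![1, 3, 5]) ∧
    fderiv ℝ nhF (stdPair c) (c • A, B) ![0, 2, 5] = c ^ 3 * (4 * A ![0, 2, 4] - 4 * A ![0, 3, 5] -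
      4 * A ![1, 2, 5] - 4 * B ![0, 1] - 4 * B ![2, 3] - 4 * B ![4, 5]) ∧
    fderiv ℝ nhF (stdPair c) (c • A, B) ![0, 3, 4] = c ^ 3 * (4 * A ![0, 2, 4] - 4 * A ![0, 3, 5] -
      4 * A ![1, 3, 4] - 4 * B ![0, 1] - 4 * B ![2, 3] - 4 * B ![4, 5]) ∧
    fderiv ℝ nhF (stdPair c) (c • A, B) ![0, 3, 5] = c ^ 3 * (2 * A ![0, 2, 5] + 2 * A ![0, 3, 4] -
      2 * A ![1, 2, 4] - 2 * A ![1, 3, 5]) ∧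
    fderiv ℝ nhF (stdPair c) (c • A, B) ![0, 4, 5] = c ^ 3 * (-4 * A ![1, 4, 5]) ∧
    fderiv ℝ nhF (stdPair c) (c • A, B) ![1, 2, 3] = c ^ 3 * (4 * A ![0, 2, 3]) ∧
    fderiv ℝ nhF (stdPair c) (c • A, B) ![1, 2, 4] = c ^ 3 * (4 * A ![0, 2, 4] - 4 * A ![1, 2, 5] -
      4 * A ![1, 3, 4] - 4 * B ![0, 1] - 4 * B ![2, 3] - 4 * B ![4, 5]) ∧
    fderiv ℝ nhF (stdPair c) (c • A, B) ![1, 2, 5] = c ^ 3 * (2 * A ![0, 2, 5] - 2 * A ![0, 3, 4] +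
      2 * A ![1, 2, 4] - 2 * A ![1, 3, 5]) ∧
    fderiv ℝ nhF (stdPair c) (c • A, B) ![1, 3, 4] = c ^ 3 * (-2 * A ![0, 2, 5] +
      2 * A ![0, 3, 4] + 2 * A ![1, 2, 4] - 2 * A ![1, 3, 5]) ∧
    fderiv ℝ nhF (stdPair c) (c • A, B) ![1, 3, 5] = c ^ 3 * (4 * A ![0, 3, 5] + 4 * A ![1, 2, 5] +
      4 * A ![1, 3, 4] + 4 * B ![0, 1] + 4 * B ![2, 3] + 4 * B ![4, 5]) ∧
    fderiv ℝ nhF (stdPair c) (c • A, B) ![1, 4, 5] = c ^ 3 * (4 * A ![0, 4, 5]) ∧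
    fderiv ℝ nhF (stdPair c) (c • A, B) ![2, 3, 4] = c ^ 3 * (-4 * A ![2, 3, 5]) ∧
    fderiv ℝ nhF (stdPair c) (c • A, B) ![2, 3, 5] = c ^ 3 * (4 * A ![2, 3, 4]) ∧
    fderiv ℝ nhF (stdPair c) (c • A, B) ![2, 4, 5] = c ^ 3 * (-4 * A ![3, 4, 5]) ∧
    fderiv ℝ nhF (stdPair c) (c • A, B) ![3, 4, 5] = c ^ 3 * (4 * A ![2, 4, 5]) := by
  rw [fderiv_nhF_std_eq hc hA hB, fderiv_nF_std one_pos hA hB]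
  simp only [Pi.smul_apply, Pi.add_apply, smul_eq_mul, lie_three, Fin.sum_univ_six, hat0]
  simp [dzComp, liftMat, -mul_eq_mul_left_iff]
  repeat' apply And.intro
  all_goals ring

theorem fderiv_gF_std_eq (i j : Fin 6) : fderiv ℝ gF (stdPair c) (c • A, B) ![i, j] =
    liftMat A j i + liftMat A i j + (1 / 2 : ℝ) * (toMatrix (B - lie (liftMat A) omega0) * J0 +
      J0 * toMatrix (B - lie (liftMat A) omega0)) i j := by
  have h1 : gF (stdPair c) = fun i => (1 : Matrix (Fin 6) (Fin 6) ℝ) (i 0) (i 1) := by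
    have h2 := metric_std hc.ne' one_pos
    rw [one_smul, one_smul] at h2
    ext i
    exact congrFun (congrFun h2 _) _
  rw [variation_eq hA, map_add, Pi.add_apply, fderiv_gF_liePair (isTypeIIAAt_std hc),
    fderiv_gF_snd hc (hB.sub (omega0_isAlt.lie _)), h1, lie_two]
  simp [Matrix.one_apply]

theorem fderiv_gF_std_symm (i j : Fin 6) : fderiv ℝ gF (stdPair c) (c • A, B) ![j, i] =
    fderiv ℝ gF (stdPair c) (c • A, B) ![i, j] := by
  have h := toMatrix_transpose (hB.sub (omega0_isAlt.lie (liftMat A)))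
  rw [fderiv_gF_std_eq hc hA hB, fderiv_gF_std_eq hc hA hB]
  set M := toMatrix (B - lie (liftMat A) omega0)
  have h2 : (M * J0 + J0 * M).transpose = M * J0 + J0 * M := by
    rw [Matrix.transpose_add, Matrix.transpose_mul, Matrix.transpose_mul, h, J0_transpose]
    simp [add_comm]
  have h3 := congrFun (congrFun h2 i) j
  rw [Matrix.transpose_apply] at h3
  rw [h3]; ring

/-- The derivative of the metric at the standard pair, in components. -/
theorem fderiv_gF_std :
    fderiv ℝ gF (stdPair c) (c • A, B) ![0, 0] = A ![0, 2, 4] / 2 - A ![0, 3, 5] / 2 + A ![1, 2, 5]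
      / 2 + A ![1, 3, 4] / 2 + B ![0, 1] ∧
    fderiv ℝ gF (stdPair c) (c • A, B) ![0, 1] = -A ![0, 2, 5] / 2 - A ![0, 3, 4] / 2 + A ![1, 2, 4]
      / 2 - A ![1, 3, 5] / 2 ∧
    fderiv ℝ gF (stdPair c) (c • A, B) ![0, 2] = A ![0, 1, 5] / 2 - A ![2, 3, 5] / 2 + B ![0, 3] / 2
      - B ![1, 2] / 2 ∧
    fderiv ℝ gF (stdPair c) (c • A, B) ![0, 3] = A ![0, 1, 4] / 2 - A ![2, 3, 4] / 2 - B ![0, 2] / 2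
      - B ![1, 3] / 2 ∧
    fderiv ℝ gF (stdPair c) (c • A, B) ![0, 4] = -A ![0, 1, 3] / 2 + A ![3, 4, 5] / 2 + B ![0, 5] /
      2 - B ![1, 4] / 2 ∧
    fderiv ℝ gF (stdPair c) (c • A, B) ![0, 5] = -A ![0, 1, 2] / 2 + A ![2, 4, 5] / 2 - B ![0, 4] /
      2 - B ![1, 5] / 2 ∧
    fderiv ℝ gF (stdPair c) (c • A, B) ![1, 1] = -A ![0, 2, 4] / 2 + A ![0, 3, 5] / 2 - A ![1, 2, 5]
      / 2 - A ![1, 3, 4] / 2 + B ![0, 1] ∧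
    fderiv ℝ gF (stdPair c) (c • A, B) ![1, 2] = A ![0, 1, 4] / 2 - A ![2, 3, 4] / 2 + B ![0, 2] / 2
      + B ![1, 3] / 2 ∧
    fderiv ℝ gF (stdPair c) (c • A, B) ![1, 3] = -A ![0, 1, 5] / 2 + A ![2, 3, 5] / 2 + B ![0, 3] /
      2 - B ![1, 2] / 2 ∧
    fderiv ℝ gF (stdPair c) (c • A, B) ![1, 4] = -A ![0, 1, 2] / 2 + A ![2, 4, 5] / 2 + B ![0, 4] /
      2 + B ![1, 5] / 2 ∧
    fderiv ℝ gF (stdPair c) (c • A, B) ![1, 5] = A ![0, 1, 3] / 2 - A ![3, 4, 5] / 2 + B ![0, 5] / 2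
      - B ![1, 4] / 2 ∧
    fderiv ℝ gF (stdPair c) (c • A, B) ![2, 2] = A ![0, 2, 4] / 2 + A ![0, 3, 5] / 2 - A ![1, 2, 5]
      / 2 + A ![1, 3, 4] / 2 + B ![2, 3] ∧
    fderiv ℝ gF (stdPair c) (c • A, B) ![2, 3] = -A ![0, 2, 5] / 2 + A ![0, 3, 4] / 2 - A ![1, 2, 4]
      / 2 - A ![1, 3, 5] / 2 ∧
    fderiv ℝ gF (stdPair c) (c • A, B) ![2, 4] = A ![1, 2, 3] / 2 - A ![1, 4, 5] / 2 + B ![2, 5] / 2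
      - B ![3, 4] / 2 ∧
    fderiv ℝ gF (stdPair c) (c • A, B) ![2, 5] = A ![0, 2, 3] / 2 - A ![0, 4, 5] / 2 - B ![2, 4] / 2
      - B ![3, 5] / 2 ∧
    fderiv ℝ gF (stdPair c) (c • A, B) ![3, 3] = -A ![0, 2, 4] / 2 - A ![0, 3, 5] / 2 + A ![1, 2, 5]
      / 2 - A ![1, 3, 4] / 2 + B ![2, 3] ∧
    fderiv ℝ gF (stdPair c) (c • A, B) ![3, 4] = A ![0, 2, 3] / 2 - A ![0, 4, 5] / 2 + B ![2, 4] / 2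
      + B ![3, 5] / 2 ∧
    fderiv ℝ gF (stdPair c) (c • A, B) ![3, 5] = -A ![1, 2, 3] / 2 + A ![1, 4, 5] / 2 + B ![2, 5] /
      2 - B ![3, 4] / 2 ∧
    fderiv ℝ gF (stdPair c) (c • A, B) ![4, 4] = A ![0, 2, 4] / 2 + A ![0, 3, 5] / 2 + A ![1, 2, 5]
      / 2 - A ![1, 3, 4] / 2 + B ![4, 5] ∧
    fderiv ℝ gF (stdPair c) (c • A, B) ![4, 5] = A ![0, 2, 5] / 2 - A ![0, 3, 4] / 2 - A ![1, 2, 4]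
      / 2 - A ![1, 3, 5] / 2 ∧
    fderiv ℝ gF (stdPair c) (c • A, B) ![5, 5] = -A ![0, 2, 4] / 2 - A ![0, 3, 5] / 2 - A ![1, 2, 5]
      / 2 + A ![1, 3, 4] / 2 + B ![4, 5] := by
  obtain ⟨h1, h2⟩ := hB.sort_two
  have e : ∀ i j, toMatrix (B - lie (liftMat A) omega0) i j = B ![i, j] -
      lie (liftMat A) omega0 ![i, j] :=
    fun _ _ => rfl
  simp only [fderiv_gF_std_eq hc hA hB, Matrix.add_apply, J0_mul_apply, mul_J0_apply, e, lie_omega0]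
  simp [liftMat, h1, h2]
  repeat' apply And.intro
  all_goals ring

end

/-! ### Covariant derivatives of invariant expressions -/

section

variable {k : ℕ} {g : E6 → Matrix (Fin 6) (Fin 6) ℝ} {y : E6}

/-- The matrix `(Γ^m_{pi})` of the connection in the direction `∂_p`. -/
def connMat (g : E6 → Matrix (Fin 6) (Fin 6) ℝ) (y : E6) (p : Fin 6) :
    Matrix (Fin 6) (Fin 6) ℝ := Matrix.of fun m i => christoffel g y m p i

/-- The covariant derivative `∇_p A` in the direction `∂_p`. -/
def cov (g : E6 → Matrix (Fin 6) (Fin 6) ℝ) (A : TField k) (y : E6) (p : Fin 6) : Tens k :=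
  fun i => nabla g A y (Fin.cons p i)

theorem pd_apply {f : TField k} (hf : DifferentiableAt ℝ f y) (p : Fin 6) (i : Fin k → Fin 6) :
    pd p (fun z => f z i) y = fderiv ℝ f y (coordVec p) i := by
  rw [pd, fderiv_apply hf]
  rfl

/-- The covariant derivative is the partial derivative minus the infinitesimal action of the
connection matrix; this is what makes it commute with invariant expressions. -/
theorem cov_eq {f : TField k} (hf : DifferentiableAt ℝ f y) (p : Fin 6) :
    cov g f y p = fderiv ℝ f y (coordVec p) - lie (connMat g y p) (f y) := by
  ext i
  rw [Pi.sub_apply, ← pd_apply hf]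
  rfl

theorem cov_congr {f f' : TField k} (h : f =ᶠ[nhds y] f') (p : Fin 6) :
    cov g f y p = cov g f' y p := by
  ext i
  have h0 := h.eq_of_nhds
  have : (fun z => f z i) =ᶠ[nhds y] fun z => f' z i := h.mono fun z hz => congrFun hz i
  simp only [cov, nabla, Fin.cons_zero, Fin.cons_succ, Fin.tail_cons, h0, pd, this.fderiv_eq]

/-- The covariant derivative of a pair of fields. -/
def covPair (g : E6 → Matrix (Fin 6) (Fin 6) ℝ) (S : E6 → Tens 3 × Tens 2) (y : E6) (p : Fin 6) :
    Tens 3 × Tens 2 := (cov g (fun z => (S z).1) y p, cov g (fun z => (S z).2) y p)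

theorem covPair_eq {S : E6 → Tens 3 × Tens 2} (hS : DifferentiableAt ℝ S y) (p : Fin 6) :
    covPair g S y p = fderiv ℝ S y (coordVec p) - liePair (connMat g y p) (S y) := by
  refine Prod.ext ?_ ?_
  · rw [covPair, cov_eq hS.fst, fderiv.fst hS]; rfl
  · rw [covPair, cov_eq hS.snd, fderiv.snd hS]; rfl

/-- The derivative of a map along a curve on which it is given by the action of matrices. -/
theorem fderiv_eq_lie {V : Type*} [NormedAddCommGroup V] [NormedSpace ℝ V] {T : V → Tens k} {v w : V}
    (hT : DifferentiableAt ℝ T v) {γ : ℝ → V} (hγ : HasDerivAt γ w 0) (h0 : γ 0 = v)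
    (X : Matrix (Fin 6) (Fin 6) ℝ)
    (he : ∀ τ, (1 + τ • X).det ≠ 0 → T (γ τ) = pull (1 + τ • X) (T v)) :
    fderiv ℝ T v w = lie X (T v) := by
  subst h0
  have h3 := hasDerivAt_pull X (hasDerivAt_const (0 : ℝ) (T (γ 0)))
  rw [add_zero] at h3
  refine (hT.hasFDerivAt.comp_hasDerivAt 0 hγ).unique (h3.congr_of_eventuallyEq ?_)
  filter_upwards [eventually_det_ne X] with τ hτ using he τ hτ

theorem hasDerivAt_pullPair (X : Matrix (Fin 6) (Fin 6) ℝ) (s : Tens 3 × Tens 2) :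
    HasDerivAt (fun τ : ℝ => pullPair (1 + τ • X) s) (liePair X s) 0 := by
  have h1 := hasDerivAt_pull X (hasDerivAt_const (0 : ℝ) s.1)
  have h2 := hasDerivAt_pull X (hasDerivAt_const (0 : ℝ) s.2)
  simp only [add_zero] at h1 h2
  exact h1.prodMk h2

theorem pullPair_one (s : Tens 3 × Tens 2) : pullPair 1 s = s := by
  simp [pullPair, pull_one]

/-- An invariant expression in `(S, σ)` that is linear in `σ` commutes with covariant derivatives
of `σ` when `S` is parallel. -/
theorem cov_bilinear {T : (Tens 3 × Tens 2) × (Tens 3 × Tens 2) → Tens k}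
    {S σ : E6 → Tens 3 × Tens 2} (hS : DifferentiableAt ℝ S y) (hσ : DifferentiableAt ℝ σ y)
    (hT : DifferentiableAt ℝ T (S y, σ y))
    (he : ∀ P : Matrix (Fin 6) (Fin 6) ℝ, P.det ≠ 0 →
      T (pullPair P (S y), pullPair P (σ y)) = pull P (T (S y, σ y)))
    (L : (Tens 3 × Tens 2) →L[ℝ] Tens k) (hL : ∀ σ', T (S y, σ') = L σ') (p : Fin 6)
    (h0 : covPair g S y p = 0) :
    cov g (fun z => T (S z, σ z)) y p = L (covPair g σ y p) := by
  have hSσ : DifferentiableAt ℝ (fun z => (S z, σ z)) y := hS.prodMk hσ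
  have hc : DifferentiableAt ℝ (fun z => T (S z, σ z)) y := hT.comp y hSσ
  have h1 : fderiv ℝ (fun z => T (S z, σ z)) y (coordVec p) =
      fderiv ℝ T (S y, σ y) (fderiv ℝ S y (coordVec p), fderiv ℝ σ y (coordVec p)) := by
    have := fderiv_comp (𝕜 := ℝ) y (g := T) (f := fun z => (S z, σ z)) hT hSσ
    rw [Function.comp_def] at this
    rw [this, ContinuousLinearMap.comp_apply, hS.fderiv_prodMk hσ]
    rfl
  have h2 : fderiv ℝ T (S y, σ y) (liePair (connMat g y p) (S y), liePair (connMat g y p) (σ y)) =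
      lie (connMat g y p) (T (S y, σ y)) :=
    fderiv_eq_lie hT ((hasDerivAt_pullPair _ _).prodMk (hasDerivAt_pullPair _ _))
      (by simp only [zero_smul, add_zero, pullPair_one]) _ fun τ hτ => he _ hτ
  have h3 : fderiv ℝ T (S y, σ y) (0, covPair g σ y p) = L (covPair g σ y p) := by
    have h4 : HasDerivAt (fun τ : ℝ => T (S y, σ y + τ • covPair g σ y p))
        (fderiv ℝ T (S y, σ y) (0, covPair g σ y p)) 0 := by
      refine HasFDerivAt.comp_hasDerivAt (0 : ℝ) ?_ ((hasDerivAt_const _ _).prodMk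
        (by simpa using ((hasDerivAt_id (0 : ℝ)).smul_const (covPair g σ y p)).const_add (σ y)))
      rw [zero_smul, add_zero]
      exact hT.hasFDerivAt
    refine h4.unique ?_
    simp only [hL, map_add, map_smul]
    simpa using ((hasDerivAt_id (0 : ℝ)).smul_const (L (covPair g σ y p))).const_add (L (σ y))
  rw [cov_eq hc, h1, ← h2, ← map_sub, ← h3, covPair_eq hσ, Prod.mk_sub_mk, ← covPair_eq hS, h0]

/-- The chain rule for the covariant derivative of an invariant expression in a pair. -/
theorem cov_comp {T : Tens 3 × Tens 2 → Tens k} {S : E6 → Tens 3 × Tens 2}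
    (hS : DifferentiableAt ℝ S y) (hT : DifferentiableAt ℝ T (S y))
    (he : ∀ P : Matrix (Fin 6) (Fin 6) ℝ, P.det ≠ 0 → T (pullPair P (S y)) = pull P (T (S y)))
    (p : Fin 6) :
    cov g (fun z => T (S z)) y p = fderiv ℝ T (S y) (covPair g S y p) := by
  have hc : DifferentiableAt ℝ (fun z => T (S z)) y := hT.comp y hS
  have h1 : fderiv ℝ (fun z => T (S z)) y = (fderiv ℝ T (S y)).comp (fderiv ℝ S y) :=
    fderiv_comp (𝕜 := ℝ) y (g := T) (f := S) hT hS
  rw [cov_eq hc, h1, covPair_eq hS, map_sub, fderiv_liePair hT he]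
  rfl

end

/-- The pullback of pairs as a continuous linear map. -/
def pullPairL (P : Matrix (Fin 6) (Fin 6) ℝ) : (Tens 3 × Tens 2) →L[ℝ] (Tens 3 × Tens 2) :=
  (pullL P 3).prodMap (pullL P 2)

theorem pullPairL_apply (P : Matrix (Fin 6) (Fin 6) ℝ) (s : Tens 3 × Tens 2) :
    pullPairL P s = pullPair P s := by
  refine Prod.ext ?_ ?_
  · exact pullL_apply P s.1
  · exact pullL_apply P s.2

/-- The derivative of an equivariant map is equivariant. -/
theorem fderiv_pullPair {k : ℕ} {T : Tens 3 × Tens 2 → Tens k} {s : Tens 3 × Tens 2}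
    (hT : DifferentiableAt ℝ T s)
    (he : ∀ (P : Matrix (Fin 6) (Fin 6) ℝ) (s), P.det ≠ 0 → T (pullPair P s) = pull P (T s))
    {P : Matrix (Fin 6) (Fin 6) ℝ} (hP : P.det ≠ 0) (σ : Tens 3 × Tens 2) :
    fderiv ℝ T (pullPair P s) (pullPair P σ) = pull P (fderiv ℝ T s σ) := by
  have h1 : P * P⁻¹ = 1 := Matrix.mul_nonsing_inv _ (isUnit_iff_ne_zero.2 hP)
  have hc : ∀ s, pullPair P⁻¹ (pullPair P s) = s := fun s =>
    Prod.ext (pull_cancel h1 s.1) (pull_cancel h1 s.2)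
  have h2 : P⁻¹ * P = 1 := Matrix.nonsing_inv_mul _ (isUnit_iff_ne_zero.2 hP)
  have hc' : ∀ s, pullPair P (pullPair P⁻¹ s) = s := fun s =>
    Prod.ext (pull_cancel h2 s.1) (pull_cancel h2 s.2)
  have e : T = fun s' => pullL P k (T (pullPairL P⁻¹ s')) := by
    ext1 s'
    rw [pullL_apply, pullPairL_apply, ← he P _ hP, hc']
  have h3 : HasFDerivAt T ((pullL P k).comp ((fderiv ℝ T s).comp (pullPairL P⁻¹))) (pullPair P s) := by
    have h4 : HasFDerivAt T (fderiv ℝ T s) (pullPairL P⁻¹ (pullPair P s)) := by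
      rw [pullPairL_apply, hc]; exact hT.hasFDerivAt
    have := (pullL P k).hasFDerivAt.comp (pullPair P s) (h4.comp _ (pullPairL P⁻¹).hasFDerivAt)
    exact this.congr_of_eventuallyEq (.of_forall fun s' => congrFun e s')
  rw [h3.fderiv]
  simp only [ContinuousLinearMap.comp_apply, pullPairL_apply, pullL_apply, hc]

/-! ### Alternation and the exterior derivative -/

/-- The alternation `∑_j (-1)^j T_{i_j i₀…î_j…i_k}`, which turns `∇A` into `dA`. -/
def altD {k : ℕ} (T : Tens (k + 1)) : Tens (k + 1) := fun i =>
  ∑ j : Fin (k + 1), (-1 : ℝ) ^ (j : ℕ) * T (Fin.cons (i j) (fun a => i (j.succAbove a)))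

theorem cons_succAbove {k : ℕ} (i : Fin (k + 1) → Fin 6) (j : Fin (k + 1)) :
    (Fin.cons (i j) (fun a => i (j.succAbove a)) : Fin (k + 1) → Fin 6) =
      i ∘ (Fin.cycleRange j).symm := by
  ext a
  refine Fin.cases ?_ (fun a => ?_) a
  · simp
  · simp

theorem altD_eq {k : ℕ} (T : Tens (k + 1)) : altD T =
    ∑ j : Fin (k + 1), (-1 : ℝ) ^ (j : ℕ) • fun i => T (i ∘ (Fin.cycleRange j).symm) := by
  ext i
  simp only [altD, cons_succAbove, Finset.sum_apply, Pi.smul_apply, smul_eq_mul]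

theorem pull_altD {k : ℕ} (P : Matrix (Fin 6) (Fin 6) ℝ) (T : Tens (k + 1)) :
    altD (pull P T) = pull P (altD T) := by
  rw [altD_eq, altD_eq, pull_sum]
  refine Finset.sum_congr rfl fun j _ => ?_
  rw [pull_smul, pull_perm]

theorem altD_add {k : ℕ} (T T' : Tens (k + 1)) : altD (T + T') = altD T + altD T' := by
  ext i
  simp [altD, mul_add, Finset.sum_add_distrib]

theorem altD_smul {k : ℕ} (c : ℝ) (T : Tens (k + 1)) : altD (c • T) = c • altD T := by
  ext i
  simp only [altD, Pi.smul_apply, smul_eq_mul, Finset.mul_sum]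
  exact Finset.sum_congr rfl fun _ _ => by ring

theorem christoffel_symm {g : E6 → Matrix (Fin 6) (Fin 6) ℝ} {y : E6}
    (hg : ∀ᶠ z in nhds y, (g z).transpose = g z) (k p q : Fin 6) :
    christoffel g y k p q = christoffel g y k q p := by
  have h : ∀ s, pd s (fun z => g z p q) y = pd s (fun z => g z q p) y := fun s => by
    have : (fun z => g z p q) =ᶠ[nhds y] fun z => g z q p :=
      hg.mono fun z hz => congrFun (congrFun hz q) p
    rw [pd, pd, this.fderiv_eq]
  simp only [christoffel, h]
  congr 1
  refine Finset.sum_congr rfl fun s _ => ?_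
  ring

theorem altD_one (T : Tens 2) (i : Fin 2 → Fin 6) :
    altD (k := 1) T i = T ![i 0, i 1] - T ![i 1, i 0] := by
  rw [altD, Fin.sum_univ_two, sub_eq_add_neg]
  congr 1
  · simp only [Fin.isValue, Fin.val_zero, pow_zero, one_mul]
    congr 1; ext a; fin_cases a <;> rfl
  · simp only [Fin.isValue, Fin.val_one, pow_one, neg_mul, one_mul]
    congr 2; ext a; fin_cases a <;> rfl

theorem altD_two (T : Tens 3) (i : Fin 3 → Fin 6) :
    altD (k := 2) T i = T ![i 0, i 1, i 2] - T ![i 1, i 0, i 2] + T ![i 2, i 0, i 1] := by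
  rw [altD, Fin.sum_univ_three, sub_eq_add_neg]
  congr 1
  · congr 1
    · simp only [Fin.isValue, Fin.val_zero, pow_zero, one_mul]
      congr 1; ext a; fin_cases a <;> rfl
    · simp only [Fin.isValue, Fin.val_one, pow_one, neg_mul, one_mul]
      congr 2; ext a; fin_cases a <;> rfl
  · simp only [Fin.isValue, Fin.val_two, even_two, Even.neg_pow, one_pow, one_mul]
    congr 1; ext a; fin_cases a <;> rfl

theorem altD_three (T : Tens 4) (i : Fin 4 → Fin 6) :
    altD (k := 3) T i = T ![i 0, i 1, i 2, i 3] - T ![i 1, i 0, i 2, i 3] +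
      T ![i 2, i 0, i 1, i 3] - T ![i 3, i 0, i 1, i 2] := by
  have h : ∀ j : Fin 4, (Fin.cons (i j) (fun a => i (j.succAbove a)) : Fin 4 → Fin 6) =
      ![i j, i (j.succAbove 0), i (j.succAbove 1), i (j.succAbove 2)] := by
    intro j; ext a; fin_cases a <;> rfl
  rw [altD, Fin.sum_univ_four]
  simp only [h]
  have e3 : ((3 : Fin 4) : ℕ) = 3 := rfl
  simp only [Fin.isValue, Fin.val_zero, pow_zero, one_mul, Fin.val_one, pow_one, neg_mul,
    Fin.val_two, even_two, Even.neg_pow, one_pow, e3, Odd.neg_pow (by decide : Odd 3)]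
  rfl

/-- The terms with a symmetric connection cancel in the exterior derivative of a one-form. -/
theorem altD_lie_one {Γ : Fin 6 → Matrix (Fin 6) (Fin 6) ℝ} (hΓ : ∀ m p q, Γ p m q = Γ q m p)
    (A : Tens 1) : altD (k := 1) (fun i => lie (Γ (i 0)) A (Fin.tail i)) = 0 := by
  have e : ∀ (X : Matrix (Fin 6) (Fin 6) ℝ) (a : Fin 6), lie X A ![a] = ∑ m, X m a * A ![m] := by
    intro X a
    rw [lie, Fin.sum_univ_one]
    congr! 3
    ext x; rw [Subsingleton.elim x 0]; simp
  ext i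
  rw [altD_one]
  show lie (Γ (i 0)) A ![i 1] - lie (Γ (i 1)) A ![i 0] = 0
  rw [e, e, sub_eq_zero]
  exact Finset.sum_congr rfl fun m _ => by rw [hΓ]

theorem altD_lie_two {Γ : Fin 6 → Matrix (Fin 6) (Fin 6) ℝ} (hΓ : ∀ m p q, Γ p m q = Γ q m p)
    {A : Tens 2} (hA : IsAlt A) :
    altD (k := 2) (fun i => lie (Γ (i 0)) A (Fin.tail i)) = 0 := by
  ext i
  rw [altD_two]
  show lie (Γ (i 0)) A ![i 1, i 2] - lie (Γ (i 1)) A ![i 0, i 2] + lie (Γ (i 2)) A ![i 0, i 1] = 0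
  simp only [lie_two]
  have s : ∀ a m, A ![a, m] = -A ![m, a] := fun a m => IsAlt'.swap_two hA m a
  have f : ∀ p q r : Fin 6, ∑ m, Γ p m q * A ![r, m] = -∑ m, Γ p m q * A ![m, r] := by
    intro p q r
    rw [← Finset.sum_neg_distrib]
    exact Finset.sum_congr rfl fun m _ => by rw [s r m]; ring
  have g : ∀ p q r : Fin 6, ∑ m, Γ p m q * A ![m, r] = ∑ m, Γ q m p * A ![m, r] :=
    fun p q r => Finset.sum_congr rfl fun m _ => by rw [hΓ]
  rw [f, f, f, g (i 1) (i 0), g (i 2) (i 0), g (i 2) (i 1)]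
  ring

theorem altD_lie_three {Γ : Fin 6 → Matrix (Fin 6) (Fin 6) ℝ} (hΓ : ∀ m p q, Γ p m q = Γ q m p)
    {A : Tens 3} (hA : IsAlt A) :
    altD (k := 3) (fun i => lie (Γ (i 0)) A (Fin.tail i)) = 0 := by
  ext i
  rw [altD_three]
  show lie (Γ (i 0)) A ![i 1, i 2, i 3] - lie (Γ (i 1)) A ![i 0, i 2, i 3] +
    lie (Γ (i 2)) A ![i 0, i 1, i 3] - lie (Γ (i 3)) A ![i 0, i 1, i 2] = 0
  simp only [lie_three]
  have f1 : ∀ p q r t : Fin 6, ∑ m, Γ p m q * A ![r, m, t] = -∑ m, Γ p m q * A ![m, r, t] := by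
    intro p q r t
    rw [← Finset.sum_neg_distrib]
    exact Finset.sum_congr rfl fun m _ => by rw [IsAlt'.swap01 hA m r t]; ring
  have f2 : ∀ p q r t : Fin 6, ∑ m, Γ p m q * A ![r, t, m] = ∑ m, Γ p m q * A ![m, r, t] := by
    intro p q r t
    exact Finset.sum_congr rfl fun m _ => by
      rw [IsAlt'.swap12 hA r m t, IsAlt'.swap01 hA m r t]; ring
  have g : ∀ p q r t : Fin 6, ∑ m, Γ p m q * A ![m, r, t] = ∑ m, Γ q m p * A ![m, r, t] :=
    fun p q r t => Finset.sum_congr rfl fun m _ => by rw [hΓ]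
  simp only [f1, f2]
  rw [g (i 1) (i 0), g (i 2) (i 0), g (i 2) (i 1), g (i 3) (i 0), g (i 3) (i 1), g (i 3) (i 2)]
  ring

section

variable {g : E6 → Matrix (Fin 6) (Fin 6) ℝ} {y : E6}
  (hg : ∀ᶠ z in nhds y, (g z).transpose = g z)
include hg

theorem connMat_symm (m p q : Fin 6) : connMat g y p m q = connMat g y q m p :=
  christoffel_symm hg m p q

omit hg in
/-- The exterior derivative is the alternation of `∇` as soon as the connection terms cancel in the
alternation. -/
theorem extD_eq_of_altD_lie {k : ℕ} {A : TField k}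
    (h : altD (k := k) (fun i => lie (connMat g y (i 0)) (A y) (Fin.tail i)) = 0) :
    extD A y = altD (nabla g A y) := by
  have h2 : nabla g A y = (fun i => pd (i 0) (fun z => A z (Fin.tail i)) y) +
      (-1 : ℝ) • fun i => lie (connMat g y (i 0)) (A y) (Fin.tail i) := by
    ext i
    rw [Pi.add_apply, Pi.smul_apply, smul_eq_mul, neg_one_mul, ← sub_eq_add_neg]
    rfl
  rw [h2, altD_add, altD_smul, h, smul_zero, add_zero]
  rfl

theorem extD_one (A : TField 1) : extD A y = altD (nabla g A y) :=
  extD_eq_of_altD_lie (altD_lie_one (connMat_symm hg) _)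

theorem extD_two {A : TField 2} (hA : IsAlt (A y)) : extD A y = altD (nabla g A y) :=
  extD_eq_of_altD_lie (altD_lie_two (connMat_symm hg) hA)

theorem extD_three {A : TField 3} (hA : IsAlt (A y)) : extD A y = altD (nabla g A y) :=
  extD_eq_of_altD_lie (altD_lie_three (connMat_symm hg) hA)

end

/-! ### Parallelism of a Type IIA structure with integrable `J` and constant norm -/

theorem IsTypeIIAAt.metric_transpose {φ : Tens 3} {ω : Tens 2} (h : IsTypeIIAAt φ ω) :
    (metric φ ω).transpose = metric φ ω := by
  have := h.posDef.isHermitian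
  rwa [Matrix.IsHermitian, Matrix.conjTranspose_eq_transpose_of_trivial] at this

theorem IsTypeIIAAt.isUnit_det_metric {φ : Tens 3} {ω : Tens 2} (h : IsTypeIIAAt φ ω) :
    IsUnit (metric φ ω).det := isUnit_iff_ne_zero.2 h.posDef.det_pos.ne'

/-- `ω_{ij} = -g_{ia} J^a_j`. -/
theorem IsTypeIIAAt.toMatrix_omega {φ : Tens 3} {ω : Tens 2} (h : IsTypeIIAAt φ ω) :
    toMatrix ω = -(metric φ ω * almostComplex φ ω) := by
  obtain ⟨P, c, hc, hP, h1, h2⟩ := h.exists_frame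
  have u := isUnit_iff_ne_zero.2 hP
  have uT : IsUnit P.transpose.det := by rwa [Matrix.det_transpose]
  have e1 := metric_pull P hP φ ω
  have e2 := almostComplex_pull P hP φ ω
  have e3 := toMatrix_pull P ω
  have m := metric_std hc.ne' one_pos
  have j := almostComplex_std_of_pos hc.ne' one_pos
  rw [one_smul] at m j
  rw [one_smul] at m
  rw [h1, h2] at e1 e2
  rw [h2, toMatrix_omega0] at e3
  rw [m] at e1
  rw [j] at e2
  have key : P.transpose * toMatrix ω * P = P.transpose * -(metric φ ω * almostComplex φ ω) * P := by
    rw [← e3, ← Matrix.one_mul J0, e1, e2]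
    have : P * (P⁻¹ * almostComplex φ ω * P) = almostComplex φ ω * P := by
      rw [← Matrix.mul_assoc, Matrix.mul_nonsing_inv_cancel_left _ _ u]
    rw [Matrix.mul_assoc _ P, this]
    simp only [Matrix.mul_assoc, Matrix.mul_neg, Matrix.neg_mul]
  have k1 := congrArg (fun M => (P.transpose)⁻¹ * (M * P⁻¹)) key
  simpa only [Matrix.mul_assoc, Matrix.mul_nonsing_inv _ u, Matrix.mul_one,
    Matrix.nonsing_inv_mul_cancel_left _ _ uT] using k1

/-- Lowering the index of the Christoffel symbols. -/
theorem sum_metric_christoffel {g : E6 → Matrix (Fin 6) (Fin 6) ℝ} {y : E6}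
    (hu : IsUnit (g y).det) (l p q : Fin 6) :
    ∑ k, g y l k * christoffel g y k p q = (1 / 2 : ℝ) *
      (pd p (fun z => g z q l) y + pd q (fun z => g z p l) y - pd l (fun z => g z p q) y) := by
  set w : Fin 6 → ℝ := fun s => (1 / 2 : ℝ) *
      (pd p (fun z => g z q s) y + pd q (fun z => g z p s) y - pd s (fun z => g z p q) y) with hw
  have h : ∀ k, christoffel g y k p q = (g y)⁻¹.mulVec w k := by
    intro k
    simp only [christoffel, Matrix.mulVec, dotProduct, hw, Finset.mul_sum]
    exact Finset.sum_congr rfl fun _ _ => by ring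
  have h2 : (g y).mulVec ((g y)⁻¹.mulVec w) l = w l := by
    rw [Matrix.mulVec_mulVec, Matrix.mul_nonsing_inv _ hu, Matrix.one_mulVec]
  simp only [h]
  exact h2

/-- The metric is parallel for its Levi-Civita connection. -/
theorem pd_metric {g : E6 → Matrix (Fin 6) (Fin 6) ℝ} {y : E6} (hu : IsUnit (g y).det)
    (hg : ∀ᶠ z in nhds y, (g z).transpose = g z) (p : Fin 6) :
    (Matrix.of fun i j => pd p (fun z => g z i j) y) =
      (connMat g y p).transpose * g y + g y * connMat g y p := by
  have hs : ∀ s a b, pd s (fun z => g z a b) y = pd s (fun z => g z b a) y := fun s a b => by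
    have : (fun z => g z a b) =ᶠ[nhds y] fun z => g z b a :=
      hg.mono fun z hz => congrFun (congrFun hz b) a
    rw [pd, pd, this.fderiv_eq]
  have hy : ∀ a b, g y a b = g y b a := fun a b => congrFun (congrFun hg.self_of_nhds b) a
  ext i j
  rw [Matrix.add_apply, Matrix.mul_apply, Matrix.mul_apply]
  have e1 := sum_metric_christoffel hu i p j
  have e2 := sum_metric_christoffel hu j p i
  have e3 : ∑ m, (connMat g y p).transpose i m * g y m j =
      ∑ m, g y j m * christoffel g y m p i :=
    Finset.sum_congr rfl fun m _ => by
      rw [hy m j, mul_comm]; rfl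
  rw [e3, e2]
  show pd p (fun z => g z i j) y = _ + ∑ m, g y i m * christoffel g y m p j
  rw [e1, hs p j i]
  ring

theorem pd_sum_mul {f h : Fin 6 → E6 → ℝ} {y : E6} (hf : ∀ m, DifferentiableAt ℝ (f m) y)
    (hh : ∀ m, DifferentiableAt ℝ (h m) y) (p : Fin 6) :
    pd p (fun z => ∑ m, f m z * h m z) y = ∑ m, (pd p (f m) y * h m y + f m y * pd p (h m) y) := by
  rw [pd, fderiv_fun_sum fun m _ => (hf m).fun_mul (hh m)]
  rw [sum_apply]
  refine Finset.sum_congr rfl fun m _ => ?_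
  rw [fderiv_fun_mul (hf m) (hh m)]
  simp [pd]
  ring

/-- A pair of smooth fields on an open set that is, at each point, a Type IIA pair, is closed, has
integrable almost complex structure and constant norm. -/
structure IsParallelModel (U : Set E6) (φ : TField 3) (ω : TField 2) : Prop where
  isOpen : IsOpen U
  smooth_phi : ContDiffOn ℝ Cinf φ U
  smooth_omega : ContDiffOn ℝ Cinf ω U
  typeIIA : ∀ y ∈ U, IsTypeIIAAt (φ y) (ω y)
  closed_phi : ∀ y ∈ U, extD φ y = 0
  closed_omega : ∀ y ∈ U, extD ω y = 0
  integrable : ∀ y ∈ U, ∀ i j k, nijenhuis (fun z => almostComplex (φ z) (ω z)) y i j k = 0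
  norm_const : ∀ y ∈ U, ∀ i, pd i (fun z => normSq (φ z) (ω z)) y = 0

namespace IsParallelModel

variable {U : Set E6} {φ : TField 3} {ω : TField 2} (h : IsParallelModel U φ ω) {y : E6}
  (hy : y ∈ U)
include h hy

theorem mem_nhds : U ∈ nhds y := h.isOpen.mem_nhds hy

theorem contDiffAt_phi : ContDiffAt ℝ Cinf φ y := h.smooth_phi.contDiffAt (h.mem_nhds hy)

theorem contDiffAt_omega : ContDiffAt ℝ Cinf ω y := h.smooth_omega.contDiffAt (h.mem_nhds hy)

theorem contDiffAt_pair : ContDiffAt ℝ Cinf (fun z => (φ z, ω z)) y :=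
  (h.contDiffAt_phi hy).prodMk (h.contDiffAt_omega hy)

theorem eventually_typeIIA : ∀ᶠ z in nhds y, IsTypeIIAAt (φ z) (ω z) :=
  Filter.mem_of_superset (h.mem_nhds hy) fun z hz => h.typeIIA z hz

theorem eventually_symm :
    ∀ᶠ z in nhds y, (metricField φ ω z).transpose = metricField φ ω z :=
  (h.eventually_typeIIA hy).mono fun _ hz => hz.metric_transpose

theorem contDiffAt_J (i j : Fin 6) :
    ContDiffAt ℝ Cinf (fun z => almostComplex (φ z) (ω z) i j) y :=
  contDiffAt_almostComplex (h.contDiffAt_phi hy) (h.contDiffAt_omega hy)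
    (h.typeIIA y hy).lambda_neg i j

theorem contDiffAt_metricField (i j : Fin 6) :
    ContDiffAt ℝ Cinf (fun z => metricField φ ω z i j) y :=
  contDiffAt_metric (h.contDiffAt_phi hy) (h.contDiffAt_omega hy)
    (h.typeIIA y hy).lambda_neg (h.typeIIA y hy).det_ne (h.typeIIA y hy).normSq_ne i j

/-- Since `ω = -g J` and `g` is parallel, `∇ω = -g ∇J`. -/
theorem toMatrix_cov_omega (p : Fin 6) : toMatrix (cov (metricField φ ω) ω y p) =
    -(metricField φ ω y * ((Matrix.of fun i j => pd p (fun z => almostComplex (φ z) (ω z) i j) y) +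
      connMat (metricField φ ω) y p * almostComplex (φ y) (ω y) -
      almostComplex (φ y) (ω y) * connMat (metricField φ ω) y p)) := by
  have hT := h.typeIIA y hy
  set G := metricField φ ω with hG
  set J := fun z => almostComplex (φ z) (ω z) with hJ
  have e1 : toMatrix (cov G ω y p) = (Matrix.of fun i j => pd p (fun z => ω z ![i, j]) y) -
      ((connMat G y p).transpose * toMatrix (ω y) + toMatrix (ω y) * connMat G y p) := by
    ext i j
    have : toMatrix (cov G ω y p) i j =
      pd p (fun z => ω z ![i, j]) y - lie (connMat G y p) (ω y) ![i, j] := rfl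
    rw [this, lie_two, Matrix.sub_apply, Matrix.add_apply, Matrix.mul_apply, Matrix.mul_apply]
    congr 2
    exact Finset.sum_congr rfl fun m _ => mul_comm _ _
  have e2 : (Matrix.of fun i j => pd p (fun z => ω z ![i, j]) y) =
      -((Matrix.of fun i j => pd p (fun z => G z i j) y) * J y +
        G y * Matrix.of fun i j => pd p (fun z => J z i j) y) := by
    ext i j
    have e3 : (fun z => ω z ![i, j]) =ᶠ[nhds y] fun z => -∑ m, G z i m * J z m j :=
      (h.eventually_typeIIA hy).mono fun z hz => by
        have := congrFun (congrFun hz.toMatrix_omega i) j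
        rw [Matrix.neg_apply, Matrix.mul_apply] at this
        exact this
    have e4 := pd_sum_mul (f := fun m z => G z i m) (h := fun m z => J z m j) (y := y)
      (fun m => (h.contDiffAt_metricField hy i m).differentiableAt cinf_ne_zero)
      (fun m => (h.contDiffAt_J hy m j).differentiableAt cinf_ne_zero) p
    rw [Matrix.of_apply, pd, e3.fderiv_eq, fderiv_fun_neg, Matrix.neg_apply, Matrix.add_apply,
      Matrix.mul_apply, Matrix.mul_apply, ← Finset.sum_add_distrib]
    exact congrArg Neg.neg e4
  rw [e1, e2, pd_metric (g := G) hT.isUnit_det_metric (h.eventually_symm hy), hT.toMatrix_omega]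
  show _ - ((connMat G y p).transpose * -(G y * J y) + -(G y * J y) * connMat G y p) = _
  simp only [Matrix.mul_add, Matrix.add_mul, Matrix.mul_sub, Matrix.mul_neg, Matrix.neg_mul,
    Matrix.mul_assoc]
  abel

end IsParallelModel

/-- The covariant derivative of the almost complex structure in the direction `∂_p`. -/
def covJ (g : E6 → Matrix (Fin 6) (Fin 6) ℝ) (J : E6 → Matrix (Fin 6) (Fin 6) ℝ) (y : E6)
    (p : Fin 6) : Matrix (Fin 6) (Fin 6) ℝ :=
  (Matrix.of fun i j => pd p (fun z => J z i j) y) + connMat g y p * J y - J y * connMat g y p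

/-- The Nijenhuis tensor in terms of a symmetric connection. -/
theorem nijenhuis_eq_covJ {g : E6 → Matrix (Fin 6) (Fin 6) ℝ} {y : E6}
    (hg : ∀ᶠ z in nhds y, (g z).transpose = g z) (J : E6 → Matrix (Fin 6) (Fin 6) ℝ)
    (i j k : Fin 6) : nijenhuis J y i j k =
      ∑ l, (J y l j * covJ g J y l i k - J y l k * covJ g J y l i j -
        J y i l * (covJ g J y j l k - covJ g J y k l j)) := by
  have hs := connMat_symm hg
  set Γ := connMat g y
  set K := J y with hK
  have ha : ∀ j k, ∑ l, K l j * (Γ l * K) i k = ∑ l, K l k * (Γ l * K) i j := by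
    intro j k
    simp only [Matrix.mul_apply, Finset.mul_sum]
    rw [Finset.sum_comm]
    exact Finset.sum_congr rfl fun l _ => Finset.sum_congr rfl fun m _ => by rw [hs]; ring
  have hb : ∀ j k, ∑ l, K l j * (K * Γ l) i k = ∑ l, K i l * (Γ k * K) l j := by
    intro j k
    simp only [Matrix.mul_apply, Finset.mul_sum]
    rw [Finset.sum_comm]
    exact Finset.sum_congr rfl fun l _ => Finset.sum_congr rfl fun m _ => by rw [hs]; ring
  have hd : ∀ j k, ∑ l, K i l * (K * Γ j) l k = ∑ l, K i l * (K * Γ k) l j := by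
    intro j k
    refine Finset.sum_congr rfl fun l _ => ?_
    simp only [Matrix.mul_apply]
    congr 1
    exact Finset.sum_congr rfl fun m _ => by rw [hs]
  have e : ∀ p a b, covJ g J y p a b =
      pd p (fun z => J z a b) y + (Γ p * K) a b - (K * Γ p) a b := fun _ _ _ => rfl
  have h1 := ha j k
  have h2 := hb j k
  have h3 := hb k j
  have h4 := hd j k
  simp only [nijenhuis, e, mul_add, mul_sub, Finset.sum_sub_distrib, Finset.sum_add_distrib]
  linarith

theorem IsAlt.cov {k : ℕ} {g : E6 → Matrix (Fin 6) (Fin 6) ℝ} {f : TField k} {y : E6}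
    (hf : DifferentiableAt ℝ f y) (h : ∀ᶠ z in nhds y, IsAlt (f z)) (p : Fin 6) :
    IsAlt (cov g f y p) := by
  rw [cov_eq hf]
  refine IsAlt.sub (fun σ i => ?_) (h.self_of_nhds.lie _)
  rw [← pd_apply hf, ← pd_apply hf]
  have : (fun z => f z (i ∘ σ)) =ᶠ[nhds y] fun z => ((Equiv.Perm.sign σ : ℤ) : ℝ) * f z i :=
    h.mono fun z hz => hz σ i
  rw [pd, pd, this.fderiv_eq, fderiv_const_mul (differentiableAt_pi.1 hf i)]
  rfl

namespace IsParallelModel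

variable {U : Set E6} {φ : TField 3} {ω : TField 2} (h : IsParallelModel U φ ω) {y : E6}
  (hy : y ∈ U)
include h hy

/-- The derivative of `J² = -1`. -/
theorem covJ_anticomm (p : Fin 6) :
    almostComplex (φ y) (ω y) *
      covJ (metricField φ ω) (fun z => almostComplex (φ z) (ω z)) y p =
    -(covJ (metricField φ ω) (fun z => almostComplex (φ z) (ω z)) y p *
      almostComplex (φ y) (ω y)) := by
  have hT := h.typeIIA y hy
  set J := fun z => almostComplex (φ z) (ω z) with hJ
  set Γ := connMat (metricField φ ω) y p
  have e1 : (Matrix.of fun i j => pd p (fun z => J z i j) y) * J y +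
      J y * (Matrix.of fun i j => pd p (fun z => J z i j) y) = 0 := by
    ext i j
    have e3 : (fun z => ∑ m, J z i m * J z m j) =ᶠ[nhds y] fun _ => -(1 : Matrix _ _ ℝ) i j :=
      (h.eventually_typeIIA hy).mono fun z hz => by
        have := congrFun (congrFun (almostComplex_sq hz.alt_phi hz.lambda_neg) i) j
        rw [Matrix.neg_apply, Matrix.mul_apply] at this
        exact this
    have e4 := pd_sum_mul (f := fun m z => J z i m) (h := fun m z => J z m j) (y := y)
      (fun m => (h.contDiffAt_J hy i m).differentiableAt cinf_ne_zero)
      (fun m => (h.contDiffAt_J hy m j).differentiableAt cinf_ne_zero) p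
    rw [pd, e3.fderiv_eq] at e4
    rw [Matrix.add_apply, Matrix.mul_apply, Matrix.mul_apply, ← Finset.sum_add_distrib]
    simpa using e4.symm
  have e2 : J y * J y = -1 := almostComplex_sq hT.alt_phi hT.lambda_neg
  show J y * (_ + Γ * J y - J y * Γ) = -((_ + Γ * J y - J y * Γ) * J y)
  rw [Matrix.mul_sub, Matrix.mul_add, Matrix.sub_mul, Matrix.add_mul, ← Matrix.mul_assoc (J y) (J y),
    Matrix.mul_assoc Γ, e2, eq_neg_of_add_eq_zero_right e1, Matrix.neg_mul, Matrix.one_mul,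
    Matrix.mul_neg, Matrix.mul_one, Matrix.mul_assoc]
  abel

/-- The form `ω` is parallel: `W_p = ∇_p ω` satisfies `W_a(b, c) + W_b(c, a) + W_c(a, b) = 0` and is of
type `(2,0) + (0,2)` in its last two arguments, and the Nijenhuis equation then forces `W = 0`. -/
theorem cov_omega (p : Fin 6) : cov (metricField φ ω) ω y p = 0 := by
  have hT := h.typeIIA y hy
  set G := metricField φ ω with hG
  set J := fun z => almostComplex (φ z) (ω z) with hJ
  set W := fun p => toMatrix (cov G ω y p) with hW
  have w1 : ∀ p, W p = -(G y * covJ G J y p) := h.toMatrix_cov_omega hy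
  have hdω := (h.contDiffAt_omega hy).differentiableAt cinf_ne_zero
  have hWalt : ∀ p, IsAlt (cov G ω y p) := fun p => IsAlt.cov hdω
    ((h.eventually_typeIIA hy).mono fun z hz => hz.alt_omega) p
  have w2 : ∀ p, (W p).transpose = -W p := fun p => toMatrix_transpose (hWalt p)
  have w2' : ∀ p a b, W p a b = -W p b a := fun p a b => by
    have := congrFun (congrFun (w2 p) b) a
    simpa using this
  have hGJ : (J y).transpose * G y = -(G y * J y) := by
    have := toMatrix_transpose hT.alt_omega
    rw [hT.toMatrix_omega, Matrix.transpose_neg, Matrix.transpose_mul, hT.metric_transpose] at this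
    exact neg_injective this
  have w3 : ∀ p, (J y).transpose * W p = W p * J y := by
    intro p
    have := h.covJ_anticomm hy p
    rw [w1, Matrix.mul_neg, ← Matrix.mul_assoc, hGJ, Matrix.neg_mul, neg_neg, Matrix.mul_assoc,
      this, Matrix.neg_mul, Matrix.mul_neg, Matrix.mul_assoc]
  -- closedness of `ω`
  have w4 : ∀ a b c, W a b c = W b a c - W c a b := by
    intro a b c
    have h1 := h.closed_omega y hy
    rw [extD_two (h.eventually_symm hy) hT.alt_omega] at h1
    have h2 := congrFun h1 ![a, b, c]
    rw [altD_two] at h2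
    have h3 : W a b c - W b a c + W c a b = 0 := h2
    linarith
  -- integrability of `J`, with the upper index lowered
  have w5 : ∀ m j k, ∑ l, J y l j * W l m k - ∑ l, J y l k * W l m j + (W j * J y) m k -
      (W k * J y) m j = 0 := by
    intro m j k
    have hN : ∀ i, ∑ l, J y l j * covJ G J y l i k - ∑ l, J y l k * covJ G J y l i j -
        (J y * covJ G J y j) i k + (J y * covJ G J y k) i j = 0 := by
      intro i
      have h1 := h.integrable y hy i j k
      rw [nijenhuis_eq_covJ (h.eventually_symm hy)] at h1
      rw [← h1, Matrix.mul_apply, Matrix.mul_apply, ← Finset.sum_sub_distrib,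
        ← Finset.sum_sub_distrib, ← Finset.sum_add_distrib]
      exact Finset.sum_congr rfl fun l _ => by ring
    have h2 : ∑ i, -G y m i * (∑ l, J y l j * covJ G J y l i k - ∑ l, J y l k * covJ G J y l i j -
        (J y * covJ G J y j) i k + (J y * covJ G J y k) i j) = 0 :=
      Finset.sum_eq_zero fun i _ => by rw [hN, mul_zero]
    have h3 : ∀ p q, (W p * J y) m q = ∑ i, G y m i * (J y * covJ G J y p) i q := by
      intro p q
      rw [← Matrix.mul_apply, h.covJ_anticomm hy p, w1, Matrix.mul_neg, Matrix.neg_mul,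
        Matrix.mul_assoc]
    have h4 : ∀ p q, ∑ l, J y l p * W l m q =
        -∑ i, G y m i * ∑ l, J y l p * covJ G J y l i q := by
      intro p q
      simp only [w1, Matrix.neg_apply, Matrix.mul_apply, Finset.mul_sum]
      rw [Finset.sum_comm, ← Finset.sum_neg_distrib]
      refine Finset.sum_congr rfl fun l _ => ?_
      rw [mul_neg, Finset.mul_sum, ← Finset.sum_neg_distrib, ← Finset.sum_neg_distrib]
      exact Finset.sum_congr rfl fun i _ => by ring
    rw [h4, h4, h3, h3]
    simp only [mul_add, mul_sub, Finset.sum_add_distrib, Finset.sum_sub_distrib, neg_mul,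
      Finset.sum_neg_distrib] at h2
    linarith
  have w6 : ∀ j m k, (W j * J y) m k = (W m * J y) j k - ∑ l, J y l k * W l j m := by
    intro j m k
    rw [Matrix.mul_apply, Matrix.mul_apply, ← Finset.sum_sub_distrib]
    exact Finset.sum_congr rfl fun l _ => by rw [w4 j m l]; ring
  have w7 : ∀ m, W m * J y = 0 := by
    intro m
    ext j k
    have s : (W m * J y) k j = -(W m * J y) j k := by
      have : (W m * J y).transpose = -(W m * J y) := by
        rw [Matrix.transpose_mul, w2, Matrix.mul_neg, w3]
      exact congrFun (congrFun this j) k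
    have h1 := w5 m j k
    rw [w6 j m k, w6 k m j, s] at h1
    have e1 : ∑ l, J y l j * W l k m = -∑ l, J y l j * W l m k := by
      rw [← Finset.sum_neg_distrib]
      exact Finset.sum_congr rfl fun l _ => by rw [w2' l k m]; ring
    have e2 : ∑ l, J y l k * W l j m = -∑ l, J y l k * W l m j := by
      rw [← Finset.sum_neg_distrib]
      exact Finset.sum_congr rfl fun l _ => by rw [w2' l j m]; ring
    rw [e1, e2] at h1
    rw [Matrix.zero_apply]
    linarith
  have w8 : W p = 0 := by
    have := congrArg (· * J y) (w7 p)
    simp only [Matrix.mul_assoc, hJ, almostComplex_sq hT.alt_phi hT.lambda_neg] at this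
    simpa using this
  ext i
  have h1 : i = ![i 0, i 1] := by ext a; fin_cases a <;> rfl
  rw [h1]
  exact congrFun (congrFun w8 (i 0)) (i 1)

end IsParallelModel

/-! ### Covariant tensors attached to a pair -/

/-- `|φ|²` as a tensor of valence zero. -/
def nF0 (s : Tens 3 × Tens 2) : Tens 0 := fun _ => nF s

theorem contDiffAt_nF0 {s : Tens 3 × Tens 2} (h : IsTypeIIAAt s.1 s.2) :
    ContDiffAt ℝ Cinf nF0 s := contDiffAt_pi.2 fun _ => contDiffAt_nF h

theorem fderiv_nF0 {s : Tens 3 × Tens 2} (h : IsTypeIIAAt s.1 s.2) (σ : Tens 3 × Tens 2)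
    (i : Fin 0 → Fin 6) : fderiv ℝ nF0 s σ i = fderiv ℝ nF s σ := by
  have hd : DifferentiableAt ℝ nF s := (contDiffAt_nF h).differentiableAt cinf_ne_zero
  have : fderiv ℝ nF0 s = ContinuousLinearMap.pi fun _ => fderiv ℝ nF s :=
    fderiv_pi (fun _ => hd)
  rw [this]; rfl

theorem nF0_pullPair (P : Matrix (Fin 6) (Fin 6) ℝ) (s : Tens 3 × Tens 2) (hP : P.det ≠ 0) :
    nF0 (pullPair P s) = pull P (nF0 s) := by
  ext i; rw [pull_zero_valence]; exact normSq_pull P hP _ _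

theorem nhF_pullPair (P : Matrix (Fin 6) (Fin 6) ℝ) (s : Tens 3 × Tens 2) (hP : P.det ≠ 0) :
    nhF (pullPair P s) = pull P (nhF s) := by
  simp only [nhF, pullPair, normSq_pull P hP, hat_pull P hP, pull_smul]

theorem gF_pullPair (P : Matrix (Fin 6) (Fin 6) ℝ) (s : Tens 3 × Tens 2) (hP : P.det ≠ 0) :
    gF (pullPair P s) = pull P (gF s) := metricTens_pull P hP _ _

section

variable {s : Tens 3 × Tens 2} (h : IsTypeIIAAt s.1 s.2) {P : Matrix (Fin 6) (Fin 6) ℝ}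
  (hP : P.det ≠ 0) (σ : Tens 3 × Tens 2)
include h hP

theorem fderiv_nF_pullPair :
    fderiv ℝ nF (pullPair P s) (pullPair P σ) = fderiv ℝ nF s σ := by
  have h1 := fderiv_pullPair ((contDiffAt_nF0 h).differentiableAt cinf_ne_zero) nF0_pullPair hP σ
  have h2 := congrFun h1 ![]
  have hd : DifferentiableAt ℝ nF s := (contDiffAt_nF h).differentiableAt cinf_ne_zero
  have hd' : DifferentiableAt ℝ nF (pullPair P s) := by
    have e : nF = fun s' => nF (pullPairL P⁻¹ s') := by
      ext1 s'
      have hP' : P⁻¹.det ≠ 0 := by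
        rw [Matrix.det_nonsing_inv, Ring.inverse_eq_inv']; exact inv_ne_zero hP
      rw [pullPairL_apply]
      exact (normSq_pull P⁻¹ hP' _ _).symm
    rw [e]
    refine DifferentiableAt.comp (pullPair P s) (g := nF) (f := pullPairL P⁻¹) ?_
      (pullPairL P⁻¹).differentiableAt
    have h1 : P * P⁻¹ = 1 := Matrix.mul_nonsing_inv _ (isUnit_iff_ne_zero.2 hP)
    have hc : pullPairL P⁻¹ (pullPair P s) = s :=
      Prod.ext (pull_cancel h1 s.1) (pull_cancel h1 s.2)
    rw [hc]
    exact hd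
  have e1 : fderiv ℝ nF0 s = ContinuousLinearMap.pi fun _ => fderiv ℝ nF s :=
    fderiv_pi (fun _ => hd)
  have e2 : fderiv ℝ nF0 (pullPair P s) =
      ContinuousLinearMap.pi fun _ => fderiv ℝ nF (pullPair P s) := fderiv_pi (fun _ => hd')
  rw [e1, e2, pull_zero_valence] at h2
  exact h2

theorem fderiv_nhF_pullPair :
    fderiv ℝ nhF (pullPair P s) (pullPair P σ) = pull P (fderiv ℝ nhF s σ) :=
  fderiv_pullPair ((contDiffAt_nhF h).differentiableAt cinf_ne_zero) nhF_pullPair hP σ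

theorem fderiv_gF_pullPair :
    fderiv ℝ gF (pullPair P s) (pullPair P σ) = pull P (fderiv ℝ gF s σ) :=
  fderiv_pullPair ((contDiffAt_gF h).differentiableAt cinf_ne_zero) gF_pullPair hP σ

end

theorem pull_injective {k : ℕ} {P : Matrix (Fin 6) (Fin 6) ℝ} (hP : P.det ≠ 0) :
    Function.Injective (pull P : Tens k → Tens k) := by
  intro A B hAB
  have h1 : P * P⁻¹ = 1 := Matrix.mul_nonsing_inv _ (isUnit_iff_ne_zero.2 hP)
  rw [← pull_cancel h1 A, hAB, pull_cancel h1]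

theorem pullPair_eq_std {φ : Tens 3} {ω : Tens 2} {P : Matrix (Fin 6) (Fin 6) ℝ} {c : ℝ}
    (h1 : pull P φ = c • phi0) (h2 : pull P ω = omega0) : pullPair P (φ, ω) = stdPair c :=
  Prod.ext h1 h2

theorem omegaInv_omega0 : omegaInv omega0 = J0 := by
  have := omegaInv_std one_ne_zero
  rwa [one_smul, inv_one, one_smul] at this

theorem metric_stdPair {c : ℝ} (hc : 0 < c) : metric (c • phi0) omega0 = 1 := by
  have := metric_std hc.ne' one_pos
  rwa [one_smul, one_smul] at this

theorem hat_stdPair {c : ℝ} (hc : 0 < c) : hat (c • phi0) omega0 = c • hat0 := by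
  have := hat_std hc.ne' one_pos
  rwa [one_smul] at this

theorem normSq_stdPair {c : ℝ} (hc : 0 < c) : normSq (c • phi0) omega0 = 4 * c ^ 2 := by
  have := normSq_std hc.ne' one_pos
  rw [one_smul] at this
  rw [this]; ring

theorem contractOmega_omega0 {k : ℕ} (A : Tens (k + 2)) (i : Fin k → Fin 6) :
    contractOmega omega0 A i = (1 / 2 : ℝ) *
      (A (Fin.cons 0 (Fin.cons 1 i)) - A (Fin.cons 1 (Fin.cons 0 i)) +
       A (Fin.cons 2 (Fin.cons 3 i)) - A (Fin.cons 3 (Fin.cons 2 i)) +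
       A (Fin.cons 4 (Fin.cons 5 i)) - A (Fin.cons 5 (Fin.cons 4 i))) := by
  rw [contractOmega, omegaInv_omega0]
  simp [Fin.sum_univ_six, J0]
  ring

theorem pull_zero {k : ℕ} (P : Matrix (Fin 6) (Fin 6) ℝ) : pull P (0 : Tens k) = 0 := by
  have := pull_smul P (0 : ℝ) (0 : Tens k)
  rwa [zero_smul, zero_smul] at this

theorem hat0_comps :
    hat0 ![0, 1, 2] = 0 ∧ hat0 ![0, 1, 3] = 0 ∧ hat0 ![0, 1, 4] = 0 ∧
    hat0 ![0, 1, 5] = 0 ∧ hat0 ![0, 2, 3] = 0 ∧ hat0 ![0, 2, 4] = 0 ∧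
    hat0 ![0, 2, 5] = 1 ∧ hat0 ![0, 3, 4] = 1 ∧ hat0 ![0, 3, 5] = 0 ∧
    hat0 ![0, 4, 5] = 0 ∧ hat0 ![1, 2, 3] = 0 ∧ hat0 ![1, 2, 4] = 1 ∧
    hat0 ![1, 2, 5] = 0 ∧ hat0 ![1, 3, 4] = 0 ∧ hat0 ![1, 3, 5] = -1 ∧
    hat0 ![1, 4, 5] = 0 ∧ hat0 ![2, 3, 4] = 0 ∧ hat0 ![2, 3, 5] = 0 ∧
    hat0 ![2, 4, 5] = 0 ∧ hat0 ![3, 4, 5] = 0 := by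
  simp [hat0, dzComp]

/-- The conditions that the metric, the norm and primitivity are preserved are linear equations on
the twenty components of `A`, and they leave a line. -/
theorem eq_smul_hat0 {c : ℝ} (hc : 0 < c) {A : Tens 3} (hA : IsAlt A)
    (hg : fderiv ℝ gF (stdPair c) (c • A, 0) = 0) (hn : fderiv ℝ nF (stdPair c) (c • A, 0) = 0)
    (hp : contractOmega (k := 1) omega0 A = 0) : A = A ![0, 2, 5] • hat0 := by
  have h0 : IsAlt (0 : Tens 2) := fun _ _ => by simp
  obtain ⟨s1, s2, s3, s4⟩ := hA.sort_three
  have n := fderiv_nF_std hc hA h0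
  rw [hn] at n
  replace n := (mul_eq_zero.1 n.symm).resolve_left (by positivity)
  obtain ⟨g00, g01, g02, g03, g04, g05, g11, g12, g13, g14, g15, g22, g23, g24, g25, g33, g34, g35,
    g44, g45, g55⟩ := fderiv_gF_std hc hA h0
  clear g11 g12 g13 g14 g15 g33 g34 g35 g55
  simp only [hg, Pi.zero_apply] at n g00 g01 g02 g03 g04 g05 g22 g23 g24 g25 g44 g45
  have q : ∀ i : Fin 6, A ![0, 1, i] - A ![1, 0, i] + A ![2, 3, i] - A ![3, 2, i] +
      A ![4, 5, i] - A ![5, 4, i] = 0 := by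
    intro i
    have h1 := congrFun hp ![i]
    rw [contractOmega_omega0, Pi.zero_apply] at h1
    have h2 : (1 / 2 : ℝ) * (A ![0, 1, i] - A ![1, 0, i] + A ![2, 3, i] - A ![3, 2, i] +
      A ![4, 5, i] - A ![5, 4, i]) = 0 := h1
    linarith only [h2]
  have q0 := q 0
  have q1 := q 1
  have q2 := q 2
  have q3 := q 3
  have q4 := q 4
  have q5 := q 5
  simp only [s1, s2, s3, s4, Fin.isValue, Fin.reduceLT, neg_neg, neg_zero] at q0 q1 q2 q3 q4 q5
  refine hA.ext_twenty (hat0_isAlt.smul _) ?_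
  obtain ⟨k012, k013, k014, k015, k023, k024, k025, k034, k035, k045,
    k123, k124, k125, k134, k135, k145, k234, k235, k245, k345⟩ := hat0_comps
  simp only [Pi.smul_apply, smul_eq_mul, k012, k013, k014, k015, k023, k024, k025, k034, k035, k045,
    k123, k124, k125, k134, k135, k145, k234, k235, k245, k345, mul_zero, mul_one, mul_neg]
  refine ⟨⟨⟨?_, ?_, ?_, ?_⟩, ⟨?_, ?_, ?_, ?_⟩, ?_, ?_, ?_, ?_⟩, ⟨?_, trivial, ?_, ?_⟩, ?_, ?_, ?_, ?_⟩
  · linarith only [g05, q2]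
  · linarith only [g04, q3]
  · linarith only [g03, q4]
  · linarith only [g02, q5]
  · linarith only [g25, q0]
  · linarith only [g24, q1]
  · linarith only [g03, q4]
  · linarith only [g02, q5]
  · linarith only [g25, q0]
  · linarith only [g24, q1]
  · linarith only [g05, q2]
  · linarith only [g04, q3]
  · linarith only [n, g00, g22, g44]
  · linarith only [g01, g23, g45]
  · linarith only [n, g00, g22, g44]
  · linarith only [g01, g23, g45]
  · linarith only [n, g00, g22, g44]
  · linarith only [n, g00, g22, g44]
  · linarith only [g01, g23, g45]

/-- Variations of `φ` that preserve the metric, the norm and primitivity are multiples of `φ̂`. -/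
theorem IsTypeIIAAt.eq_smul_hat {φ : Tens 3} {ω : Tens 2} (h : IsTypeIIAAt φ ω) {A : Tens 3}
    (hA : IsAlt A) (hg : fderiv ℝ gF (φ, ω) (A, 0) = 0) (hn : fderiv ℝ nF (φ, ω) (A, 0) = 0)
    (hp : contractOmega (k := 1) ω A = 0) : ∃ t : ℝ, A = t • hat φ ω := by
  obtain ⟨P, c, hc, hP, h1, h2⟩ := h.exists_frame
  have hs := pullPair_eq_std h1 h2
  set A' := c⁻¹ • pull P A with hA'
  have hA'alt : IsAlt A' := (hA.pull P).smul _
  have e : pullPair P (A, 0) = (c • A', (0 : Tens 2)) := by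
    refine Prod.ext ?_ ?_
    · rw [hA', smul_smul, mul_inv_cancel₀ hc.ne', one_smul]; rfl
    · exact pull_zero P
  have g1 := fderiv_gF_pullPair (s := (φ, ω)) h hP (A, 0)
  have n1 := fderiv_nF_pullPair (s := (φ, ω)) h hP (A, 0)
  rw [hs, e, hg, pull_zero] at g1
  rw [hs, e, hn] at n1
  have p1 := contractOmega_pull P hP (k := 1) ω A
  rw [hp, pull_zero, h2] at p1
  have p2 : contractOmega (k := 1) omega0 A' = 0 := by
    ext i
    have := congrFun p1 i
    rw [contractOmega_omega0] at this ⊢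
    simp only [hA', Pi.smul_apply, smul_eq_mul, Pi.zero_apply] at this ⊢
    linear_combination c⁻¹ * this
  have key := eq_smul_hat0 hc hA'alt g1 n1 p2
  refine ⟨A' ![0, 2, 5], pull_injective hP ?_⟩
  rw [pull_smul, ← hat_pull P hP, h1, h2, hat_stdPair hc, smul_comm, ← key, hA', smul_smul,
    mul_inv_cancel₀ hc.ne', one_smul]

/-! ### Parallelism of the three-form -/

/-- The tensor whose components with first index `p` are those of `f p`. -/
def slotT {k : ℕ} (f : Fin 6 → Tens k) : Tens (k + 1) := fun i => f (i 0) (Fin.tail i)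

theorem slotT_cons {k : ℕ} (f : Fin 6 → Tens k) (p : Fin 6) (i : Fin k → Fin 6) :
    slotT f (Fin.cons p i) = f p i := by
  simp [slotT]

theorem pull_slotT {k : ℕ} (P : Matrix (Fin 6) (Fin 6) ℝ) (f : Fin 6 → Tens k) :
    pull P (slotT f) = slotT fun p => ∑ a, P a p • pull P (f a) := by
  ext i
  rw [← Fin.cons_self_tail i, pull_cons, slotT_cons]
  simp only [slotT_cons, Finset.sum_apply, Pi.smul_apply, smul_eq_mul]

theorem fderiv_of_affine {V F : Type*} [NormedAddCommGroup V] [NormedSpace ℝ V]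
    [NormedAddCommGroup F] [NormedSpace ℝ F] {T : V → F} {v w : V} {L : F}
    (hT : DifferentiableAt ℝ T v) (h : ∀ τ : ℝ, T (v + τ • w) = T v + τ • L) :
    fderiv ℝ T v w = L := by
  have h1 : HasDerivAt (fun τ : ℝ => v + τ • w) w 0 := by
    simpa using ((hasDerivAt_id (0 : ℝ)).smul_const w).const_add v
  have h2 : HasDerivAt (fun τ : ℝ => T (v + τ • w)) (fderiv ℝ T v w) 0 := by
    refine HasFDerivAt.comp_hasDerivAt (0 : ℝ) ?_ h1
    rw [zero_smul, add_zero]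
    exact hT.hasFDerivAt
  refine h2.unique ?_
  simp only [h]
  simpa using ((hasDerivAt_id (0 : ℝ)).smul_const L).const_add (T v)

theorem nabla_eq_slotT {k : ℕ} (g : E6 → Matrix (Fin 6) (Fin 6) ℝ) (A : TField k) (y : E6) :
    nabla g A y = slotT (cov g A y) := by
  ext i
  rw [slotT, cov, Fin.cons_self_tail]

/-- Wedging with `φ̂` is injective on one-forms. -/
theorem IsTypeIIAAt.eq_zero_of_altD_hat {φ : Tens 3} {ω : Tens 2} (h : IsTypeIIAAt φ ω)
    {t : Fin 6 → ℝ} (ht : altD (slotT fun p => t p • hat φ ω) = 0) : t = 0 := by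
  obtain ⟨P, c, hc, hP, h1, h2⟩ := h.exists_frame
  have e := pull_altD P (slotT fun p => t p • hat φ ω)
  rw [ht, pull_zero, pull_slotT] at e
  set t' : Fin 6 → ℝ := fun p => c * ∑ a, P a p * t a with ht'
  have e2 : (fun p => ∑ a, P a p • pull P (t a • hat φ ω)) = fun p => t' p • hat0 := by
    ext1 p
    simp only [pull_smul, ← hat_pull P hP, h1, h2, hat_stdPair hc, smul_smul]
    rw [← Finset.sum_smul]
    show _ = (c * ∑ a, P a p * t a) • hat0
    rw [Finset.mul_sum]
    congr 1
    exact Finset.sum_congr rfl fun _ _ => by ring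
  rw [e2] at e
  obtain ⟨k012, k013, k014, k015, k023, k024, k025, k034, k035, k045,
    k123, k124, k125, k134, k135, k145, k234, k235, k245, k345⟩ := hat0_comps
  have q : ∀ a b c d : Fin 6, t' a * hat0 ![b, c, d] - t' b * hat0 ![a, c, d] +
      t' c * hat0 ![a, b, d] - t' d * hat0 ![a, b, c] = 0 := by
    intro a b c d
    have := congrFun e ![a, b, c, d]
    rw [altD_three] at this
    exact this
  have q0 := q 0 1 2 4
  have q1 := q 0 1 2 5
  have q2 := q 0 2 3 4
  have q3 := q 0 2 3 5
  have q4 := q 0 2 4 5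
  have q5 := q 0 3 4 5
  simp only [k012, k013, k014, k015, k023, k024, k025, k034, k035, k045, k123, k124, k125, k134,
    k135, k145, k234, k235, k245, k345] at q0 q1 q2 q3 q4 q5
  have z : ∀ p, t' p = 0 := by
    intro p
    fin_cases p
    · show t' 0 = 0; linarith only [q0]
    · show t' 1 = 0; linarith only [q1]
    · show t' 2 = 0; linarith only [q2]
    · show t' 3 = 0; linarith only [q3]
    · show t' 4 = 0; linarith only [q4]
    · show t' 5 = 0; linarith only [q5]
  have z2 : P.transpose.mulVec t = 0 := by
    ext p
    have h3 := (mul_eq_zero.1 (z p)).resolve_left hc.ne'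
    exact h3
  have hu : IsUnit P.transpose.det := by
    rw [Matrix.det_transpose]; exact isUnit_iff_ne_zero.2 hP
  have := congrArg ((P.transpose)⁻¹.mulVec) z2
  rwa [Matrix.mulVec_mulVec, Matrix.nonsing_inv_mul _ hu, Matrix.one_mulVec,
    Matrix.mulVec_zero] at this

namespace IsParallelModel

variable {U : Set E6} {φ : TField 3} {ω : TField 2} (h : IsParallelModel U φ ω) {y : E6}
  (hy : y ∈ U)
include h hy

/-- The metric of the pair is parallel for its own Levi-Civita connection. -/
theorem cov_metricTens (p : Fin 6) :
    cov (metricField φ ω) (fun z => gF (φ z, ω z)) y p = 0 := by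
  have hT := h.typeIIA y hy
  have h1 := pd_metric (g := metricField φ ω) hT.isUnit_det_metric (h.eventually_symm hy) p
  ext i
  have h2 := congrFun (congrFun h1 (i 0)) (i 1)
  have e : i = ![i 0, i 1] := by ext a; fin_cases a <;> rfl
  rw [e]
  show pd p (fun z => metricField φ ω z (i 0) (i 1)) y -
    lie (connMat (metricField φ ω) y p) (gF (φ y, ω y)) ![i 0, i 1] = 0
  rw [lie_two]
  rw [Matrix.of_apply] at h2
  rw [h2, Matrix.add_apply, Matrix.mul_apply, Matrix.mul_apply, sub_eq_zero]
  congr 1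
  exact Finset.sum_congr rfl fun m _ => mul_comm _ _

/-- The form `φ` is parallel. As `ω`, the metric, the norm and primitivity are preserved by parallel
transport, each `∇_p φ` is a multiple `t_p φ̂`; the equation `dφ = 0` then says `t ∧ φ̂ = 0`. -/
theorem cov_phi (p : Fin 6) : cov (metricField φ ω) φ y p = 0 := by
  have hT := h.typeIIA y hy
  have hS : DifferentiableAt ℝ (fun z => (φ z, ω z)) y :=
    (h.contDiffAt_pair hy).differentiableAt cinf_ne_zero
  have hφd := (h.contDiffAt_phi hy).differentiableAt cinf_ne_zero
  set A := cov (metricField φ ω) φ y with hA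
  have hAalt : ∀ p, IsAlt (A p) := fun p => IsAlt.cov hφd
    ((h.eventually_typeIIA hy).mono fun z hz => hz.alt_phi) p
  have hcov : ∀ p, covPair (metricField φ ω) (fun z => (φ z, ω z)) y p = (A p, 0) := fun p =>
    Prod.ext rfl (h.cov_omega hy p)
  have hg : ∀ p, fderiv ℝ gF (φ y, ω y) (A p, 0) = 0 := by
    intro p
    have h1 := cov_comp (g := metricField φ ω) (T := gF) hS
      ((contDiffAt_gF hT).differentiableAt cinf_ne_zero) (fun P hP => gF_pullPair P _ hP) p
    rw [hcov p, h.cov_metricTens hy p] at h1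
    exact h1.symm
  have hn : ∀ p, fderiv ℝ nF (φ y, ω y) (A p, 0) = 0 := by
    intro p
    have h1 := cov_comp (g := metricField φ ω) (T := nF0) hS
      ((contDiffAt_nF0 hT).differentiableAt cinf_ne_zero) (fun P hP => nF0_pullPair P _ hP) p
    rw [hcov p] at h1
    rw [← fderiv_nF0 hT _ ![], ← h1]
    show pd p (fun z => normSq (φ z) (ω z)) y - lie _ (nF0 (φ y, ω y)) ![] = 0
    rw [h.norm_const y hy p]
    simp [lie]
  have hp : ∀ p, contractOmega (k := 1) (ω y) (A p) = 0 := by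
    intro p
    set T : Tens 3 × Tens 2 → Tens 1 := fun s => contractOmega (k := 1) s.2 s.1 with hTdef
    have hTd : ContDiffAt ℝ Cinf T (φ y, ω y) := by
      refine contDiffAt_pi.2 fun i => contDiffAt_const.mul (ContDiffAt.sum fun a _ =>
        ContDiffAt.sum fun b _ => ?_)
      exact (contDiffAt_omegaInv contDiffAt_snd hT.det_ne a b).mul
        (contDiffAt_pi.1 contDiffAt_fst _)
    have h1 := cov_comp (g := metricField φ ω) (T := T) hS (hTd.differentiableAt cinf_ne_zero)
      (fun P hP => contractOmega_pull P hP _ _) p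
    have h2 : cov (metricField φ ω) (fun z => T (φ z, ω z)) y p = 0 := by
      rw [cov_congr (f' := fun _ => 0)
        ((h.eventually_typeIIA hy).mono fun z hz => hz.primitive), cov_eq (differentiableAt_const _)]
      ext i; simp [lie]
    rw [h2, hcov p] at h1
    rw [fderiv_of_affine (hTd.differentiableAt cinf_ne_zero)
      (L := contractOmega (k := 1) (ω y) (A p))] at h1
    · exact h1.symm
    intro τ
    ext i
    simp only [hTdef, contractOmega, Prod.smul_mk, Prod.mk_add_mk, smul_zero, add_zero, Pi.add_apply,
      Pi.smul_apply, smul_eq_mul, mul_add, Finset.sum_add_distrib, Finset.mul_sum]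
    congr 1
    exact Finset.sum_congr rfl fun _ _ => Finset.sum_congr rfl fun _ _ => by ring
  choose t ht using fun p => hT.eq_smul_hat (hAalt p) (hg p) (hn p) (hp p)
  have h1 := h.closed_phi y hy
  rw [extD_three (h.eventually_symm hy) hT.alt_phi, nabla_eq_slotT, ← hA,
    show A = fun p => t p • hat (φ y) (ω y) from funext ht] at h1
  rw [ht, hT.eq_zero_of_altD_hat h1, Pi.zero_apply, zero_smul]

theorem covPair_pair (p : Fin 6) :
    covPair (metricField φ ω) (fun z => (φ z, ω z)) y p = 0 :=
  Prod.ext (h.cov_phi hy p) (h.cov_omega hy p)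

end IsParallelModel

/-! ### Partial derivatives of smooth functions and of smooth families -/

theorem contDiffAt_pd {f : E6 → ℝ} {y : E6} (hf : ContDiffAt ℝ Cinf f y) (i : Fin 6) :
    ContDiffAt ℝ Cinf (pd i f) y :=
  (hf.fderiv_right (m := Cinf) (by decide)).clm_apply contDiffAt_const

theorem pd_comm {f : E6 → ℝ} {y : E6} (hf : ContDiffAt ℝ Cinf f y) (i j : Fin 6) :
    pd i (pd j f) y = pd j (pd i f) y := by
  have hd : DifferentiableAt ℝ (fderiv ℝ f) y :=
    (hf.fderiv_right (m := Cinf) (by decide)).differentiableAt cinf_ne_zero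
  have e : ∀ i j, pd i (pd j f) y = fderiv ℝ (fderiv ℝ f) y (coordVec i) (coordVec j) := by
    intro i j
    show fderiv ℝ (fun z => fderiv ℝ f z (coordVec j)) y (coordVec i) = _
    rw [fderiv_clm_apply hd (differentiableAt_const _)]
    simp
  rw [e, e]
  exact (hf.isSymmSndFDerivAt (by simp [minSmoothness_of_isRCLikeNormedField]; decide)).eq _ _

section Family

variable {f : ℝ → E6 → ℝ} {y : E6} (hf : ContDiffAt ℝ Cinf (fun p : ℝ × E6 => f p.1 p.2) (0, y))
include hf

theorem eventually_contDiffAt_family :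
    ∀ᶠ p in nhds ((0 : ℝ), y), DifferentiableAt ℝ (fun p : ℝ × E6 => f p.1 p.2) p := by
  have h1 := (hf.of_le (show (1 : WithTop ℕ∞) ≤ Cinf by decide)).eventually (by decide)
  exact h1.mono fun p hp => hp.differentiableAt (by decide)

theorem pd_family (i : Fin 6) : ∀ᶠ p in nhds ((0 : ℝ), y),
    pd i (f p.1) p.2 = fderiv ℝ (fun p : ℝ × E6 => f p.1 p.2) p (0, coordVec i) := by
  filter_upwards [eventually_contDiffAt_family hf] with p hp
  have h1 : HasFDerivAt (fun z : E6 => (p.1, z)) (ContinuousLinearMap.inr ℝ ℝ E6) p.2 :=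
    hasFDerivAt_prodMk_right _ _
  have h2 := HasFDerivAt.comp p.2 (g := fun p : ℝ × E6 => f p.1 p.2) hp.hasFDerivAt h1
  rw [pd]
  have h3 : fderiv ℝ (f p.1) p.2 = _ := h2.fderiv
  rw [h3]
  simp

theorem deriv_family : ∀ᶠ z in nhds y,
    HasDerivAt (fun t => f t z) (fderiv ℝ (fun p : ℝ × E6 => f p.1 p.2) (0, z) (1, 0)) 0 := by
  have hc : Filter.Tendsto (fun z : E6 => ((0 : ℝ), z)) (nhds y) (nhds (0, y)) :=
    (Continuous.prodMk_right 0).tendsto y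
  filter_upwards [hc.eventually (eventually_contDiffAt_family hf)] with z hz
  have h1 : HasDerivAt (fun t : ℝ => (t, z)) ((1 : ℝ), (0 : E6)) 0 :=
    (hasDerivAt_id 0).prodMk (hasDerivAt_const _ _)
  exact HasFDerivAt.comp_hasDerivAt (0 : ℝ) (l := fun p : ℝ × E6 => f p.1 p.2) hz.hasFDerivAt h1

theorem contDiffAt_pd_family (i : Fin 6) :
    ContDiffAt ℝ Cinf (fun p : ℝ × E6 => pd i (f p.1) p.2) (0, y) :=
  ((hf.fderiv_right (m := Cinf) (by decide)).clm_apply contDiffAt_const).congr_of_eventuallyEq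
    (pd_family hf i)

/-- Differentiation in the parameter commutes with partial derivatives. -/
theorem hasDerivAt_pd {f' : E6 → ℝ}
    (h' : ∀ᶠ z in nhds y, HasDerivAt (fun t => f t z) (f' z) 0) (i : Fin 6) :
    HasDerivAt (fun t => pd i (f t) y) (pd i f' y) 0 := by
  set F := fun p : ℝ × E6 => f p.1 p.2 with hF
  have hd : DifferentiableAt ℝ (fderiv ℝ F) (0, y) :=
    (hf.fderiv_right (m := Cinf) (by decide)).differentiableAt cinf_ne_zero
  have hs := (hf.isSymmSndFDerivAt
    (by simp [minSmoothness_of_isRCLikeNormedField]; decide)).eq ((1 : ℝ), (0 : E6)) (0, coordVec i)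
  have e1 : f' =ᶠ[nhds y] fun z => fderiv ℝ F (0, z) (1, 0) := by
    filter_upwards [h', deriv_family hf] with z h1 h2 using h1.unique h2
  have e2 : pd i f' y = fderiv ℝ (fderiv ℝ F) (0, y) (0, coordVec i) (1, 0) := by
    have h1 : HasFDerivAt (fun z : E6 => ((0 : ℝ), z)) (ContinuousLinearMap.inr ℝ ℝ E6) y :=
      hasFDerivAt_prodMk_right _ _
    have h2 := (HasFDerivAt.comp y hd.hasFDerivAt h1).clm_apply
      (hasFDerivAt_const ((1 : ℝ), (0 : E6)) y)
    rw [pd, e1.fderiv_eq]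
    have h3 : fderiv ℝ (fun z => fderiv ℝ F (0, z) (1, 0)) y = _ := h2.fderiv
    rw [h3]
    simp
  have e3 : (fun t => pd i (f t) y) =ᶠ[nhds 0] fun t => fderiv ℝ F (t, y) (0, coordVec i) := by
    have hc : Filter.Tendsto (fun t : ℝ => (t, y)) (nhds 0) (nhds (0, y)) :=
      (Continuous.prodMk_left y).tendsto 0
    exact hc.eventually (pd_family hf i)
  rw [e2, ← hs]
  have h1 : HasDerivAt (fun t : ℝ => (t, y)) ((1 : ℝ), (0 : E6)) 0 :=
    (hasDerivAt_id 0).prodMk (hasDerivAt_const _ _)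
  have h2 := (HasFDerivAt.comp_hasDerivAt (0 : ℝ) (l := fderiv ℝ F) hd.hasFDerivAt h1).clm_apply
    (hasDerivAt_const (0 : ℝ) ((0 : ℝ), coordVec i))
  refine HasDerivAt.congr_of_eventuallyEq ?_ e3
  simpa using h2

end Family

theorem extD_eq_altD {k : ℕ} (A : TField k) (y : E6) :
    extD A y = altD (fun i => pd (i 0) (fun w => A w (Fin.tail i)) y) := rfl

theorem extD_zero_apply (A : TField 0) (y : E6) (i : Fin 1 → Fin 6) :
    extD A y i = pd (i 0) (fun w => A w ![]) y := by
  rw [extD, Fin.sum_univ_one]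
  simp only [Fin.val_zero, pow_zero, one_mul]
  congr! 3

theorem extD_one_apply (A : TField 1) (y : E6) (i : Fin 2 → Fin 6) :
    extD A y i = pd (i 0) (fun w => A w ![i 1]) y - pd (i 1) (fun w => A w ![i 0]) y := by
  rw [extD_eq_altD, altD_one]
  rfl

theorem extD_two_apply (A : TField 2) (y : E6) (i : Fin 3 → Fin 6) :
    extD A y i = pd (i 0) (fun w => A w ![i 1, i 2]) y - pd (i 1) (fun w => A w ![i 0, i 2]) y +
      pd (i 2) (fun w => A w ![i 0, i 1]) y := by
  rw [extD_eq_altD, altD_two]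
  rfl

theorem pd_sub {f h : E6 → ℝ} {y : E6} (hf : DifferentiableAt ℝ f y) (hh : DifferentiableAt ℝ h y)
    (i : Fin 6) : pd i (fun z => f z - h z) y = pd i f y - pd i h y := by
  rw [pd, fderiv_fun_sub hf hh]; rfl

theorem extD_extD_zero {A : TField 0} {y : E6} (hA : ContDiffAt ℝ Cinf A y) :
    extD (extD A) y = 0 := by
  have hc : ContDiffAt ℝ Cinf (fun w => A w ![]) y := contDiffAt_pi.1 hA _
  ext i
  rw [extD_one_apply]
  simp only [extD_zero_apply]
  exact sub_eq_zero.2 (pd_comm hc _ _)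

theorem extD_extD_one {A : TField 1} {y : E6} (hA : ContDiffAt ℝ Cinf A y) :
    extD (extD A) y = 0 := by
  have hc : ∀ b, ContDiffAt ℝ Cinf (fun w => A w b) y := fun b => contDiffAt_pi.1 hA _
  have hd : ∀ j b, DifferentiableAt ℝ (pd j fun z => A z b) y := fun j b =>
    (contDiffAt_pd (hc b) j).differentiableAt cinf_ne_zero
  ext i
  rw [extD_two_apply]
  simp only [extD_one_apply]
  show pd (i 0) (fun w => pd (i 1) (fun w => A w ![i 2]) w - pd (i 2) (fun w => A w ![i 1]) w) y -
    pd (i 1) (fun w => pd (i 0) (fun w => A w ![i 2]) w - pd (i 2) (fun w => A w ![i 0]) w) y +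
    pd (i 2) (fun w => pd (i 0) (fun w => A w ![i 1]) w - pd (i 1) (fun w => A w ![i 0]) w) y = 0
  rw [pd_sub (hd _ _) (hd _ _), pd_sub (hd _ _) (hd _ _), pd_sub (hd _ _) (hd _ _)]
  have e1 := pd_comm (hc ![i 2]) (i 0) (i 1)
  have e2 := pd_comm (hc ![i 1]) (i 0) (i 2)
  have e3 := pd_comm (hc ![i 0]) (i 1) (i 2)
  rw [e1, e2, e3]
  ring

/-! ### The linearization of the flow operators -/

section Family

variable {k : ℕ} {f : ℝ → TField k} {f' : TField k} {y : E6}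
  (hf : ∀ i, ContDiffAt ℝ Cinf (fun p : ℝ × E6 => f p.1 p.2 i) (0, y))
include hf

theorem contDiffAt_extD_family (i : Fin (k + 1) → Fin 6) :
    ContDiffAt ℝ Cinf (fun p : ℝ × E6 => extD (f p.1) p.2 i) (0, y) :=
  ContDiffAt.sum fun j _ => contDiffAt_const.mul
    (contDiffAt_pd_family (f := fun t z => f t z (fun a => i (j.succAbove a))) (hf _) _)

theorem hasDerivAt_extD (h' : ∀ᶠ z in nhds y, HasDerivAt (fun t => f t z) (f' z) 0) :
    HasDerivAt (fun t => extD (f t) y) (extD f' y) 0 := by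
  refine hasDerivAt_pi.2 fun i => HasDerivAt.fun_sum fun j _ => HasDerivAt.const_mul _ ?_
  exact hasDerivAt_pd (f := fun t z => f t z (fun a => i (j.succAbove a))) (hf _)
    (h'.mono fun z hz => hasDerivAt_pi.1 hz _) _

/-- The derivative in the parameter of a smooth family is smooth in the remaining variables. -/
theorem contDiffAt_of_hasDerivAt
    (h' : ∀ᶠ z in nhds y, HasDerivAt (fun t => f t z) (f' z) 0) : ContDiffAt ℝ Cinf f' y := by
  refine contDiffAt_pi.2 fun i => ?_
  have h1 : ContDiffAt ℝ Cinf
      (fun z => fderiv ℝ (fun p : ℝ × E6 => f p.1 p.2 i) (0, z) (1, 0)) y := by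
    have h2 := ((hf i).fderiv_right (m := Cinf) (by decide)).clm_apply
      (contDiffAt_const (c := ((1 : ℝ), (0 : E6))))
    exact ContDiffAt.comp (f := fun z : E6 => ((0 : ℝ), z)) y h2
      (contDiffAt_const.prodMk contDiffAt_id)
  refine h1.congr_of_eventuallyEq ?_
  filter_upwards [h', deriv_family (f := fun t z => f t z i) (hf i)] with z hz hz'
  exact (hasDerivAt_pi.1 hz i).unique hz'

end Family

theorem extD_add {k : ℕ} {A B : TField k} {y : E6} (hA : DifferentiableAt ℝ A y)
    (hB : DifferentiableAt ℝ B y) : extD (fun z => A z + B z) y = extD A y + extD B y := by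
  ext i
  rw [Pi.add_apply, extD, extD, extD, ← Finset.sum_add_distrib]
  refine Finset.sum_congr rfl fun j _ => ?_
  rw [← mul_add]
  congr 1
  have := fderiv_fun_add (differentiableAt_pi.1 hA fun a => i (j.succAbove a))
    (differentiableAt_pi.1 hB fun a => i (j.succAbove a))
  rw [pd, pd, pd, ← add_apply, ← this]
  rfl

theorem extD_congr {k : ℕ} {A B : TField k} {y : E6} (h : A =ᶠ[nhds y] B) :
    extD A y = extD B y := by
  ext i
  refine Finset.sum_congr rfl fun j _ => ?_
  have : (fun z => A z (fun a => i (j.succAbove a))) =ᶠ[nhds y]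
      fun z => B z (fun a => i (j.succAbove a)) := h.mono fun z hz => congrFun hz _
  rw [pd, pd, this.fderiv_eq]

theorem extD_smul {k : ℕ} {A : TField k} {u : E6 → ℝ} {y : E6} (hA : DifferentiableAt ℝ A y)
    (hu : DifferentiableAt ℝ u y) (h0 : ∀ i, pd i u y = 0) :
    extD (fun z => u z • A z) y = u y • extD A y := by
  ext i
  rw [Pi.smul_apply, extD, extD, smul_eq_mul, Finset.mul_sum]
  refine Finset.sum_congr rfl fun j _ => ?_
  have h1 := fderiv_fun_mul hu (differentiableAt_pi.1 hA fun a => i (j.succAbove a))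
  have h2 : fderiv ℝ u y (coordVec (i j)) = 0 := h0 (i j)
  have h3 : pd (i j) (fun z => (u z • A z) fun a => i (j.succAbove a)) y =
      u y * pd (i j) (fun z => A z fun a => i (j.succAbove a)) y := by
    show fderiv ℝ (fun z => u z * A z fun a => i (j.succAbove a)) y (coordVec (i j)) = _
    rw [h1]
    simp [pd, h2]
  rw [h3]; ring

/-- Smooth closed variations of a pair on an open set. -/
structure IsVariation (U : Set E6) (α : TField 3) (β : TField 2) : Prop where
  smooth_fst : ContDiffOn ℝ Cinf α U
  smooth_snd : ContDiffOn ℝ Cinf β U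
  alt_fst : ∀ y ∈ U, IsAlt (α y)
  alt_snd : ∀ y ∈ U, IsAlt (β y)
  closed_fst : ∀ y ∈ U, extD α y = 0
  closed_snd : ∀ y ∈ U, extD β y = 0

/-- The derivative of an invariant expression in the pair `(φ, ω)` in the direction `(α, β)`, as a
field. -/
def varField {F : Type*} [NormedAddCommGroup F] [NormedSpace ℝ F] (T : Tens 3 × Tens 2 → F)
    (φ : TField 3) (ω : TField 2) (α : TField 3) (β : TField 2) (z : E6) : F :=
  fderiv ℝ T (φ z, ω z) (α z, β z)

section

variable {U : Set E6} {φ : TField 3} {ω : TField 2} (h : IsParallelModel U φ ω)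
  {α : TField 3} {β : TField 2} (v : IsVariation U α β) {y : E6} (hy : y ∈ U)
include h v hy

theorem contDiffAt_variedPair :
    ContDiffAt ℝ Cinf (fun p : ℝ × E6 => ((φ + p.1 • α) p.2, (ω + p.1 • β) p.2)) (0, y) := by
  have hα : ContDiffAt ℝ Cinf α y := v.smooth_fst.contDiffAt (h.mem_nhds hy)
  have hβ : ContDiffAt ℝ Cinf β y := v.smooth_snd.contDiffAt (h.mem_nhds hy)
  have h2 : ContDiffAt ℝ Cinf (Prod.snd : ℝ × E6 → E6) (0, y) := contDiffAt_snd
  have c : ∀ {k : ℕ} {u : TField k}, ContDiffAt ℝ Cinf u y →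
      ContDiffAt ℝ Cinf (fun p : ℝ × E6 => u p.2) (0, y) := fun hu =>
    ContDiffAt.comp (f := (Prod.snd : ℝ × E6 → E6)) (0, y) hu h2
  exact ((c (h.contDiffAt_phi hy)).add (contDiffAt_fst.smul (c hα))).prodMk
    ((c (h.contDiffAt_omega hy)).add (contDiffAt_fst.smul (c hβ)))

variable {F : Type*} [NormedAddCommGroup F] [NormedSpace ℝ F] {T : Tens 3 × Tens 2 → F}

theorem contDiffAt_comp_variedPair (hT : ContDiffAt ℝ Cinf T (φ y, ω y)) :
    ContDiffAt ℝ Cinf (fun p : ℝ × E6 => T ((φ + p.1 • α) p.2, (ω + p.1 • β) p.2)) (0, y) := by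
  refine ContDiffAt.comp (g := T) (0, y) ?_ (contDiffAt_variedPair h v hy)
  simpa using hT

omit h v hy in
theorem hasDerivAt_comp_variedPair (φ : TField 3) (ω : TField 2) (α : TField 3) (β : TField 2)
    (hT : DifferentiableAt ℝ T (φ y, ω y)) :
    HasDerivAt (fun t : ℝ => T ((φ + t • α) y, (ω + t • β) y)) (varField T φ ω α β y) 0 := by
  have h1 : HasDerivAt (fun t : ℝ => ((φ + t • α) y, (ω + t • β) y)) (α y, β y) 0 := by
    refine HasDerivAt.prodMk ?_ ?_
    · simpa using ((hasDerivAt_id (0 : ℝ)).smul_const (α y)).const_add (φ y)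
    · simpa using ((hasDerivAt_id (0 : ℝ)).smul_const (β y)).const_add (ω y)
  refine HasFDerivAt.comp_hasDerivAt (0 : ℝ) ?_ h1
  simpa using hT.hasFDerivAt

theorem contDiffAt_metric_family (i j : Fin 6) : ContDiffAt ℝ Cinf
    (fun p : ℝ × E6 => metricField (φ + p.1 • α) (ω + p.1 • β) p.2 i j) (0, y) :=
  contDiffAt_pi.1 (contDiffAt_comp_variedPair h v hy (contDiffAt_gF (h.typeIIA y hy))) ![i, j]

theorem contDiffAt_metric_inv_family (i j : Fin 6) : ContDiffAt ℝ Cinf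
    (fun p : ℝ × E6 => (metricField (φ + p.1 • α) (ω + p.1 • β) p.2)⁻¹ i j) (0, y) := by
  refine contDiffAt_inv_entry (contDiffAt_metric_family h v hy) ?_ i j
  have := (h.typeIIA y hy).isUnit_det_metric.ne_zero
  simpa [metricField] using this

theorem contDiffAt_normSq_family : ContDiffAt ℝ Cinf
    (fun p : ℝ × E6 => normSq ((φ + p.1 • α) p.2) ((ω + p.1 • β) p.2)) (0, y) :=
  contDiffAt_comp_variedPair h v hy (contDiffAt_nF (h.typeIIA y hy))

theorem contDiffAt_christoffel_family (k p q : Fin 6) : ContDiffAt ℝ Cinf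
    (fun x : ℝ × E6 => christoffel (metricField (φ + x.1 • α) (ω + x.1 • β)) x.2 k p q) (0, y) := by
  have hp : ∀ a b c, ContDiffAt ℝ Cinf (fun x : ℝ × E6 =>
      pd a (fun z => metricField (φ + x.1 • α) (ω + x.1 • β) z b c) x.2) (0, y) := fun a b c =>
    contDiffAt_pd_family (f := fun t z => metricField (φ + t • α) (ω + t • β) z b c)
      (contDiffAt_metric_family h v hy b c) a
  exact contDiffAt_const.mul (ContDiffAt.sum fun s _ =>
    (contDiffAt_metric_inv_family h v hy k s).mul (((hp _ _ _).add (hp _ _ _)).sub (hp _ _ _)))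

theorem contDiffAt_christoffel (k p q : Fin 6) :
    ContDiffAt ℝ Cinf (fun z => christoffel (metricField φ ω) z k p q) y := by
  have h1 := contDiffAt_christoffel_family h v hy k p q
  have h2 := ContDiffAt.comp (f := fun z : E6 => ((0 : ℝ), z)) y h1
    (contDiffAt_const.prodMk contDiffAt_id)
  simpa [Function.comp_def] using h2

theorem contDiffAt_deTurck_family (k : Fin 6) : ContDiffAt ℝ Cinf (fun x : ℝ × E6 =>
    deTurck (metricField φ ω) (φ + x.1 • α) (ω + x.1 • β) x.2 k) (0, y) := by
  have hg : ∀ p q, ContDiffAt ℝ Cinf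
      (fun x : ℝ × E6 => christoffel (metricField φ ω) x.2 k p q) (0, y) := fun p q =>
    ContDiffAt.comp (f := (Prod.snd : ℝ × E6 → E6)) (0, y) (contDiffAt_christoffel h v hy k p q)
      contDiffAt_snd
  refine ((contDiffAt_normSq_family h v hy).mul (ContDiffAt.sum fun p _ => ContDiffAt.sum fun q _ =>
    (contDiffAt_metric_inv_family h v hy p q).mul
      ((contDiffAt_christoffel_family h v hy k p q).sub (hg p q)))).sub
    (ContDiffAt.sum fun l _ => (contDiffAt_metric_inv_family h v hy l k).mul ?_)
  exact contDiffAt_pd_family (f := fun t z => normSq ((φ + t • α) z) ((ω + t • β) z))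
    (contDiffAt_normSq_family h v hy) l

end

/-- The covector field `g_{kl} δV^l` of the linearized vector field `V`, from the covariant
derivatives `D = ∇δg` and `N = d(δ|φ|²)`, as a tensor expression with inverse metric `w`. -/
def deTurckForm (w : Matrix (Fin 6) (Fin 6) ℝ) (n : ℝ) (D : Tens 3) (N : Tens 1) : Tens 1 :=
  n • (contr (k := 1) w D + (-(1 / 2) : ℝ) • contr (k := 1) w fun i => D (i ∘ (finRotate 3).symm)) +
    (-1 : ℝ) • N

theorem deTurckForm_apply (w : Matrix (Fin 6) (Fin 6) ℝ) (n : ℝ) (D : Tens 3) (N : Tens 1)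
    (s : Fin 6) : deTurckForm w n D N ![s] =
      n * (∑ p, ∑ q, w p q * (D ![p, q, s] - (1 / 2 : ℝ) * D ![s, p, q])) - N ![s] := by
  have e : ∀ p q, (Fin.cons p (Fin.cons q ![s]) : Fin 3 → Fin 6) ∘ (finRotate 3).symm =
      ![s, p, q] := by
    intro p q; ext a; fin_cases a <;> rfl
  have e1 : contr (k := 1) w D ![s] = ∑ p, ∑ q, w p q * D ![p, q, s] := rfl
  have e2 : contr (k := 1) w (fun i => D (i ∘ (finRotate 3).symm)) ![s] =
      ∑ p, ∑ q, w p q * D ![s, p, q] :=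
    Finset.sum_congr rfl fun p _ => Finset.sum_congr rfl fun q _ => by
      show w p q * D (_ ∘ _) = _
      rw [e]
  have e3 : ∑ p, ∑ q, w p q * (D ![p, q, s] - (1 / 2 : ℝ) * D ![s, p, q]) =
      ∑ p, ∑ q, w p q * D ![p, q, s] - (1 / 2 : ℝ) * ∑ p, ∑ q, w p q * D ![s, p, q] := by
    simp only [Finset.mul_sum, ← Finset.sum_sub_distrib]
    exact Finset.sum_congr rfl fun _ _ => Finset.sum_congr rfl fun _ _ => by ring
  simp only [deTurckForm, Pi.add_apply, Pi.smul_apply, smul_eq_mul, e1, e2, e3]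
  ring

theorem metric_symm (φ : Tens 3) {ω : Tens 2} (hω : IsAlt ω) (i j : Fin 6) :
    metric φ ω i j = metric φ ω j i := by
  have hw : ∀ a b, omegaInv ω a b = -omegaInv ω b a := fun a b => by
    have := congrFun (congrFun (omegaInv_transpose hω) b) a
    simpa using this
  simp only [metric, Matrix.of_apply]
  congr 1
  have e : ∀ f : Fin 6 → Fin 6 → Fin 6 → Fin 6 → ℝ,
      ∑ a, ∑ b, ∑ k, ∑ p, f a b k p = ∑ k, ∑ p, ∑ a, ∑ b, f a b k p := by
    intro f
    calc _ = ∑ a, ∑ k, ∑ b, ∑ p, f a b k p :=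
          Finset.sum_congr rfl fun _ _ => Finset.sum_comm
      _ = ∑ k, ∑ a, ∑ b, ∑ p, f a b k p := Finset.sum_comm
      _ = ∑ k, ∑ a, ∑ p, ∑ b, f a b k p :=
          Finset.sum_congr rfl fun _ _ => Finset.sum_congr rfl fun _ _ => Finset.sum_comm
      _ = _ := Finset.sum_congr rfl fun _ _ => Finset.sum_comm
  rw [e]
  refine Finset.sum_congr rfl fun k _ => Finset.sum_congr rfl fun p _ =>
    Finset.sum_congr rfl fun a _ => Finset.sum_congr rfl fun b _ => ?_
  rw [hw a k, hw b p]; ring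

section

variable {U : Set E6} {φ : TField 3} {ω : TField 2} (h : IsParallelModel U φ ω)
  {α : TField 3} {β : TField 2} (v : IsVariation U α β) {y : E6} (hy : y ∈ U)
include h v hy

omit v in
theorem hasDerivAt_metric_family (i j : Fin 6) :
    HasDerivAt (fun t : ℝ => metricField (φ + t • α) (ω + t • β) y i j)
      (varField gF φ ω α β y ![i, j]) 0 :=
  hasDerivAt_pi.1 (hasDerivAt_comp_variedPair φ ω α β
    ((contDiffAt_gF (h.typeIIA y hy)).differentiableAt cinf_ne_zero)) ![i, j]

theorem varField_gF_symm (i j : Fin 6) :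
    varField gF φ ω α β y ![i, j] = varField gF φ ω α β y ![j, i] := by
  refine (hasDerivAt_metric_family h hy i j).unique
    ((hasDerivAt_metric_family h hy j i).congr_of_eventuallyEq (.of_forall fun t => ?_))
  exact metric_symm _ ((h.typeIIA y hy).alt_omega.add ((v.alt_snd y hy).smul t)) i j

/-- The variation of the Christoffel symbols is the tensor
`(1/2) g^{km} (∇_p h_{mq} + ∇_q h_{mp} - ∇_m h_{pq})`, where `h` is the variation of the metric. -/
theorem hasDerivAt_christoffel (k p q : Fin 6) :
    HasDerivAt (fun t : ℝ => christoffel (metricField (φ + t • α) (ω + t • β)) y k p q)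
      (∑ s, (metricField φ ω y)⁻¹ k s * ((1 / 2 : ℝ) *
        (nabla (metricField φ ω) (varField gF φ ω α β) y ![p, q, s] +
         nabla (metricField φ ω) (varField gF φ ω α β) y ![q, p, s] -
         nabla (metricField φ ω) (varField gF φ ω α β) y ![s, p, q]))) 0 := by
  set g := metricField φ ω with hg
  set G := varField gF φ ω α β with hG
  have hsymm := h.eventually_symm hy
  have hu : IsUnit (g y).det := (h.typeIIA y hy).isUnit_det_metric
  set C : Fin 6 → ℝ := fun k =>
    deriv (fun t : ℝ => christoffel (metricField (φ + t • α) (ω + t • β)) y k p q) 0 with hC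
  have z0 : φ + (0 : ℝ) • α = φ := by rw [zero_smul, add_zero]
  have z1 : ω + (0 : ℝ) • β = ω := by rw [zero_smul, add_zero]
  have hd : ∀ k, HasDerivAt
      (fun t : ℝ => christoffel (metricField (φ + t • α) (ω + t • β)) y k p q) (C k) 0 := by
    intro k
    have h1 := ContDiffAt.comp (f := fun t : ℝ => (t, y)) 0
      (contDiffAt_christoffel_family h v hy k p q) (contDiffAt_id.prodMk contDiffAt_const)
    exact (h1.differentiableAt cinf_ne_zero).hasDerivAt
  have hpd : ∀ a b c, HasDerivAt
      (fun t : ℝ => pd a (fun z => metricField (φ + t • α) (ω + t • β) z b c) y)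
      (pd a (fun z => G z ![b, c]) y) 0 := by
    intro a b c
    refine hasDerivAt_pd (f := fun t z => metricField (φ + t • α) (ω + t • β) z b c)
      (contDiffAt_metric_family h v hy b c) ?_ a
    filter_upwards [h.mem_nhds hy] with z hz using hasDerivAt_metric_family h hz b c
  have hunit : ∀ᶠ t : ℝ in nhds 0, IsUnit (metricField (φ + t • α) (ω + t • β) y).det := by
    have hc2 : ContinuousAt (fun t : ℝ => (metricField (φ + t • α) (ω + t • β) y).det) 0 :=
      (contDiffAt_det fun i j => ContDiffAt.comp (f := fun t : ℝ => (t, y)) 0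
        (contDiffAt_metric_family h v hy i j) (contDiffAt_id.prodMk contDiffAt_const)).continuousAt
    have : (metricField (φ + (0 : ℝ) • α) (ω + (0 : ℝ) • β) y).det ≠ 0 := by
      rw [z0, z1]; exact hu.ne_zero
    exact (hc2.eventually_ne this).mono fun t ht => isUnit_iff_ne_zero.2 ht
  have hGalt : ∀ a b c, pd a (fun z => G z ![b, c]) y = pd a (fun z => G z ![c, b]) y := by
    intro a b c
    have : (fun z => G z ![b, c]) =ᶠ[nhds y] fun z => G z ![c, b] := by
      filter_upwards [h.mem_nhds hy] with z hz using varField_gF_symm h v hz b c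
    rw [pd, pd, this.fderiv_eq]
  -- The identity for `g_{lk} Γ^k_{pq}` is differentiated; no derivative of `g⁻¹` is needed.
  have key : ∀ l, ∑ k, g y l k * C k = (1 / 2 : ℝ) * (nabla g G y ![p, q, l] +
      nabla g G y ![q, p, l] - nabla g G y ![l, p, q]) := by
    intro l
    have h1 := HasDerivAt.fun_sum (u := Finset.univ) fun (k : Fin 6) _ =>
      (hasDerivAt_metric_family (α := α) (β := β) h hy l k).mul (hd k)
    have h2 := (((hpd p q l).add (hpd q p l)).sub (hpd l p q)).const_mul (1 / 2 : ℝ)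
    have h3 := h1.unique (h2.congr_of_eventuallyEq (hunit.mono fun t ht =>
      sum_metric_christoffel ht l p q))
    simp only [z0, z1, Finset.sum_add_distrib] at h3
    have hn : ∀ a b c, nabla g G y ![a, b, c] = pd a (fun z => G z ![b, c]) y -
        (∑ m, connMat g y a m b * G y ![m, c] + ∑ m, connMat g y a m c * G y ![b, m]) := by
      intro a b c
      rw [← lie_two]; rfl
    have hGs : ∀ b c, G y ![b, c] = G y ![c, b] := varField_gF_symm h v hy
    have e1 : ∑ m, connMat g y q m p * G y ![m, l] = ∑ m, connMat g y p m q * G y ![m, l] :=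
      Finset.sum_congr rfl fun m _ => by rw [connMat_symm hsymm]
    have e2 : ∑ m, connMat g y l m p * G y ![m, q] = ∑ m, connMat g y p m l * G y ![q, m] :=
      Finset.sum_congr rfl fun m _ => by rw [connMat_symm hsymm, hGs]
    have e3 : ∑ m, connMat g y l m q * G y ![p, m] = ∑ m, connMat g y q m l * G y ![p, m] :=
      Finset.sum_congr rfl fun m _ => by rw [connMat_symm hsymm]
    have e4 : ∑ k, G y ![l, k] * christoffel g y k p q = ∑ m, connMat g y p m q * G y ![m, l] :=
      Finset.sum_congr rfl fun m _ => by rw [hGs, mul_comm]; rfl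
    rw [hn, hn, hn, e1, e2, e3]
    rw [e4] at h3
    linarith
  refine (hd k).congr_deriv ?_
  have h5 : (g y).mulVec C = fun s => (1 / 2 : ℝ) * (nabla g G y ![p, q, s] +
      nabla g G y ![q, p, s] - nabla g G y ![s, p, q]) := funext key
  have h6 := congrArg ((g y)⁻¹.mulVec) h5
  rw [Matrix.mulVec_mulVec, Matrix.nonsing_inv_mul _ hu, Matrix.one_mulVec] at h6
  exact congrFun h6 k

/-- At `t = 0` the Christoffel symbols of the varied metric coincide with the background ones and
`|φ|²` is constant, so only the derivatives of these two factors contribute. -/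
theorem hasDerivAt_deTurck (k : Fin 6) :
    HasDerivAt (fun t : ℝ => deTurck (metricField φ ω) (φ + t • α) (ω + t • β) y k)
      (∑ s, (metricField φ ω y)⁻¹ k s * deTurckForm (metricField φ ω y)⁻¹ (normSq (φ y) (ω y))
        (nabla (metricField φ ω) (varField gF φ ω α β) y)
        (nabla (metricField φ ω) (varField nF0 φ ω α β) y) ![s]) 0 := by
  have hT := h.typeIIA y hy
  have z0 : φ + (0 : ℝ) • α = φ := by rw [zero_smul, add_zero]
  have z1 : ω + (0 : ℝ) • β = ω := by rw [zero_smul, add_zero]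
  have hi : ∀ p q, HasDerivAt
      (fun t : ℝ => (metricField (φ + t • α) (ω + t • β) y)⁻¹ p q)
      (deriv (fun t : ℝ => (metricField (φ + t • α) (ω + t • β) y)⁻¹ p q) 0) 0 := fun p q =>
    ((ContDiffAt.comp (f := fun t : ℝ => (t, y)) 0 (contDiffAt_metric_inv_family h v hy p q)
      (contDiffAt_id.prodMk contDiffAt_const)).differentiableAt cinf_ne_zero).hasDerivAt
  have hnz : ∀ z ∈ U, HasDerivAt (fun t : ℝ => normSq ((φ + t • α) z) ((ω + t • β) z))
      (varField nF φ ω α β z) 0 := fun z hz => hasDerivAt_comp_variedPair φ ω α β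
    ((contDiffAt_nF (h.typeIIA z hz)).differentiableAt cinf_ne_zero)
  have hN : ∀ s, nabla (metricField φ ω) (varField nF0 φ ω α β) y ![s] =
      pd s (varField nF φ ω α β) y := by
    intro s
    have e : (fun z => varField nF0 φ ω α β z (Fin.tail ![s])) =ᶠ[nhds y] varField nF φ ω α β := by
      filter_upwards [h.mem_nhds hy] with z hz using fderiv_nF0 (h.typeIIA z hz) _ _
    rw [nabla]
    simp only [Finset.univ_eq_empty, Finset.sum_empty, sub_zero]
    rw [pd, e.fderiv_eq]
    rfl
  have hpn : ∀ l, HasDerivAt (fun t : ℝ => pd l (fun z => normSq ((φ + t • α) z) ((ω + t • β) z)) y)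
      (pd l (varField nF φ ω α β) y) 0 := fun l =>
    hasDerivAt_pd (f := fun t z => normSq ((φ + t • α) z) ((ω + t • β) z))
      (contDiffAt_normSq_family h v hy) (by
        filter_upwards [h.mem_nhds hy] with z hz using hnz z hz) l
  have h1 := (hnz y hy).fun_mul (HasDerivAt.fun_sum (u := Finset.univ) fun (p : Fin 6) _ =>
    HasDerivAt.fun_sum (u := Finset.univ) fun (q : Fin 6) _ =>
      (hi p q).fun_mul ((hasDerivAt_christoffel h v hy k p q).sub_const
        (christoffel (metricField φ ω) y k p q)))
  have h2 := HasDerivAt.fun_sum (u := Finset.univ) fun (l : Fin 6) _ => (hi l k).mul (hpn l)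
  refine (h1.sub h2).congr_deriv ?_
  have hs : ∀ a b, (metricField φ ω y)⁻¹ a b = (metricField φ ω y)⁻¹ b a := by
    intro a b
    have : ((metricField φ ω y)⁻¹).transpose = (metricField φ ω y)⁻¹ := by
      rw [Matrix.transpose_nonsing_inv]
      exact congrArg _ hT.metric_transpose
    exact congrFun (congrFun this b) a
  have hn0 : ∀ l, pd l (fun z => normSq (φ z) (ω z)) y = 0 := h.norm_const y hy
  simp only [z0, z1, sub_self, mul_zero, Finset.sum_const_zero, zero_add, hn0, add_zero]
  set w := (metricField φ ω y)⁻¹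
  set D := nabla (metricField φ ω) (varField gF φ ω α β) y
  simp only [deTurckForm_apply, hN]
  have e1 : ∀ s, ∑ p, ∑ q, w p q * ((1 / 2 : ℝ) * (D ![p, q, s] + D ![q, p, s] - D ![s, p, q])) =
      ∑ p, ∑ q, w p q * (D ![p, q, s] - (1 / 2 : ℝ) * D ![s, p, q]) := by
    intro s
    have e2 : ∑ p, ∑ q, w p q * D ![q, p, s] = ∑ p, ∑ q, w p q * D ![p, q, s] := by
      rw [Finset.sum_comm]
      exact Finset.sum_congr rfl fun _ _ => Finset.sum_congr rfl fun _ _ => by rw [hs]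
    have e3 : ∀ p q, w p q * ((1 / 2 : ℝ) * (D ![p, q, s] + D ![q, p, s] - D ![s, p, q])) =
        w p q * (D ![p, q, s] - (1 / 2 : ℝ) * D ![s, p, q]) +
          (1 / 2 : ℝ) * (w p q * D ![q, p, s] - w p q * D ![p, q, s]) := fun _ _ => by ring
    simp only [e3, Finset.sum_add_distrib, ← Finset.mul_sum, Finset.sum_sub_distrib, e2, sub_self,
      mul_zero, add_zero]
  have e4 : ∀ X : Fin 6 → Fin 6 → Fin 6 → ℝ, ∑ p, ∑ q, w p q * ∑ s, w k s * X p q s =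
      ∑ s, w k s * ∑ p, ∑ q, w p q * X p q s := by
    intro X
    simp only [Finset.mul_sum]
    calc _ = ∑ p, ∑ s, ∑ q, w p q * (w k s * X p q s) :=
          Finset.sum_congr rfl fun _ _ => Finset.sum_comm
      _ = ∑ s, ∑ p, ∑ q, w p q * (w k s * X p q s) := Finset.sum_comm
      _ = _ := Finset.sum_congr rfl fun _ _ => Finset.sum_congr rfl fun _ _ =>
          Finset.sum_congr rfl fun _ _ => by ring
  rw [e4, Finset.mul_sum, ← Finset.sum_sub_distrib]
  refine Finset.sum_congr rfl fun s _ => ?_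
  rw [e1, hs s k]
  ring

end

/-- The linearization `δV` of the vector field `V` at a Ricci-flat Type IIA structure. -/
def deTurckVar (φ : TField 3) (ω : TField 2) (α : TField 3) (β : TField 2) (z : E6) : Fin 6 → ℝ :=
  (metricField φ ω z)⁻¹.mulVec fun s =>
    deTurckForm (metricField φ ω z)⁻¹ (normSq (φ z) (ω z))
      (nabla (metricField φ ω) (varField gF φ ω α β) z)
      (nabla (metricField φ ω) (varField nF0 φ ω α β) z) ![s]

theorem isAlt_hat {φ : Tens 3} (h : IsAlt φ) (ω : Tens 2) : IsAlt (hat φ ω) := by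
  rw [hat_eq]
  exact h.pull _

section

variable {U : Set E6} {φ : TField 3} {ω : TField 2} (h : IsParallelModel U φ ω)
  {y : E6} (hy : y ∈ U)
include h hy

/-- `d(|φ|² φ̂) = 0`, since `φ` and `ω` are parallel. -/
theorem IsParallelModel.extD_nhF : extD (k := 3) (fun z => nhF (φ z, ω z)) y = 0 := by
  rw [extD_three (h.eventually_symm hy)
    ((isAlt_hat (h.typeIIA y hy).alt_phi (ω y)).smul _), nabla_eq_slotT]
  have : cov (metricField φ ω) (fun z => nhF (φ z, ω z)) y = 0 := by
    ext1 p
    rw [cov_comp (T := nhF) (S := fun z => (φ z, ω z))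
      ((h.contDiffAt_pair hy).differentiableAt cinf_ne_zero)
      ((contDiffAt_nhF (h.typeIIA y hy)).differentiableAt cinf_ne_zero)
      (fun P hP => nhF_pullPair P _ hP) p, h.covPair_pair hy p, map_zero]
    rfl
  rw [this]
  ext i
  simp [altD, slotT]

theorem IsParallelModel.deTurck_self (k : Fin 6) : deTurck (metricField φ ω) φ ω y k = 0 := by
  have hn0 : ∀ l, pd l (fun z => normSq (φ z) (ω z)) y = 0 := h.norm_const y hy
  simp [deTurck, hn0]

variable {α : TField 3} {β : TField 2} (v : IsVariation U α β)
include v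

theorem contDiffAt_omegaInv_family (a b : Fin 6) :
    ContDiffAt ℝ Cinf (fun p : ℝ × E6 => omegaInv ((ω + p.1 • β) p.2) a b) (0, y) := by
  refine contDiffAt_omegaInv (contDiffAt_variedPair h v hy).snd ?_ a b
  simpa using (h.typeIIA y hy).det_ne

omit h hy v in
theorem contDiffAt_slice {f : ℝ × E6 → ℝ} (hf : ContDiffAt ℝ Cinf f (0, y)) :
    DifferentiableAt ℝ (fun t : ℝ => f (t, y)) 0 :=
  (ContDiffAt.comp (f := fun t : ℝ => (t, y)) 0 hf
    (contDiffAt_id.prodMk contDiffAt_const)).differentiableAt cinf_ne_zero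

theorem contDiffAt_nhF_family (i : Fin 3 → Fin 6) : ContDiffAt ℝ Cinf (fun p : ℝ × E6 =>
    (normSq ((φ + p.1 • α) p.2) ((ω + p.1 • β) p.2) •
      hat ((φ + p.1 • α) p.2) ((ω + p.1 • β) p.2)) i) (0, y) :=
  contDiffAt_pi.1 (contDiffAt_comp_variedPair h v hy (contDiffAt_nhF (h.typeIIA y hy))) i

theorem contDiffAt_contractOmega_family (i : Fin 2 → Fin 6) :
    ContDiffAt ℝ Cinf (fun p : ℝ × E6 => contractOmega (k := 2) ((ω + p.1 • β) p.2)
      (extD (k := 3) (fun w => normSq ((φ + p.1 • α) w) ((ω + p.1 • β) w) •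
        hat ((φ + p.1 • α) w) ((ω + p.1 • β) w)) p.2) i) (0, y) :=
  contDiffAt_const.mul (ContDiffAt.sum fun a _ => ContDiffAt.sum fun b _ =>
    (contDiffAt_omegaInv_family h hy v a b).mul
      (contDiffAt_extD_family (f := fun t w => normSq ((φ + t • α) w) ((ω + t • β) w) •
        hat ((φ + t • α) w) ((ω + t • β) w)) (contDiffAt_nhF_family h hy v) _))

/-- Since `d(|φ|² φ̂) = 0` at `t = 0`, the variation of `Λ_ω` does not contribute. -/
theorem hasDerivAt_contractOmega :
    HasDerivAt (fun t : ℝ => contractOmega (k := 2) ((ω + t • β) y)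
      (extD (k := 3) (fun w => normSq ((φ + t • α) w) ((ω + t • β) w) •
        hat ((φ + t • α) w) ((ω + t • β) w)) y))
      (contractOmega (k := 2) (ω y) (extD (k := 3) (varField nhF φ ω α β) y)) 0 := by
  have z0 : φ + (0 : ℝ) • α = φ := by rw [zero_smul, add_zero]
  have z1 : ω + (0 : ℝ) • β = ω := by rw [zero_smul, add_zero]
  have hX : HasDerivAt (fun t : ℝ => extD (k := 3)
      (fun w => normSq ((φ + t • α) w) ((ω + t • β) w) •
        hat ((φ + t • α) w) ((ω + t • β) w)) y) (extD (k := 3) (varField nhF φ ω α β) y) 0 := by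
    refine hasDerivAt_extD (f := fun t w => normSq ((φ + t • α) w) ((ω + t • β) w) •
        hat ((φ + t • α) w) ((ω + t • β) w)) (contDiffAt_nhF_family h hy v) ?_
    filter_upwards [h.mem_nhds hy] with z hz
    exact hasDerivAt_comp_variedPair φ ω α β
      ((contDiffAt_nhF (h.typeIIA z hz)).differentiableAt cinf_ne_zero)
  have hX0 : extD (k := 3) (fun w => normSq (φ w) (ω w) • hat (φ w) (ω w)) y = 0 :=
    h.extD_nhF hy
  refine hasDerivAt_pi.2 fun i => ?_
  refine (HasDerivAt.const_mul (1 / 2 : ℝ) (HasDerivAt.fun_sum (u := Finset.univ) fun a _ =>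
    HasDerivAt.fun_sum (u := Finset.univ) fun b _ =>
      (contDiffAt_slice (contDiffAt_omegaInv_family h hy v a b)).hasDerivAt.fun_mul
        (hasDerivAt_pi.1 hX (Fin.cons b (Fin.cons a i))))).congr_deriv ?_
  simp only [z0, z1, hX0, Pi.zero_apply, mul_zero, zero_add]
  rfl

theorem contDiffAt_interior_family {k : ℕ} {f : ℝ → TField (k + 1)}
    (hf : ∀ i, ContDiffAt ℝ Cinf (fun p : ℝ × E6 => f p.1 p.2 i) (0, y)) (i : Fin k → Fin 6) :
    ContDiffAt ℝ Cinf (fun p : ℝ × E6 => interior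
      (deTurck (metricField φ ω) (φ + p.1 • α) (ω + p.1 • β) p.2) (f p.1 p.2) i) (0, y) :=
  ContDiffAt.sum fun a _ => (contDiffAt_deTurck_family h v hy a).mul (hf _)

/-- Since `V = 0` at `t = 0`, the variation of the form does not contribute. -/
theorem hasDerivAt_interior {k : ℕ} {f : ℝ → TField (k + 1)}
    (hf : ∀ i, ContDiffAt ℝ Cinf (fun p : ℝ × E6 => f p.1 p.2 i) (0, y)) :
    HasDerivAt (fun t : ℝ => interior
      (deTurck (metricField φ ω) (φ + t • α) (ω + t • β) y) (f t y))
      (interior (deTurckVar φ ω α β y) (f 0 y)) 0 := by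
  have z0 : φ + (0 : ℝ) • α = φ := by rw [zero_smul, add_zero]
  have z1 : ω + (0 : ℝ) • β = ω := by rw [zero_smul, add_zero]
  refine hasDerivAt_pi.2 fun i => ?_
  refine (HasDerivAt.fun_sum (u := Finset.univ) fun a _ =>
    (hasDerivAt_deTurck h v hy a).fun_mul (contDiffAt_slice (hf (Fin.cons a i))).hasDerivAt).congr_deriv
      ?_
  simp only [z0, z1, h.deTurck_self hy, zero_mul, add_zero]
  rfl

theorem contDiffAt_fst_family (i : Fin 3 → Fin 6) :
    ContDiffAt ℝ Cinf (fun p : ℝ × E6 => (φ + p.1 • α) p.2 i) (0, y) :=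
  contDiffAt_pi.1 (contDiffAt_variedPair h v hy).fst i

theorem contDiffAt_snd_family (i : Fin 2 → Fin 6) :
    ContDiffAt ℝ Cinf (fun p : ℝ × E6 => (ω + p.1 • β) p.2 i) (0, y) :=
  contDiffAt_pi.1 (contDiffAt_variedPair h v hy).snd i

/-- The linearization of `E` is the exterior derivative of an explicit two-form. -/
theorem hasDerivAt_flowE :
    HasDerivAt (fun t : ℝ => flowE (metricField φ ω) (φ + t • α) (ω + t • β) y)
      (extD (k := 2) (fun z => contractOmega (k := 2) (ω z) (extD (k := 3) (varField nhF φ ω α β) z) +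
        interior (k := 2) (deTurckVar φ ω α β z) (φ z)) y) 0 := by
  have z0 : φ + (0 : ℝ) • α = φ := by rw [zero_smul, add_zero]
  have hc := contDiffAt_contractOmega_family h hy v
  have hi := contDiffAt_interior_family h hy v (k := 2) (f := fun t z => (φ + t • α) z)
    (contDiffAt_fst_family h hy v)
  have hc' : ∀ᶠ z in nhds y, HasDerivAt (fun t : ℝ => contractOmega (k := 2) ((ω + t • β) z)
      (extD (k := 3) (fun w => normSq ((φ + t • α) w) ((ω + t • β) w) •
        hat ((φ + t • α) w) ((ω + t • β) w)) z))
      (contractOmega (k := 2) (ω z) (extD (k := 3) (varField nhF φ ω α β) z)) 0 := by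
    filter_upwards [h.mem_nhds hy] with z hz using hasDerivAt_contractOmega h hz v
  have hi' : ∀ᶠ z in nhds y, HasDerivAt (fun t : ℝ => interior (k := 2)
      (deTurck (metricField φ ω) (φ + t • α) (ω + t • β) z) ((φ + t • α) z))
      (interior (k := 2) (deTurckVar φ ω α β z) (φ z)) 0 := by
    filter_upwards [h.mem_nhds hy] with z hz
    have := hasDerivAt_interior h hz v (k := 2) (f := fun t z => (φ + t • α) z)
      (contDiffAt_fst_family h hz v)
    simpa only [z0] using this
  rw [extD_add
    ((contDiffAt_of_hasDerivAt (f := fun t z => contractOmega (k := 2) ((ω + t • β) z)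
      (extD (k := 3) (fun w => normSq ((φ + t • α) w) ((ω + t • β) w) •
        hat ((φ + t • α) w) ((ω + t • β) w)) z)) hc hc').differentiableAt cinf_ne_zero)
    ((contDiffAt_of_hasDerivAt (f := fun t z => interior (k := 2)
      (deTurck (metricField φ ω) (φ + t • α) (ω + t • β) z) ((φ + t • α) z))
      hi hi').differentiableAt cinf_ne_zero)]
  exact (hasDerivAt_extD (f := fun t z => contractOmega (k := 2) ((ω + t • β) z)
      (extD (k := 3) (fun w => normSq ((φ + t • α) w) ((ω + t • β) w) •
        hat ((φ + t • α) w) ((ω + t • β) w)) z)) hc hc').add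
    (hasDerivAt_extD (f := fun t z => interior (k := 2)
      (deTurck (metricField φ ω) (φ + t • α) (ω + t • β) z) ((φ + t • α) z)) hi hi')

theorem hasDerivAt_flowF :
    HasDerivAt (fun t : ℝ => flowF (metricField φ ω) (φ + t • α) (ω + t • β) y)
      (extD (k := 1) (fun z => interior (k := 1) (deTurckVar φ ω α β z) (ω z)) y) 0 := by
  have z1 : ω + (0 : ℝ) • β = ω := by rw [zero_smul, add_zero]
  refine hasDerivAt_extD (f := fun t z => interior (k := 1)
      (deTurck (metricField φ ω) (φ + t • α) (ω + t • β) z) ((ω + t • β) z))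
    (contDiffAt_interior_family h hy v (k := 1) (f := fun t z => (ω + t • β) z)
      (contDiffAt_snd_family h hy v)) ?_
  filter_upwards [h.mem_nhds hy] with z hz
  have := hasDerivAt_interior h hz v (k := 1) (f := fun t z => (ω + t • β) z)
    (contDiffAt_snd_family h hz v)
  simpa only [z1] using this

end

/-! ### The first-order invariants of a variation -/

/-- The one-form `⋆(α ∧ ω + φ ∧ β)` of a variation `(α, β)` of `(φ, ω)` at a point. -/
def defect (s σ : Tens 3 × Tens 2) : Tens 1 :=
  hodgeStar (p := 5) (q := 1) (metric s.1 s.2) (volForm s.2) (wedge σ.1 s.2 + wedge s.1 σ.2)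

/-- The ratio `φ ∧ α / vol` of a variation `(α, β)` of `(φ, ω)` at a point. -/
def topRatio (s σ : Tens 3 × Tens 2) : Tens 0 := fun _ =>
  wedge (p := 3) (q := 3) s.1 σ.1 id / vol s.2

theorem hodgeStar_add {p q : ℕ} (g : Matrix (Fin 6) (Fin 6) ℝ) (v : Tens (p + q)) (A B : Tens p) :
    hodgeStar g v (A + B) = hodgeStar g v A + hodgeStar g v B := by
  ext j
  simp only [hodgeStar, Pi.add_apply, mul_add, add_mul, Finset.sum_add_distrib]

theorem hodgeStar_smul {p q : ℕ} (g : Matrix (Fin 6) (Fin 6) ℝ) (v : Tens (p + q)) (c : ℝ)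
    (A : Tens p) : hodgeStar g v (c • A) = c • hodgeStar g v A := by
  ext j
  simp only [hodgeStar, Pi.smul_apply, smul_eq_mul, Finset.mul_sum]
  exact Finset.sum_congr rfl fun _ _ => Finset.sum_congr rfl fun _ _ => by ring

theorem defect_add (s σ τ : Tens 3 × Tens 2) : defect s (σ + τ) = defect s σ + defect s τ := by
  simp only [defect, Prod.fst_add, Prod.snd_add, wedge_add_left, wedge_add_right,
    ← hodgeStar_add]
  congr 1
  abel

theorem defect_smul (s : Tens 3 × Tens 2) (c : ℝ) (σ : Tens 3 × Tens 2) :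
    defect s (c • σ) = c • defect s σ := by
  simp only [defect, Prod.smul_fst, Prod.smul_snd, wedge_smul_left, wedge_smul_right,
    ← hodgeStar_smul, smul_add]

/-- `defect` as a linear map of the variation. -/
def defectL (s : Tens 3 × Tens 2) : (Tens 3 × Tens 2) →L[ℝ] Tens 1 :=
  LinearMap.toContinuousLinearMap
    { toFun := defect s, map_add' := defect_add s, map_smul' := defect_smul s }

/-- `topRatio` as a linear map of the variation. -/
def topRatioL (s : Tens 3 × Tens 2) : (Tens 3 × Tens 2) →L[ℝ] Tens 0 :=
  LinearMap.toContinuousLinearMap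
    { toFun := topRatio s
      map_add' := fun σ τ => by
        ext i; simp only [topRatio, Prod.fst_add, wedge_add_right, Pi.add_apply, add_div]
      map_smul' := fun c σ => by
        ext i
        simp only [topRatio, Prod.smul_fst, wedge_smul_right, Pi.smul_apply, smul_eq_mul,
          RingHom.id_apply, mul_div_assoc] }

theorem defect_pullPair {P : Matrix (Fin 6) (Fin 6) ℝ} (hP : P.det ≠ 0) (s σ : Tens 3 × Tens 2) :
    defect (pullPair P s) (pullPair P σ) = pull P (defect s σ) := by
  simp only [defect, pullPair, ← pull_wedge, pull_volForm, ← pull_add]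
  exact hodgeStar_pull P hP _ _ _ _

theorem topRatio_pullPair {P : Matrix (Fin 6) (Fin 6) ℝ} (hP : P.det ≠ 0)
    (s σ : Tens 3 × Tens 2) :
    topRatio (pullPair P s) (pullPair P σ) = pull P (topRatio s σ) := by
  have h : pull P (topRatio s σ) = topRatio s σ := by
    ext i
    rw [pull, Fintype.sum_eq_single i fun x hx => absurd (Subsingleton.elim x i) hx]
    simp
  rw [h]
  ext i
  simp only [topRatio, pullPair, ← pull_wedge]
  exact top_div_vol_pull P hP (wedge_isAlt _ _) _

theorem contDiffAt_hodgeStar {E : Type*} [NormedAddCommGroup E] [NormedSpace ℝ E] {x : E} {p q : ℕ}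
    {g : E → Matrix (Fin 6) (Fin 6) ℝ} {v : E → Tens (p + q)} {A : E → Tens p}
    (hg : ∀ i j, ContDiffAt ℝ Cinf (fun z => (g z)⁻¹ i j) x) (hv : ContDiffAt ℝ Cinf v x)
    (hA : ContDiffAt ℝ Cinf A x) : ContDiffAt ℝ Cinf (fun z => hodgeStar (g z) (v z) (A z)) x :=
  contDiffAt_pi.2 fun _ => contDiffAt_const.mul (ContDiffAt.sum fun _ _ => ContDiffAt.sum fun _ _ =>
    ((contDiffAt_prod fun _ _ => hg _ _).mul (contDiffAt_pi.1 hA _)).mul (contDiffAt_pi.1 hv _))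

theorem contDiffAt_metric_inv {E : Type*} [NormedAddCommGroup E] [NormedSpace ℝ E] {x : E}
    {S : E → Tens 3 × Tens 2} (hS : ContDiffAt ℝ Cinf S x) (h : IsTypeIIAAt (S x).1 (S x).2)
    (i j : Fin 6) : ContDiffAt ℝ Cinf (fun z => (metric (S z).1 (S z).2)⁻¹ i j) x :=
  contDiffAt_inv_entry (contDiffAt_metric hS.fst hS.snd h.lambda_neg h.det_ne h.normSq_ne)
    h.isUnit_det_metric.ne_zero i j

theorem contDiffAt_defect {E : Type*} [NormedAddCommGroup E] [NormedSpace ℝ E] {x : E}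
    {S σ : E → Tens 3 × Tens 2} (hS : ContDiffAt ℝ Cinf S x) (hσ : ContDiffAt ℝ Cinf σ x)
    (h : IsTypeIIAAt (S x).1 (S x).2) : ContDiffAt ℝ Cinf (fun z => defect (S z) (σ z)) x :=
  contDiffAt_hodgeStar (contDiffAt_metric_inv hS h)
    ((contDiffAt_wedge (contDiffAt_wedge hS.snd hS.snd) hS.snd).const_smul (1 / 6 : ℝ))
    ((contDiffAt_wedge hσ.fst hS.snd).add (contDiffAt_wedge hS.fst hσ.snd))

theorem contDiffAt_topRatio {E : Type*} [NormedAddCommGroup E] [NormedSpace ℝ E] {x : E}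
    {S σ : E → Tens 3 × Tens 2} (hS : ContDiffAt ℝ Cinf S x) (hσ : ContDiffAt ℝ Cinf σ x)
    (h : IsTypeIIAAt (S x).1 (S x).2) : ContDiffAt ℝ Cinf (fun z => topRatio (S z) (σ z)) x :=
  contDiffAt_pi.2 fun _ => (contDiffAt_pi.1 (contDiffAt_wedge hS.fst hσ.fst) id).div
    (contDiffAt_vol hS.snd) (vol_ne_zero h.lambda_neg)

theorem sum_mul_top {F v : Tens 6} (hv : IsAlt v) :
    ∑ i, F i * v i = (∑ σ : Equiv.Perm (Fin 6), ((Equiv.Perm.sign σ : ℤ) : ℝ) * F σ) * v id := by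
  rw [Finset.sum_mul]
  refine (Fintype.sum_of_injective (fun σ : Equiv.Perm (Fin 6) => (σ : Fin 6 → Fin 6))
    DFunLike.coe_injective _ _ ?_ ?_).symm
  · intro j hj
    have : ¬ Function.Injective j := fun h => hj
      ⟨Equiv.ofBijective j (Finite.injective_iff_bijective.1 h), rfl⟩
    simp only [Function.Injective, not_forall] at this
    obtain ⟨a, b, h, hab⟩ := this
    rw [hv.eq_zero hab h, mul_zero]
  · intro σ
    have := hv σ id
    simp only [Function.id_comp] at this
    rw [this]
    ring

/-- The Hodge star of a five-form in a unimodular orthonormal frame. -/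
theorem hodgeStar_five {A : Tens 5} (hA : IsAlt A) {v : Tens 6} (hv : IsAlt v) (j : Fin 6) :
    hodgeStar (p := 5) (q := 1) 1 v A ![j] = (-1) ^ ((j : ℕ) + 1) * A j.succAbove * v id := by
  rw [← wedge_dx hA j, wedge, mul_assoc]
  have h := sum_mul_top (F := fun i => A (fun a => i (Fin.castAdd 1 a)) *
    dx j (fun b => i (Fin.natAdd 5 b))) hv
  simp only [← mul_assoc] at h
  have e : ∑ i, A (fun a => i (Fin.castAdd 1 a)) * dx j (fun b => i (Fin.natAdd 5 b)) * v i =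
      ∑ i : Fin 5 → Fin 6, A i * v (Fin.append i ![j]) := by
    refine (sum_append (p := 5) (q := 1) _).trans ?_
    refine Finset.sum_congr rfl fun a _ => ?_
    have e1 : ∀ b : Fin 1 → Fin 6, (fun x => Fin.append a b (Fin.castAdd 1 x)) = a := fun b =>
      funext fun x => Fin.append_left a b x
    have e2 : ∀ b : Fin 1 → Fin 6, (fun x => Fin.append a b (Fin.natAdd 5 x)) = b := fun b =>
      funext fun x => Fin.append_right a b x
    simp only [e1, e2]
    rw [Finset.sum_eq_single ![j]]
    · simp [dx]
    · intro b _ hb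
      have : b 0 ≠ j := fun h => hb (by ext x; fin_cases x; simp [h])
      simp [dx, this]
    · simp
  rw [hodgeStar_eq, inv_one, Matrix.transpose_one, pull_one, ← e]
  rw [h]
  simp [Nat.factorial]

/-! ### Universal tensor expressions -/

namespace TensorExpr

/-- Every tensor expression is equivariant under linear coordinate changes. -/
theorem eval_pull {P : Matrix (Fin 6) (Fin 6) ℝ} (hP : P.det ≠ 0) (φ : Tens 3) (ω : Tens 2) {n : ℕ}
    (T : TensorExpr n) : T.eval (pull P φ) (pull P ω) = pull P (T.eval φ ω) := by
  induction T with
  | phi => rfl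
  | omega => rfl
  | metric => exact metricTens_pull P hP φ ω
  | add S T hS hT => rw [eval, hS, hT, ← pull_add]; rfl
  | smul c T hT => rw [eval, hT, ← pull_smul]; rfl
  | perm σ T hT => rw [eval, hT]; exact (pull_perm P σ _).symm
  | prod S T hS hT => rw [eval, hS, hT]; exact (pull_tprod P _ _).symm
  | contract T hT =>
    rw [eval, hT]
    exact pull_contr_of_eq P (conj_metric_inv_pull P hP φ ω) _

theorem star_eq_contr {n : ℕ} (T : TensorExpr (n + 2)) (φ : Tens 3) (ω : Tens 2) (A : Tens 2) :
    T.star φ ω A = contr ((TypeIIA.metric φ ω)⁻¹ * toMatrix A * (TypeIIA.metric φ ω)⁻¹.transpose)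
      (T.eval φ ω) := by
  ext i
  refine Finset.sum_congr rfl fun p _ => Finset.sum_congr rfl fun q _ => ?_
  simp only [Matrix.mul_apply, Finset.sum_mul, Matrix.transpose_apply, toMatrix, Matrix.of_apply]
  rw [Finset.sum_comm]
  exact Finset.sum_congr rfl fun _ _ => Finset.sum_congr rfl fun _ _ => by ring

theorem star_pull {P : Matrix (Fin 6) (Fin 6) ℝ} (hP : P.det ≠ 0) (φ : Tens 3) (ω : Tens 2) {n : ℕ}
    (T : TensorExpr (n + 2)) (A : Tens 2) :
    T.star (pull P φ) (pull P ω) (pull P A) = pull P (T.star φ ω A) := by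
  rw [star_eq_contr, star_eq_contr, eval_pull hP]
  refine pull_contr_of_eq P ?_ _
  rw [toMatrix_pull, ← conj_metric_inv_pull P hP φ ω]
  simp only [Matrix.transpose_mul, Matrix.transpose_transpose, Matrix.mul_assoc]

theorem star_zero {n : ℕ} (T : TensorExpr (n + 2)) (φ : Tens 3) (ω : Tens 2) :
    T.star φ ω 0 = 0 := by
  ext i; simp [star]

section Smooth

variable {E : Type*} [NormedAddCommGroup E] [NormedSpace ℝ E] {x : E} {S : E → Tens 3 × Tens 2}
  (hS : ContDiffAt ℝ Cinf S x) (h : IsTypeIIAAt (S x).1 (S x).2)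
include hS h

theorem contDiffAt_eval {n : ℕ} (T : TensorExpr n) :
    ContDiffAt ℝ Cinf (fun z => T.eval (S z).1 (S z).2) x := by
  induction T with
  | phi => exact hS.fst
  | omega => exact hS.snd
  | metric =>
    exact contDiffAt_pi.2 fun i =>
      contDiffAt_metric hS.fst hS.snd h.lambda_neg h.det_ne h.normSq_ne (i 0) (i 1)
  | add S T hS hT => exact hS.add hT
  | smul c T hT => exact hT.const_smul c
  | perm σ T hT => exact contDiffAt_pi.2 fun i => contDiffAt_pi.1 hT (i ∘ σ)
  | prod S T hS hT =>
    exact contDiffAt_pi.2 fun i => (contDiffAt_pi.1 hS _).mul (contDiffAt_pi.1 hT _)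
  | contract T hT =>
    exact contDiffAt_pi.2 fun i => ContDiffAt.sum fun p _ => ContDiffAt.sum fun q _ =>
      (contDiffAt_metric_inv hS h p q).mul (contDiffAt_pi.1 hT _)

theorem contDiffAt_star {n : ℕ} (T : TensorExpr (n + 2)) {A : E → Tens 2}
    (hA : ContDiffAt ℝ Cinf A x) :
    ContDiffAt ℝ Cinf (fun z => T.star (S z).1 (S z).2 (A z)) x :=
  contDiffAt_pi.2 fun _ => ContDiffAt.sum fun p _ => ContDiffAt.sum fun q _ =>
    ContDiffAt.sum fun r _ => ContDiffAt.sum fun s _ =>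
      (((contDiffAt_metric_inv hS h p r).mul (contDiffAt_metric_inv hS h q s)).mul
        (contDiffAt_pi.1 (contDiffAt_eval hS h T) _)).mul (contDiffAt_pi.1 hA _)

end Smooth

/-- The scalar `φ_{abc} φ^{abc} = 6 |φ|²`. -/
def phiSq : TensorExpr 0 :=
  .contract (n := 0) (.contract (n := 2) (.contract (n := 4)
    (.perm (n := 6) ⟨![0, 2, 4, 1, 3, 5], ![0, 3, 1, 4, 2, 5], by decide, by decide⟩
      (.prod (m := 3) (n := 3) .phi .phi))))

/-- The tensor `ω_{pi} ω_{qj} - ω_{pj} ω_{qi}` with the order `p, q, i, j` of the indices. -/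
def omegaSq : TensorExpr 4 :=
  .add (.perm (n := 4) ⟨![0, 2, 1, 3], ![0, 2, 1, 3], by decide, by decide⟩
      (.prod (m := 2) (n := 2) .omega .omega))
    (.smul (-1) (.perm (n := 4) ⟨![0, 3, 1, 2], ![0, 2, 3, 1], by decide, by decide⟩
      (.prod (m := 2) (n := 2) .omega .omega)))

/-- The tensor `𝓔₁ = (|φ|² / 2) (ω_{pi} ω_{qj} - ω_{pj} ω_{qi})`. -/
def defectE : TensorExpr (2 + 2) := .smul (1 / 12) (.prod (m := 0) (n := 4) phiSq omegaSq)

/-- The tensor `𝓔₂ = 2 φ_{apq} g^{ab} ω_{bi}`. -/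
def defectF : TensorExpr (1 + 2) :=
  .smul 2 (.contract (n := 3)
    (.perm (n := 5) ⟨![0, 2, 3, 1, 4], ![0, 3, 1, 2, 4], by decide, by decide⟩
      (.prod (m := 3) (n := 2) .phi .omega)))

theorem eval_phiSq (φ : Tens 3) (ω : Tens 2) (i : Fin 0 → Fin 6) :
    phiSq.eval φ ω i = ∑ c, ∑ c', (TypeIIA.metric φ ω)⁻¹ c c' * ∑ b, ∑ b',
      (TypeIIA.metric φ ω)⁻¹ b b' * ∑ a, ∑ a', (TypeIIA.metric φ ω)⁻¹ a a' *
        (φ ![a, b, c] * φ ![a', b', c']) := by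
  refine Finset.sum_congr rfl fun c _ => Finset.sum_congr rfl fun c' _ =>
    congrArg (fun x : ℝ => (TypeIIA.metric φ ω)⁻¹ c c' * x) ?_
  refine Finset.sum_congr rfl fun b _ => Finset.sum_congr rfl fun b' _ =>
    congrArg (fun x : ℝ => (TypeIIA.metric φ ω)⁻¹ b b' * x) ?_
  refine Finset.sum_congr rfl fun a _ => Finset.sum_congr rfl fun a' _ =>
    congrArg (fun x : ℝ => (TypeIIA.metric φ ω)⁻¹ a a' * x) ?_
  refine congrArg₂ (fun a b : ℝ => a * b) (congrArg φ ?_) (congrArg φ ?_) <;> ext x <;> fin_cases x <;> rfl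

theorem eval_omegaSq (φ : Tens 3) (ω : Tens 2) (i : Fin 4 → Fin 6) :
    omegaSq.eval φ ω i = ω ![i 0, i 2] * ω ![i 1, i 3] - ω ![i 0, i 3] * ω ![i 1, i 2] := by
  have e : omegaSq.eval φ ω i = ω ![i 0, i 2] * ω ![i 1, i 3] +
      (-1) * (ω ![i 0, i 3] * ω ![i 1, i 2]) := by
    refine congrArg₂ (fun a b : ℝ => a + b) ?_ (congrArg (fun a : ℝ => (-1) * a) ?_) <;>
    refine congrArg₂ (fun a b : ℝ => a * b) (congrArg ω ?_) (congrArg ω ?_) <;> ext x <;> fin_cases x <;> rfl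
  rw [e]; ring

theorem eval_defectE (φ : Tens 3) (ω : Tens 2) (i : Fin 4 → Fin 6) :
    defectE.eval φ ω i = 1 / 12 * (phiSq.eval φ ω ![] *
      (ω ![i 0, i 2] * ω ![i 1, i 3] - ω ![i 0, i 3] * ω ![i 1, i 2])) := by
  have e1 : (fun a : Fin 0 => i (Fin.castAdd 4 a)) = ![] := Subsingleton.elim _ _
  have e2 : (fun b : Fin 4 => i (Fin.natAdd 0 b)) = i := by
    ext b; fin_cases b <;> rfl
  have e : defectE.eval φ ω i = 1 / 12 * (phiSq.eval φ ω (fun a : Fin 0 => i (Fin.castAdd 4 a)) *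
      omegaSq.eval φ ω fun b : Fin 4 => i (Fin.natAdd 0 b)) := rfl
  rw [e, e1, e2, eval_omegaSq]

theorem eval_defectF (φ : Tens 3) (ω : Tens 2) (i : Fin 3 → Fin 6) :
    defectF.eval φ ω i = 2 * ∑ a, ∑ b, (TypeIIA.metric φ ω)⁻¹ a b *
      (φ ![a, i 0, i 1] * ω ![b, i 2]) := by
  refine congrArg (fun a : ℝ => 2 * a) (Finset.sum_congr rfl fun a _ =>
    Finset.sum_congr rfl fun b _ => congrArg (fun x : ℝ => (TypeIIA.metric φ ω)⁻¹ a b * x) ?_)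
  refine congrArg₂ (fun a b : ℝ => a * b) (congrArg φ ?_) (congrArg ω ?_) <;> ext x <;> fin_cases x <;> rfl

end TensorExpr

theorem isAlt_two_of_swap {X : Tens 2} (h : ∀ i j, X ![j, i] = -X ![i, j]) : IsAlt X := by
  intro σ i
  have e : ∀ i : Fin 2 → Fin 6, i = ![i 0, i 1] := fun i => by ext a; fin_cases a <;> rfl
  rw [e (i ∘ σ), e i]
  obtain hσ | hσ : σ = 1 ∨ σ = Equiv.swap 0 1 := by
    revert σ; decide
  · subst hσ; simp
  · subst hσ; simp [h (i 0) (i 1)]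

theorem isAlt_star_defectE (φ : Tens 3) (ω : Tens 2) (A : Tens 2) :
    IsAlt (TensorExpr.defectE.star φ ω A) := by
  refine isAlt_two_of_swap fun i j => ?_
  simp only [TensorExpr.star, ← Finset.sum_neg_distrib]
  refine Finset.sum_congr rfl fun p _ => Finset.sum_congr rfl fun q _ =>
    Finset.sum_congr rfl fun r _ => Finset.sum_congr rfl fun s _ => ?_
  have e : ∀ i j : Fin 6, TensorExpr.defectE.eval φ ω (Fin.cons p (Fin.cons q ![i, j])) =
      1 / 12 * (TensorExpr.phiSq.eval φ ω ![] * (ω ![p, i] * ω ![q, j] - ω ![p, j] * ω ![q, i])) :=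
    fun i j => TensorExpr.eval_defectE φ ω _
  rw [e, e]
  ring

/-! ### The linearized operators at a point -/

/-- The linearization of the vector field `V` at a parallel pair `s = (φ, ω)`, as a function of the
first covariant derivatives `σ` of the variation. -/
def linV (s : Tens 3 × Tens 2) (σ : Fin 6 → Tens 3 × Tens 2) : Fin 6 → ℝ :=
  (metric s.1 s.2)⁻¹.mulVec fun k => deTurckForm (metric s.1 s.2)⁻¹ (normSq s.1 s.2)
    (slotT fun p => fderiv ℝ gF s (σ p)) (slotT fun p => fderiv ℝ nF0 s (σ p)) ![k]

/-- The potential of the linearization of `E`, as a function of the first covariant derivatives of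
the variation. -/
def linE (s : Tens 3 × Tens 2) (σ : Fin 6 → Tens 3 × Tens 2) : Tens 2 :=
  contractOmega (k := 2) s.2 (altD (slotT fun p => fderiv ℝ nhF s (σ p))) +
    interior (k := 2) (linV s σ) s.1

/-- The potential of the linearization of `F`, as a function of the first covariant derivatives of
the variation. -/
def linF (s : Tens 3 × Tens 2) (σ : Fin 6 → Tens 3 × Tens 2) : Tens 1 :=
  interior (k := 1) (linV s σ) s.2

/-- The sum of `-|φ|² d⋆α`, of a contraction with the derivative of the defect, and of the exact form
`d (|φ|² / 2 ⋆(α ∧ ω - φ ∧ β))`, as a function of the first covariant derivatives of `(α, β)`. -/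
def ansE (s : Tens 3 × Tens 2) (σ : Fin 6 → Tens 3 × Tens 2) : Tens 2 :=
  normSq s.1 s.2 • contr (k := 2) (metric s.1 s.2)⁻¹ (slotT fun p => (σ p).1) +
    TensorExpr.defectE.star s.1 s.2 (slotT fun p => defect s (σ p)) +
    altD (slotT fun p => (normSq s.1 s.2 / 2) • defect s ((σ p).1, -(σ p).2))

/-- The sum of `-|φ|² d⋆β`, of a contraction with the derivative of the defect, and of the exact form
`d (2 φ ∧ α / vol)`, as a function of the first covariant derivatives of `(α, β)`. -/
def ansF (s : Tens 3 × Tens 2) (σ : Fin 6 → Tens 3 × Tens 2) : Tens 1 :=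
  normSq s.1 s.2 • contr (k := 1) (metric s.1 s.2)⁻¹ (slotT fun p => (σ p).2) +
    TensorExpr.defectF.star s.1 s.2 (slotT fun p => defect s (σ p)) +
    altD (slotT fun p => (2 : ℝ) • topRatio s (σ p))

/-! ### The linearized operators in a standard frame -/

theorem sum_omega0 (i : Fin 6) (f : Fin 6 → ℝ) :
    ∑ p, omega0 ![p, i] * f p = ![-f 1, f 0, -f 3, f 2, -f 5, f 4] i := by
  fin_cases i <;> simp [Fin.sum_univ_six, omega0, J0]

theorem altD_slotT_one (f : Fin 6 → Tens 1) (i j : Fin 6) :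
    altD (slotT f) ![i, j] = f i ![j] - f j ![i] := by
  rw [altD_one]
  rfl

theorem altD_slotT_three (f : Fin 6 → Tens 3) (u v i j : Fin 6) :
    altD (slotT f) ![u, v, i, j] =
      f u ![v, i, j] - f v ![u, i, j] + f i ![u, v, j] - f j ![u, v, i] := by
  rw [altD_three]
  rfl

section

variable {c : ℝ} (hc : 0 < c) {a : Fin 6 → Tens 3} {b : Fin 6 → Tens 2} (ha : ∀ p, IsAlt (a p))
  (hb : ∀ p, IsAlt (b p))

include hc in
/-- The components of `⋆(α ∧ ω + φ ∧ β)` in the standard frame. -/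
theorem defect_std {A : Tens 3} {B : Tens 2} (hA : IsAlt A) (hB : IsAlt B) :
    defect (stdPair c) (c • A, B) ![0] =
      c * (-A ![1, 2, 3] - A ![1, 4, 5] + B ![2, 5] + B ![3, 4]) ∧
    defect (stdPair c) (c • A, B) ![1] =
      c * (A ![0, 2, 3] + A ![0, 4, 5] + B ![2, 4] - B ![3, 5]) ∧
    defect (stdPair c) (c • A, B) ![2] =
      c * (-A ![0, 1, 3] - A ![3, 4, 5] - B ![0, 5] - B ![1, 4]) ∧
    defect (stdPair c) (c • A, B) ![3] =
      c * (A ![0, 1, 2] + A ![2, 4, 5] - B ![0, 4] + B ![1, 5]) ∧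
    defect (stdPair c) (c • A, B) ![4] =
      c * (-A ![0, 1, 5] - A ![2, 3, 5] + B ![0, 3] + B ![1, 2]) ∧
    defect (stdPair c) (c • A, B) ![5] =
      c * (A ![0, 1, 4] + A ![2, 3, 4] + B ![0, 2] - B ![1, 3]) := by
  have h : ∀ j : Fin 6, defect (stdPair c) (c • A, B) ![j] = (-1) ^ ((j : ℕ) + 1) *
      (wedge (c • A) omega0 (j.succAbove) + wedge (c • phi0) B (j.succAbove)) := by
    intro j
    have e := hodgeStar_five (A := wedge (c • A) omega0 + wedge (c • phi0) B)
      ((wedge_isAlt _ _).add (wedge_isAlt _ _)) (volForm_isAlt omega0) j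
    have hv : volForm omega0 id = 1 := vol_omega0
    rw [hv, mul_one] at e
    rw [← Pi.add_apply, ← e, ← metric_stdPair hc]
    rfl
  simp only [h, wedge_three_two (hA.smul c) omega0_isAlt, wedge_three_two (phi0_isAlt.smul c) hB]
  simp [Fin.succAbove, omega0, J0, phi0, dzComp]
  repeat' apply And.intro
  all_goals ring

theorem topRatio_std {A : Tens 3} (hA : IsAlt A) (B : Tens 2) (i : Fin 0 → Fin 6) :
    topRatio (stdPair c) (c • A, B) i =
      c ^ 2 * (A ![0, 2, 5] + A ![0, 3, 4] + A ![1, 2, 4] - A ![1, 3, 5]) := by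
  show wedge (p := 3) (q := 3) (c • phi0) (c • A) id / vol omega0 = _
  rw [vol_omega0, div_one, wedge_three_three (phi0_isAlt.smul c) (hA.smul c)]
  simp [phi0, dzComp]
  ring

theorem star_std {n : ℕ} (hc : 0 < c) (T : TensorExpr (n + 2)) (A : Tens 2) (i : Fin n → Fin 6) :
    T.star (c • phi0) omega0 A i =
      ∑ p, ∑ q, A ![p, q] * T.eval (c • phi0) omega0 (Fin.cons p (Fin.cons q i)) := by
  rw [TensorExpr.star_eq_contr, metric_stdPair hc, inv_one, Matrix.transpose_one, Matrix.one_mul,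
    Matrix.mul_one]
  rfl

theorem phiSq_std (hc : 0 < c) : TensorExpr.phiSq.eval (c • phi0) omega0 ![] = 24 * c ^ 2 := by
  rw [TensorExpr.eval_phiSq, metric_stdPair hc]
  simp [Fin.sum_univ_six, phi0, dzComp, Matrix.one_apply]
  ring

theorem star_defectE_std (hc : 0 < c) (A : Tens 2) (i j : Fin 6) :
    TensorExpr.defectE.star (c • phi0) omega0 A ![i, j] = 2 * c ^ 2 *
      (∑ q, omega0 ![q, j] * ∑ p, omega0 ![p, i] * A ![p, q] -
        ∑ q, omega0 ![q, i] * ∑ p, omega0 ![p, j] * A ![p, q]) := by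
  have e : ∀ p q, TensorExpr.defectE.eval (c • phi0) omega0 (Fin.cons p (Fin.cons q ![i, j])) =
      1 / 12 * (24 * c ^ 2 * (omega0 ![p, i] * omega0 ![q, j] - omega0 ![p, j] * omega0 ![q, i])) :=
    fun p q => by rw [← phiSq_std hc]; exact TensorExpr.eval_defectE _ _ _
  rw [star_std hc, Finset.sum_comm]
  simp only [e, Finset.mul_sum, ← Finset.sum_sub_distrib]
  exact Finset.sum_congr rfl fun _ _ => Finset.sum_congr rfl fun _ _ => by ring

theorem star_defectF_std (hc : 0 < c) (A : Tens 2) (i : Fin 6) :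
    TensorExpr.defectF.star (c • phi0) omega0 A ![i] = 2 * c *
      ∑ a, omega0 ![a, i] * ∑ p, ∑ q, phi0 ![a, p, q] * A ![p, q] := by
  have e : ∀ p q, TensorExpr.defectF.eval (c • phi0) omega0 (Fin.cons p (Fin.cons q ![i])) =
      2 * ∑ a, c * phi0 ![a, p, q] * omega0 ![a, i] := by
    intro p q
    refine (TensorExpr.eval_defectF _ _ _).trans (congrArg (fun x : ℝ => 2 * x) ?_)
    rw [metric_stdPair hc, inv_one]
    refine Finset.sum_congr rfl fun a _ => ?_
    rw [Finset.sum_eq_single a]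
    · rw [Matrix.one_apply_eq, one_mul]; rfl
    · intro x _ hx; rw [Matrix.one_apply_ne hx.symm, zero_mul]
    · simp
  rw [star_std hc]
  simp only [e, Finset.mul_sum]
  calc _ = ∑ p, ∑ x, ∑ q, A ![p, q] * (2 * (c * phi0 ![x, p, q] * omega0 ![x, i])) :=
        Finset.sum_congr rfl fun _ _ => Finset.sum_comm
    _ = ∑ x, ∑ p, ∑ q, A ![p, q] * (2 * (c * phi0 ![x, p, q] * omega0 ![x, i])) := Finset.sum_comm
    _ = _ := Finset.sum_congr rfl fun _ _ => Finset.sum_congr rfl fun _ _ =>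
        Finset.sum_congr rfl fun _ _ => by ring

end

section

variable {c : ℝ} (hc : 0 < c) {a : Fin 6 → Tens 3} {b : Fin 6 → Tens 2} (ha : ∀ p, IsAlt (a p))
  (hb : ∀ p, IsAlt (b p))
include hc ha hb

omit ha hb in
theorem linV_std_eq (k : Fin 6) : linV (stdPair c) (fun p => (c • a p, b p)) k =
    4 * c ^ 2 * ∑ p, (fderiv ℝ gF (stdPair c) (c • a p, b p) ![p, k] -
      (1 / 2 : ℝ) * fderiv ℝ gF (stdPair c) (c • a k, b k) ![p, p]) -
      fderiv ℝ nF (stdPair c) (c • a k, b k) := by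
  have h1 : metric (stdPair c).1 (stdPair c).2 = 1 := metric_stdPair hc
  have h2 : normSq (stdPair c).1 (stdPair c).2 = 4 * c ^ 2 := normSq_stdPair hc
  rw [linV, h1, h2, inv_one, Matrix.one_mulVec, deTurckForm_apply]
  have e : ∀ p : Fin 6, ∀ f : Fin 6 → ℝ, ∑ q, (1 : Matrix (Fin 6) (Fin 6) ℝ) p q * f q = f p := by
    intro p f
    simp [Matrix.one_apply]
  simp only [e]
  congr 1
  exact fderiv_nF0 (isTypeIIAAt_std hc) _ _

/-- The linearized vector field in the standard frame, from the derivatives of the metric and of the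
norm. -/
theorem linV_std :
    linV (stdPair c) (fun p => (c • a p, b p)) 0 = c ^ 2 * (4 * a 0 ![1, 2, 5] + 4 * a 0 ![1, 3,
      4] + 4 * b 0 ![0, 1] - 2 * a 1 ![0, 2, 5] - 2 * a 1 ![0, 3, 4] + 2 * a 1 ![1, 2, 4] - 2 *
      a 1 ![1, 3, 5] + 2 * a 2 ![0, 1, 5] - 2 * a 2 ![2, 3, 5] + 2 * b 2 ![0, 3] - 2 * b 2 ![1,
      2] + 2 * a 3 ![0, 1, 4] - 2 * a 3 ![2, 3, 4] - 2 * b 3 ![0, 2] - 2 * b 3 ![1, 3] - 2 * a 4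
      ![0, 1, 3] + 2 * a 4 ![3, 4, 5] + 2 * b 4 ![0, 5] - 2 * b 4 ![1, 4] - 2 * a 5 ![0, 1, 2] +
      2 * a 5 ![2, 4, 5] - 2 * b 5 ![0, 4] - 2 * b 5 ![1, 5]) ∧
    linV (stdPair c) (fun p => (c • a p, b p)) 1 = c ^ 2 * (- 2 * a 0 ![0, 2, 5] - 2 * a 0 ![0,
      3, 4] + 2 * a 0 ![1, 2, 4] - 2 * a 0 ![1, 3, 5] - 4 * a 1 ![0, 2, 4] + 4 * a 1 ![0, 3, 5]
      + 4 * b 1 ![0, 1] + 2 * a 2 ![0, 1, 4] - 2 * a 2 ![2, 3, 4] + 2 * b 2 ![0, 2] + 2 * b 2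
      ![1, 3] - 2 * a 3 ![0, 1, 5] + 2 * a 3 ![2, 3, 5] + 2 * b 3 ![0, 3] - 2 * b 3 ![1, 2] - 2
      * a 4 ![0, 1, 2] + 2 * a 4 ![2, 4, 5] + 2 * b 4 ![0, 4] + 2 * b 4 ![1, 5] + 2 * a 5 ![0,
      1, 3] - 2 * a 5 ![3, 4, 5] + 2 * b 5 ![0, 5] - 2 * b 5 ![1, 4]) ∧
    linV (stdPair c) (fun p => (c • a p, b p)) 2 = c ^ 2 * (2 * a 0 ![0, 1, 5] - 2 * a 0 ![2, 3,
      5] + 2 * b 0 ![0, 3] - 2 * b 0 ![1, 2] + 2 * a 1 ![0, 1, 4] - 2 * a 1 ![2, 3, 4] + 2 * b 1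
      ![0, 2] + 2 * b 1 ![1, 3] + 4 * a 2 ![0, 3, 5] + 4 * a 2 ![1, 3, 4] + 4 * b 2 ![2, 3] - 2
      * a 3 ![0, 2, 5] + 2 * a 3 ![0, 3, 4] - 2 * a 3 ![1, 2, 4] - 2 * a 3 ![1, 3, 5] + 2 * a 4
      ![1, 2, 3] - 2 * a 4 ![1, 4, 5] + 2 * b 4 ![2, 5] - 2 * b 4 ![3, 4] + 2 * a 5 ![0, 2, 3] -
      2 * a 5 ![0, 4, 5] - 2 * b 5 ![2, 4] - 2 * b 5 ![3, 5]) ∧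
    linV (stdPair c) (fun p => (c • a p, b p)) 3 = c ^ 2 * (2 * a 0 ![0, 1, 4] - 2 * a 0 ![2, 3,
      4] - 2 * b 0 ![0, 2] - 2 * b 0 ![1, 3] - 2 * a 1 ![0, 1, 5] + 2 * a 1 ![2, 3, 5] + 2 * b 1
      ![0, 3] - 2 * b 1 ![1, 2] - 2 * a 2 ![0, 2, 5] + 2 * a 2 ![0, 3, 4] - 2 * a 2 ![1, 2, 4] -
      2 * a 2 ![1, 3, 5] - 4 * a 3 ![0, 2, 4] + 4 * a 3 ![1, 2, 5] + 4 * b 3 ![2, 3] + 2 * a 4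
      ![0, 2, 3] - 2 * a 4 ![0, 4, 5] + 2 * b 4 ![2, 4] + 2 * b 4 ![3, 5] - 2 * a 5 ![1, 2, 3] +
      2 * a 5 ![1, 4, 5] + 2 * b 5 ![2, 5] - 2 * b 5 ![3, 4]) ∧
    linV (stdPair c) (fun p => (c • a p, b p)) 4 = c ^ 2 * (- 2 * a 0 ![0, 1, 3] + 2 * a 0 ![3,
      4, 5] + 2 * b 0 ![0, 5] - 2 * b 0 ![1, 4] - 2 * a 1 ![0, 1, 2] + 2 * a 1 ![2, 4, 5] + 2 *
      b 1 ![0, 4] + 2 * b 1 ![1, 5] + 2 * a 2 ![1, 2, 3] - 2 * a 2 ![1, 4, 5] + 2 * b 2 ![2, 5]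
      - 2 * b 2 ![3, 4] + 2 * a 3 ![0, 2, 3] - 2 * a 3 ![0, 4, 5] + 2 * b 3 ![2, 4] + 2 * b 3
      ![3, 5] + 4 * a 4 ![0, 3, 5] + 4 * a 4 ![1, 2, 5] + 4 * b 4 ![4, 5] + 2 * a 5 ![0, 2, 5] -
      2 * a 5 ![0, 3, 4] - 2 * a 5 ![1, 2, 4] - 2 * a 5 ![1, 3, 5]) ∧
    linV (stdPair c) (fun p => (c • a p, b p)) 5 = c ^ 2 * (- 2 * a 0 ![0, 1, 2] + 2 * a 0 ![2,
      4, 5] - 2 * b 0 ![0, 4] - 2 * b 0 ![1, 5] + 2 * a 1 ![0, 1, 3] - 2 * a 1 ![3, 4, 5] + 2 *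
      b 1 ![0, 5] - 2 * b 1 ![1, 4] + 2 * a 2 ![0, 2, 3] - 2 * a 2 ![0, 4, 5] - 2 * b 2 ![2, 4]
      - 2 * b 2 ![3, 5] - 2 * a 3 ![1, 2, 3] + 2 * a 3 ![1, 4, 5] + 2 * b 3 ![2, 5] - 2 * b 3
      ![3, 4] + 2 * a 4 ![0, 2, 5] - 2 * a 4 ![0, 3, 4] - 2 * a 4 ![1, 2, 4] - 2 * a 4 ![1, 3,
      5] - 4 * a 5 ![0, 2, 4] + 4 * a 5 ![1, 3, 4] + 4 * b 5 ![4, 5]) := by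
  have s := fun p => fderiv_gF_std_symm hc (ha p) (hb p)
  have g := fun p => fderiv_gF_std hc (ha p) (hb p)
  have n := fun p => fderiv_nF_std hc (ha p) (hb p)
  simp only [forall_and] at g
  obtain ⟨g00, g01, g02, g03, g04, g05, g11, g12, g13, g14, g15, g22, g23, g24, g25, g33, g34, g35, g44, g45, g55⟩ := g
  refine ⟨?_, ?_, ?_, ?_, ?_, ?_⟩
  · rw [linV_std_eq hc, Fin.sum_univ_six, s 1 0 1, s 2 0 2, s 3 0 3, s 4 0 4, s 5 0 5, g00, g01, g02, g03, g04, g05, g11, g22, g33, g44, g55, n]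
    ring
  · rw [linV_std_eq hc, Fin.sum_univ_six, s 2 1 2, s 3 1 3, s 4 1 4, s 5 1 5, g00, g01, g11, g12, g13, g14, g15, g22, g33, g44, g55, n]
    ring
  · rw [linV_std_eq hc, Fin.sum_univ_six, s 3 2 3, s 4 2 4, s 5 2 5, g00, g02, g11, g12, g22, g23, g24, g25, g33, g44, g55, n]
    ring
  · rw [linV_std_eq hc, Fin.sum_univ_six, s 4 3 4, s 5 3 5, g00, g03, g11, g13, g22, g23, g33, g34, g35, g44, g55, n]
    ring
  · rw [linV_std_eq hc, Fin.sum_univ_six, s 5 4 5, g00, g04, g11, g14, g22, g24, g33, g34, g44, g45, g55, n]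
    ring
  · rw [linV_std_eq hc, Fin.sum_univ_six, g00, g05, g11, g15, g22, g25, g33, g35, g44, g45, g55, n]
    ring

theorem contractOmega_altD_std (i j : Fin 6) :
    contractOmega (k := 2) omega0
      (altD (slotT fun p => fderiv ℝ nhF (stdPair c) (c • a p, b p))) ![i, j] =
    ∑ r : Fin 3, (fderiv ℝ nhF (stdPair c) (c • a (![0, 2, 4] r), b (![0, 2, 4] r))
          ![![1, 3, 5] r, i, j] -
        fderiv ℝ nhF (stdPair c) (c • a (![1, 3, 5] r), b (![1, 3, 5] r)) ![![0, 2, 4] r, i, j] +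
        fderiv ℝ nhF (stdPair c) (c • a i, b i) ![![0, 2, 4] r, ![1, 3, 5] r, j] -
        fderiv ℝ nhF (stdPair c) (c • a j, b j) ![![0, 2, 4] r, ![1, 3, 5] r, i]) := by
  have hN := fun p => fderiv_nhF_std_isAlt hc (ha p) (hb p)
  set N := fun p => fderiv ℝ nhF (stdPair c) (c • a p, b p) with hNdef
  have e : ∀ u v, altD (slotT N) (Fin.cons u (Fin.cons v ![i, j])) =
      N u ![v, i, j] - N v ![u, i, j] + N i ![u, v, j] - N j ![u, v, i] := fun u v =>
    altD_slotT_three N u v i j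
  have sw : ∀ p x y z, N p ![y, x, z] = -N p ![x, y, z] := fun p x y z =>
    IsAlt'.swap01 (hN p) x y z
  rw [contractOmega_omega0]
  simp only [e, Fin.sum_univ_three]
  show _ = N 0 ![1, i, j] - N 1 ![0, i, j] + N i ![0, 1, j] - N j ![0, 1, i] +
    (N 2 ![3, i, j] - N 3 ![2, i, j] + N i ![2, 3, j] - N j ![2, 3, i]) +
    (N 4 ![5, i, j] - N 5 ![4, i, j] + N i ![4, 5, j] - N j ![4, 5, i])
  rw [sw i 0 1, sw j 0 1, sw i 2 3, sw j 2 3, sw i 4 5, sw j 4 5]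
  ring

end

section

variable {c : ℝ} (hc : 0 < c) {a : Fin 6 → Tens 3} {b : Fin 6 → Tens 2} (ha : ∀ p, IsAlt (a p))
  (hb : ∀ p, IsAlt (b p))
include hc ha hb

/-- The components of `Λ_ω d(δ(|φ|² φ̂))` in the standard frame. -/
theorem contractOmega_altD_std_table :
    contractOmega (k := 2) omega0 (altD (slotT fun p => fderiv ℝ nhF (stdPair c) (c • a p, b p)))
      ![0, 1] = c ^ 3 * (4 * a 2 ![0, 1, 2] + 4 * a 3 ![0, 1, 3] + 4 * a 0 ![0, 2, 3] + 4 * a 1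
      ![1, 2, 3] + 4 * a 4 ![0, 1, 4] + 4 * a 5 ![0, 1, 5] + 4 * a 0 ![0, 4, 5] + 4 * a 1 ![1, 4,
      5]) ∧
    contractOmega (k := 2) omega0 (altD (slotT fun p => fderiv ℝ nhF (stdPair c) (c • a p, b p)))
      ![0, 2] = c ^ 3 * (4 * a 4 ![0, 2, 4] - 4 * a 4 ![0, 3, 5] - 4 * a 4 ![1, 2, 5] - 4 * b 4
      ![0, 1] - 4 * b 4 ![2, 3] - 4 * b 4 ![4, 5] + 2 * a 5 ![0, 2, 5] + 2 * a 5 ![0, 3, 4] + 2 *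
      a 5 ![1, 2, 4] + 2 * a 5 ![1, 3, 5] - 4 * a 0 ![3, 4, 5] + 4 * a 2 ![1, 4, 5]) ∧
    contractOmega (k := 2) omega0 (altD (slotT fun p => fderiv ℝ nhF (stdPair c) (c • a p, b p)))
      ![0, 3] = c ^ 3 * (2 * a 4 ![0, 2, 5] + 2 * a 4 ![0, 3, 4] - 2 * a 4 ![1, 2, 4] - 2 * a 4
      ![1, 3, 5] - 4 * a 5 ![0, 2, 4] + 4 * a 5 ![0, 3, 5] + 4 * a 5 ![1, 3, 4] + 4 * b 5 ![0, 1]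
      + 4 * b 5 ![2, 3] + 4 * b 5 ![4, 5] + 4 * a 0 ![2, 4, 5] + 4 * a 3 ![1, 4, 5]) ∧
    contractOmega (k := 2) omega0 (altD (slotT fun p => fderiv ℝ nhF (stdPair c) (c • a p, b p)))
      ![0, 4] = c ^ 3 * (- 4 * a 2 ![0, 2, 4] + 4 * a 2 ![0, 3, 5] + 4 * a 2 ![1, 3, 4] + 4 * b 2
      ![0, 1] + 4 * b 2 ![2, 3] + 4 * b 2 ![4, 5] - 2 * a 3 ![0, 2, 5] - 2 * a 3 ![0, 3, 4] - 2 *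
      a 3 ![1, 2, 4] - 2 * a 3 ![1, 3, 5] - 4 * a 0 ![2, 3, 5] + 4 * a 4 ![1, 2, 3]) ∧
    contractOmega (k := 2) omega0 (altD (slotT fun p => fderiv ℝ nhF (stdPair c) (c • a p, b p)))
      ![0, 5] = c ^ 3 * (- 2 * a 2 ![0, 2, 5] - 2 * a 2 ![0, 3, 4] + 2 * a 2 ![1, 2, 4] + 2 * a 2
      ![1, 3, 5] + 4 * a 3 ![0, 2, 4] - 4 * a 3 ![0, 3, 5] - 4 * a 3 ![1, 2, 5] - 4 * b 3 ![0, 1]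
      - 4 * b 3 ![2, 3] - 4 * b 3 ![4, 5] + 4 * a 0 ![2, 3, 4] + 4 * a 5 ![1, 2, 3]) ∧
    contractOmega (k := 2) omega0 (altD (slotT fun p => fderiv ℝ nhF (stdPair c) (c • a p, b p)))
      ![1, 2] = c ^ 3 * (2 * a 4 ![0, 2, 5] - 2 * a 4 ![0, 3, 4] + 2 * a 4 ![1, 2, 4] - 2 * a 4
      ![1, 3, 5] - 4 * a 5 ![0, 2, 4] + 4 * a 5 ![1, 2, 5] + 4 * a 5 ![1, 3, 4] + 4 * b 5 ![0, 1]
      + 4 * b 5 ![2, 3] + 4 * b 5 ![4, 5] - 4 * a 1 ![3, 4, 5] - 4 * a 2 ![0, 4, 5]) ∧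
    contractOmega (k := 2) omega0 (altD (slotT fun p => fderiv ℝ nhF (stdPair c) (c • a p, b p)))
      ![1, 3] = c ^ 3 * (4 * a 4 ![0, 3, 5] + 4 * a 4 ![1, 2, 5] + 4 * a 4 ![1, 3, 4] + 4 * b 4
      ![0, 1] + 4 * b 4 ![2, 3] + 4 * b 4 ![4, 5] + 2 * a 5 ![0, 2, 5] - 2 * a 5 ![0, 3, 4] - 2 *
      a 5 ![1, 2, 4] + 2 * a 5 ![1, 3, 5] + 4 * a 1 ![2, 4, 5] - 4 * a 3 ![0, 4, 5]) ∧
    contractOmega (k := 2) omega0 (altD (slotT fun p => fderiv ℝ nhF (stdPair c) (c • a p, b p)))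
      ![1, 4] = c ^ 3 * (2 * a 2 ![0, 2, 5] - 2 * a 2 ![0, 3, 4] - 2 * a 2 ![1, 2, 4] + 2 * a 2
      ![1, 3, 5] + 4 * a 3 ![0, 2, 4] - 4 * a 3 ![1, 2, 5] - 4 * a 3 ![1, 3, 4] - 4 * b 3 ![0, 1]
      - 4 * b 3 ![2, 3] - 4 * b 3 ![4, 5] - 4 * a 1 ![2, 3, 5] - 4 * a 4 ![0, 2, 3]) ∧
    contractOmega (k := 2) omega0 (altD (slotT fun p => fderiv ℝ nhF (stdPair c) (c • a p, b p)))
      ![1, 5] = c ^ 3 * (- 4 * a 2 ![0, 3, 5] - 4 * a 2 ![1, 2, 5] - 4 * a 2 ![1, 3, 4] - 4 * b 2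
      ![0, 1] - 4 * b 2 ![2, 3] - 4 * b 2 ![4, 5] + 2 * a 3 ![0, 2, 5] - 2 * a 3 ![0, 3, 4] + 2 *
      a 3 ![1, 2, 4] - 2 * a 3 ![1, 3, 5] + 4 * a 1 ![2, 3, 4] - 4 * a 5 ![0, 2, 3]) ∧
    contractOmega (k := 2) omega0 (altD (slotT fun p => fderiv ℝ nhF (stdPair c) (c • a p, b p)))
      ![2, 3] = c ^ 3 * (4 * a 0 ![0, 2, 3] + 4 * a 1 ![1, 2, 3] + 4 * a 2 ![0, 1, 2] + 4 * a 3
      ![0, 1, 3] + 4 * a 4 ![2, 3, 4] + 4 * a 5 ![2, 3, 5] + 4 * a 2 ![2, 4, 5] + 4 * a 3 ![3, 4,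
      5]) ∧
    contractOmega (k := 2) omega0 (altD (slotT fun p => fderiv ℝ nhF (stdPair c) (c • a p, b p)))
      ![2, 4] = c ^ 3 * (4 * a 0 ![0, 2, 4] - 4 * a 0 ![1, 2, 5] - 4 * a 0 ![1, 3, 4] - 4 * b 0
      ![0, 1] - 4 * b 0 ![2, 3] - 4 * b 0 ![4, 5] + 2 * a 1 ![0, 2, 5] + 2 * a 1 ![0, 3, 4] + 2 *
      a 1 ![1, 2, 4] + 2 * a 1 ![1, 3, 5] - 4 * a 2 ![0, 1, 5] + 4 * a 4 ![0, 1, 3]) ∧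
    contractOmega (k := 2) omega0 (altD (slotT fun p => fderiv ℝ nhF (stdPair c) (c • a p, b p)))
      ![2, 5] = c ^ 3 * (2 * a 0 ![0, 2, 5] - 2 * a 0 ![0, 3, 4] + 2 * a 0 ![1, 2, 4] - 2 * a 0
      ![1, 3, 5] - 4 * a 1 ![0, 2, 4] + 4 * a 1 ![0, 3, 5] + 4 * a 1 ![1, 2, 5] + 4 * b 1 ![0, 1]
      + 4 * b 1 ![2, 3] + 4 * b 1 ![4, 5] + 4 * a 2 ![0, 1, 4] + 4 * a 5 ![0, 1, 3]) ∧
    contractOmega (k := 2) omega0 (altD (slotT fun p => fderiv ℝ nhF (stdPair c) (c • a p, b p)))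
      ![3, 4] = c ^ 3 * (- 2 * a 0 ![0, 2, 5] + 2 * a 0 ![0, 3, 4] + 2 * a 0 ![1, 2, 4] - 2 * a 0
      ![1, 3, 5] - 4 * a 1 ![0, 2, 4] + 4 * a 1 ![0, 3, 5] + 4 * a 1 ![1, 3, 4] + 4 * b 1 ![0, 1]
      + 4 * b 1 ![2, 3] + 4 * b 1 ![4, 5] - 4 * a 3 ![0, 1, 5] - 4 * a 4 ![0, 1, 2]) ∧
    contractOmega (k := 2) omega0 (altD (slotT fun p => fderiv ℝ nhF (stdPair c) (c • a p, b p)))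
      ![3, 5] = c ^ 3 * (4 * a 0 ![0, 3, 5] + 4 * a 0 ![1, 2, 5] + 4 * a 0 ![1, 3, 4] + 4 * b 0
      ![0, 1] + 4 * b 0 ![2, 3] + 4 * b 0 ![4, 5] - 2 * a 1 ![0, 2, 5] - 2 * a 1 ![0, 3, 4] + 2 *
      a 1 ![1, 2, 4] + 2 * a 1 ![1, 3, 5] + 4 * a 3 ![0, 1, 4] - 4 * a 5 ![0, 1, 2]) ∧
    contractOmega (k := 2) omega0 (altD (slotT fun p => fderiv ℝ nhF (stdPair c) (c • a p, b p)))
      ![4, 5] = c ^ 3 * (4 * a 0 ![0, 4, 5] + 4 * a 1 ![1, 4, 5] + 4 * a 4 ![0, 1, 4] + 4 * a 5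
      ![0, 1, 5] + 4 * a 2 ![2, 4, 5] + 4 * a 3 ![3, 4, 5] + 4 * a 4 ![2, 3, 4] + 4 * a 5 ![2, 3,
      5]) := by
  have s := fun p => (fderiv_nhF_std_isAlt hc (ha p) (hb p)).sort_three
  have n := fun p => fderiv_nhF_std hc (ha p) (hb p)
  simp only [forall_and] at s n
  obtain ⟨s1, s2, s3, s4⟩ := s
  obtain ⟨n012, n013, n014, n015, n023, n024, n025, n034, n035, n045, n123, n124, n125, n134, n135, n145, n234, n235, n245, n345⟩ := n
  simp only [contractOmega_altD_std hc ha hb, Fin.sum_univ_three]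
  refine ⟨?_, ?_, ?_, ?_, ?_, ?_, ?_, ?_, ?_, ?_, ?_, ?_, ?_, ?_, ?_⟩
  · simp [s1, s2, s3, s4, n012, n013, n014, n015, n023, n045, n123, n145]
    ring
  · simp [s1, s2, s3, s4, n012, n023, n024, n025, n045, n245]
    ring
  · simp [s1, s2, s3, s4, n013, n023, n034, n035, n045, n345]
    ring
  · simp [s1, s2, s3, s4, n014, n023, n024, n034, n045, n234]
    ring
  · simp [s1, s2, s3, s4, n015, n023, n025, n035, n045, n235]
    ring
  · simp [s1, s2, s3, s4, n012, n123, n124, n125, n145, n245]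
    ring
  · simp [s1, s2, s3, s4, n013, n123, n134, n135, n145, n345]
    ring
  · simp [s1, s2, s3, s4, n014, n123, n124, n134, n145, n234]
    ring
  · simp [s1, s2, s3, s4, n015, n123, n125, n135, n145, n235]
    ring
  · simp [s1, s2, s3, s4, n012, n013, n023, n123, n234, n235, n245, n345]
    ring
  · simp [s1, s2, s3, s4, n012, n014, n024, n124, n234, n245]
    ring
  · simp [s1, s2, s3, s4, n012, n015, n025, n125, n235, n245]
    ring
  · simp [s1, s2, s3, s4, n013, n014, n034, n134, n234, n345]
    ring
  · simp [s1, s2, s3, s4, n013, n015, n035, n135, n235, n345]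
    ring
  · simp [s1, s2, s3, s4, n014, n015, n045, n145, n234, n235, n245, n345]
    ring

end

section

variable {c : ℝ} (hc : 0 < c) {a : Fin 6 → Tens 3} {b : Fin 6 → Tens 2}
include hc

omit hc in
theorem linE_std_apply (i j : Fin 6) : linE (stdPair c) (fun p => (c • a p, b p)) ![i, j] =
    contractOmega (k := 2) omega0
      (altD (slotT fun p => fderiv ℝ nhF (stdPair c) (c • a p, b p))) ![i, j] +
    c * ∑ k, phi0 ![k, i, j] * linV (stdPair c) (fun p => (c • a p, b p)) k := by
  rw [linE, Pi.add_apply, Finset.mul_sum]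
  refine congrArg₂ (fun x y : ℝ => x + y) rfl (Finset.sum_congr rfl fun k _ => ?_)
  show _ * (c * phi0 ![k, i, j]) = _
  ring

omit hc in
theorem contr_one_slotT {k : ℕ} (f : Fin 6 → Tens (k + 1)) (i : Fin k → Fin 6) :
    contr 1 (slotT f) i = ∑ p, f p (Fin.cons p i) := by
  refine Finset.sum_congr rfl fun p _ => ?_
  rw [Finset.sum_eq_single p]
  · rw [Matrix.one_apply_eq, one_mul, slotT_cons]
  · intro q _ hq; rw [Matrix.one_apply_ne hq.symm, zero_mul]
  · simp

theorem ansE_std_apply (i j : Fin 6) : ansE (stdPair c) (fun p => (c • a p, b p)) ![i, j] =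
    4 * c ^ 2 * (c * ∑ p, a p ![p, i, j]) +
    2 * c ^ 2 * (∑ q, omega0 ![q, j] * ∑ p, omega0 ![p, i] * defect (stdPair c) (c • a p, b p) ![q] -
      ∑ q, omega0 ![q, i] * ∑ p, omega0 ![p, j] * defect (stdPair c) (c • a p, b p) ![q]) +
    2 * c ^ 2 * (defect (stdPair c) (c • a i, -b i) ![j] -
      defect (stdPair c) (c • a j, -b j) ![i]) := by
  have h1 : metric (stdPair c).1 (stdPair c).2 = 1 := metric_stdPair hc
  have h2 : normSq (stdPair c).1 (stdPair c).2 = 4 * c ^ 2 := normSq_stdPair hc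
  rw [ansE, h1, h2, inv_one, Pi.add_apply, Pi.add_apply, Pi.smul_apply, contr_one_slotT,
    altD_slotT_one]
  refine congrArg₂ (fun x y : ℝ => x + y) (congrArg₂ (fun x y : ℝ => x + y) ?_ ?_) ?_
  · rw [Finset.mul_sum]; rfl
  · exact star_defectE_std hc _ i j
  · simp only [Pi.smul_apply, smul_eq_mul]; ring

omit hc in
theorem linF_std_apply (i : Fin 6) : linF (stdPair c) (fun p => (c • a p, b p)) ![i] =
    ∑ k, omega0 ![k, i] * linV (stdPair c) (fun p => (c • a p, b p)) k := by
  show ∑ k, linV (stdPair c) (fun p => (c • a p, b p)) k * omega0 (Fin.cons k ![i]) = _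
  exact Finset.sum_congr rfl fun k _ => mul_comm _ _

theorem ansF_std_apply (i : Fin 6) : ansF (stdPair c) (fun p => (c • a p, b p)) ![i] =
    4 * c ^ 2 * (∑ p, b p ![p, i]) +
    2 * c * (∑ x, omega0 ![x, i] * ∑ p, ∑ q,
      phi0 ![x, p, q] * defect (stdPair c) (c • a p, b p) ![q]) +
    2 * topRatio (stdPair c) (c • a i, b i) ![] := by
  have h1 : metric (stdPair c).1 (stdPair c).2 = 1 := metric_stdPair hc
  have h2 : normSq (stdPair c).1 (stdPair c).2 = 4 * c ^ 2 := normSq_stdPair hc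
  rw [ansF, h1, h2, inv_one, Pi.add_apply, Pi.add_apply, Pi.smul_apply, contr_one_slotT]
  refine congrArg₂ (fun x y : ℝ => x + y) (congrArg₂ (fun x y : ℝ => x + y) rfl ?_) ?_
  · exact star_defectF_std hc _ i
  · have e : altD (slotT fun p => (2 : ℝ) • topRatio (stdPair c) (c • a p, b p)) ![i] =
        ∑ j : Fin 1, (-1 : ℝ) ^ (j : ℕ) * _ := rfl
    rw [e, Fin.sum_univ_one]
    simp [slotT]
    rfl

end

section

variable {c : ℝ} (hc : 0 < c) {a : Fin 6 → Tens 3} {b : Fin 6 → Tens 2} (ha : ∀ p, IsAlt (a p))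
  (hb : ∀ p, IsAlt (b p))
include hc ha hb

set_option maxHeartbeats 1600000 in
/-- Closedness of `β` is used through the components `(Λ_ω dβ)_k = dβ_{01k} + dβ_{23k} + dβ_{45k}`: the
two sides differ by `-4 c³ ∑_k φ₀_{ijk} (Λ_ω dβ)_k`. -/
theorem linE_std (h : altD (slotT b) = 0) {i j : Fin 6} (hij : i < j) :
    linE (stdPair c) (fun p => (c • a p, b p)) ![i, j] =
      ansE (stdPair c) (fun p => (c • a p, b p)) ![i, j] := by
  have k : ∀ x y z, b x ![y, z] - b y ![x, z] + b z ![x, y] = 0 := fun x y z => by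
    have := congrFun h ![x, y, z]
    rw [altD_two] at this
    exact this
  rw [linE_std_apply, ansE_std_apply hc]
  obtain ⟨v0, v1, v2, v3, v4, v5⟩ := linV_std hc ha hb
  have d := fun p => defect_std hc (ha p) (hb p)
  have d' := fun p => defect_std hc (ha p) (B := -b p) ((neg_one_smul ℝ (b p)) ▸ (hb p).smul (-1))
  have s := fun p => (ha p).sort_three
  simp only [forall_and] at d d' s
  obtain ⟨d0, d1, d2, d3, d4, d5⟩ := d
  obtain ⟨e0, e1, e2, e3, e4, e5⟩ := d'
  obtain ⟨s1, s2, s3, s4⟩ := s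
  obtain ⟨L01, L02, L03, L04, L05, L12, L13, L14, L15, L23, L24, L25, L34, L35, L45⟩ :=
    contractOmega_altD_std_table hc ha hb
  simp only [Fin.sum_univ_six (f := fun p => a p _), sum_omega0]
  fin_cases i <;> fin_cases j <;> first | exact absurd hij (by decide) | skip
  · simp [Fin.sum_univ_six, phi0, dzComp, s1, s2, s3, s4, L01, d0, d1, e0, e1]
    ring
  · simp [Fin.sum_univ_six, phi0, dzComp, s1, s2, s3, s4, L02, v4, d1, d3, e0, e2]
    linear_combination -4 * c ^ 3 * k 0 1 4 - 4 * c ^ 3 * k 2 3 4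
  · simp [Fin.sum_univ_six, phi0, dzComp, s1, s2, s3, s4, L03, v5, d1, d2, e0, e3]
    linear_combination 4 * c ^ 3 * k 0 1 5 + 4 * c ^ 3 * k 2 3 5
  · simp [Fin.sum_univ_six, phi0, dzComp, s1, s2, s3, s4, L04, v2, d1, d5, e0, e4]
    linear_combination 4 * c ^ 3 * k 0 1 2 + 4 * c ^ 3 * k 2 4 5
  · simp [Fin.sum_univ_six, phi0, dzComp, s1, s2, s3, s4, L05, v3, d1, d4, e0, e5]
    linear_combination -4 * c ^ 3 * k 0 1 3 - 4 * c ^ 3 * k 3 4 5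
  · simp [Fin.sum_univ_six, phi0, dzComp, s1, s2, s3, s4, L12, v5, d0, d3, e1, e2]
    linear_combination 4 * c ^ 3 * k 0 1 5 + 4 * c ^ 3 * k 2 3 5
  · simp [Fin.sum_univ_six, phi0, dzComp, s1, s2, s3, s4, L13, v4, d0, d2, e1, e3]
    linear_combination 4 * c ^ 3 * k 0 1 4 + 4 * c ^ 3 * k 2 3 4
  · simp [Fin.sum_univ_six, phi0, dzComp, s1, s2, s3, s4, L14, v3, d0, d5, e1, e4]
    linear_combination -4 * c ^ 3 * k 0 1 3 - 4 * c ^ 3 * k 3 4 5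
  · simp [Fin.sum_univ_six, phi0, dzComp, s1, s2, s3, s4, L15, v2, d0, d4, e1, e5]
    linear_combination -4 * c ^ 3 * k 0 1 2 - 4 * c ^ 3 * k 2 4 5
  · simp [Fin.sum_univ_six, phi0, dzComp, s1, s2, s3, s4, L23, d2, d3, e2, e3]
    ring
  · simp [Fin.sum_univ_six, phi0, dzComp, s1, s2, s3, s4, L24, v0, d3, d5, e2, e4]
    linear_combination -4 * c ^ 3 * k 0 2 3 - 4 * c ^ 3 * k 0 4 5
  · simp [Fin.sum_univ_six, phi0, dzComp, s1, s2, s3, s4, L25, v1, d3, d4, e2, e5]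
    linear_combination 4 * c ^ 3 * k 1 2 3 + 4 * c ^ 3 * k 1 4 5
  · simp [Fin.sum_univ_six, phi0, dzComp, s1, s2, s3, s4, L34, v1, d2, d5, e3, e4]
    linear_combination 4 * c ^ 3 * k 1 2 3 + 4 * c ^ 3 * k 1 4 5
  · simp [Fin.sum_univ_six, phi0, dzComp, s1, s2, s3, s4, L35, v0, d2, d4, e3, e5]
    linear_combination 4 * c ^ 3 * k 0 2 3 + 4 * c ^ 3 * k 0 4 5
  · simp [Fin.sum_univ_six, phi0, dzComp, s1, s2, s3, s4, L45, d4, d5, e4, e5]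
    ring

set_option maxHeartbeats 1600000 in
/-- Closedness of `α` is used through its contraction with `φ₀`: the two sides differ by
`4 c² ∑_a J₀^a_i ∑_{x<y<z} φ₀_{xyz} dα_{axyz}`. -/
theorem linF_std (h : altD (slotT a) = 0) (i : Fin 6) :
    linF (stdPair c) (fun p => (c • a p, b p)) ![i] =
      ansF (stdPair c) (fun p => (c • a p, b p)) ![i] := by
  have k : ∀ x y z w, a x ![y, z, w] - a y ![x, z, w] + a z ![x, y, w] - a w ![x, y, z] = 0 :=
    fun x y z w => by
      have := congrFun h ![x, y, z, w]
      rw [altD_three] at this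
      exact this
  rw [linF_std_apply, ansF_std_apply hc]
  obtain ⟨v0, v1, v2, v3, v4, v5⟩ := linV_std hc ha hb
  have d := fun p => defect_std hc (ha p) (hb p)
  have t := fun p => topRatio_std (c := c) (ha p) (b p) ![]
  have s := fun p => (hb p).sort_two
  simp only [forall_and] at d s
  obtain ⟨d0, d1, d2, d3, d4, d5⟩ := d
  obtain ⟨s1, s2⟩ := s
  simp only [sum_omega0, sum_phi0_eq, t]
  fin_cases i
  · simp [Fin.sum_univ_six, s1, s2, v1, d0, d1, d2, d3, d4, d5]
    linear_combination -4 * c ^ 2 * k 0 1 2 4 + 4 * c ^ 2 * k 0 1 3 5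
  · simp [Fin.sum_univ_six, s1, s2, v0, d0, d1, d2, d3, d4, d5]
    linear_combination 4 * c ^ 2 * k 0 1 2 5 + 4 * c ^ 2 * k 0 1 3 4
  · simp [Fin.sum_univ_six, s1, s2, v3, d0, d1, d2, d3, d4, d5]
    linear_combination 4 * c ^ 2 * k 0 2 3 4 - 4 * c ^ 2 * k 1 2 3 5
  · simp [Fin.sum_univ_six, s1, s2, v2, d0, d1, d2, d3, d4, d5]
    linear_combination -4 * c ^ 2 * k 0 2 3 5 - 4 * c ^ 2 * k 1 2 3 4
  · simp [Fin.sum_univ_six, s1, s2, v5, d0, d1, d2, d3, d4, d5]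
    linear_combination -4 * c ^ 2 * k 0 2 4 5 + 4 * c ^ 2 * k 1 3 4 5
  · simp [Fin.sum_univ_six, s1, s2, v4, d0, d1, d2, d3, d4, d5]
    linear_combination 4 * c ^ 2 * k 0 3 4 5 + 4 * c ^ 2 * k 1 2 4 5

end

/-! ### The linearized operators at an arbitrary point -/

/-- The action of a matrix on pairs with an additional covector index. -/
def pullSlot (P : Matrix (Fin 6) (Fin 6) ℝ) (σ : Fin 6 → Tens 3 × Tens 2) :
    Fin 6 → Tens 3 × Tens 2 := fun p => ∑ a, P a p • pullPair P (σ a)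

theorem slotT_pullSlot {k : ℕ} {P : Matrix (Fin 6) (Fin 6) ℝ} {L L' : (Tens 3 × Tens 2) →L[ℝ] Tens k}
    (h : ∀ σ, L' (pullPair P σ) = pull P (L σ)) (σ : Fin 6 → Tens 3 × Tens 2) :
    slotT (fun p => L' (pullSlot P σ p)) = pull P (slotT fun p => L (σ p)) := by
  rw [pull_slotT]
  simp only [pullSlot, map_sum, map_smul, h]

theorem pullSlot_fst (P : Matrix (Fin 6) (Fin 6) ℝ) (σ : Fin 6 → Tens 3 × Tens 2) :
    slotT (fun p => (pullSlot P σ p).1) = pull P (slotT fun p => (σ p).1) :=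
  slotT_pullSlot (L := .fst ℝ _ _) (L' := .fst ℝ _ _) (fun _ => rfl) σ

theorem pullSlot_snd (P : Matrix (Fin 6) (Fin 6) ℝ) (σ : Fin 6 → Tens 3 × Tens 2) :
    slotT (fun p => (pullSlot P σ p).2) = pull P (slotT fun p => (σ p).2) :=
  slotT_pullSlot (L := .snd ℝ _ _) (L' := .snd ℝ _ _) (fun _ => rfl) σ

theorem IsAlt.sum {ι : Type*} {k : ℕ} {s : Finset ι} {A : ι → Tens k} (h : ∀ a ∈ s, IsAlt (A a)) :
    IsAlt (∑ a ∈ s, A a) := by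
  intro σ i
  rw [Finset.sum_apply, Finset.sum_apply, Finset.mul_sum]
  exact Finset.sum_congr rfl fun a ha => h a ha σ i

theorem isAlt_pullSlot {P : Matrix (Fin 6) (Fin 6) ℝ} {σ : Fin 6 → Tens 3 × Tens 2}
    (h1 : ∀ p, IsAlt (σ p).1) (h2 : ∀ p, IsAlt (σ p).2) (p : Fin 6) :
    IsAlt (pullSlot P σ p).1 ∧ IsAlt (pullSlot P σ p).2 := by
  rw [pullSlot, Prod.fst_sum, Prod.snd_sum]
  exact ⟨IsAlt.sum fun a _ => ((h1 a).pull P).smul _, IsAlt.sum fun a _ => ((h2 a).pull P).smul _⟩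

theorem deTurckForm_pull {P w w' : Matrix (Fin 6) (Fin 6) ℝ} (h : P * w' * P.transpose = w) (n : ℝ)
    (D : Tens 3) (N : Tens 1) :
    deTurckForm w' n (pull P D) (pull P N) = pull P (deTurckForm w n D N) := by
  have e : (fun i : Fin 3 → Fin 6 => pull P D (i ∘ (finRotate 3).symm)) =
      pull P fun i => D (i ∘ (finRotate 3).symm) := (pull_perm P (finRotate 3).symm D).symm
  rw [deTurckForm, deTurckForm, e, pull_contr_of_eq P h, pull_contr_of_eq P h]
  simp only [pull_add, pull_smul]

section

variable {s : Tens 3 × Tens 2} (hs : IsTypeIIAAt s.1 s.2) {P : Matrix (Fin 6) (Fin 6) ℝ}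
  (hP : P.det ≠ 0) (σ : Fin 6 → Tens 3 × Tens 2)
include hs hP

theorem mulVec_linV_pull : P.mulVec (linV (pullPair P s) (pullSlot P σ)) = linV s σ := by
  have hw : P * (metric (pullPair P s).1 (pullPair P s).2)⁻¹ * P.transpose = (metric s.1 s.2)⁻¹ :=
    conj_metric_inv_pull P hP s.1 s.2
  have hn : normSq (pullPair P s).1 (pullPair P s).2 = normSq s.1 s.2 := normSq_pull P hP s.1 s.2
  rw [linV, linV, slotT_pullSlot (fderiv_gF_pullPair hs hP), slotT_pullSlot
    (L := fderiv ℝ nF0 s) fun τ => fderiv_pullPair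
      ((contDiffAt_nF0 hs).differentiableAt cinf_ne_zero) (fun P s hP => nF0_pullPair P s hP) hP τ,
    hn, deTurckForm_pull hw]
  set θ := deTurckForm (metric s.1 s.2)⁻¹ (normSq s.1 s.2)
    (slotT fun p => fderiv ℝ gF s (σ p)) (slotT fun p => fderiv ℝ nF0 s (σ p))
  have e : (fun k => pull P θ ![k]) = P.transpose.mulVec fun k => θ ![k] := by
    ext k
    rw [pull, sum_fin_one]
    simp [Matrix.mulVec, dotProduct]
  rw [e, Matrix.mulVec_mulVec, Matrix.mulVec_mulVec, hw]

theorem linE_pull : linE (pullPair P s) (pullSlot P σ) = pull P (linE s σ) := by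
  rw [linE, linE, slotT_pullSlot (fderiv_nhF_pullPair hs hP), pull_altD, pull_add]
  congr 1
  · exact contractOmega_pull P hP _ _
  · rw [← mulVec_linV_pull hs hP σ]
    exact pull_interior P _ _

theorem linF_pull : linF (pullPair P s) (pullSlot P σ) = pull P (linF s σ) := by
  rw [linF, linF, ← mulVec_linV_pull hs hP σ]
  exact pull_interior P _ _

omit hs in
theorem slotT_defect_pull : slotT (fun p => defect (pullPair P s) (pullSlot P σ p)) =
    pull P (slotT fun p => defect s (σ p)) :=
  slotT_pullSlot (L := defectL s) (L' := defectL (pullPair P s)) (defect_pullPair hP s) σ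

omit hs in
theorem ansE_pull : ansE (pullPair P s) (pullSlot P σ) = pull P (ansE s σ) := by
  have hw : P * (metric (pullPair P s).1 (pullPair P s).2)⁻¹ * P.transpose = (metric s.1 s.2)⁻¹ :=
    conj_metric_inv_pull P hP s.1 s.2
  have hn : normSq (pullPair P s).1 (pullPair P s).2 = normSq s.1 s.2 := normSq_pull P hP s.1 s.2
  have h3 := slotT_pullSlot
    (L := (normSq s.1 s.2 / 2) • (defectL s).comp
      ((ContinuousLinearMap.fst ℝ (Tens 3) (Tens 2)).prod (-.snd ℝ (Tens 3) (Tens 2))))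
    (L' := (normSq s.1 s.2 / 2) • (defectL (pullPair P s)).comp
      ((ContinuousLinearMap.fst ℝ (Tens 3) (Tens 2)).prod (-.snd ℝ (Tens 3) (Tens 2))))
    (P := P) (fun τ => by
      have := defect_pullPair hP s (τ.1, -τ.2)
      rw [show pullPair P (τ.1, -τ.2) = (pull P τ.1, -pull P τ.2) from
        Prod.ext rfl (by
          show pull P (-τ.2) = _
          rw [← neg_one_smul ℝ, pull_smul, neg_one_smul])] at this
      show (normSq s.1 s.2 / 2) • defect (pullPair P s) (pull P τ.1, -pull P τ.2) = _
      rw [this, ← pull_smul]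
      rfl) σ
  rw [ansE, ansE, hn, pullSlot_fst, slotT_defect_pull hP, pull_add, pull_add, pull_smul,
    pull_contr_of_eq P hw, ← pull_altD]
  congr 1
  · congr 1
    exact TensorExpr.star_pull hP _ _ _ _
  · exact congrArg altD h3

omit hs in
theorem ansF_pull : ansF (pullPair P s) (pullSlot P σ) = pull P (ansF s σ) := by
  have hw : P * (metric (pullPair P s).1 (pullPair P s).2)⁻¹ * P.transpose = (metric s.1 s.2)⁻¹ :=
    conj_metric_inv_pull P hP s.1 s.2
  have hn : normSq (pullPair P s).1 (pullPair P s).2 = normSq s.1 s.2 := normSq_pull P hP s.1 s.2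
  have h3 := slotT_pullSlot (L := (2 : ℝ) • topRatioL s) (L' := (2 : ℝ) • topRatioL (pullPair P s))
    (P := P) (fun τ => by
      show (2 : ℝ) • topRatio (pullPair P s) (pullPair P τ) = _
      rw [topRatio_pullPair hP, ← pull_smul]
      rfl) σ
  rw [ansF, ansF, hn, pullSlot_snd, slotT_defect_pull hP, pull_add, pull_add, pull_smul,
    pull_contr_of_eq P hw, ← pull_altD]
  congr 1
  · congr 1
    exact TensorExpr.star_pull hP _ _ _ _
  · exact congrArg altD h3

end

section

variable {c : ℝ} (hc : 0 < c) {a : Fin 6 → Tens 3} {b : Fin 6 → Tens 2} (ha : ∀ p, IsAlt (a p))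
  (hb : ∀ p, IsAlt (b p))
include hc ha hb

/-- Both potentials are antisymmetric, so increasing indices suffice. -/
theorem linE_std_swap (i j : Fin 6) : linE (stdPair c) (fun p => (c • a p, b p)) ![j, i] =
    -linE (stdPair c) (fun p => (c • a p, b p)) ![i, j] := by
  have hN := fun p => fderiv_nhF_std_isAlt hc (ha p) (hb p)
  have sw : ∀ p x, fderiv ℝ nhF (stdPair c) (c • a p, b p) ![x, j, i] =
      -fderiv ℝ nhF (stdPair c) (c • a p, b p) ![x, i, j] := fun p x =>
    IsAlt'.swap12 (hN p) x i j
  have sp : ∀ k, phi0 ![k, j, i] = -phi0 ![k, i, j] := fun k => IsAlt'.swap12 phi0_isAlt k i j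
  rw [linE_std_apply, linE_std_apply, contractOmega_altD_std hc ha hb,
    contractOmega_altD_std hc ha hb]
  simp only [sw, sp, neg_mul, Finset.sum_neg_distrib, Fin.sum_univ_three]
  ring

omit hb in
theorem ansE_std_swap (i j : Fin 6) : ansE (stdPair c) (fun p => (c • a p, b p)) ![j, i] =
    -ansE (stdPair c) (fun p => (c • a p, b p)) ![i, j] := by
  have sw : ∀ p x, a p ![x, j, i] = -a p ![x, i, j] := fun p x => IsAlt'.swap12 (ha p) x i j
  rw [ansE_std_apply hc, ansE_std_apply hc]
  simp only [sw, Finset.sum_neg_distrib]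
  ring

theorem linE_std_eq (h : altD (slotT b) = 0) :
    linE (stdPair c) (fun p => (c • a p, b p)) = ansE (stdPair c) (fun p => (c • a p, b p)) := by
  ext i
  have e : i = ![i 0, i 1] := by ext x; fin_cases x <;> rfl
  rw [e]
  rcases lt_trichotomy (i 0) (i 1) with h1 | h1 | h1
  · exact linE_std hc ha hb h h1
  · have e1 := linE_std_swap hc ha hb (i 0) (i 0)
    have e2 := ansE_std_swap hc (b := b) ha (i 0) (i 0)
    rw [← h1]
    linarith
  · rw [linE_std_swap hc ha hb (i 1) (i 0), ansE_std_swap hc (b := b) ha (i 1) (i 0),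
      linE_std hc ha hb h h1]

theorem linF_std_eq (h : altD (slotT a) = 0) :
    linF (stdPair c) (fun p => (c • a p, b p)) = ansF (stdPair c) (fun p => (c • a p, b p)) := by
  ext i
  have e : i = ![i 0] := by ext x; fin_cases x; rfl
  rw [e]
  exact linF_std hc ha hb h (i 0)

end

section

variable {φ : Tens 3} {ω : Tens 2} (h : IsTypeIIAAt φ ω) {σ : Fin 6 → Tens 3 × Tens 2}
  (h1 : ∀ p, IsAlt (σ p).1) (h2 : ∀ p, IsAlt (σ p).2)
include h h1 h2

/-- The normal form of a Type IIA pair together with the derivatives of a variation, which are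
transported to the standard frame. -/
theorem exists_frame_slot : ∃ (P : Matrix (Fin 6) (Fin 6) ℝ) (c : ℝ) (a : Fin 6 → Tens 3)
    (b : Fin 6 → Tens 2), 0 < c ∧ P.det ≠ 0 ∧ pullPair P (φ, ω) = stdPair c ∧
      (∀ p, IsAlt (a p)) ∧ (∀ p, IsAlt (b p)) ∧ pullSlot P σ = (fun p => (c • a p, b p)) ∧
      c • slotT a = pull P (slotT fun p => (σ p).1) ∧ slotT b = pull P (slotT fun p => (σ p).2) := by
  obtain ⟨P, c, hc, hP, e1, e2⟩ := h.exists_frame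
  have e3 : ∀ p, c • c⁻¹ • (pullSlot P σ p).1 = (pullSlot P σ p).1 := fun p => by
    rw [smul_smul, mul_inv_cancel₀ hc.ne', one_smul]
  refine ⟨P, c, fun p => c⁻¹ • (pullSlot P σ p).1, fun p => (pullSlot P σ p).2, hc, hP,
    pullPair_eq_std e1 e2, fun p => ((isAlt_pullSlot h1 h2 p).1).smul _,
    fun p => (isAlt_pullSlot h1 h2 p).2, ?_, ?_, ?_⟩
  · ext1 p
    rw [e3]
  · rw [← pullSlot_fst]
    ext i
    exact congrFun (e3 (i 0)) _
  · rw [← pullSlot_snd]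

/-- For `dβ = 0`, the potential of the linearization of `E` is `-|φ|² d⋆α` up to the derivative of
the defect and an exact form. -/
theorem linE_eq (h0 : altD (slotT fun p => (σ p).2) = 0) : linE (φ, ω) σ = ansE (φ, ω) σ := by
  obtain ⟨P, c, a, b, hc, hP, e1, ha, hb, e2, -, e3⟩ := exists_frame_slot h h1 h2
  refine pull_injective hP ?_
  rw [← linE_pull (s := (φ, ω)) h hP, ← ansE_pull (s := (φ, ω)) hP, e1, e2]
  refine linE_std_eq hc ha hb ?_
  rw [e3, pull_altD, h0, pull_zero]

/-- For `dα = 0`, the potential of the linearization of `F` is `-|φ|² d⋆β` up to the derivative of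
the defect and an exact form. -/
theorem linF_eq (h0 : altD (slotT fun p => (σ p).1) = 0) : linF (φ, ω) σ = ansF (φ, ω) σ := by
  obtain ⟨P, c, a, b, hc, hP, e1, ha, hb, e2, e3, -⟩ := exists_frame_slot h h1 h2
  refine pull_injective hP ?_
  rw [← linF_pull (s := (φ, ω)) h hP, ← ansF_pull (s := (φ, ω)) hP, e1, e2]
  refine linF_std_eq hc ha hb ?_
  have e4 : c • altD (slotT a) = 0 := by
    rw [← altD_smul, e3, pull_altD, h0, pull_zero]
  exact (smul_eq_zero.1 e4).resolve_left hc.ne'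

end

/-! ### The linearized flow of a parallel model -/

theorem extD_zero {g : E6 → Matrix (Fin 6) (Fin 6) ℝ} {y : E6} (A : TField 0) :
    extD A y = altD (nabla g A y) := by
  refine extD_eq_of_altD_lie ?_
  ext i
  simp [altD, lie]

theorem codiff_eq_contr {k : ℕ} (g : E6 → Matrix (Fin 6) (Fin 6) ℝ) (A : TField (k + 1)) (y : E6) :
    codiff g A y = -contr (g y)⁻¹ (slotT (cov g A y)) := by
  rw [← nabla_eq_slotT]
  rfl

theorem codiff_eq_zero {k : ℕ} {g : E6 → Matrix (Fin 6) (Fin 6) ℝ} {A : TField (k + 1)} {y : E6}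
    (h : A =ᶠ[nhds y] 0) : codiff g A y = 0 := by
  have h1 : cov g A y = 0 := by
    ext1 p
    rw [cov_congr (f' := fun _ => 0) h, cov_eq (differentiableAt_const _)]
    ext i
    simp [lie]
  rw [codiff_eq_contr, h1]
  ext i
  simp [contr, slotT]

theorem contDiffAt_nabla {k : ℕ} {g : E6 → Matrix (Fin 6) (Fin 6) ℝ} {A : TField k} {y : E6}
    (hg : ∀ m p q, ContDiffAt ℝ Cinf (fun z => christoffel g z m p q) y)
    (hA : ContDiffAt ℝ Cinf A y) : ContDiffAt ℝ Cinf (nabla g A) y :=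
  contDiffAt_pi.2 fun _ => (contDiffAt_pd (contDiffAt_pi.1 hA _) _).sub
    (ContDiffAt.sum fun _ _ => ContDiffAt.sum fun _ _ => (hg _ _ _).mul (contDiffAt_pi.1 hA _))

theorem contDiffAt_extD {k : ℕ} {A : TField k} {y : E6} (hA : ContDiffAt ℝ Cinf A y) :
    ContDiffAt ℝ Cinf (extD A) y :=
  contDiffAt_pi.2 fun _ => ContDiffAt.sum fun _ _ =>
    contDiffAt_const.mul (contDiffAt_pd (contDiffAt_pi.1 hA _) _)

section

variable {U : Set E6} {φ : TField 3} {ω : TField 2} (h : IsParallelModel U φ ω)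
  {α : TField 3} {β : TField 2} (v : IsVariation U α β) {y : E6} (hy : y ∈ U)
include h v hy

theorem contDiffAt_variation : ContDiffAt ℝ Cinf (fun z => (α z, β z)) y :=
  (v.smooth_fst.contDiffAt (h.mem_nhds hy)).prodMk (v.smooth_snd.contDiffAt (h.mem_nhds hy))

/-- Covariant differentiation of an invariant expression that is linear in the variation. -/
theorem cov_invariant {k : ℕ} (T : Tens 3 × Tens 2 → Tens 3 × Tens 2 → Tens k)
    (hT : ContDiffAt ℝ Cinf (fun x : (Tens 3 × Tens 2) × (Tens 3 × Tens 2) => T x.1 x.2)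
      ((φ y, ω y), (α y, β y)))
    (he : ∀ P : Matrix (Fin 6) (Fin 6) ℝ, P.det ≠ 0 → ∀ σ,
      T (pullPair P (φ y, ω y)) (pullPair P σ) = pull P (T (φ y, ω y) σ))
    (L : (Tens 3 × Tens 2) →L[ℝ] Tens k) (hL : ∀ σ, T (φ y, ω y) σ = L σ) (p : Fin 6) :
    cov (metricField φ ω) (fun z => T (φ z, ω z) (α z, β z)) y p =
      T (φ y, ω y) (cov (metricField φ ω) α y p, cov (metricField φ ω) β y p) := by
  rw [hL]
  exact cov_bilinear (T := fun x : (Tens 3 × Tens 2) × (Tens 3 × Tens 2) => T x.1 x.2)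
    (S := fun z => (φ z, ω z)) (σ := fun z => (α z, β z))
    ((h.contDiffAt_pair hy).differentiableAt cinf_ne_zero)
    ((contDiffAt_variation h v hy).differentiableAt cinf_ne_zero)
    (hT.differentiableAt cinf_ne_zero) (fun P hP => he P hP _) L hL p (h.covPair_pair hy p)

/-- The covariant derivative of the first variation of an equivariant expression `T`. -/
theorem cov_varField {k : ℕ} {T : Tens 3 × Tens 2 → Tens k} (hT : ContDiffAt ℝ Cinf T (φ y, ω y))
    (he : ∀ (P : Matrix (Fin 6) (Fin 6) ℝ) (s), P.det ≠ 0 → T (pullPair P s) = pull P (T s))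
    (p : Fin 6) : cov (metricField φ ω) (varField T φ ω α β) y p =
      fderiv ℝ T (φ y, ω y) (cov (metricField φ ω) α y p, cov (metricField φ ω) β y p) := by
  refine cov_invariant h v hy (fun s σ => fderiv ℝ T s σ) ?_ (fun P hP σ =>
    fderiv_pullPair (hT.differentiableAt cinf_ne_zero) he hP σ) (fderiv ℝ T (φ y, ω y))
    (fun _ => rfl) p
  have h1 : ContDiffAt ℝ Cinf (fderiv ℝ T) (φ y, ω y) := hT.fderiv_right (by decide)
  exact (ContDiffAt.comp (f := Prod.fst)
    (((φ y, ω y), (α y, β y)) : (Tens 3 × Tens 2) × (Tens 3 × Tens 2)) h1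
    contDiffAt_fst).clm_apply contDiffAt_snd

theorem nabla_varField {k : ℕ} {T : Tens 3 × Tens 2 → Tens k}
    (hT : ContDiffAt ℝ Cinf T (φ y, ω y))
    (he : ∀ (P : Matrix (Fin 6) (Fin 6) ℝ) (s), P.det ≠ 0 → T (pullPair P s) = pull P (T s)) :
    nabla (metricField φ ω) (varField T φ ω α β) y = slotT fun p =>
      fderiv ℝ T (φ y, ω y) (cov (metricField φ ω) α y p, cov (metricField φ ω) β y p) := by
  rw [nabla_eq_slotT]
  exact congrArg slotT (funext fun p => cov_varField h v hy hT he p)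

theorem deTurckVar_eq : deTurckVar φ ω α β y = linV (φ y, ω y) fun p =>
    (cov (metricField φ ω) α y p, cov (metricField φ ω) β y p) := by
  have hT := h.typeIIA y hy
  rw [deTurckVar, nabla_varField h v hy (contDiffAt_gF hT) gF_pullPair,
    nabla_varField h v hy (contDiffAt_nF0 hT) nF0_pullPair]
  rfl

theorem isAlt_varField_nhF : IsAlt (varField nhF φ ω α β y) := by
  have hT := h.typeIIA y hy
  have hd := hasDerivAt_pi.1 (hasDerivAt_comp_variedPair φ ω α β
    ((contDiffAt_nhF hT).differentiableAt cinf_ne_zero))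
  intro σ i
  refine (hd (i ∘ σ)).unique (((hd i).const_mul ((Equiv.Perm.sign σ : ℤ) : ℝ)).congr_of_eventuallyEq
    (.of_forall fun t => ?_))
  exact ((isAlt_hat (hT.alt_phi.add ((v.alt_fst y hy).smul t)) _).smul _) σ i

theorem isAlt_cov_fst (p : Fin 6) : IsAlt (cov (metricField φ ω) α y p) :=
  IsAlt.cov ((contDiffAt_variation h v hy).fst.differentiableAt cinf_ne_zero)
    (by filter_upwards [h.mem_nhds hy] with z hz using v.alt_fst z hz) p

theorem isAlt_cov_snd (p : Fin 6) : IsAlt (cov (metricField φ ω) β y p) :=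
  IsAlt.cov ((contDiffAt_variation h v hy).snd.differentiableAt cinf_ne_zero)
    (by filter_upwards [h.mem_nhds hy] with z hz using v.alt_snd z hz) p

theorem altD_cov_fst : altD (slotT fun p => cov (metricField φ ω) α y p) = 0 := by
  rw [← v.closed_fst y hy, extD_three (h.eventually_symm hy) (v.alt_fst y hy), nabla_eq_slotT]

theorem altD_cov_snd : altD (slotT fun p => cov (metricField φ ω) β y p) = 0 := by
  rw [← v.closed_snd y hy, extD_two (h.eventually_symm hy) (v.alt_snd y hy), nabla_eq_slotT]

theorem potentialE_eq : contractOmega (k := 2) (ω y) (extD (k := 3) (varField nhF φ ω α β) y) +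
    interior (k := 2) (deTurckVar φ ω α β y) (φ y) = linE (φ y, ω y) fun p =>
      (cov (metricField φ ω) α y p, cov (metricField φ ω) β y p) := by
  rw [deTurckVar_eq h v hy, extD_three (h.eventually_symm hy) (isAlt_varField_nhF h v hy),
    nabla_varField h v hy (contDiffAt_nhF (h.typeIIA y hy)) nhF_pullPair]
  rfl

theorem contDiffAt_primitiveDefect : ContDiffAt ℝ Cinf (primitiveDefect φ ω α β) y :=
  contDiffAt_defect (S := fun z => (φ z, ω z)) (σ := fun z => (α z, β z)) (h.contDiffAt_pair hy)
    (contDiffAt_variation h v hy) (h.typeIIA y hy)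

theorem nabla_primitiveDefect : nabla (metricField φ ω) (primitiveDefect φ ω α β) y =
    slotT fun p => defect (φ y, ω y)
      (cov (metricField φ ω) α y p, cov (metricField φ ω) β y p) := by
  rw [nabla_eq_slotT]
  refine congrArg slotT (funext fun p => cov_invariant h v hy defect ?_
    (fun P hP σ => defect_pullPair hP _ σ) (defectL (φ y, ω y)) (fun _ => rfl) p)
  exact contDiffAt_defect contDiffAt_fst contDiffAt_snd (h.typeIIA y hy)

end

/-- The one-form `(|φ|² / 2) ⋆(α ∧ ω - φ ∧ β)`. -/
def exactPotential (s σ : Tens 3 × Tens 2) : Tens 1 :=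
  (normSq s.1 s.2 / 2) • defect s (σ.1, -σ.2)

/-- `exactPotential` as a linear map of the variation. -/
def exactPotentialL (s : Tens 3 × Tens 2) : (Tens 3 × Tens 2) →L[ℝ] Tens 1 :=
  (normSq s.1 s.2 / 2) • (defectL s).comp
    ((ContinuousLinearMap.fst ℝ (Tens 3) (Tens 2)).prod (-.snd ℝ (Tens 3) (Tens 2)))

theorem exactPotential_pullPair {P : Matrix (Fin 6) (Fin 6) ℝ} (hP : P.det ≠ 0)
    (s σ : Tens 3 × Tens 2) :
    exactPotential (pullPair P s) (pullPair P σ) = pull P (exactPotential s σ) := by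
  have hn : normSq (pullPair P s).1 (pullPair P s).2 = normSq s.1 s.2 := normSq_pull P hP s.1 s.2
  have e : ((pullPair P σ).1, -(pullPair P σ).2) = pullPair P (σ.1, -σ.2) :=
    Prod.ext rfl (by
      show -pull P σ.2 = pull P (-σ.2)
      rw [← neg_one_smul ℝ σ.2, pull_smul, neg_one_smul])
  rw [exactPotential, hn, e, defect_pullPair hP, ← pull_smul]
  rfl

theorem contDiffAt_exactPotential {E : Type*} [NormedAddCommGroup E] [NormedSpace ℝ E] {x : E}
    {S σ : E → Tens 3 × Tens 2} (hS : ContDiffAt ℝ Cinf S x) (hσ : ContDiffAt ℝ Cinf σ x)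
    (h : IsTypeIIAAt (S x).1 (S x).2) :
    ContDiffAt ℝ Cinf (fun z => exactPotential (S z) (σ z)) x :=
  ((ContDiffAt.comp x (contDiffAt_nF h) hS).div_const 2).smul
    (contDiffAt_defect hS (hσ.fst.prodMk hσ.snd.neg) h)

section

variable {U : Set E6} {φ : TField 3} {ω : TField 2} (h : IsParallelModel U φ ω)
  {α : TField 3} {β : TField 2} (v : IsVariation U α β) {y : E6} (hy : y ∈ U)
include h v hy

theorem extD_exactPotential : extD (k := 1) (fun z => exactPotential (φ z, ω z) (α z, β z)) y =
    altD (slotT fun p => exactPotential (φ y, ω y)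
      (cov (metricField φ ω) α y p, cov (metricField φ ω) β y p)) := by
  rw [extD_one (h.eventually_symm hy), nabla_eq_slotT]
  refine congrArg (fun f => altD (slotT f)) (funext fun p => cov_invariant h v hy exactPotential ?_
    (fun P hP σ => exactPotential_pullPair hP _ σ) (exactPotentialL (φ y, ω y)) (fun _ => rfl) p)
  exact contDiffAt_exactPotential contDiffAt_fst contDiffAt_snd (h.typeIIA y hy)

theorem extD_topRatio : extD (k := 0) (fun z => (2 : ℝ) • topRatio (φ z, ω z) (α z, β z)) y =
    altD (slotT fun p => (2 : ℝ) • topRatio (φ y, ω y)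
      (cov (metricField φ ω) α y p, cov (metricField φ ω) β y p)) := by
  rw [extD_zero (g := metricField φ ω), nabla_eq_slotT]
  refine congrArg (fun f => altD (slotT f)) (funext fun p => cov_invariant h v hy
    (fun s σ => (2 : ℝ) • topRatio s σ) ?_ (fun P hP σ => ?_) ((2 : ℝ) • topRatioL (φ y, ω y))
    (fun _ => rfl) p)
  · exact (contDiffAt_topRatio contDiffAt_fst contDiffAt_snd (h.typeIIA y hy)).const_smul _
  · show (2 : ℝ) • topRatio _ _ = _
    rw [topRatio_pullPair hP, pull_smul]

/-- The potential of the linearization of `E` on closed variations. -/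
theorem potentialE_eq_ans :
    contractOmega (k := 2) (ω y) (extD (k := 3) (varField nhF φ ω α β) y) +
      interior (k := 2) (deTurckVar φ ω α β y) (φ y) =
    (-normSq (φ y) (ω y)) • codiff (k := 2) (metricField φ ω) α y +
      TensorExpr.defectE.star (φ y) (ω y)
        (nabla (metricField φ ω) (primitiveDefect φ ω α β) y) +
      extD (k := 1) (fun z => exactPotential (φ z, ω z) (α z, β z)) y := by
  rw [potentialE_eq h v hy, linE_eq (h.typeIIA y hy) (isAlt_cov_fst h v hy) (isAlt_cov_snd h v hy)
    (altD_cov_snd h v hy), ansE, extD_exactPotential h v hy, nabla_primitiveDefect h v hy,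
    codiff_eq_contr, smul_neg, neg_smul, neg_neg]
  rfl

/-- The potential of the linearization of `F` on closed variations. -/
theorem potentialF_eq_ans :
    interior (k := 1) (deTurckVar φ ω α β y) (ω y) =
    (-normSq (φ y) (ω y)) • codiff (k := 1) (metricField φ ω) β y +
      TensorExpr.defectF.star (φ y) (ω y)
        (nabla (metricField φ ω) (primitiveDefect φ ω α β) y) +
      extD (k := 0) (fun z => (2 : ℝ) • topRatio (φ z, ω z) (α z, β z)) y := by
  have e : interior (k := 1) (deTurckVar φ ω α β y) (ω y) = linF (φ y, ω y) fun p =>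
      (cov (metricField φ ω) α y p, cov (metricField φ ω) β y p) := by
    rw [deTurckVar_eq h v hy]; rfl
  rw [e, linF_eq (h.typeIIA y hy) (isAlt_cov_fst h v hy) (isAlt_cov_snd h v hy)
    (altD_cov_fst h v hy), ansF, extD_topRatio h v hy, nabla_primitiveDefect h v hy,
    codiff_eq_contr, smul_neg, neg_smul, neg_neg]
  rfl

theorem contDiffAt_codiff {k : ℕ} {A : TField (k + 1)} (hA : ContDiffAt ℝ Cinf A y) :
    ContDiffAt ℝ Cinf (codiff (metricField φ ω) A) y :=
  contDiffAt_pi.2 fun _ => (ContDiffAt.sum fun p _ => ContDiffAt.sum fun q _ =>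
    (contDiffAt_metric_inv (h.contDiffAt_pair hy) (h.typeIIA y hy) p q).mul
      (contDiffAt_pi.1 (contDiffAt_nabla (contDiffAt_christoffel h v hy) hA) _)).neg

theorem contDiffAt_star_defect {n : ℕ} (T : TensorExpr (n + 2)) : ContDiffAt ℝ Cinf (fun z =>
    T.star (φ z) (ω z) (nabla (metricField φ ω) (primitiveDefect φ ω α β) z)) y :=
  TensorExpr.contDiffAt_star (S := fun z => (φ z, ω z)) (h.contDiffAt_pair hy) (h.typeIIA y hy) T
    (contDiffAt_nabla (contDiffAt_christoffel h v hy) (contDiffAt_primitiveDefect h v hy))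

/-- The exterior derivative of the potential: the term `-|φ|² d⋆A` gives `-|φ|² □A` because `|φ|²` is
constant and `dA = 0`, and the closed summand `f` drops out. -/
theorem extD_potential {k : ℕ} {A : TField (k + 1)} (hA : ContDiffAt ℝ Cinf A y)
    (hA0 : extD A =ᶠ[nhds y] 0) (T : TensorExpr (k + 2)) {f : TField k}
    (hf : DifferentiableAt ℝ f y) (hf0 : extD f y = 0) :
    extD (fun z => (-normSq (φ z) (ω z)) • codiff (metricField φ ω) A z +
        T.star (φ z) (ω z) (nabla (metricField φ ω) (primitiveDefect φ ω α β) z) + f z) y =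
      -(normSq (φ y) (ω y)) • hodgeLaplacian (metricField φ ω) A y +
        extD (fun z => T.star (φ z) (ω z)
          (nabla (metricField φ ω) (primitiveDefect φ ω α β) z)) y := by
  have h1 : DifferentiableAt ℝ (fun z => -normSq (φ z) (ω z)) y :=
    ((ContDiffAt.comp y (contDiffAt_nF (h.typeIIA y hy))
      (h.contDiffAt_pair hy)).differentiableAt cinf_ne_zero).fun_neg
  have h2 := (contDiffAt_codiff h v hy hA).differentiableAt cinf_ne_zero
  have h3 := (contDiffAt_star_defect h v hy T).differentiableAt cinf_ne_zero
  have h4 : ∀ i, pd i (fun z => -normSq (φ z) (ω z)) y = 0 := fun i => by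
    have := h.norm_const y hy i
    rw [pd] at this ⊢
    rw [fderiv_fun_neg, neg_apply, this, neg_zero]
  rw [extD_add ((h1.fun_smul h2).fun_add h3) hf, hf0, add_zero, extD_add (h1.fun_smul h2) h3,
    extD_smul h2 h1 h4, hodgeLaplacian, Pi.add_apply, codiff_eq_zero hA0, add_zero]

/-- The linearization of `E` on closed variations, in a chart. -/
theorem hasDerivAt_flowE_star :
    HasDerivAt (fun t : ℝ => flowE (metricField φ ω) (φ + t • α) (ω + t • β) y)
      (-(normSq (φ y) (ω y)) • hodgeLaplacian (k := 2) (metricField φ ω) α y +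
        extD (fun z => TensorExpr.defectE.star (φ z) (ω z)
          (nabla (metricField φ ω) (primitiveDefect φ ω α β) z)) y) 0 := by
  have hσ := contDiffAt_variation h v hy
  have hl : ContDiffAt ℝ Cinf (fun z => exactPotential (φ z, ω z) (α z, β z)) y :=
    contDiffAt_exactPotential (h.contDiffAt_pair hy) hσ (h.typeIIA y hy)
  rw [← extD_potential h v hy (k := 2) hσ.fst
    (by filter_upwards [h.mem_nhds hy] with z hz using v.closed_fst z hz) TensorExpr.defectE
    ((contDiffAt_extD hl).differentiableAt cinf_ne_zero) (extD_extD_one hl)]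
  refine (hasDerivAt_flowE h hy v).congr_deriv (extD_congr ?_)
  filter_upwards [h.mem_nhds hy] with z hz using potentialE_eq_ans h v hz

/-- The linearization of `F` on closed variations, in a chart. -/
theorem hasDerivAt_flowF_star :
    HasDerivAt (fun t : ℝ => flowF (metricField φ ω) (φ + t • α) (ω + t • β) y)
      (-(normSq (φ y) (ω y)) • hodgeLaplacian (k := 1) (metricField φ ω) β y +
        extD (fun z => TensorExpr.defectF.star (φ z) (ω z)
          (nabla (metricField φ ω) (primitiveDefect φ ω α β) z)) y) 0 := by
  have hσ := contDiffAt_variation h v hy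
  have hl : ContDiffAt ℝ Cinf (fun z => (2 : ℝ) • topRatio (φ z, ω z) (α z, β z)) y :=
    (contDiffAt_topRatio (h.contDiffAt_pair hy) hσ (h.typeIIA y hy)).const_smul _
  rw [← extD_potential h v hy (k := 1) hσ.snd
    (by filter_upwards [h.mem_nhds hy] with z hz using v.closed_snd z hz) TensorExpr.defectF
    ((contDiffAt_extD hl).differentiableAt cinf_ne_zero) (extD_extD_zero hl)]
  refine (hasDerivAt_flowF h hy v).congr_deriv (extD_congr ?_)
  filter_upwards [h.mem_nhds hy] with z hz using potentialF_eq_ans h v hz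

end

/-! ### Passage to charts -/

section

variable {M : Type*} [TopologicalSpace M] [ChartedSpace E6 M]

theorem isAlt_inChart {k : ℕ} (e : OpenPartialHomeomorph M E6) (α : Form M k) (y : E6) :
    IsAlt (inChart e α y) := by
  intro σ i
  have := (α (e.symm y)).map_perm
    (fun a => mfderiv 𝓘(ℝ, E6) (𝓡 6) e.symm y (coordVec (i a))) σ
  rw [Units.smul_def, zsmul_eq_mul] at this
  exact this

theorem IsRicciFlatTypeIIA.isParallelModel {φ : Form M 3} {ω : Form M 2}
    (h : IsRicciFlatTypeIIA φ ω) {e : OpenPartialHomeomorph M E6}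
    (he : e ∈ IsManifold.maximalAtlas (𝓡 6) Cinf M) :
    IsParallelModel e.target (inChart e φ) (inChart e ω) where
  isOpen := e.open_target
  smooth_phi := h.smooth_phi e he
  smooth_omega := h.smooth_omega e he
  typeIIA y hy :=
    { alt_phi := isAlt_inChart e φ y
      alt_omega := isAlt_inChart e ω y
      det_ne := h.nondegenerate_omega e he y hy
      lambda_neg := h.nondegenerate_phi e he y hy
      primitive := h.primitive e he y hy
      posDef := h.posDef e he y hy }
  closed_phi := h.closed_phi e he
  closed_omega := h.closed_omega e he
  integrable := h.integrable e he
  norm_const := h.norm_const e he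

theorem isVariation_inChart {α : Form M 3} {β : Form M 2} (hα : IsSmoothForm α)
    (hβ : IsSmoothForm β) (hα' : IsClosedForm α) (hβ' : IsClosedForm β)
    {e : OpenPartialHomeomorph M E6} (he : e ∈ IsManifold.maximalAtlas (𝓡 6) Cinf M) :
    IsVariation e.target (inChart e α) (inChart e β) where
  smooth_fst := hα e he
  smooth_snd := hβ e he
  alt_fst y _ := isAlt_inChart e α y
  alt_snd y _ := isAlt_inChart e β y
  closed_fst := hα' e he
  closed_snd := hβ' e he

end

/-- If `α ∧ ω + φ ∧ β` vanishes near a point, then so do the derivatives of its Hodge star. -/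
theorem extD_star_eq_zero {φ : TField 3} {ω : TField 2} {α : TField 3} {β : TField 2} {U : Set E6}
    (hU : IsOpen U) (h : ∀ y ∈ U, wedge (α y) (ω y) + wedge (φ y) (β y) = 0)
    (g : E6 → Matrix (Fin 6) (Fin 6) ℝ) {n : ℕ} (T : TensorExpr (n + 2)) {y : E6} (hy : y ∈ U) :
    extD (fun z => T.star (φ z) (ω z) (nabla g (primitiveDefect φ ω α β) z)) y = 0 := by
  have h1 : ∀ z ∈ U, nabla g (primitiveDefect φ ω α β) z = 0 := by
    intro z hz
    have h2 : primitiveDefect φ ω α β =ᶠ[nhds z] fun _ => 0 := by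
      filter_upwards [hU.mem_nhds hz] with w hw
      rw [primitiveDefect, h w hw]
      ext i
      simp [hodgeStar]
    have h3 : cov g (primitiveDefect φ ω α β) z = 0 := by
      ext1 p
      rw [cov_congr h2, cov_eq (differentiableAt_const _)]
      ext i
      simp [lie]
    rw [nabla_eq_slotT, h3]
    rfl
  have h4 : (fun z => T.star (φ z) (ω z) (nabla g (primitiveDefect φ ω α β) z)) =ᶠ[nhds y]
      fun _ => 0 := by
    filter_upwards [hU.mem_nhds hy] with z hz
    rw [h1 z hz, TensorExpr.star_zero]
  rw [extD_congr h4]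
  ext i
  simp [extD, pd]

end

end TypeIIA

theorem theorem4 :
    ∃ (Eφ : TensorExpr (2 + 2)) (Eω : TensorExpr (1 + 2)),
      ∀ (M : Type*) [TopologicalSpace M] [T2Space M] [CompactSpace M] [ChartedSpace E6 M]
        [IsManifold (𝓡 6) Cinf M] (φ : Form M 3) (ω : Form M 2), IsRicciFlatTypeIIA φ ω →
      ∀ (δφ : Form M 3) (δω : Form M 2), IsSmoothForm δφ → IsSmoothForm δω →
        IsClosedForm δφ → IsClosedForm δω →
      ∀ e ∈ IsManifold.maximalAtlas (𝓡 6) Cinf M,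
      ∀ g : E6 → Matrix (Fin 6) (Fin 6) ℝ, g = metricField (inChart e φ) (inChart e ω) →
      ∀ H : TField 1,
        H = primitiveDefect (inChart e φ) (inChart e ω) (inChart e δφ) (inChart e δω) →
        -- variations that preserve primitivity to first order
        ((∀ e' ∈ IsManifold.maximalAtlas (𝓡 6) Cinf M, ∀ y ∈ e'.target,
            wedge (inChart e' δφ y) (inChart e' ω y)
              + wedge (inChart e' φ y) (inChart e' δω y) = 0) →
          ∀ y ∈ e.target,
            HasDerivAt
              (fun t : ℝ => flowE g (inChart e (φ + t • δφ)) (inChart e (ω + t • δω)) y)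
              (-(normSq (inChart e φ y) (inChart e ω y)) •
                hodgeLaplacian (k := 2) g (inChart e δφ) y) 0 ∧
            HasDerivAt
              (fun t : ℝ => flowF g (inChart e (φ + t • δφ)) (inChart e (ω + t • δω)) y)
              (-(normSq (inChart e φ y) (inChart e ω y)) •
                hodgeLaplacian (k := 1) g (inChart e δω) y) 0) ∧
        -- arbitrary closed variations
        (∀ y ∈ e.target,
          IsAlt (Eφ.star (inChart e φ y) (inChart e ω y) (nabla g H y)) ∧
          HasDerivAt
            (fun t : ℝ => flowE g (inChart e (φ + t • δφ)) (inChart e (ω + t • δω)) y)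
            (-(normSq (inChart e φ y) (inChart e ω y)) •
                hodgeLaplacian (k := 2) g (inChart e δφ) y
              + extD (fun z => Eφ.star (inChart e φ z) (inChart e ω z) (nabla g H z)) y) 0 ∧
          HasDerivAt
            (fun t : ℝ => flowF g (inChart e (φ + t • δφ)) (inChart e (ω + t • δω)) y)
            (-(normSq (inChart e φ y) (inChart e ω y)) •
                hodgeLaplacian (k := 1) g (inChart e δω) y
              + extD (fun z => Eω.star (inChart e φ z) (inChart e ω z) (nabla g H z)) y) 0) := by
  refine ⟨TensorExpr.defectE, TensorExpr.defectF, ?_⟩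
  intro M _ _ _ _ _ φ ω h δφ δω hδφ hδω hδφ' hδω' e he g hg H hH
  subst hg hH
  have hm := h.isParallelModel he
  have hv := isVariation_inChart hδφ hδω hδφ' hδω' he
  refine ⟨fun h0 y hy => ?_, fun y hy => ⟨isAlt_star_defectE _ _ _,
    hasDerivAt_flowE_star hm hv hy, hasDerivAt_flowF_star hm hv hy⟩⟩
  have hE := hasDerivAt_flowE_star hm hv hy
  have hF := hasDerivAt_flowF_star hm hv hy
  rw [extD_star_eq_zero hm.isOpen (h0 e he) _ _ hy, add_zero] at hE hF
  exact ⟨hE, hF⟩
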